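/- Let $s\ge 4$ be an integer, $T,\rho>0$, $\mathcal O=\{x'\in\mathbb R^3:|x'|<\rho\}$, $\mho=(0,T)\times\mathcal O$, $\mathbb M_T=(0,T)\times\mathbb R^3$ and $\Box=\partial_t^2-\Delta_{x'}$. For open $\Omega\subseteq\mathbb R^3$ let $$\mathscr H^s((0,T)\times\Omega)=\bigcap_{0\le k\le s}C^k\big((0,T);H^{s-k}(\Omega)\big),\qquad \|u\|=\sum_{k\le s}\ \sup_{0<t<T}\|\partial_t^ku(t)\|_{H^{s-k}(\Omega)},$$ where only $u$ of finite norm are admitted. A source is a function $f\in\mathscr H^s(\mathbb M_T)$ that vanishes outside $\mho$ (equivalently, a function on $\mho$ whose extension by zero lies in $\mathscr H^s(\mathbb M_T)$); $\|f\|_{\mathscr H^s(\mho)}$ is its norm. Let $M\in\mathbb R$, and call a real function in $C^\infty(\mathbb R\times\mathbb R^3)$ admissible if its derivatives of order at most $s$ are bounded by $M$ on $[0,T]\times\{|x'|\le\rho+T\}$. There is $\varrho_0>0$, depending only on $s,T,\rho,M$, such that the following holds for every $\varrho\in(0,\varrho_0]$. (a) For all admissible $V,h$ and every source $f$ with $\|f\|_{\mathscr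 H^s(\mho)}\le\varrho$, the problem $$\Box u+Vu+hu^3=f\quad(0<t<T),\qquad u\equiv0\quad(t\le0)$$ has a unique solution $u\in\mathscr H^s(\mathbb M_T)$ on $(0,T)$; so the source-to-solution map $\mathcal P_{V,h}(f)=u|_\mho$ is well defined. For all sources $f_{(1)},f_{(2)},f_{(3)}$ let $u(\varepsilon)$ be the solution with source $\sum_j\varepsilon_{(j)}f_{(j)}$ for small $\varepsilon$, and put $$u_{(123)}=-\tfrac1{3!}\,\partial_{\varepsilon_{(1)}}\partial_{\varepsilon_{(2)}}\partial_{\varepsilon_{(3)}}u(\varepsilon)\big|_{\varepsilon=0},\qquad T_{V,h}(f_{(1)},f_{(2)},f_{(3)})=u_{(123)}|_\mho .$$ Then $u_{(123)}\in\mathscr H^s(\mathbb M_T)$, and there are $u_{(j)}\in\mathscr H^s(\mathbb M_T)$ with $(\Box+V)u_{(j)}=f_{(j)}$ and $(\Box+V)u_{(123)}=h\,u_{(1)}u_{(2)}u_{(3)}$ for $0<t<T$, all of them vanishing for $t\le0$. (b) There is $C>0$, depending only on $s,T,\rho,M,\varrho$, such that for all admissible $V,h,\tilde V,\tilde h$ and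 all $\delta\in(0,\varrho)$: if $$\big\|\mathcal P_{V,h}(f)-\mathcal P_{\tilde V,\tilde h}(f)\big\|_{\mathscr H^s(\mho)}\le\delta\quad\text{for all sources $f$ with }\|f\|_{\mathscr H^s(\mho)}\le\varrho,$$ then $$\big\|T_{V,h}-T_{\tilde V,\tilde h}\big\|\le C\,\delta^{2/5},$$ where $\|B\|=\sup\{\|B(f_{(1)},f_{(2)},f_{(3)})\|_{\mathscr H^s(\mho)}:\ \|f_{(j)}\|_{\mathscr H^s(\mho)}=1,\ j=1,2,3\}$ over sources $f_{(j)}$. -/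

import Mathlib

open MeasureTheory Set Filter Topology
open scoped ENNReal ContDiff

noncomputable section

namespace CubicWave

/-- Physical space `ℝ³` with its Euclidean norm. -/
abbrev E3 : Type := EuclideanSpace ℝ (Fin 3)

/-- Real `L²(Ω)` for a set `Ω ⊆ ℝ³`. -/
abbrev L2 (Ω : Set E3) : Type := Lp ℝ 2 ((volume : Measure E3).restrict Ω)

/-! ### Weak derivatives and integer order Sobolev spaces -/

/-- The classical partial derivative `∂ᵢ φ`. -/
def pderiv (i : Fin 3) (φ : E3 → ℝ) : E3 → ℝ :=
  fun x => fderiv ℝ φ x (EuclideanSpace.single i 1)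

/-- The classical derivative `∂^α φ` for a multi-index `α`. -/
def pderivs (α : Fin 3 → ℕ) (φ : E3 → ℝ) : E3 → ℝ :=
  (pderiv 0)^[α 0] ((pderiv 1)^[α 1] ((pderiv 2)^[α 2] φ))

/-- Test functions `C_c^∞(Ω)`. -/
def IsTest (Ω : Set E3) (φ : E3 → ℝ) : Prop :=
  ContDiff ℝ ∞ φ ∧ HasCompactSupport φ ∧ tsupport φ ⊆ Ω

/-- `g' = ∂^α g` in the sense of distributions on `Ω`. -/
def HasWeakDeriv (Ω : Set E3) (α : Fin 3 → ℕ) (g g' : L2 Ω) : Prop :=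
  ∀ φ : E3 → ℝ, IsTest Ω φ →
    ∫ x in Ω, g x * pderivs α φ x = (-1) ^ (∑ i, α i) * ∫ x in Ω, g' x * φ x

theorem pderiv_smooth (i : Fin 3) {φ : E3 → ℝ} (h : ContDiff ℝ ∞ φ ∧ HasCompactSupport φ) :
    ContDiff ℝ ∞ (pderiv i φ) ∧ HasCompactSupport (pderiv i φ) := by
  refine ⟨?_, ?_⟩
  · exact (h.1.fderiv_right (m := ∞) (by simp)).clm_apply contDiff_const
  · exact h.2.fderiv_apply ℝ (EuclideanSpace.single i 1)

theorem iterate_pderiv_smooth (i : Fin 3) (n : ℕ) {φ : E3 → ℝ}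
    (h : ContDiff ℝ ∞ φ ∧ HasCompactSupport φ) :
    ContDiff ℝ ∞ ((pderiv i)^[n] φ) ∧ HasCompactSupport ((pderiv i)^[n] φ) := by
  induction n with
  | zero => exact h
  | succ n ih =>
    rw [Function.iterate_succ_apply']
    exact pderiv_smooth i ih

theorem pderivs_smooth (α : Fin 3 → ℕ) {φ : E3 → ℝ}
    (h : ContDiff ℝ ∞ φ ∧ HasCompactSupport φ) :
    ContDiff ℝ ∞ (pderivs α φ) ∧ HasCompactSupport (pderivs α φ) :=
  iterate_pderiv_smooth 0 _ (iterate_pderiv_smooth 1 _ (iterate_pderiv_smooth 2 _ h))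

theorem integrable_mul_smooth {Ω : Set E3} (g : L2 Ω) {ψ : E3 → ℝ}
    (h : ContDiff ℝ ∞ ψ ∧ HasCompactSupport ψ) :
    Integrable (fun x => g x * ψ x) ((volume : Measure E3).restrict Ω) := by
  have h2 : MemLp ψ 2 ((volume : Measure E3).restrict Ω) :=
    (h.1.continuous.memLp_of_hasCompactSupport (μ := (volume : Measure E3)) h.2).restrict Ω
  exact (Lp.memLp g).integrable_mul h2

theorem hasWeakDeriv_add {Ω : Set E3} {α : Fin 3 → ℕ} {g₁ g₂ k₁ k₂ : L2 Ω}
    (h₁ : HasWeakDeriv Ω α g₁ k₁) (h₂ : HasWeakDeriv Ω α g₂ k₂) :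
    HasWeakDeriv Ω α (g₁ + g₂) (k₁ + k₂) := by
  intro φ hφ
  have hs : ContDiff ℝ ∞ φ ∧ HasCompactSupport φ := ⟨hφ.1, hφ.2.1⟩
  have key : ∀ (a b : L2 Ω) (ψ : E3 → ℝ), (ContDiff ℝ ∞ ψ ∧ HasCompactSupport ψ) →
      ∫ x in Ω, (a + b : L2 Ω) x * ψ x = (∫ x in Ω, a x * ψ x) + ∫ x in Ω, b x * ψ x := by
    intro a b ψ hψ
    rw [← integral_add (integrable_mul_smooth a hψ) (integrable_mul_smooth b hψ)]
    refine integral_congr_ae ?_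
    filter_upwards [Lp.coeFn_add a b] with x hx
    rw [hx, Pi.add_apply, add_mul]
  rw [key _ _ _ (pderivs_smooth α hs), key _ _ _ hs, h₁ φ hφ, h₂ φ hφ, mul_add]

theorem hasWeakDeriv_smul {Ω : Set E3} {α : Fin 3 → ℕ} (c : ℝ) {g k : L2 Ω}
    (h : HasWeakDeriv Ω α g k) : HasWeakDeriv Ω α (c • g) (c • k) := by
  intro φ hφ
  have key : ∀ (a : L2 Ω) (ψ : E3 → ℝ),
      ∫ x in Ω, (c • a : L2 Ω) x * ψ x = c * ∫ x in Ω, a x * ψ x := by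
    intro a ψ
    rw [← integral_const_mul]
    refine integral_congr_ae ?_
    filter_upwards [Lp.coeFn_smul c a] with x hx
    rw [hx, Pi.smul_apply, smul_eq_mul, mul_assoc]
  rw [key, key, h φ hφ]
  ring

theorem hasWeakDeriv_zero {Ω : Set E3} {α : Fin 3 → ℕ} :
    HasWeakDeriv Ω α (0 : L2 Ω) 0 := by
  have h : ∀ ψ : E3 → ℝ, ∫ x in Ω, (0 : L2 Ω) x * ψ x = 0 := by
    intro ψ
    refine integral_eq_zero_of_ae ?_
    filter_upwards [Lp.coeFn_zero ℝ 2 ((volume : Measure E3).restrict Ω)] with x hx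
    rw [hx]
    simp
  intro φ _
  rw [h, h, mul_zero]

/-- The multi-indices `α` with `|α| ≤ m`. -/
def multiIdx (m : ℕ) : Finset (Fin 3 → ℕ) :=
  (Fintype.piFinset fun _ => Finset.range (m + 1)).filter fun α => ∑ i, α i ≤ m

theorem zero_mem_multiIdx (m : ℕ) : (0 : Fin 3 → ℕ) ∈ multiIdx m := by
  simp [multiIdx]

/-- The Sobolev space `H^m(Ω)`: an element is the family `(∂^α g)_{|α| ≤ m}` of weak derivatives of
an `L²` function `g`, all of them in `L²(Ω)`, and its norm is `(∑ ‖∂^α g‖²)^{1/2}`. -/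
def Sob (Ω : Set E3) (m : ℕ) : Submodule ℝ (PiLp 2 fun _ : multiIdx m => L2 Ω) where
  carrier := {g | ∀ α, HasWeakDeriv Ω α.1 (g ⟨0, zero_mem_multiIdx m⟩) (g α)}
  add_mem' := by
    intro a b ha hb α
    exact hasWeakDeriv_add (ha α) (hb α)
  zero_mem' := by
    intro α
    exact hasWeakDeriv_zero
  smul_mem' := by
    intro c a ha α
    exact hasWeakDeriv_smul c (ha α)

/-- The `L²` function underlying an element of `H^m(Ω)`. -/
def Sob.toL2 {Ω : Set E3} {m : ℕ} (g : Sob Ω m) : L2 Ω := g.1 ⟨0, zero_mem_multiIdx m⟩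

/-- The `H^m(Ω)` norm of an `L²` function, equal to `∞` if the function is not in `H^m(Ω)`. -/
def sobENorm (Ω : Set E3) (m : ℕ) (g : L2 Ω) : ℝ≥0∞ :=
  ⨅ (G : Sob Ω m) (_ : Sob.toL2 G = g), ‖G‖ₑ

/-! ### The spaces `⋂_{0 ≤ k ≤ s} C^k((0,T); H^{s-k}(Ω))`

Functions on `(0,T) × Ω` are curves `u : ℝ → L²(Ω)`; only the values on `(0,T)` matter. -/

/-- `u ∈ C^k((0,T); H^{s-k}(Ω))` for all `0 ≤ k ≤ s`. -/
def MemHs (s : ℕ) (T : ℝ) (Ω : Set E3) (u : ℝ → L2 Ω) : Prop :=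
  ∀ k ≤ s, ∃ U : ℝ → Sob Ω (s - k),
    ContDiffOn ℝ k U (Ioo 0 T) ∧ ∀ t ∈ Ioo 0 T, Sob.toL2 (U t) = u t

open Classical in
/-- The norm `∑_{k ≤ s} sup_{0<t<T} ‖∂_t^k u(t)‖_{H^{s-k}(Ω)}`, equal to `∞` outside the space. -/
def hsENorm (s : ℕ) (T : ℝ) (Ω : Set E3) (u : ℝ → L2 Ω) : ℝ≥0∞ :=
  if MemHs s T Ω u then
    ∑ k ∈ Finset.range (s + 1), ⨆ t ∈ Ioo 0 T, sobENorm Ω (s - k) (iteratedDeriv k u t)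
  else ⊤

/-- The restriction `L²(ℝ³) → L²(Ω)`. -/
def res (Ω : Set E3) (g : L2 univ) : L2 Ω :=
  ((Lp.memLp g).mono_measure (Measure.restrict_mono_set volume (subset_univ Ω))).toLp g

/-- The ball `𝒪` of radius `ρ`; the measurement cylinder is `℧ = (0,T) × 𝒪`. -/
abbrev ball3 (ρ : ℝ) : Set E3 := Metric.ball 0 ρ

/-- Sources: elements of `ℋ^s(M_T)`, `M_T = (0,T) × ℝ³`, vanishing outside the cylinder
`(0,T) × 𝒪`. -/
def IsSource (s : ℕ) (T ρ : ℝ) (f : ℝ → L2 univ) : Prop :=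
  hsENorm s T univ f < ⊤ ∧
    ∀ t ∈ Ioo 0 T, ∀ᵐ x ∂(volume : Measure E3), x ∉ ball3 ρ → f t x = 0

/-! ### The wave equations -/

/-- `u ∈ ℋ^s(M_T)` is a strong solution of `□u + V u = F` on `(0,T) × ℝ³` with `u ≡ 0` for `t ≤ 0`.
Continuity of `u` and `∂_t u` across `t = 0` encodes the vanishing Cauchy data. -/
def IsWaveSol (s : ℕ) (T : ℝ) (V : ℝ × E3 → ℝ) (F : ℝ → E3 → ℝ) (u : ℝ → L2 univ) : Prop :=
  hsENorm s T univ u < ⊤ ∧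
  (∀ t ≤ 0, u t = 0) ∧ ContDiffOn ℝ 1 u (Iio T) ∧
  ∀ t ∈ Ioo 0 T, ∃ L : Fin 3 → L2 univ,
    (∀ i, HasWeakDeriv univ (Pi.single i 2) (u t) (L i)) ∧
    ∀ᵐ x ∂(volume : Measure E3),
      deriv (deriv u) t x - ∑ i, L i x + V (t, x) * u t x = F t x

/-- `u ∈ ℋ^s(M_T)` solves `□u + V u + h u³ = f` for `0 < t < T`, and `u ≡ 0` for `t ≤ 0`. -/
def IsCubicSol (s : ℕ) (T : ℝ) (V h : ℝ × E3 → ℝ) (f u : ℝ → L2 univ) : Prop :=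
  IsWaveSol s T V (fun t x => f t x - h (t, x) * u t x ^ 3) u

open Classical in
/-- The solution `u` of the cubic equation with source `f` (zero if there is none). -/
def cubicSol (s : ℕ) (T : ℝ) (V h : ℝ × E3 → ℝ) (f : ℝ → L2 univ) : ℝ → L2 univ :=
  if H : ∃ u, IsCubicSol s T V h f u then H.choose else 0

/-- The source-to-solution map `P_{V,h} : f ↦ u|_℧`. -/
def srcToSol (s : ℕ) (T ρ : ℝ) (V h : ℝ × E3 → ℝ) (f : ℝ → L2 univ) : ℝ → L2 (ball3 ρ) :=
  fun t => res (ball3 ρ) (cubicSol s T V h f t)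

/-- The third order linearization
`u_(123) = -(1/3!) ∂_{ε₁} ∂_{ε₂} ∂_{ε₃} u(ε₁ f₁ + ε₂ f₂ + ε₃ f₃)` at `ε = 0`. -/
def thirdLin (s : ℕ) (T : ℝ) (V h : ℝ × E3 → ℝ) (f₁ f₂ f₃ : ℝ → L2 univ) : ℝ → L2 univ :=
  fun t => (-(1 / 6) : ℝ) •
    deriv (fun ε₁ : ℝ => deriv (fun ε₂ : ℝ => deriv (fun ε₃ : ℝ =>
      cubicSol s T V h (ε₁ • f₁ + ε₂ • f₂ + ε₃ • f₃) t) 0) 0) 0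

/-- The trilinear response operator `T_{V,h}(f₁,f₂,f₃) = u_(123)|_℧`. -/
def triOp (s : ℕ) (T ρ : ℝ) (V h : ℝ × E3 → ℝ) (f₁ f₂ f₃ : ℝ → L2 univ) : ℝ → L2 (ball3 ρ) :=
  fun t => res (ball3 ρ) (thirdLin s T V h f₁ f₂ f₃ t)

/-- The operator norm `sup {‖B(f₁,f₂,f₃)‖_{ℋ^s(℧)} : ‖f_j‖_{ℋ^s(℧)} = 1}`. Sources vanish outside
`℧`, so their norm over `M_T` is their norm over `℧`. -/
def triNorm (s : ℕ) (T ρ : ℝ)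
    (B : (ℝ → L2 univ) → (ℝ → L2 univ) → (ℝ → L2 univ) → (ℝ → L2 (ball3 ρ))) : ℝ≥0∞ :=
  sSup {r | ∃ f₁ f₂ f₃, IsSource s T ρ f₁ ∧ IsSource s T ρ f₂ ∧ IsSource s T ρ f₃ ∧
    hsENorm s T univ f₁ = 1 ∧ hsENorm s T univ f₂ = 1 ∧ hsENorm s T univ f₃ = 1 ∧
    r = hsENorm s T (ball3 ρ) (B f₁ f₂ f₃)}

/-- Smooth coefficients on `ℝ × ℝ³` whose derivatives of order at most `s` are bounded by `M` on
`[0,T] × {|x'| ≤ ρ + T}`, the region that waves emitted in `℧` can reach. -/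
def IsCoeff (s : ℕ) (T ρ M : ℝ) (V : ℝ × E3 → ℝ) : Prop :=
  ContDiff ℝ ∞ V ∧ ∀ j ≤ s, ∀ p ∈ Icc 0 T ×ˢ Metric.closedBall (0 : E3) (ρ + T),
    ‖iteratedFDeriv ℝ j V p‖ ≤ M

end CubicWave

end

/-!
The equations are solved without Fourier analysis or energy estimates, by Kirchhoff's formula
`u(t) = ∫₀ᵗ τ · (mean of F(t - τ, · + τ y) over |y| = 1) dτ` (`kir`) for the solution of `□u = F`
with vanishing data in three space dimensions. It is an average of translates of `F`, so it is a bounded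
operation on curves in `L²(ℝ³)`, it commutes with weak derivatives, and it respects the propagation
cone `|x| ≤ ρ + t`. That it inverts `□` comes down to the identity `integral_sph_laplacian` for the
Laplacian under spherical means, which is a consequence of rotation invariance (`inner_kir`,
`kir_wave`).

The work takes place in the Banach space `RegCurve` of curves `u : (0,T) → L²(ℝ³)` supported in
`|x| ≤ ρ + t` all of whose mixed derivatives of order at most `s` exist and are continuous in
`L²(ℝ³)`, the `k`-th order ones being of size at most `A L ^ k exp (L t)` for some `A`, the norm of
`u`. With this weight
- the space is an algebra (`Reg.mul`), by the Sobolev embedding `H²(ℝ³) ⊆ L^∞` of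
  `exists_sobolev_bound`, which is obtained by integrating along rays;
- multiplication by an admissible coefficient is bounded by a constant independent of `L`
  (`Reg.coeff`);
- Kirchhoff's operator gains a factor `C / L` (`Reg.kir`, `exists_kopC_le`).

Hence, for `L` large depending on `s, T, ρ, M` only, `□ + V` is inverted by a Neumann series, and
the cubic equation becomes `u + K(u,u,u) = lin f` with a bounded symmetric trilinear `K`, where
`K(x,y,z)` solves `(□ + V) w = h x y z` (`exists_uniform_response`). Any two solutions of finite
norm agree: by the reproducing identity for spherical means of test functions, the difference of two
solutions is bounded on backward light cones by the time integral of itself (`IsCubicSol.unique`).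

The abstract equation `u + K(u,u,u) = a` is solved for small `a` by a fixed point
`u = a - K(a,a,a) + O(‖a‖⁵)` (`exists_cubic_solution`), near zero also by a smooth function of `a`
with third derivative `-6 K` at `0` (`exists_smooth_cubic_solution`, `third_derivative`); with
uniqueness, this identifies the third linearization with `K(lin f₁, lin f₂, lin f₃)`.

For the stability estimate, the alternating sum over signs of `u(ε (f₁ ± f₂ ± f₃))` equals
`-24 ε³ K(lin f₁, lin f₂, lin f₃) + O(ε⁵)`, the quadratic and quartic terms in `ε` being absent
(`IsResponse.exists_remainder`). Dividing by `ε³`, measurements that agree up to `δ` determine the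
response up to a multiple of `δ / ε³ + ε²`, and `ε ~ δ ^ (1 / 5)` gives `δ ^ (2 / 5)`
(`exists_step`).
-/

open MeasureTheory Set Filter Topology
open scoped ENNReal ContDiff

noncomputable section

namespace CubicWave

/-! ### Translations, test functions and weak derivatives in `L²(ℝ³)` -/

/-- Lebesgue measure on `ℝ³`, in the form in which it enters `L2 univ`. -/
abbrev μ₀ : Measure E3 := (volume : Measure E3).restrict univ

theorem μ₀_eq : μ₀ = (volume : Measure E3) := Measure.restrict_univ

instance : μ₀.IsAddHaarMeasure := by rw [μ₀_eq]; infer_instance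

/-- The real Hilbert space `L²(ℝ³)`. -/
abbrev H : Type := L2 univ

theorem mp_shift (v : E3) : MeasurePreserving (fun x : E3 => x + v) μ₀ μ₀ :=
  measurePreserving_add_right μ₀ v

/-- Translation `(shift v g)(x) = g (x + v)`. -/
def shift (v : E3) : H →ₗᵢ[ℝ] H :=
  Lp.compMeasurePreservingₗᵢ ℝ (fun x : E3 => x + v) (mp_shift v)

theorem shift_coe (v : E3) (g : H) : shift v g =ᵐ[μ₀] fun x => g (x + v) :=
  Lp.coeFn_compMeasurePreserving g (mp_shift v)

theorem ae_shift {p : E3 → Prop} (v : E3) (h : ∀ᵐ x ∂μ₀, p x) : ∀ᵐ x ∂μ₀, p (x + v) :=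
  (mp_shift v).quasiMeasurePreserving.ae h

theorem norm_shift (v : E3) (g : H) : ‖shift v g‖ = ‖g‖ := (shift v).norm_map g

theorem shift_zero (g : H) : shift 0 g = g := by
  refine Lp.ext ?_
  filter_upwards [shift_coe 0 g] with x hx
  rw [hx, add_zero]

theorem shift_shift (v w : E3) (g : H) : shift v (shift w g) = shift (v + w) g := by
  refine Lp.ext ?_
  filter_upwards [shift_coe v (shift w g), shift_coe (v + w) g, ae_shift v (shift_coe w g)]
    with x h1 h2 h3
  rw [h1, h2, h3, add_assoc]

theorem continuous_shift : Continuous fun p : E3 × H => shift p.1 p.2 := by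
  refine Continuous.compMeasurePreservingLp (f := fun p : E3 × H => p.2)
    (g := fun p : E3 × H => (ContinuousMap.mk (fun x : E3 => x + p.1))) continuous_snd ?_
    (fun p => mp_shift p.1) (by norm_num)
  refine ContinuousMap.continuous_of_continuous_uncurry _ ?_
  change Continuous fun q : (E3 × H) × E3 => q.2 + q.1.1
  fun_prop

theorem inner_eq (g k : H) : inner ℝ g k = ∫ x, g x * k x ∂μ₀ := by
  rw [L2.inner_def]
  refine integral_congr_ae (Eventually.of_forall fun x => ?_)
  simp [mul_comm]

theorem inner_shift (v : E3) (g k : H) : inner ℝ (shift v g) k = inner ℝ g (shift (-v) k) := by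
  rw [← (shift (-v)).inner_map_map, shift_shift, neg_add_cancel, shift_zero]

attribute [irreducible] shift

/-- The element of `L²(ℝ³)` given by a function; zero if the function is not square integrable. -/
def ofFun (a : E3 → ℝ) : H :=
  open Classical in if h : MemLp a 2 μ₀ then h.toLp a else 0

theorem ofFun_coe {a : E3 → ℝ} (h : MemLp a 2 μ₀) : ofFun a =ᵐ[μ₀] a := by
  rw [ofFun, dif_pos h]
  exact h.coeFn_toLp

theorem ofFun_congr {a b : E3 → ℝ} (h : a =ᵐ[μ₀] b) : ofFun a = ofFun b := by
  unfold ofFun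
  by_cases ha : MemLp a 2 μ₀
  · have hb : MemLp b 2 μ₀ := (memLp_congr_ae h).1 ha
    rw [dif_pos ha, dif_pos hb]
    exact (MemLp.toLp_eq_toLp_iff ha hb).2 h
  · have hb : ¬ MemLp b 2 μ₀ := fun hb => ha ((memLp_congr_ae h).2 hb)
    rw [dif_neg ha, dif_neg hb]

theorem ofFun_eq {a : E3 → ℝ} {g : H} (h : a =ᵐ[μ₀] g) : ofFun a = g :=
  Lp.ext ((ofFun_coe ((memLp_congr_ae h).2 (Lp.memLp g))).trans h)

/-- Smooth compactly supported functions on `ℝ³`. -/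
abbrev Test (φ : E3 → ℝ) : Prop := ContDiff ℝ ∞ φ ∧ HasCompactSupport φ

theorem isTest_univ {φ : E3 → ℝ} : IsTest univ φ ↔ Test φ :=
  ⟨fun h => ⟨h.1, h.2.1⟩, fun h => ⟨h.1, h.2, subset_univ _⟩⟩

theorem Test.memLp {φ : E3 → ℝ} (h : Test φ) : MemLp φ 2 μ₀ :=
  h.1.continuous.memLp_of_hasCompactSupport h.2

theorem Test.coe {φ : E3 → ℝ} (h : Test φ) : ofFun φ =ᵐ[μ₀] φ := ofFun_coe h.memLp

theorem Test.inner {φ : E3 → ℝ} (h : Test φ) (g : H) :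
    inner ℝ g (ofFun φ) = ∫ x, g x * φ x ∂μ₀ := by
  rw [inner_eq]
  refine integral_congr_ae ?_
  filter_upwards [h.coe] with x hx
  rw [hx]

theorem Test.shift {φ : E3 → ℝ} (h : Test φ) (v : E3) : Test (fun x => φ (x + v)) :=
  ⟨h.1.comp (contDiff_id.add contDiff_const),
    h.2.comp_homeomorph (Homeomorph.addRight v)⟩

theorem shift_ofFun {φ : E3 → ℝ} (h : Test φ) (v : E3) :
    CubicWave.shift v (ofFun φ) = ofFun (fun x => φ (x + v)) := by
  refine Lp.ext ?_
  filter_upwards [shift_coe v (ofFun φ), ae_shift v h.coe, (h.shift v).coe] with x h1 h2 h3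
  rw [h1, h2, h3]

theorem pderiv_shift (i : Fin 3) (φ : E3 → ℝ) (v : E3) :
    pderiv i (fun x => φ (x + v)) = fun x => pderiv i φ (x + v) := by
  funext x
  simp only [pderiv]
  rw [fderiv_comp_add_right]

theorem Test.pderiv {φ : E3 → ℝ} (h : Test φ) (i : Fin 3) : Test (pderiv i φ) :=
  pderiv_smooth i h

/-- Elements of `L²(ℝ³)` are separated by test functions. -/
theorem eq_zero_of_inner_test {g : H} (h : ∀ φ, Test φ → inner ℝ g (ofFun φ) = 0) : g = 0 := by
  have h1 : ∀ᵐ x ∂μ₀, g x = 0 := by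
    refine ae_eq_zero_of_integral_contDiff_smul_eq_zero
      ((Lp.memLp g).locallyIntegrable (by norm_num)) ?_
    intro φ h1 h2
    rw [← h φ ⟨h1, h2⟩, Test.inner ⟨h1, h2⟩]
    simp [mul_comm]
  refine Lp.ext ?_
  filter_upwards [h1, Lp.coeFn_zero ℝ 2 μ₀] with x h1 h2
  rw [h1, h2]; rfl

theorem ext_inner_test {g k : H} (h : ∀ φ, Test φ → inner ℝ g (ofFun φ) = inner ℝ k (ofFun φ)) :
    g = k := by
  rw [← sub_eq_zero]
  refine eq_zero_of_inner_test fun φ hφ => ?_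
  rw [inner_sub_left, h φ hφ, sub_self]

/-- `g' = ∂ᵢ g` in the sense of distributions on `ℝ³`. -/
def WD (i : Fin 3) (g g' : H) : Prop :=
  ∀ φ, Test φ → inner ℝ g (ofFun (pderiv i φ)) = -inner ℝ g' (ofFun φ)

theorem WD.unique {i : Fin 3} {g g₁ g₂ : H} (h₁ : WD i g g₁) (h₂ : WD i g g₂) : g₁ = g₂ :=
  ext_inner_test fun φ hφ => neg_injective ((h₁ φ hφ).symm.trans (h₂ φ hφ))

theorem WD.add {i : Fin 3} {g g' k k' : H} (h : WD i g g') (h' : WD i k k') :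
    WD i (g + k) (g' + k') := fun φ hφ => by
  rw [inner_add_left, inner_add_left, h φ hφ, h' φ hφ]; ring

theorem WD.smul {i : Fin 3} {g g' : H} (c : ℝ) (h : WD i g g') : WD i (c • g) (c • g') :=
  fun φ hφ => by
    rw [inner_smul_left, inner_smul_left, h φ hφ]; simp

theorem WD.zero (i : Fin 3) : WD i 0 0 := fun φ _ => by simp

theorem WD.shift {i : Fin 3} {g g' : H} (v : E3) (h : WD i g g') :
    WD i (shift v g) (shift v g') := fun φ hφ => by
  rw [inner_shift, inner_shift, shift_ofFun hφ, shift_ofFun (hφ.pderiv i),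
    ← h _ (hφ.shift (-v)), pderiv_shift]

theorem isClosed_WD (i : Fin 3) : IsClosed {p : H × H | WD i p.1 p.2} := by
  simp only [WD, ofPred_forall]
  refine isClosed_iInter fun φ => isClosed_iInter fun _ => isClosed_eq ?_ ?_ <;> fun_prop

theorem fderiv_apply_eq (φ : E3 → ℝ) (x v : E3) :
    fderiv ℝ φ x v = ∑ i, v i * pderiv i φ x := by
  have hv : v = ∑ i, v i • EuclideanSpace.single i (1 : ℝ) := by
    ext j
    simp [Finset.sum_apply, Pi.single_apply]
  conv_lhs => rw [hv]
  simp only [map_sum, map_smul, smul_eq_mul, pderiv]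

theorem Test.WD {φ : E3 → ℝ} (h : Test φ) (i : Fin 3) :
    WD i (ofFun φ) (ofFun (CubicWave.pderiv i φ)) := by
  intro ψ hψ
  rw [real_inner_comm, real_inner_comm (ofFun ψ), h.inner, (h.pderiv i).inner]
  have e : ∀ {a b : E3 → ℝ}, Test a → Test b →
      (∫ x, (ofFun a : E3 → ℝ) x * b x ∂μ₀) = ∫ x, b x * a x ∂μ₀ := by
    intro a b ha hb
    refine integral_congr_ae ?_
    filter_upwards [ha.coe] with x hx
    rw [hx, mul_comm]
  rw [e (hψ.pderiv i) h, e hψ (h.pderiv i)]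
  have int : ∀ {a b : E3 → ℝ}, Test a → Test b → Integrable (fun x => a x * b x) μ₀ :=
    fun {a b} ha hb => (ha.1.continuous.mul hb.1.continuous).integrable_of_hasCompactSupport
      (ha.2.mul_right)
  have := integral_mul_fderiv_eq_neg_fderiv_mul_of_integrable (μ := μ₀) (f := φ) (g := ψ)
    (v := EuclideanSpace.single i 1) (int (h.pderiv i) hψ) (int h (hψ.pderiv i)) (int h hψ)
    (fun x _ => (h.1.differentiable (by simp)).differentiableAt)
    (fun x _ => (hψ.1.differentiable (by simp)).differentiableAt)
  simp only [CubicWave.pderiv]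
  rw [this]

/-- Differentiation of a translated test function in the weak topology of `L²(ℝ³)`. -/
theorem hasDerivAt_integral_shift_test {φ : E3 → ℝ} (h : Test φ) (g : H) (v : E3) (r₀ : ℝ) :
    HasDerivAt (fun r : ℝ => ∫ x, g x * φ (x + r • v) ∂μ₀)
      (∫ x, g x * ∑ i, v i * pderiv i φ (x + r₀ • v) ∂μ₀) r₀ := by
  have hfd : Continuous (fderiv ℝ φ) := h.1.continuous_fderiv (by simp)
  obtain ⟨C, hC⟩ : ∃ C, ∀ x, ‖fderiv ℝ φ x‖ ≤ C :=
    (h.2.fderiv (𝕜 := ℝ)).exists_bound_of_continuous hfd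
  obtain ⟨R, hR⟩ := (h.2.isCompact.isBounded).subset_closedBall (0 : E3)
  set K : Set E3 := Metric.closedBall 0 (R + (|r₀| + 1) * ‖v‖) with hK
  have hKm : MeasurableSet K := Metric.isClosed_closedBall.measurableSet
  have hsm : ∀ r : ℝ, Test (fun x => φ (x + r • v)) := fun r => h.shift _
  have key := hasDerivAt_integral_of_dominated_loc_of_deriv_le (μ := μ₀)
    (F := fun (r : ℝ) x => g x * φ (x + r • v))
    (F' := fun (r : ℝ) x => g x * fderiv ℝ φ (x + r • v) v) (x₀ := r₀)
    (s := Metric.ball r₀ 1) (bound := fun x => ‖g x * K.indicator (fun _ => C * ‖v‖) x‖)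
    (Metric.ball_mem_nhds r₀ one_pos)
    (Eventually.of_forall fun r =>
      (Lp.aestronglyMeasurable g).mul (hsm r).1.continuous.aestronglyMeasurable)
    (integrable_mul_smooth g (hsm r₀))
    ((Lp.aestronglyMeasurable g).mul
      (by
        apply Continuous.aestronglyMeasurable
        fun_prop))
    ?_ ?_ ?_
  · simpa only [fderiv_apply_eq] using key.2
  · refine Eventually.of_forall fun x r hr => ?_
    rw [norm_mul, norm_mul]
    gcongr
    by_cases hx : x ∈ K
    · rw [indicator_of_mem hx]
      refine ((fderiv ℝ φ _).le_opNorm v).trans ?_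
      rw [Real.norm_of_nonneg (by have := (norm_nonneg _).trans (hC 0); positivity)]
      gcongr
      exact hC _
    · rw [indicator_of_notMem hx]
      have : x + r • v ∉ tsupport φ := by
        intro hm
        have h1 := hR hm
        rw [mem_closedBall_zero_iff] at h1
        apply hx
        rw [hK, mem_closedBall_zero_iff]
        have h2 : ‖x‖ ≤ ‖x + r • v‖ + ‖r • v‖ := by
          simpa using norm_sub_le (x + r • v) (r • v)
        have h3 : |r| ≤ |r₀| + 1 := by
          rw [Metric.mem_ball, Real.dist_eq] at hr
          have := abs_sub_abs_le_abs_sub r r₀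
          linarith
        rw [norm_smul, Real.norm_eq_abs] at h2
        nlinarith [norm_nonneg v]
      have h0 : fderiv ℝ φ (x + r • v) = 0 :=
        image_eq_zero_of_notMem_tsupport fun hm => this (tsupport_fderiv_subset ℝ hm)
      simp [h0]
  · refine Integrable.norm ?_
    have hm : MemLp (K.indicator fun _ => C * ‖v‖) 2 μ₀ :=
      memLp_indicator_const 2 hKm _ (Or.inr (by
        rw [μ₀_eq]; exact (isCompact_closedBall _ _).measure_lt_top.ne))
    exact (Lp.memLp g).integrable_mul hm
  · refine Eventually.of_forall fun x r _ => HasDerivAt.const_mul _ ?_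
    have h1 : HasFDerivAt φ (fderiv ℝ φ (x + r • v)) (x + r • v) :=
      (h.1.differentiable (by simp)).differentiableAt.hasFDerivAt
    have h2 : HasDerivAt (fun r : ℝ => x + r • v) v r := by
      simpa using ((hasDerivAt_id r).smul_const v).const_add x
    exact h1.comp_hasDerivAt r h2

theorem hasDerivAt_inner_shift {g : H} {g' : Fin 3 → H} (hg : ∀ i, WD i g (g' i)) (v : E3)
    {φ : E3 → ℝ} (h : Test φ) (r : ℝ) :
    HasDerivAt (fun r : ℝ => inner ℝ (shift (r • v) g) (ofFun φ))
      (inner ℝ (shift (r • v) (∑ i, v i • g' i)) (ofFun φ)) r := by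
  have h1 := hasDerivAt_integral_shift_test h g (-v) r
  have e1 : (fun r : ℝ => inner ℝ (shift (r • v) g) (ofFun φ)) =
      fun r : ℝ => ∫ x, g x * φ (x + r • -v) ∂μ₀ := by
    funext r
    rw [inner_shift, shift_ofFun h, (h.shift _).inner]
    simp
  rw [e1]
  convert h1 using 1
  have e2 : (∫ x, g x * ∑ i, (-v) i * pderiv i φ (x + r • -v) ∂μ₀)
      = ∑ i, (-v i) * ∫ x, g x * pderiv i φ (x + r • -v) ∂μ₀ := by
    simp only [Finset.mul_sum]
    rw [integral_finsetSum]
    · refine Finset.sum_congr rfl fun i _ => ?_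
      rw [← integral_const_mul]
      refine integral_congr_ae (Eventually.of_forall fun x => ?_)
      simp only [PiLp.neg_apply]
      ring
    · intro i _
      have := (integrable_mul_smooth g ((h.pderiv i).shift (r • -v))).const_mul ((-v) i)
      refine this.congr (Eventually.of_forall fun x => ?_)
      dsimp only
      ring
  rw [e2, map_sum, sum_inner]
  refine Finset.sum_congr rfl fun i _ => ?_
  rw [map_smul, inner_smul_left, inner_shift, shift_ofFun h]
  have e3 := hg i _ (h.shift (-(r • v)))
  rw [pderiv_shift, ((h.pderiv i).shift _).inner] at e3
  rw [smul_neg, e3]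
  simp

theorem continuous_shift_left (g : H) : Continuous fun w : E3 => shift w g :=
  continuous_shift.comp (continuous_id.prodMk continuous_const)

theorem continuous_shift_line (v w : E3) (g : H) : Continuous fun r : ℝ => shift (w + r • v) g :=
  (continuous_shift_left g).comp (by fun_prop : Continuous fun r : ℝ => w + r • v)

/-- The fundamental theorem of calculus for translations of an `H¹` function. -/
theorem shift_sub_self {g : H} {g' : Fin 3 → H} (hg : ∀ i, WD i g (g' i)) (v : E3) :
    shift v g - g = ∫ r in (0 : ℝ)..1, shift (r • v) (∑ i, v i • g' i) := by
  have hc : Continuous fun r : ℝ => shift (r • v) (∑ i, v i • g' i) := by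
    simpa using continuous_shift_line v 0 (∑ i, v i • g' i)
  refine ext_inner_test fun φ hφ => ?_
  have h1 : ∫ r in (0 : ℝ)..1, inner ℝ (shift (r • v) (∑ i, v i • g' i)) (ofFun φ) =
      inner ℝ (shift ((1 : ℝ) • v) g) (ofFun φ) - inner ℝ (shift ((0 : ℝ) • v) g) (ofFun φ) :=
    intervalIntegral.integral_eq_sub_of_hasDerivAt
      (fun r _ => hasDerivAt_inner_shift hg v hφ r)
      ((hc.inner continuous_const).intervalIntegrable 0 1)
  rw [one_smul, zero_smul, shift_zero, ← inner_sub_left] at h1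
  rw [← h1]
  generalize ofFun φ = k
  have h2 := (innerSL ℝ k).intervalIntegral_comp_comm (hc.intervalIntegrable (μ := volume) 0 1)
  simp only [innerSL_apply_apply] at h2
  rw [real_inner_comm, ← h2]
  simp only [real_inner_comm k]

theorem norm_shift_sub_le {g : H} {g' : Fin 3 → H} (hg : ∀ i, WD i g (g' i)) {c : ℝ} {w : E3}
    (h : ∀ r ∈ Ioc (0 : ℝ) 1, ∑ i, ‖shift (r • w) (g' i) - g' i‖ ≤ c) :
    ‖shift w g - g - ∑ i, w i • g' i‖ ≤ c * ‖w‖ := by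
  have hc : Continuous fun r : ℝ => shift (r • w) (∑ i, w i • g' i) := by
    simpa using continuous_shift_line w 0 (∑ i, w i • g' i)
  have e1 : shift w g - g - ∑ i, w i • g' i
      = ∫ r in (0 : ℝ)..1, (shift (r • w) (∑ i, w i • g' i) - ∑ i, w i • g' i) := by
    rw [intervalIntegral.integral_sub (hc.intervalIntegrable 0 1)
      (intervalIntegrable_const), ← shift_sub_self hg w]
    simp
  rw [e1]
  have h2 := intervalIntegral.norm_integral_le_of_norm_le_const (a := 0) (b := 1)
    (f := fun r : ℝ => shift (r • w) (∑ i, w i • g' i) - ∑ i, w i • g' i) (C := c * ‖w‖) ?_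
  · simpa using h2
  intro r hr
  rw [uIoc_of_le zero_le_one] at hr
  calc ‖shift (r • w) (∑ i, w i • g' i) - ∑ i, w i • g' i‖
      = ‖∑ i, w i • (shift (r • w) (g' i) - g' i)‖ := by
        simp only [map_sum, map_smul, smul_sub, Finset.sum_sub_distrib]
    _ ≤ ∑ i, ‖w‖ * ‖shift (r • w) (g' i) - g' i‖ := by
        refine norm_sum_le_of_le _ fun i _ => ?_
        rw [norm_smul]
        gcongr
        exact PiLp.norm_apply_le w i
    _ ≤ c * ‖w‖ := by
        rw [← Finset.mul_sum, mul_comm]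
        gcongr
        exact h r hr

/-- Translation is differentiable on `H¹`, the derivative being the gradient. -/
theorem hasFDerivAt_shift {g : H} {g' : Fin 3 → H} (hg : ∀ i, WD i g (g' i)) (v : E3) :
    HasFDerivAt (fun v => shift v g)
      (∑ i, (EuclideanSpace.proj i : E3 →L[ℝ] ℝ).smulRight (shift v (g' i))) v := by
  have hgv : ∀ i, WD i (shift v g) (shift v (g' i)) := fun i => (hg i).shift v
  rw [hasFDerivAt_iff_isLittleO_nhds_zero, Asymptotics.isLittleO_iff]
  intro c hc
  have hcont : Continuous fun w : E3 => ∑ i, ‖shift w (shift v (g' i)) - shift v (g' i)‖ :=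
    continuous_finsetSum _ fun i _ => ((continuous_shift_left _).sub continuous_const).norm
  have h1 : ∀ᶠ w in 𝓝 (0 : E3), ∑ i, ‖shift w (shift v (g' i)) - shift v (g' i)‖ < c := by
    refine hcont.continuousAt.eventually_lt continuousAt_const ?_
    simp only [shift_zero, sub_self, norm_zero, Finset.sum_const_zero]
    exact hc
  obtain ⟨δ, hδ, hball⟩ := Metric.eventually_nhds_iff_ball.1 h1
  filter_upwards [Metric.ball_mem_nhds (0 : E3) hδ] with w hw
  have e1 : (∑ i, (EuclideanSpace.proj i : E3 →L[ℝ] ℝ).smulRight (shift v (g' i))) w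
      = ∑ i, w i • shift v (g' i) := by
    simp only [sum_apply, ContinuousLinearMap.smulRight_apply]
    rfl
  rw [e1, add_comm v w, ← shift_shift]
  refine norm_shift_sub_le hgv fun r hr => (hball _ ?_).le
  rw [mem_ball_zero_iff] at hw ⊢
  rw [norm_smul, Real.norm_of_nonneg hr.1.le]
  nlinarith [norm_nonneg w, hr.2]

theorem hasDerivAt_shift_line {g : H} {g' : Fin 3 → H} (hg : ∀ i, WD i g (g' i)) (v w : E3)
    (r : ℝ) : HasDerivAt (fun r : ℝ => shift (w + r • v) g)
      (∑ i, v i • shift (w + r • v) (g' i)) r := by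
  have h2 : HasDerivAt (fun r : ℝ => w + r • v) v r := by
    simpa using ((hasDerivAt_id r).smul_const v).const_add w
  have h3 := (hasFDerivAt_shift hg (w + r • v)).comp_hasDerivAt r h2
  simp only [sum_apply, ContinuousLinearMap.smulRight_apply] at h3
  exact h3

/-- If the translates in the direction `eᵢ` are differentiable in `L²`, then the derivative is the
weak partial derivative. -/
theorem WD.of_hasDerivAt {i : Fin 3} {g g' : H}
    (h : HasDerivAt (fun r : ℝ => CubicWave.shift (r • EuclideanSpace.single i 1) g) g' 0) :
    WD i g g' := by
  intro φ hφ
  have h1 : HasDerivAt (fun r : ℝ => inner ℝ (CubicWave.shift (r • EuclideanSpace.single i 1) g)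
      (ofFun φ)) (inner ℝ g' (ofFun φ)) 0 := by
    simpa using h.inner ℝ (hasDerivAt_const (0 : ℝ) (ofFun φ))
  have h2 : HasDerivAt (fun r : ℝ => inner ℝ g
      (CubicWave.shift (0 + r • -EuclideanSpace.single i 1) (ofFun φ)))
      (inner ℝ g (∑ j, (-EuclideanSpace.single i (1 : ℝ) : E3) j •
        CubicWave.shift (0 + (0 : ℝ) • -EuclideanSpace.single i 1) (ofFun (pderiv j φ)))) 0 := by
    simpa using (hasDerivAt_const (0 : ℝ) g).inner ℝ
      (hasDerivAt_shift_line (fun j => hφ.WD j) (-EuclideanSpace.single i 1) 0 0)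
  have h3 : (fun r : ℝ => inner ℝ (CubicWave.shift (r • EuclideanSpace.single i 1) g) (ofFun φ)) =
      fun r : ℝ => inner ℝ g (CubicWave.shift (0 + r • -EuclideanSpace.single i 1) (ofFun φ)) := by
    funext r
    rw [inner_shift]; simp
  rw [h3] at h1
  have h4 := h1.unique h2
  rw [h4]
  simp [shift_zero]

theorem WD.hasDerivAt {g : H} {g' : Fin 3 → H} (hg : ∀ i, WD i g (g' i)) (i : Fin 3) :
    HasDerivAt (fun r : ℝ => CubicWave.shift (r • EuclideanSpace.single i 1) g) (g' i) 0 := by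
  have := hasDerivAt_shift_line hg (EuclideanSpace.single i 1) 0 0
  simpa [shift_zero, Pi.single_apply] using this

/-! ### The rotation invariant probability measure on the unit sphere -/

/-- The uniform probability measure on the unit sphere of `ℝ³`: the image of the normalized
Lebesgue measure of the unit ball under `x ↦ x / ‖x‖`. -/
def sph : Measure E3 :=
  (ProbabilityTheory.cond (volume : Measure E3) (Metric.ball 0 1)).map fun x => ‖x‖⁻¹ • x

theorem measurable_radial : Measurable fun x : E3 => ‖x‖⁻¹ • x := by fun_prop

instance : IsProbabilityMeasure (ProbabilityTheory.cond (volume : Measure E3) (Metric.ball 0 1)) :=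
  ProbabilityTheory.cond_isProbabilityMeasure_of_finite
    (Metric.measure_ball_pos _ _ one_pos).ne' measure_ball_lt_top.ne

instance : IsProbabilityMeasure sph :=
  Measure.isProbabilityMeasure_map measurable_radial.aemeasurable

theorem ae_sph_norm : ∀ᵐ y ∂sph, ‖y‖ = 1 := by
  rw [sph, ae_map_iff measurable_radial.aemeasurable
    (measurableSet_eq_fun measurable_norm measurable_const)]
  have h : ∀ᵐ x ∂(volume : Measure E3), x ≠ 0 := by
    simp [ae_iff, measure_singleton]
  have h2 : (ProbabilityTheory.cond (volume : Measure E3) (Metric.ball 0 1)) ≪ volume :=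
    ProbabilityTheory.cond_absolutelyContinuous
  filter_upwards [h2.ae_le h] with x hx
  rw [norm_smul, norm_inv, norm_norm, inv_mul_cancel₀ (norm_ne_zero_iff.2 hx)]

theorem map_sph (R : E3 ≃ₗᵢ[ℝ] E3) : MeasurePreserving R sph sph := by
  have hR : Measurable R := R.continuous.measurable
  refine ⟨hR, ?_⟩
  have h1 : Measure.map R (ProbabilityTheory.cond (volume : Measure E3) (Metric.ball 0 1)) =
      ProbabilityTheory.cond (volume : Measure E3) (Metric.ball 0 1) := by
    have h2 := (R.measurePreserving.restrict_preimage
      (s := Metric.ball (0 : E3) 1) Metric.isOpen_ball.measurableSet).map_eq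
    have h3 : R ⁻¹' Metric.ball (0 : E3) 1 = Metric.ball 0 1 := by
      ext x; simp
    rw [h3] at h2
    rw [ProbabilityTheory.cond, Measure.map_smul, h2]
  rw [sph, Measure.map_map hR measurable_radial]
  have h4 : (R ∘ fun x : E3 => ‖x‖⁻¹ • x) = (fun x : E3 => ‖x‖⁻¹ • x) ∘ R := by
    funext x; simp
  rw [h4, ← Measure.map_map measurable_radial hR, h1]

/-- The generator `x ↦ x_p e_q - x_q e_p` of the rotations of the plane spanned by `e_p`, `e_q`. -/
def rotGen (p q : Fin 3) : E3 →L[ℝ] E3 :=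
  (EuclideanSpace.proj p : E3 →L[ℝ] ℝ).smulRight (EuclideanSpace.single q 1) -
    (EuclideanSpace.proj q : E3 →L[ℝ] ℝ).smulRight (EuclideanSpace.single p 1)

theorem rotGen_apply (p q : Fin 3) (x : E3) : rotGen p q x =
    x p • EuclideanSpace.single q 1 - x q • EuclideanSpace.single p 1 := rfl

theorem rotGen_inner (p q : Fin 3) (x y : E3) :
    inner ℝ (rotGen p q x) y = -inner ℝ x (rotGen p q y) := by
  rw [rotGen_apply, rotGen_apply, inner_sub_left, inner_sub_right, inner_smul_left,
    inner_smul_left, inner_smul_right, inner_smul_right, EuclideanSpace.inner_single_left,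
    EuclideanSpace.inner_single_left, EuclideanSpace.inner_single_right,
    EuclideanSpace.inner_single_right]
  simp
  ring

theorem rotGen_cube {p q : Fin 3} (h : p ≠ q) (x : E3) :
    rotGen p q (rotGen p q (rotGen p q x)) = -rotGen p q x := by
  have h' := h.symm
  simp only [rotGen_apply]
  simp [h, h']
  module

/-- The rotation by the angle `θ` in the plane spanned by `e_p`, `e_q`. -/
def rot (p q : Fin 3) (θ : ℝ) : E3 →L[ℝ] E3 :=
  ContinuousLinearMap.id ℝ E3 + Real.sin θ • rotGen p q +
    (1 - Real.cos θ) • (rotGen p q).comp (rotGen p q)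

theorem rot_apply (p q : Fin 3) (θ : ℝ) (x : E3) : rot p q θ x =
    x + Real.sin θ • rotGen p q x + (1 - Real.cos θ) • rotGen p q (rotGen p q x) := rfl

theorem norm_rot {p q : Fin 3} (h : p ≠ q) (θ : ℝ) (x : E3) : ‖rot p q θ x‖ = ‖x‖ := by
  have e : inner ℝ (rot p q θ x) (rot p q θ x) = inner ℝ x x := by
    have h1 : ∀ y, inner ℝ y (rotGen p q y) = 0 := by
      intro y
      have h := rotGen_inner p q y y
      have h' := real_inner_comm y (rotGen p q y)
      linarith
    have h0 : inner ℝ (rotGen p q x) x = 0 := by rw [real_inner_comm]; exact h1 x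
    have h2 : inner ℝ (rotGen p q (rotGen p q x)) (rotGen p q (rotGen p q x)) =
        inner ℝ (rotGen p q x) (rotGen p q x) := by
      rw [rotGen_inner, rotGen_cube h, inner_neg_right, neg_neg]
    have h3 : inner ℝ (rotGen p q (rotGen p q x)) x =
        -inner ℝ (rotGen p q x) (rotGen p q x) := rotGen_inner p q _ _
    have h4 : inner ℝ x (rotGen p q (rotGen p q x)) =
        -inner ℝ (rotGen p q x) (rotGen p q x) := by rw [real_inner_comm]; exact h3
    have h5 := h1 (rotGen p q x)
    have h6 : inner ℝ (rotGen p q (rotGen p q x)) (rotGen p q x) = 0 := by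
      rw [real_inner_comm]; exact h5
    have h7 := h1 x
    rw [rot_apply]
    simp only [inner_add_left, inner_add_right, inner_smul_left, inner_smul_right, h0, h2, h3, h4,
      h5, h6, h7]
    simp only [conj_trivial]
    have := Real.sin_sq_add_cos_sq θ
    linear_combination (inner ℝ (rotGen p q x) (rotGen p q x)) * this
  rw [real_inner_self_eq_norm_sq, real_inner_self_eq_norm_sq] at e
  exact (sq_eq_sq₀ (norm_nonneg _) (norm_nonneg _)).1 e

/-- `rot p q θ` as a linear isometric equivalence. -/
def rotEquiv {p q : Fin 3} (h : p ≠ q) (θ : ℝ) : E3 ≃ₗᵢ[ℝ] E3 :=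
  LinearIsometry.toLinearIsometryEquiv
    ⟨(rot p q θ : E3 →ₗ[ℝ] E3), norm_rot h θ⟩ rfl

theorem hasDerivAt_rot (p q : Fin 3) (x : E3) (θ : ℝ) : HasDerivAt (fun θ => rot p q θ x)
    (Real.cos θ • rotGen p q x + Real.sin θ • rotGen p q (rotGen p q x)) θ := by
  simp only [rot_apply]
  have h1 := (Real.hasDerivAt_sin θ).smul_const (rotGen p q x)
  have h2 := ((Real.hasDerivAt_cos θ).const_sub 1).smul_const (rotGen p q (rotGen p q x))
  refine HasDerivAt.congr_deriv ((h1.const_add x).fun_add h2) ?_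
  simp

theorem integrable_sph {F : Type*} [NormedAddCommGroup F] {f : E3 → F} (hf : Continuous f) :
    Integrable f sph := by
  obtain ⟨C, hC⟩ := (isCompact_closedBall (0 : E3) 1).exists_bound_of_continuousOn hf.continuousOn
  refine Integrable.of_bound hf.aestronglyMeasurable C ?_
  filter_upwards [ae_sph_norm] with y hy
  exact hC y (by simp [hy])

section

variable {F : Type*} [NormedAddCommGroup F] [NormedSpace ℝ F]

/-- Rotation invariance, infinitesimally: the derivative of a function along a rotation field has
mean zero over the sphere. -/
theorem integral_sph_rotGen {p q : Fin 3} (h : p ≠ q) {f : E3 → F}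
    {f' : E3 → E3 →L[ℝ] F} (hf : ∀ x, HasFDerivAt f (f' x) x) (hf' : Continuous f') :
    ∫ y, f' y (rotGen p q y) ∂sph = 0 := by
  have hfc : Continuous f := continuous_iff_continuousAt.2 fun x => (hf x).continuousAt
  obtain ⟨C, hC⟩ :=
    (isCompact_closedBall (0 : E3) 1).exists_bound_of_continuousOn hf'.continuousOn
  have hC0 : 0 ≤ C := (norm_nonneg _).trans (hC 0 (by simp))
  have hcr : ∀ θ, Continuous (rot p q θ) := fun θ => (rot p q θ).continuous
  have key := hasDerivAt_integral_of_dominated_loc_of_deriv_le (μ := sph)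
    (F := fun (θ : ℝ) y => f (rot p q θ y))
    (F' := fun (θ : ℝ) y => f' (rot p q θ y)
      (Real.cos θ • rotGen p q y + Real.sin θ • rotGen p q (rotGen p q y))) (x₀ := 0)
    (s := univ) (bound := fun _ => C * (‖rotGen p q‖ + ‖rotGen p q‖ * ‖rotGen p q‖))
    univ_mem
    (Eventually.of_forall fun θ => (hfc.comp (hcr θ)).aestronglyMeasurable)
    (integrable_sph (hfc.comp (hcr 0)))
    (by
      apply Continuous.aestronglyMeasurable
      have := hcr 0
      fun_prop)
    ?_ (integrable_const _) ?_
  · have hconst : (fun θ : ℝ => ∫ y, f (rot p q θ y) ∂sph) = fun _ => ∫ y, f y ∂sph := by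
      funext θ
      exact (map_sph (rotEquiv h θ)).integral_comp
        (rotEquiv h θ).toHomeomorph.measurableEmbedding f
    have h2 := key.2
    rw [hconst] at h2
    have h3 := h2.unique (hasDerivAt_const (0 : ℝ) _)
    simpa [rot_apply] using h3
  · filter_upwards [ae_sph_norm] with y hy θ _
    have hJ : ‖rotGen p q y‖ ≤ ‖rotGen p q‖ := by
      simpa [hy] using (rotGen p q).le_opNorm y
    refine ((f' _).le_opNorm _).trans ?_
    gcongr
    · exact hC _ (by simp [norm_rot h, hy])
    · refine (norm_add_le _ _).trans ?_
      rw [norm_smul, norm_smul]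
      have h1 : ‖Real.cos θ‖ ≤ 1 := Real.abs_cos_le_one θ
      have h2 : ‖Real.sin θ‖ ≤ 1 := Real.abs_sin_le_one θ
      have h3 : ‖rotGen p q (rotGen p q y)‖ ≤ ‖rotGen p q‖ * ‖rotGen p q‖ :=
        ((rotGen p q).le_opNorm _).trans (by gcongr)
      refine add_le_add ?_ ?_
      · exact (mul_le_of_le_one_left (norm_nonneg _) h1).trans hJ
      · exact (mul_le_of_le_one_left (norm_nonneg _) h2).trans h3
  · exact Eventually.of_forall fun y θ _ =>
      (hf _).comp_hasDerivAt θ (hasDerivAt_rot p q y θ)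

/-- The spherical Laplacian of a `C²` function has mean zero over the sphere. It is the sum of the
squares of the three generators of rotations, which gives the stated expression on the sphere. -/
theorem integral_sph_laplacian {f₁ : Fin 3 → E3 → F} {f₂ : Fin 3 → Fin 3 → E3 → F}
    (hf₁ : ∀ i x, HasFDerivAt (f₁ i)
      (∑ j, (EuclideanSpace.proj j : E3 →L[ℝ] ℝ).smulRight (f₂ i j x)) x)
    (hf₂ : ∀ i j, Continuous (f₂ i j)) :
    ∫ y, (∑ i, f₂ i i y - ∑ i, ∑ j, (y i * y j) • f₂ i j y - (2 : ℝ) • ∑ i, y i • f₁ i y) ∂sph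
      = 0 := by
  have hc₁ : ∀ i, Continuous (f₁ i) := fun i =>
    continuous_iff_continuousAt.2 fun x => (hf₁ i x).continuousAt
  set A : Fin 3 → Fin 3 → E3 → F := fun p q y =>
    ∑ i, ((rotGen p q (rotGen p q y)) i • f₁ i y +
      (rotGen p q y) i • ∑ j, (rotGen p q y) j • f₂ i j y) with hA
  have key : ∀ p q, p ≠ q → ∫ y, A p q y ∂sph = 0 := by
    intro p q hpq
    have hd : ∀ x, HasFDerivAt (fun y => ∑ i, (rotGen p q y) i • f₁ i y)
        (∑ i, ((rotGen p q x) i • (∑ j, (EuclideanSpace.proj j : E3 →L[ℝ] ℝ).smulRight (f₂ i j x))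
          + ((EuclideanSpace.proj i : E3 →L[ℝ] ℝ).comp (rotGen p q)).smulRight (f₁ i x))) x := by
      intro x
      refine HasFDerivAt.fun_sum fun i _ => ?_
      exact HasFDerivAt.fun_smul
        (((EuclideanSpace.proj i : E3 →L[ℝ] ℝ).comp (rotGen p q)).hasFDerivAt) (hf₁ i x)
    have h := integral_sph_rotGen hpq hd (by
      refine continuous_finsetSum _ fun i _ => Continuous.add ?_ ?_
      · refine Continuous.smul
          ((EuclideanSpace.proj i : E3 →L[ℝ] ℝ).continuous.comp (rotGen p q).continuous)
          (continuous_finsetSum _ fun j _ => ?_)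
        exact (ContinuousLinearMap.smulRightL ℝ E3 F _).continuous.comp (hf₂ i j)
      · exact (ContinuousLinearMap.smulRightL ℝ E3 F _).continuous.comp (hc₁ i))
    rw [← h]
    refine integral_congr_ae (Eventually.of_forall fun y => ?_)
    simp only [hA, sum_apply, add_apply, smul_apply,
      ContinuousLinearMap.smulRight_apply, ContinuousLinearMap.comp_apply]
    refine Finset.sum_congr rfl fun i _ => ?_
    rw [add_comm]
    rfl
  have hint : ∀ p q, Integrable (A p q) sph := by
    intro p q
    apply integrable_sph
    have h1 := hc₁
    have h2 := hf₂
    fun_prop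
  have hsum : ∫ y, (A 0 1 y + A 0 2 y + A 1 2 y) ∂sph = 0 := by
    have h1 : Integrable (fun y => A 0 1 y + A 0 2 y) sph := (hint _ _).add (hint _ _)
    rw [integral_add h1 (hint _ _), integral_add (hint _ _) (hint _ _),
      key 0 1 (by decide), key 0 2 (by decide), key 1 2 (by decide)]
    simp
  rw [← hsum]
  refine integral_congr_ae ?_
  filter_upwards [ae_sph_norm] with y hy
  have hn : y 0 ^ 2 + y 1 ^ 2 + y 2 ^ 2 = 1 := by
    have := EuclideanSpace.norm_sq_eq y
    rw [hy] at this
    simp [Fin.sum_univ_three] at this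
    linarith
  have e : ∑ i, f₂ i i y = (y 0 ^ 2 + y 1 ^ 2 + y 2 ^ 2) • ∑ i, f₂ i i y := by
    rw [hn, one_smul]
  rw [e]
  simp [hA, rotGen_apply, Fin.sum_univ_three]
  module

end

/-! ### The Sobolev embedding `H²(ℝ³) ⊂ L^∞` -/

/-- `D` dominates `E` pointwise. -/
def Dom (E D : H) : Prop := ∀ᵐ x ∂μ₀, |E x| ≤ D x

theorem Dom.abs (E : H) : Dom E |E| := by
  filter_upwards [Lp.coeFn_abs E] with x hx
  rw [hx]

theorem Dom.add {E D E' D' : H} (h : Dom E D) (h' : Dom E' D') : Dom (E + E') (D + D') := by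
  filter_upwards [h, h', Lp.coeFn_add E E', Lp.coeFn_add D D'] with x h1 h2 h3 h4
  rw [h3, h4]
  exact (abs_add_le _ _).trans (add_le_add h1 h2)

theorem Dom.smul {E D : H} (h : Dom E D) {a b : ℝ} (hab : |a| ≤ b) : Dom (a • E) (b • D) := by
  filter_upwards [h, Lp.coeFn_smul a E, Lp.coeFn_smul b D] with x h1 h3 h4
  rw [h3, h4, Pi.smul_apply, Pi.smul_apply, smul_eq_mul, smul_eq_mul, abs_mul]
  exact mul_le_mul hab h1 (abs_nonneg _) ((abs_nonneg _).trans hab)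

theorem Dom.smul_one {E D : H} (h : Dom E D) {a : ℝ} (hab : |a| ≤ 1) : Dom (a • E) D := by
  simpa using h.smul hab

theorem Dom.sum {E D : Fin 3 → H} (h : ∀ i, Dom (E i) (D i)) : Dom (∑ i, E i) (∑ i, D i) := by
  rw [Fin.sum_univ_three, Fin.sum_univ_three]
  exact ((h 0).add (h 1)).add (h 2)

theorem Dom.inner_shift {E D k : H} (h : Dom E D) (hk : ∀ᵐ x ∂μ₀, 0 ≤ k x) (v : E3) :
    |inner ℝ (shift v E) k| ≤ inner ℝ (shift v D) k := by
  rw [inner_eq, inner_eq]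
  have hint : ∀ G : H, Integrable (fun x => G x * k x) μ₀ := fun G =>
    (Lp.memLp G).integrable_mul (Lp.memLp k)
  refine abs_integral_le_integral_abs.trans ?_
  refine integral_mono_ae (hint _).abs (hint _) ?_
  filter_upwards [ae_shift v h, hk, shift_coe v E, shift_coe v D] with x h1 h2 h3 h4
  rw [h3, h4, abs_mul, abs_of_nonneg h2]
  exact mul_le_mul_of_nonneg_right h1 h2

theorem coord_abs_le {y : E3} (hy : ‖y‖ ≤ 1) (i : Fin 3) : |y i| ≤ 1 :=
  (PiLp.norm_apply_le y i).trans hy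

/-- Sum of the absolute values of the derivatives of order at most two, with the weights that occur
in `abs_inner_le_ray`. -/
def jetAbs (g : H) (g₁ : Fin 3 → H) (g₂ : Fin 3 → Fin 3 → H) : H :=
  ((1 : ℝ) • ∑ j, ∑ i, |g₂ i j| + (4 : ℝ) • ∑ i, |g₁ i|) + (2 : ℝ) • |g|

theorem norm_jetAbs_le {g : H} {g₁ : Fin 3 → H} {g₂ : Fin 3 → Fin 3 → H} {N : ℝ} (h : ‖g‖ ≤ N)
    (h₁ : ∀ i, ‖g₁ i‖ ≤ N) (h₂ : ∀ i j, ‖g₂ i j‖ ≤ N) : ‖jetAbs g g₁ g₂‖ ≤ 23 * N := by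
  have a1 : ‖∑ i, |g₁ i|‖ ≤ ∑ _i : Fin 3, N :=
    norm_sum_le_of_le _ fun i _ => by rw [norm_abs_eq_norm]; exact h₁ i
  have a2 : ‖∑ j, ∑ i, |g₂ i j|‖ ≤ ∑ _j : Fin 3, ∑ _i : Fin 3, N :=
    norm_sum_le_of_le _ fun j _ => norm_sum_le_of_le _ fun i _ => by
      rw [norm_abs_eq_norm]; exact h₂ i j
  rw [jetAbs]
  refine (norm_add_le _ _).trans ?_
  refine (add_le_add_left (norm_add_le _ _) _).trans ?_
  rw [norm_smul, norm_smul, norm_smul, norm_abs_eq_norm]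
  simp at a1 a2 ⊢
  linarith

/-- Taylor's formula along a ray, cut off at distance one: `g = ∫₀¹ r ∂_r² ((1-r)² g(· + r y)) dr`.
-/
theorem abs_inner_le_ray {g k : H} {g₁ : Fin 3 → H} {g₂ : Fin 3 → Fin 3 → H}
    (h₁ : ∀ i, WD i g (g₁ i)) (h₂ : ∀ i j, WD j (g₁ i) (g₂ i j))
    (hk : ∀ᵐ x ∂μ₀, 0 ≤ k x) {y : E3} (hy : ‖y‖ ≤ 1) :
    |inner ℝ g k| ≤ ∫ r in (0 : ℝ)..1, r * inner ℝ (shift (r • y) (jetAbs g g₁ g₂)) k := by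
  set G₁ : H := ∑ i, y i • g₁ i with hG₁
  set G₂ : H := ∑ j, y j • ∑ i, y i • g₂ i j with hG₂
  have hW : ∀ j, WD j G₁ (∑ i, y i • g₂ i j) := by
    intro j
    rw [hG₁, Fin.sum_univ_three, Fin.sum_univ_three]
    exact (((h₂ 0 j).smul _).add ((h₂ 1 j).smul _)).add ((h₂ 2 j).smul _)
  have hc : ∀ G : H, Continuous fun r : ℝ => inner ℝ (shift (r • y) G) k := by
    intro G
    have : Continuous fun r : ℝ => shift (r • y) G := by
      simpa using continuous_shift_line y 0 G
    exact this.inner continuous_const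
  have hd : ∀ (G : H) (G' : Fin 3 → H), (∀ i, WD i G (G' i)) → ∀ r : ℝ,
      HasDerivAt (fun r : ℝ => inner ℝ (shift (r • y) G) k)
        (inner ℝ (shift (r • y) (∑ i, y i • G' i)) k) r := by
    intro G G' h r
    have h1 := hasDerivAt_shift_line h y 0 r
    have h2 := h1.inner ℝ (hasDerivAt_const r k)
    simp only [zero_add, inner_zero_right] at h2
    refine h2.congr_deriv ?_
    rw [map_sum]
    simp only [map_smul]
  set a : ℝ → ℝ := fun r => inner ℝ (shift (r • y) g) k with ha
  set b : ℝ → ℝ := fun r => inner ℝ (shift (r • y) G₁) k with hb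
  set c : ℝ → ℝ := fun r => inner ℝ (shift (r • y) G₂) k with hcdef
  have hda : ∀ r, HasDerivAt a (b r) r := hd g g₁ h₁
  have hdb : ∀ r, HasDerivAt b (c r) r := hd G₁ _ hW
  set f : ℝ → ℝ := fun r => r * ((1 - r) ^ 2 * c r - 4 * (1 - r) * b r + 2 * a r) with hf
  have hfc : Continuous f := by
    have h1 := hc g
    have h2 := hc G₁
    have h3 := hc G₂
    simp only [hf, ha, hb, hcdef]
    fun_prop
  have hQ : ∀ r : ℝ, HasDerivAt
      (fun r => r * ((1 - r) ^ 2 * b r - 2 * (1 - r) * a r) - (1 - r) ^ 2 * a r) (f r) r := by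
    intro r
    have h1 : HasDerivAt (fun r : ℝ => 1 - r) (-1) r := by
      simpa using (hasDerivAt_id r).const_sub 1
    have h2 : HasDerivAt (fun r : ℝ => (1 - r) ^ 2) (-2 * (1 - r)) r := by
      refine (h1.pow 2).congr_deriv ?_
      simp
    have h3 := (hasDerivAt_id r).fun_mul ((h2.fun_mul (hdb r)).fun_sub
      ((h1.const_mul 2).fun_mul (hda r)))
    refine (h3.fun_sub (h2.fun_mul (hda r))).congr_deriv ?_
    simp only [hf, id]
    ring
  have hI := intervalIntegral.integral_eq_sub_of_hasDerivAt (a := 0) (b := 1)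
    (fun r _ => hQ r) (hfc.intervalIntegrable 0 1)
  have ha0 : inner ℝ g k = ∫ r in (0 : ℝ)..1, f r := by
    rw [hI]
    simp [ha, shift_zero]
  rw [ha0, ← Real.norm_eq_abs]
  refine intervalIntegral.norm_integral_le_of_norm_le (μ := volume) zero_le_one ?_
    ((continuous_id.mul (hc (jetAbs g g₁ g₂))).intervalIntegrable 0 1)
  refine Eventually.of_forall fun r hr => ?_
  have hr0 : |1 - r| ≤ 1 := by rw [abs_le]; constructor <;> linarith [hr.1, hr.2]
  have hfr : f r = r * inner ℝ (shift (r • y)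
      (((1 - r) ^ 2 • G₂ + (-4 * (1 - r)) • G₁) + (2 : ℝ) • g)) k := by
    simp only [hf, ha, hb, hcdef, map_add, map_smul, inner_add_left, inner_smul_left,
      conj_trivial]
    ring
  rw [hfr, Real.norm_eq_abs, abs_mul, abs_of_pos hr.1]
  refine mul_le_mul_of_nonneg_left (Dom.inner_shift ?_ hk _) hr.1.le
  refine ((Dom.smul ?_ ?_).add (Dom.smul ?_ ?_)).add (Dom.smul (Dom.abs g) (by norm_num))
  · exact Dom.sum fun j => Dom.smul_one
      (Dom.sum fun i => (Dom.abs _).smul_one (coord_abs_le hy i)) (coord_abs_le hy j)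
  · rw [abs_pow]; exact pow_le_one₀ (abs_nonneg _) hr0
  · exact Dom.sum fun i => (Dom.abs _).smul_one (coord_abs_le hy i)
  · rw [abs_mul]; norm_num; linarith

/-- The mean value of an `L²` function over a ball of radius `r`, by Cauchy–Schwarz. -/
theorem lintegral_ball_le (D : H) (x : E3) {r : ℝ} (hr : 0 < r) :
    ∫⁻ y in Metric.ball (0 : E3) 1, ‖D (x + r • y)‖ₑ ≤
      ENNReal.ofReal ((r ^ 3)⁻¹) ^ (1 / 2 : ℝ) * ‖D‖ₑ *
        (volume (Metric.ball (0 : E3) 1)) ^ (1 / 2 : ℝ) := by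
  have hmeas : StronglyMeasurable fun y : E3 => D (x + r • y) :=
    (Lp.stronglyMeasurable D).comp_measurable (by fun_prop)
  have h1 := eLpNorm_le_eLpNorm_mul_rpow_measure_univ (p := 1) (q := 2)
    (μ := volume.restrict (Metric.ball (0 : E3) 1)) (by norm_num) hmeas.aestronglyMeasurable
  rw [eLpNorm_one_eq_lintegral_enorm] at h1
  refine h1.trans ?_
  have e : (1 / (1 : ℝ≥0∞).toReal - 1 / (2 : ℝ≥0∞).toReal) = 1 / 2 := by norm_num
  rw [e, Measure.restrict_apply_univ]
  gcongr
  refine (eLpNorm_mono_measure _ Measure.restrict_le_self).trans ?_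
  have h2 : Measure.map (fun y : E3 => x + r • y) volume =
      ENNReal.ofReal ((r ^ 3)⁻¹) • (volume : Measure E3) := by
    have h3 : (fun y : E3 => x + r • y) = (fun z => x + z) ∘ fun y => r • y := rfl
    rw [h3, ← Measure.map_map (by fun_prop) (by fun_prop), Measure.map_addHaar_smul _ hr.ne',
      Measure.map_smul, map_add_left_eq_self]
    simp [abs_of_pos hr]
  have h4 : eLpNorm (fun y : E3 => D (x + r • y)) 2 volume =
      eLpNorm D 2 (Measure.map (fun y : E3 => x + r • y) volume) :=
    (eLpNorm_map_measure (Lp.stronglyMeasurable D).aestronglyMeasurable (by fun_prop)).symm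
  rw [h4, h2, eLpNorm_smul_measure_of_ne_top (by norm_num), Lp.enorm_def]
  have h5 : ∀ a : E3 → ℝ, eLpNorm a 2 μ₀ = eLpNorm a 2 volume := fun a => by rw [μ₀_eq]
  rw [h5]
  simp

theorem lintegral_ray_lt_top :
    ∫⁻ r in Ioo (0 : ℝ) 1, ENNReal.ofReal r * ENNReal.ofReal ((r ^ 3)⁻¹) ^ (1 / 2 : ℝ) < ⊤ := by
  have h : IntegrableOn (fun r : ℝ => r ^ (-(1 / 2) : ℝ)) (Ioo 0 1) := by
    rw [intervalIntegral.integrableOn_Ioo_rpow_iff one_pos]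
    norm_num
  refine lt_of_le_of_lt ?_ h.2
  refine setLIntegral_mono' measurableSet_Ioo fun r hr => ?_
  have h0 : (0 : ℝ) ≤ (r ^ 3)⁻¹ := inv_nonneg.2 (pow_nonneg hr.1.le 3)
  rw [ENNReal.ofReal_rpow_of_nonneg h0 (by norm_num), ← ENNReal.ofReal_mul hr.1.le,
    ← ofReal_norm]
  refine ENNReal.ofReal_le_ofReal ((le_of_eq ?_).trans (Real.le_norm_self _))
  rw [← Real.rpow_natCast, ← Real.rpow_neg hr.1.le, ← Real.rpow_mul hr.1.le]
  conv_lhs => enter [1]; rw [← Real.rpow_one r]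
  rw [← Real.rpow_add hr.1]
  norm_num

/-- The set integral of an `H²` function is bounded by the measure of the set: Taylor's formula is
averaged over all rays in the unit ball, and the average over the ball of radius `r` costs a factor
`r^{-3/2}`, which is integrable against `r dr`. -/
theorem exists_abs_setIntegral_le : ∃ C : ℝ, 0 ≤ C ∧ ∀ (g : H) (g₁ : Fin 3 → H)
    (g₂ : Fin 3 → Fin 3 → H), (∀ i, WD i g (g₁ i)) → (∀ i j, WD j (g₁ i) (g₂ i j)) →
    ∀ A : Set E3, MeasurableSet A → volume A < ⊤ →
      |∫ x in A, g x| ≤ C * ‖jetAbs g g₁ g₂‖ * (volume A).toReal := by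
  set B : Set E3 := Metric.ball 0 1
  set c : ℝ≥0∞ := ∫⁻ r in Ioo (0 : ℝ) 1,
    ENNReal.ofReal r * ENNReal.ofReal ((r ^ 3)⁻¹) ^ (1 / 2 : ℝ) with hc
  have hB0 : volume B ≠ 0 := (Metric.measure_ball_pos _ _ one_pos).ne'
  have hBt : volume B ≠ ⊤ := measure_ball_lt_top.ne
  set c' : ℝ≥0∞ := c * (volume B) ^ (1 / 2 : ℝ) * (volume B)⁻¹ with hc'
  have hc't : c' ≠ ⊤ := by
    refine ENNReal.mul_ne_top (ENNReal.mul_ne_top lintegral_ray_lt_top.ne ?_)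
      (ENNReal.inv_ne_top.2 hB0)
    exact ENNReal.rpow_ne_top_of_nonneg (by norm_num) hBt
  refine ⟨c'.toReal, ENNReal.toReal_nonneg, ?_⟩
  intro g g₁ g₂ h₁ h₂ A hA hAt
  set D := jetAbs g g₁ g₂
  have hAμ : μ₀ A ≠ ⊤ := by rw [μ₀_eq]; exact hAt.ne
  set k : H := indicatorConstLp 2 hA hAμ (1 : ℝ) with hkdef
  have hkc : k =ᵐ[μ₀] A.indicator fun _ => (1 : ℝ) := indicatorConstLp_coeFn
  have hk : ∀ᵐ x ∂μ₀, 0 ≤ k x := by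
    filter_upwards [hkc] with x hx
    rw [hx]
    exact indicator_nonneg (fun _ _ => zero_le_one) x
  have hin : ∀ G : H, inner ℝ G k = ∫ x in A, G x := by
    intro G
    rw [inner_eq, ← integral_indicator hA, μ₀_eq]
    refine integral_congr_ae ?_
    rw [μ₀_eq] at hkc
    filter_upwards [hkc] with x hx
    rw [hx]
    by_cases hx : x ∈ A <;> simp [hx]
  have hDsm : StronglyMeasurable D := Lp.stronglyMeasurable D
  have hDm : ∀ v : E3, ENNReal.ofReal (inner ℝ (shift v D) k) ≤ ∫⁻ x in A, ‖D (x + v)‖ₑ := by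
    intro v
    rw [hin]
    have e : ∫ x in A, (shift v D : E3 → ℝ) x = ∫ x in A, D (x + v) := by
      refine integral_congr_ae ?_
      have := shift_coe v D
      rw [μ₀_eq] at this
      exact ae_restrict_of_ae this
    rw [e]
    refine (ENNReal.ofReal_le_ofReal (Real.le_norm_self _)).trans ?_
    rw [ofReal_norm]
    exact enorm_integral_le_lintegral_enorm _
  -- the estimate along a fixed ray
  have hray : ∀ y ∈ B, ENNReal.ofReal |inner ℝ g k| ≤
      ∫⁻ r in Ioo (0 : ℝ) 1, ENNReal.ofReal r * ∫⁻ x in A, ‖D (x + r • y)‖ₑ := by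
    intro y hy
    have h := abs_inner_le_ray h₁ h₂ hk (mem_ball_zero_iff.1 hy).le
    refine (ENNReal.ofReal_le_ofReal h).trans ?_
    rw [intervalIntegral.integral_of_le zero_le_one, integral_Ioc_eq_integral_Ioo]
    refine (ENNReal.ofReal_le_ofReal (Real.le_norm_self _)).trans ?_
    rw [ofReal_norm]
    refine (enorm_integral_le_lintegral_enorm _).trans ?_
    refine setLIntegral_mono' measurableSet_Ioo fun r hr => ?_
    have h0 : 0 ≤ inner ℝ (shift (r • y) D) k := by
      have hD : Dom 0 D := by
        have hD' := (((Dom.sum fun j => Dom.sum fun i => Dom.abs (g₂ i j)).smul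
          (a := 0) (b := 1) (by norm_num)).add ((Dom.sum fun i => Dom.abs (g₁ i)).smul
          (a := 0) (b := 4) (by norm_num))).add ((Dom.abs g).smul (a := 0) (b := 2) (by norm_num))
        simp only [zero_smul, add_zero] at hD'
        exact hD'
      exact (abs_nonneg _).trans (hD.inner_shift hk _)
    rw [enorm_mul, Real.enorm_of_nonneg hr.1.le, Real.enorm_of_nonneg h0]
    gcongr
    exact hDm _
  -- average over `y` in the unit ball; the factor `c` is finite, as `r ^ (-1 / 2)` is integrable
  have hmeas3 : Measurable fun q : (E3 × ℝ) × E3 => ‖D (q.2 + q.1.2 • q.1.1)‖ₑ :=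
    (hDsm.measurable.comp (by fun_prop)).enorm
  have hmeas2 : Measurable fun q : E3 × ℝ => ∫⁻ x in A, ‖D (x + q.2 • q.1)‖ₑ :=
    hmeas3.lintegral_prod_right'
  have havg : ENNReal.ofReal |inner ℝ g k| * volume B ≤
      c * (volume B) ^ (1 / 2 : ℝ) * ‖D‖ₑ * volume A := by
    calc ENNReal.ofReal |inner ℝ g k| * volume B
        = ∫⁻ _y in B, ENNReal.ofReal |inner ℝ g k| := by
          rw [setLIntegral_const]
      _ ≤ ∫⁻ y in B, ∫⁻ r in Ioo (0 : ℝ) 1,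
            ENNReal.ofReal r * ∫⁻ x in A, ‖D (x + r • y)‖ₑ :=
          setLIntegral_mono' Metric.isOpen_ball.measurableSet hray
      _ = ∫⁻ r in Ioo (0 : ℝ) 1, ∫⁻ y in B,
            ENNReal.ofReal r * ∫⁻ x in A, ‖D (x + r • y)‖ₑ := by
          refine lintegral_lintegral_swap ?_
          exact ((by fun_prop : Measurable fun q : E3 × ℝ => ENNReal.ofReal q.2).mul
            hmeas2).aemeasurable
      _ ≤ ∫⁻ r in Ioo (0 : ℝ) 1, (ENNReal.ofReal r * ENNReal.ofReal ((r ^ 3)⁻¹) ^ (1 / 2 : ℝ)) *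
            ((volume B) ^ (1 / 2 : ℝ) * ‖D‖ₑ * volume A) := by
          refine setLIntegral_mono' measurableSet_Ioo fun r hr => ?_
          rw [lintegral_const_mul' _ _ ENNReal.ofReal_ne_top]
          have hsw : ∫⁻ y in B, ∫⁻ x in A, ‖D (x + r • y)‖ₑ =
              ∫⁻ x in A, ∫⁻ y in B, ‖D (x + r • y)‖ₑ := by
            refine lintegral_lintegral_swap ?_
            exact ((hDsm.measurable.comp
              (by fun_prop : Measurable fun q : E3 × E3 => q.2 + r • q.1)).enorm).aemeasurable
          rw [hsw]
          calc ENNReal.ofReal r * ∫⁻ x in A, ∫⁻ y in B, ‖D (x + r • y)‖ₑ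
              ≤ ENNReal.ofReal r * ∫⁻ _x in A, ENNReal.ofReal ((r ^ 3)⁻¹) ^ (1 / 2 : ℝ) * ‖D‖ₑ *
                  (volume B) ^ (1 / 2 : ℝ) := by
                gcongr with x
                exact lintegral_ball_le D x hr.1
            _ = _ := by
                rw [setLIntegral_const]
                ring
      _ = c * (volume B) ^ (1 / 2 : ℝ) * ‖D‖ₑ * volume A := by
          rw [lintegral_mul_const]
          · rw [hc]; ring
          · fun_prop
  have hfin : ENNReal.ofReal |inner ℝ g k| ≤ c' * ‖D‖ₑ * volume A := by
    rw [← ENNReal.mul_le_mul_iff_left hB0 hBt]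
    refine havg.trans (le_of_eq ?_)
    have := ENNReal.mul_inv_cancel hB0 hBt
    calc c * (volume B) ^ (1 / 2 : ℝ) * ‖D‖ₑ * volume A
        = c * (volume B) ^ (1 / 2 : ℝ) * ‖D‖ₑ * volume A * (volume B * (volume B)⁻¹) := by
          rw [this, mul_one]
      _ = _ := by rw [hc']; ring
  rw [← hin]
  have := ENNReal.toReal_mono (ENNReal.mul_ne_top (ENNReal.mul_ne_top hc't (by simp)) hAt.ne) hfin
  rw [ENNReal.toReal_ofReal (abs_nonneg _), ENNReal.toReal_mul, ENNReal.toReal_mul,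
    toReal_enorm] at this
  exact this

/-- The Sobolev embedding `H²(ℝ³) ⊂ L^∞(ℝ³)`. A bound for all set integrals by the measure of the
set is a pointwise bound. -/
theorem exists_sobolev_bound : ∃ C : ℝ, 1 ≤ C ∧ ∀ (g : H) (g₁ : Fin 3 → H)
    (g₂ : Fin 3 → Fin 3 → H), (∀ i, WD i g (g₁ i)) → (∀ i j, WD j (g₁ i) (g₂ i j)) →
    ∀ N : ℝ, ‖g‖ ≤ N → (∀ i, ‖g₁ i‖ ≤ N) → (∀ i j, ‖g₂ i j‖ ≤ N) →
      ∀ᵐ x ∂μ₀, |g x| ≤ C * N := by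
  obtain ⟨C, hC0, hC⟩ := exists_abs_setIntegral_le
  refine ⟨C * 23 + 1, by linarith, ?_⟩
  intro g g₁ g₂ h₁ h₂ N h h₁' h₂'
  have hN : 0 ≤ N := (norm_nonneg _).trans h
  have key : ∀ A : Set E3, MeasurableSet A → volume A < ⊤ →
      |∫ x in A, g x| ≤ (C * 23 + 1) * N * (volume A).toReal := by
    intro A hA hAt
    refine (hC g g₁ g₂ h₁ h₂ A hA hAt).trans ?_
    refine mul_le_mul_of_nonneg_right ?_ ENNReal.toReal_nonneg
    calc C * ‖jetAbs g g₁ g₂‖ ≤ C * (23 * N) := by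
          gcongr; exact norm_jetAbs_le h h₁' h₂'
      _ ≤ _ := by nlinarith
  have hint : ∀ A : Set E3, MeasurableSet A → volume A < ⊤ → IntegrableOn g A := by
    intro A hA hAt
    have : MemLp g 2 (volume.restrict A) := by
      have := (Lp.memLp g).restrict A
      rwa [Measure.restrict_restrict hA, inter_univ] at this
    have hfin : IsFiniteMeasure (volume.restrict A) := ⟨by simpa using hAt⟩
    exact this.integrable (by norm_num)
  have hconst : ∀ (c : ℝ) (A : Set E3), volume A < ⊤ → IntegrableOn (fun _ => c) A := by
    intro c A hAt
    exact integrableOn_const hAt.ne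
  have hup : 0 ≤ᵐ[volume] fun x => (C * 23 + 1) * N - g x := by
    refine ae_nonneg_of_forall_setIntegral_nonneg_of_sigmaFinite
      (fun A hA hAt => (hconst _ A hAt).sub (hint A hA hAt)) fun A hA hAt => ?_
    rw [integral_sub (hconst _ A hAt) (hint A hA hAt), setIntegral_const, smul_eq_mul]
    have := abs_le.1 (key A hA hAt)
    simp only [Measure.real]
    linarith [this.2]
  have hlow : 0 ≤ᵐ[volume] fun x => (C * 23 + 1) * N + g x := by
    refine ae_nonneg_of_forall_setIntegral_nonneg_of_sigmaFinite
      (fun A hA hAt => (hconst _ A hAt).add (hint A hA hAt)) fun A hA hAt => ?_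
    rw [integral_add (hconst _ A hAt) (hint A hA hAt), setIntegral_const, smul_eq_mul]
    have := abs_le.1 (key A hA hAt)
    simp only [Measure.real]
    linarith [this.1]
  rw [μ₀_eq]
  filter_upwards [hup, hlow] with x h1 h2
  simp only [Pi.zero_apply] at h1 h2
  rw [abs_le]
  constructor <;> linarith

/-! ### Supports -/

/-- The square integrable functions that vanish outside the closed ball of radius `R`. -/
def Supp (R : ℝ) : Submodule ℝ H where
  carrier := {g | ∀ᵐ x ∂μ₀, R < ‖x‖ → g x = 0}
  add_mem' := by
    intro a b ha hb
    filter_upwards [ha, hb, Lp.coeFn_add a b] with x h1 h2 h3 hx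
    rw [h3, Pi.add_apply, h1 hx, h2 hx, add_zero]
  zero_mem' := by
    filter_upwards [Lp.coeFn_zero ℝ 2 μ₀] with x h1 _
    rw [h1]; rfl
  smul_mem' := by
    intro c a ha
    filter_upwards [ha, Lp.coeFn_smul c a] with x h1 h3 hx
    rw [h3, Pi.smul_apply, h1 hx, smul_zero]

theorem mem_Supp {R : ℝ} {g : H} : g ∈ Supp R ↔ ∀ᵐ x ∂μ₀, R < ‖x‖ → g x = 0 := Iff.rfl

theorem measurableSet_far (R : ℝ) : MeasurableSet {x : E3 | R < ‖x‖} :=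
  measurableSet_lt measurable_const measurable_norm

theorem isClosed_Supp (R : ℝ) : IsClosed (Supp R : Set H) := by
  have hm : ∀ k : H, MemLp ({x : E3 | R < ‖x‖}.indicator k) 2 μ₀ := fun k =>
    (Lp.memLp k).indicator (measurableSet_far R)
  have e : (Supp R : Set H) =
      ⋂ k : H, {g | inner ℝ g (ofFun ({x : E3 | R < ‖x‖}.indicator k)) = 0} := by
    ext g
    rw [mem_iInter]
    constructor
    · intro hg k
      rw [mem_ofPred_eq, inner_eq]
      refine integral_eq_zero_of_ae ?_
      filter_upwards [mem_Supp.1 hg, ofFun_coe (hm k)] with x h1 h2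
      rw [h2]
      by_cases hx : R < ‖x‖
      · simp [h1 hx]
      · simp [hx]
    · intro h
      have h1 := h g
      rw [mem_ofPred_eq, inner_eq] at h1
      have h2 : ∫ x, {x : E3 | R < ‖x‖}.indicator (fun x => g x * g x) x ∂μ₀ = 0 := by
        rw [← h1]
        refine integral_congr_ae ?_
        filter_upwards [ofFun_coe (hm g)] with x h2
        rw [h2]
        by_cases hx : R < ‖x‖ <;> simp [hx]
      rw [integral_eq_zero_iff_of_nonneg] at h2
      · change ∀ᵐ x ∂μ₀, R < ‖x‖ → g x = 0
        filter_upwards [h2] with x hx hxR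
        simpa [hxR] using hx
      · intro x
        exact indicator_nonneg (fun x _ => mul_self_nonneg _) x
      · exact ((Lp.memLp g).integrable_mul (Lp.memLp g)).indicator (measurableSet_far R)
  rw [e]
  refine isClosed_iInter fun k => isClosed_eq ?_ continuous_const
  fun_prop

theorem Supp.mono {R R' : ℝ} (h : R ≤ R') {g : H} (hg : g ∈ Supp R) : g ∈ Supp R' := by
  filter_upwards [mem_Supp.1 hg] with x h1 hx
  exact h1 (h.trans_lt hx)

theorem Supp.shift {R : ℝ} {g : H} (hg : g ∈ Supp R) (v : E3) : shift v g ∈ Supp (R + ‖v‖) := by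
  filter_upwards [ae_shift v (mem_Supp.1 hg), shift_coe v g] with x h1 h2 hx
  rw [h2]
  refine h1 ?_
  have : ‖x‖ ≤ ‖x + v‖ + ‖v‖ := by simpa using norm_sub_le (x + v) v
  linarith

theorem isOpen_far (R : ℝ) : IsOpen {x : E3 | R < ‖x‖} := isOpen_lt continuous_const continuous_norm

/-- Weak derivatives are local, so they do not enlarge the support. -/
theorem Supp.wd {R : ℝ} {g g' : H} {i : Fin 3} (hg : g ∈ Supp R) (h : WD i g g') : g' ∈ Supp R := by
  refine (isOpen_far R).ae_eq_zero_of_integral_contDiff_smul_eq_zero (μ := μ₀)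
    (((Lp.memLp g').locallyIntegrable (by norm_num)).locallyIntegrableOn _) ?_
  intro φ h1 h2 h3
  have h4 := h φ ⟨h1, h2⟩
  rw [Test.inner ⟨h1, h2⟩, Test.inner (Test.pderiv ⟨h1, h2⟩ i)] at h4
  have h5 : ∫ x, g x * pderiv i φ x ∂μ₀ = 0 := by
    refine integral_eq_zero_of_ae ?_
    filter_upwards [mem_Supp.1 hg] with x hx
    by_cases hxR : R < ‖x‖
    · simp [hx hxR]
    · have h6 : x ∉ tsupport φ := fun hm => hxR (h3 hm)
      have h7 : fderiv ℝ φ x = 0 :=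
        image_eq_zero_of_notMem_tsupport fun hm => h6 (tsupport_fderiv_subset ℝ hm)
      simp [pderiv, h7]
  rw [h5] at h4
  rw [show (fun x => φ x • g' x) = fun x => g' x * φ x from funext fun x => mul_comm _ _]
  linarith

/-! ### Multiplication -/

/-- The product of a function with an element of `L²(ℝ³)` (zero if it is not in `L²`). -/
def ml (a : E3 → ℝ) (g : H) : H := ofFun fun x => a x * g x

/-- The product of two elements of `L²(ℝ³)` (zero if it is not in `L²`). -/
abbrev prod (g k : H) : H := ml g k

theorem prod_comm (g k : H) : prod g k = prod k g := by
  unfold prod ml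
  congr 1
  funext x
  ring

/-- `|a| ≤ C` almost everywhere. -/
def Bdd (C : ℝ) (a : E3 → ℝ) : Prop := ∀ᵐ x ∂μ₀, |a x| ≤ C

theorem Lp_aesm (g : H) : AEStronglyMeasurable g μ₀ := Lp.aestronglyMeasurable g

theorem memLp_ml {a : E3 → ℝ} (ha : AEStronglyMeasurable a μ₀) {C : ℝ} {g : H}
    (h : ∀ᵐ x ∂μ₀, |a x * g x| ≤ C * |g x|) : MemLp (fun x => a x * g x) 2 μ₀ := by
  refine (Lp.memLp g).of_le_mul (c := C) (ha.mul (Lp_aesm g)) ?_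
  simpa [Real.norm_eq_abs] using h

theorem Bdd.mul {C : ℝ} {a : E3 → ℝ} (h : Bdd C a) (g : H) :
    ∀ᵐ x ∂μ₀, |a x * g x| ≤ C * |g x| := by
  filter_upwards [h] with x hx
  rw [abs_mul]
  gcongr

theorem ml_coe {a : E3 → ℝ} (ha : AEStronglyMeasurable a μ₀) {C : ℝ} (h : Bdd C a) (g : H) :
    ml a g =ᵐ[μ₀] fun x => a x * g x := ofFun_coe (memLp_ml ha (h.mul g))

theorem norm_ml_le' {a : E3 → ℝ} (ha : AEStronglyMeasurable a μ₀) {C : ℝ} {g : H}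
    (h : ∀ᵐ x ∂μ₀, |a x * g x| ≤ C * |g x|) : ‖ml a g‖ ≤ C * ‖g‖ := by
  refine Lp.norm_le_mul_norm_of_ae_le_mul ?_
  filter_upwards [h, ofFun_coe (memLp_ml ha h)] with x h1 h2
  rw [ml, h2]
  exact h1

theorem norm_ml_le {a : E3 → ℝ} (ha : AEStronglyMeasurable a μ₀) {C : ℝ}
    (h : Bdd C a) (g : H) : ‖ml a g‖ ≤ C * ‖g‖ := norm_ml_le' ha (h.mul g)

theorem ml_mem_Supp {a : E3 → ℝ} {R : ℝ} {g : H} (hg : g ∈ Supp R) : ml a g ∈ Supp R := by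
  rw [mem_Supp, ml, ofFun]
  split_ifs with h
  · filter_upwards [mem_Supp.1 hg, h.coeFn_toLp] with x h1 h2 hx
    rw [h2, h1 hx, mul_zero]
  · filter_upwards [Lp.coeFn_zero ℝ 2 μ₀] with x h1 _
    rw [h1]; rfl

theorem shift_prod (v : E3) {g k : H} {C : ℝ} (h : Bdd C g) :
    shift v (prod g k) = prod (shift v g) (shift v k) := by
  symm
  refine ofFun_eq ?_
  filter_upwards [shift_coe v (prod g k), ae_shift v (ml_coe (Lp_aesm g) h k), shift_coe v g,
    shift_coe v k] with x h1 h2 h3 h4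
  rw [h1, h2, h3, h4]

/-- The product rule, when the first factor is differentiable in `L^∞` and the second in `L²`. -/
theorem hasDerivAt_ml {a : ℝ → E3 → ℝ} {a' : E3 → ℝ} {u : ℝ → H} {u' : H} {C : ℝ} (hC : 0 ≤ C)
    (hm : ∀ h, AEStronglyMeasurable (a h) μ₀) (hm' : AEStronglyMeasurable a' μ₀)
    (h0 : Bdd C (a 0)) (h0' : Bdd C a')
    (hd : ∀ ε > 0, ∀ᶠ h in 𝓝 (0 : ℝ), Bdd (ε * |h|) fun x => a h x - a 0 x - h * a' x)
    (hu : HasDerivAt u u' 0) :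
    HasDerivAt (fun h => ml (a h) (u h)) (ml a' (u 0) + ml (a 0) u') 0 := by
  rw [hasDerivAt_iff_isLittleO_nhds_zero, Asymptotics.isLittleO_iff]
  intro c hc
  set ε : ℝ := c / (‖u 0‖ + 1 + C + C) with hε
  have hD : 0 < ‖u 0‖ + 1 + C + C := by positivity
  have hεpos : 0 < ε := by positivity
  have hu2 := (hasDerivAt_iff_isLittleO_nhds_zero.1 hu)
  rw [Asymptotics.isLittleO_iff] at hu2
  have hcont := hu.continuousAt
  have e1 : ∀ᶠ h in 𝓝 (0 : ℝ), ‖u h - u 0‖ < min ε 1 := by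
    have : Tendsto (fun h => ‖u h - u 0‖) (𝓝 0) (𝓝 0) := by
      simpa using (hcont.sub (continuousAt_const (y := u 0))).norm.tendsto
    exact this.eventually_lt_const (by positivity)
  filter_upwards [hd ε hεpos, hu2 hεpos, e1] with h hh1 hh2 hh3
  rw [zero_add] at hh2 ⊢
  set d : E3 → ℝ := fun x => a h x - a 0 x - h * a' x with hddef
  have hdx : ∀ x, d x = a h x - a 0 x - h * a' x := fun _ => rfl
  have hdm : AEStronglyMeasurable d μ₀ := ((hm h).sub (hm 0)).sub (hm'.const_mul h)
  have hah : Bdd (ε * |h| + C + |h| * C) (a h) := by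
    filter_upwards [hh1, h0, h0'] with x h1 h2 h3
    have : a h x = d x + a 0 x + h * a' x := by simp only [hddef]; ring
    rw [this]
    refine (abs_add_le _ _).trans (add_le_add ((abs_add_le _ _).trans (add_le_add h1 h2)) ?_)
    rw [abs_mul]
    gcongr
  have key : ml (a h) (u h) - ml (a 0) (u 0) - h • (ml a' (u 0) + ml (a 0) u') =
      ml d (u h) + h • ml a' (u h - u 0) + ml (a 0) (u h - u 0 - h • u') := by
    have s1 : u h - u 0 - h • u' = (u h - u 0) + (-h) • u' := by rw [neg_smul]; abel
    have s2 : ml (a h) (u h) - ml (a 0) (u 0) - h • (ml a' (u 0) + ml (a 0) u') =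
      (ml (a h) (u h) + (-1 : ℝ) • ml (a 0) (u 0)) + (-h) • (ml a' (u 0) + ml (a 0) u') := by
      module
    rw [s1, s2]
    refine Lp.ext ?_
    filter_upwards [Lp.coeFn_add (ml (a h) (u h) + (-1 : ℝ) • ml (a 0) (u 0))
        ((-h) • (ml a' (u 0) + ml (a 0) u')),
      Lp.coeFn_add (ml (a h) (u h)) ((-1 : ℝ) • ml (a 0) (u 0)),
      Lp.coeFn_smul (-1 : ℝ) (ml (a 0) (u 0)), Lp.coeFn_smul (-h) (ml a' (u 0) + ml (a 0) u'),
      Lp.coeFn_add (ml a' (u 0)) (ml (a 0) u'),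
      Lp.coeFn_add (ml d (u h) + h • ml a' (u h - u 0)) (ml (a 0) ((u h - u 0) + (-h) • u')),
      Lp.coeFn_add (ml d (u h)) (h • ml a' (u h - u 0)), Lp.coeFn_smul h (ml a' (u h - u 0)),
      Lp.coeFn_add (u h - u 0) ((-h) • u'), Lp.coeFn_sub (u h) (u 0), Lp.coeFn_smul (-h) u',
      ml_coe (hm h) hah (u h), ml_coe (hm 0) h0 (u 0), ml_coe hm' h0' (u 0), ml_coe (hm 0) h0 u',
      ml_coe hdm hh1 (u h), ml_coe hm' h0' (u h - u 0),
      ml_coe (hm 0) h0 ((u h - u 0) + (-h) • u')]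
      with x x1 x2 x3 x4 x5 x6 x7 x8 x9 x10 x11 y1 y2 y3 y4 y5 y6 y7
    simp only [x1, x2, x3, x4, x5, x6, x7, x8, x9, x10, x11, y1, y2, y3, y4, y5, y6, y7,
      Pi.add_apply, Pi.smul_apply, Pi.sub_apply, smul_eq_mul, hdx]
    ring
  rw [key]
  have n1 : ‖ml d (u h)‖ ≤ ε * |h| * (‖u 0‖ + 1) := by
    refine (norm_ml_le hdm hh1 _).trans ?_
    gcongr
    have : ‖u h‖ ≤ ‖u h - u 0‖ + ‖u 0‖ := by simpa using norm_add_le (u h - u 0) (u 0)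
    have := hh3.trans_le (min_le_right _ _)
    linarith
  have n2 : ‖h • ml a' (u h - u 0)‖ ≤ |h| * (C * ε) := by
    rw [norm_smul, Real.norm_eq_abs]
    gcongr
    refine (norm_ml_le hm' h0' _).trans ?_
    gcongr
    exact (hh3.trans_le (min_le_left _ _)).le
  have n3 : ‖ml (a 0) (u h - u 0 - h • u')‖ ≤ C * (ε * |h|) := by
    refine (norm_ml_le (hm 0) h0 _).trans ?_
    gcongr
    simpa using hh2
  calc _ ≤ ε * |h| * (‖u 0‖ + 1) + |h| * (C * ε) + C * (ε * |h|) :=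
        (norm_add_le _ _).trans (add_le_add ((norm_add_le _ _).trans (add_le_add n1 n2)) n3)
    _ = ε * (‖u 0‖ + 1 + C + C) * |h| := by ring
    _ = c * ‖h‖ := by rw [hε, div_mul_cancel₀ _ hD.ne', Real.norm_eq_abs]

theorem prod_coe {g k : H} {C : ℝ} (h : Bdd C g) : prod g k =ᵐ[μ₀] fun x => g x * k x :=
  ml_coe (Lp_aesm g) h k

theorem prod_coe' {g k : H} {C : ℝ} (h : Bdd C k) : prod g k =ᵐ[μ₀] fun x => g x * k x := by
  rw [prod_comm]
  filter_upwards [prod_coe (k := g) h] with x hx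
  rw [hx, mul_comm]

theorem norm_prod_le {g k : H} {C : ℝ} (h : Bdd C g) : ‖prod g k‖ ≤ C * ‖k‖ :=
  norm_ml_le (Lp_aesm g) h k

theorem norm_prod_le' {g k : H} {C : ℝ} (h : Bdd C k) : ‖prod g k‖ ≤ C * ‖g‖ := by
  rw [prod_comm]
  exact norm_prod_le h

theorem Bdd.add {C C' : ℝ} {g k : H} (h : Bdd C g) (h' : Bdd C' k) : Bdd (C + C') (g + k : H) := by
  filter_upwards [h, h', Lp.coeFn_add g k] with x h1 h2 h3
  rw [h3]
  exact (abs_add_le _ _).trans (add_le_add h1 h2)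

theorem Bdd.smul {C : ℝ} {g : H} (h : Bdd C g) (c : ℝ) : Bdd (|c| * C) (c • g : H) := by
  filter_upwards [h, Lp.coeFn_smul c g] with x h1 h3
  rw [h3, Pi.smul_apply, smul_eq_mul, abs_mul]
  gcongr

theorem prod_add {g k k' : H} {C : ℝ} (h : Bdd C g) : prod g (k + k') = prod g k + prod g k' := by
  refine Lp.ext ?_
  filter_upwards [prod_coe (k := k + k') h, prod_coe (k := k) h, prod_coe (k := k') h,
    Lp.coeFn_add k k', Lp.coeFn_add (prod g k) (prod g k')] with x h1 h2 h3 h4 h5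
  rw [h1, h5, Pi.add_apply, h2, h3, h4, Pi.add_apply, mul_add]

theorem prod_smul {g k : H} (c : ℝ) {C : ℝ} (h : Bdd C g) :
    prod g (c • k) = c • prod g k := by
  refine Lp.ext ?_
  filter_upwards [prod_coe (k := c • k) h, prod_coe (k := k) h,
    Lp.coeFn_smul c k, Lp.coeFn_smul c (prod g k)] with x h1 h2 h4 h5
  rw [h1, h5, Pi.smul_apply, h2, h4, Pi.smul_apply, smul_eq_mul, smul_eq_mul]
  ring

theorem add_prod {g g' k : H} {C C' : ℝ} (h : Bdd C g) (h' : Bdd C' g') :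
    prod (g + g') k = prod g k + prod g' k := by
  refine Lp.ext ?_
  filter_upwards [prod_coe (k := k) (h.add h'), prod_coe (k := k) h, prod_coe (k := k) h',
    Lp.coeFn_add g g', Lp.coeFn_add (prod g k) (prod g' k)] with x h1 h2 h3 h4 h5
  rw [h1, h5, Pi.add_apply, h2, h3, h4, Pi.add_apply, add_mul]

theorem smul_prod {g k : H} (c : ℝ) {C : ℝ} (h : Bdd C g) :
    prod (c • g) k = c • prod g k := by
  refine Lp.ext ?_
  filter_upwards [prod_coe (k := k) (h.smul c), prod_coe (k := k) h,
    Lp.coeFn_smul c g, Lp.coeFn_smul c (prod g k)] with x h1 h2 h4 h5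
  rw [h1, h5, Pi.smul_apply, h2, h4, Pi.smul_apply, smul_eq_mul, smul_eq_mul]
  ring

/-- The product rule, when both factors are differentiable in `L²`, both have bounded values and
one of them is continuous in `L^∞`. -/
theorem hasDerivAt_prod {a b : ℝ → H} {a' b' : H} {C : ℝ} (hC : 0 ≤ C)
    (ha0 : Bdd C (a 0)) (hb0 : Bdd C (b 0))
    (hb : ∀ ε > 0, ∀ᶠ h in 𝓝 (0 : ℝ), Bdd ε (b h - b 0 : H))
    (ha : HasDerivAt a a' 0) (hb' : HasDerivAt b b' 0) :
    HasDerivAt (fun h => prod (a h) (b h)) (prod a' (b 0) + prod (a 0) b') 0 := by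
  have hsum : ∀ h, prod (a h) (b 0) = prod (b 0) (a h) := fun h => prod_comm _ _
  -- `a b - a₀ b₀ = (a - a₀) b₀ + a₀ (b - b₀) + (a - a₀) (b - b₀)`
  have h1 : HasDerivAt (fun h => prod (b 0) (a h)) (prod (b 0) a') 0 := by
    have := hasDerivAt_ml (a := fun _ => b 0) (a' := 0) hC (fun _ => Lp_aesm _)
      aestronglyMeasurable_zero hb0 (by simp [Bdd, hC]) (by
        intro ε hε
        filter_upwards with h
        simp only [Bdd, Pi.zero_apply, mul_zero, sub_self, abs_zero]
        exact Eventually.of_forall fun _ => by positivity) ha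
    refine this.congr_deriv ?_
    rw [add_eq_right]
    exact ofFun_eq (Eventually.of_forall fun x => by simp)
  have h2 : HasDerivAt (fun h => prod (a 0) (b h)) (prod (a 0) b') 0 := by
    have := hasDerivAt_ml (a := fun _ => a 0) (a' := 0) hC (fun _ => Lp_aesm _)
      aestronglyMeasurable_zero ha0 (by simp [Bdd, hC]) (by
        intro ε hε
        filter_upwards with h
        simp only [Bdd, Pi.zero_apply, mul_zero, sub_self, abs_zero]
        exact Eventually.of_forall fun _ => by positivity) hb'
    refine this.congr_deriv ?_
    rw [add_eq_right]
    exact ofFun_eq (Eventually.of_forall fun x => by simp)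
  have h3 : HasDerivAt (fun h => prod (b h - b 0) (a h - a 0)) 0 0 := by
    rw [hasDerivAt_iff_isLittleO_nhds_zero, Asymptotics.isLittleO_iff]
    intro c hc
    have hO := (ha.isBigO_sub).bound
    obtain ⟨K, hK⟩ := hO
    have hε : 0 < c / (|K| + 1) := by positivity
    filter_upwards [hK, hb _ hε] with h hh1 hh2
    have hz : prod (b 0 - b 0) (a 0 - a 0) = 0 := by
      exact ofFun_eq (Eventually.of_forall fun x => by simp)
    rw [zero_add, hz, smul_zero, sub_zero, sub_zero]
    refine (norm_prod_le hh2).trans ?_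
    rw [sub_zero] at hh1
    calc c / (|K| + 1) * ‖a h - a 0‖ ≤ c / (|K| + 1) * ((|K| + 1) * ‖h‖) := by
          gcongr
          refine hh1.trans ?_
          gcongr
          linarith [le_abs_self K]
      _ = c * ‖h‖ := by field_simp
  have h4 := (h1.fun_add h2).fun_add (h3.add_const (-(prod (a 0) (b 0))))
  refine (h4.congr_of_eventuallyEq ?_).congr_deriv ?_
  · filter_upwards [hb 1 one_pos] with h hh
    have hbh : Bdd (1 + C) (b h) := by
      have := hh.add hb0
      rwa [sub_add_cancel] at this
    have e1 : prod (b h - b 0) (a h - a 0) =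
        prod (b h) (a h) + (-1 : ℝ) • prod (b h) (a 0)
          + (-1 : ℝ) • (prod (b 0) (a h) + (-1 : ℝ) • prod (b 0) (a 0)) := by
      rw [sub_eq_add_neg (b h), sub_eq_add_neg (a h), ← neg_one_smul ℝ (b 0),
        ← neg_one_smul ℝ (a 0), add_prod hbh (hb0.smul _), smul_prod _ hb0, prod_add hbh,
        prod_add hb0, prod_smul _ hbh, prod_smul _ hb0]
    rw [e1, prod_comm (a h) (b h), prod_comm (a 0) (b h), prod_comm (a 0) (b 0)]
    module
  · rw [add_zero, prod_comm a' (b 0)]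

/-! ### Curves in `L²(ℝ³)` with space-time derivatives -/

/-- The space-time directions: `none` is time and `some i` is the `i`-th space direction. -/
abbrev Dir : Type := Option (Fin 3)

/-- `u'` is the derivative of the curve `u : (0,T) → L²(ℝ³)` in a space-time direction: a strong
derivative in time, a weak derivative in space. -/
def IsD (T : ℝ) : Dir → (ℝ → H) → (ℝ → H) → Prop
  | none, u, u' => ∀ t ∈ Ioo 0 T, HasDerivAt u (u' t) t
  | some i, u, u' => ∀ t ∈ Ioo 0 T, WD i (u t) (u' t)

/-- A continuous curve on `(0,T)` with `‖u(t)‖ ≤ A e^{Lt}` that vanishes outside the light cone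
`|x| ≤ ρ + t`. -/
def Reg0 (ρ T L A : ℝ) (u : ℝ → H) : Prop :=
  ContinuousOn u (Ioo 0 T) ∧ ∀ t ∈ Ioo 0 T, ‖u t‖ ≤ A * Real.exp (L * t) ∧ u t ∈ Supp (ρ + t)

/-- All space-time derivatives of `u` of order `k ≤ n` are curves as in `Reg0`, with bounds
`L^k A e^{Lt}`. A large weight `L` makes the operators of the wave equation small. -/
def Reg (ρ T L : ℝ) : ℕ → ℝ → (ℝ → H) → Prop
  | 0, A, u => Reg0 ρ T L A u
  | n + 1, A, u => Reg0 ρ T L A u ∧ ∀ j, ∃ u', IsD T j u u' ∧ Reg ρ T L n (L * A) u'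

variable {ρ T L : ℝ} {u v u' v' : ℝ → H} {j : Dir} {A B : ℝ} {n : ℕ}

theorem IsD.unique {u₁ u₂ : ℝ → H} (h₁ : IsD T j u u₁) (h₂ : IsD T j u u₂) {t : ℝ}
    (ht : t ∈ Ioo 0 T) : u₁ t = u₂ t := by
  cases j with
  | none => exact (h₁ t ht).unique (h₂ t ht)
  | some i => exact (h₁ t ht).unique (h₂ t ht)

theorem IsD.congr {u₂ u₂' : ℝ → H} (h : IsD T j u u') (e : ∀ t ∈ Ioo 0 T, u t = u₂ t)
    (e' : ∀ t ∈ Ioo 0 T, u' t = u₂' t) : IsD T j u₂ u₂' := by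
  cases j with
  | none =>
    intro t ht
    rw [← e' t ht]
    refine (h t ht).congr_of_eventuallyEq ?_
    filter_upwards [isOpen_Ioo.mem_nhds ht] with s hs
    rw [e s hs]
  | some i =>
    intro t ht
    rw [← e' t ht, ← e t ht]
    exact h t ht

theorem IsD.add (h : IsD T j u u') (h' : IsD T j v v') : IsD T j (u + v) (u' + v') := by
  cases j with
  | none => exact fun t ht => (h t ht).add (h' t ht)
  | some i => exact fun t ht => (h t ht).add (h' t ht)

theorem IsD.smul (c : ℝ) (h : IsD T j u u') : IsD T j (c • u) (c • u') := by
  cases j with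
  | none => exact fun t ht => (h t ht).const_smul c
  | some i => exact fun t ht => (h t ht).smul c

theorem Reg.reg0 (h : Reg ρ T L n A u) : Reg0 ρ T L A u := by
  cases n with
  | zero => exact h
  | succ n => exact h.1

theorem Reg.cont (h : Reg ρ T L n A u) : ContinuousOn u (Ioo 0 T) := h.reg0.1

theorem Reg.norm_le (h : Reg ρ T L n A u) {t : ℝ} (ht : t ∈ Ioo 0 T) :
    ‖u t‖ ≤ A * Real.exp (L * t) := (h.reg0.2 t ht).1

theorem Reg.supp (h : Reg ρ T L n A u) {t : ℝ} (ht : t ∈ Ioo 0 T) : u t ∈ Supp (ρ + t) :=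
  (h.reg0.2 t ht).2

theorem Reg.deriv (h : Reg ρ T L (n + 1) A u) (j : Dir) :
    ∃ u', IsD T j u u' ∧ Reg ρ T L n (L * A) u' := h.2 j

theorem Reg.nonneg (hT : 0 < T) (h : Reg ρ T L n A u) : 0 ≤ A := by
  have ht : T / 2 ∈ Ioo 0 T := ⟨by linarith, by linarith⟩
  have := (norm_nonneg _).trans (h.norm_le ht)
  exact nonneg_of_mul_nonneg_left this (Real.exp_pos _)

theorem Reg0.mono (h : Reg0 ρ T L A u) (hAB : A ≤ B) : Reg0 ρ T L B u :=
  ⟨h.1, fun t ht => ⟨(h.2 t ht).1.trans (by gcongr), (h.2 t ht).2⟩⟩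

theorem Reg.mono (hL : 0 ≤ L) (h : Reg ρ T L n A u) (hAB : A ≤ B) : Reg ρ T L n B u := by
  induction n generalizing A B u with
  | zero => exact Reg0.mono h hAB
  | succ n ih =>
    refine ⟨h.1.mono hAB, fun j => ?_⟩
    obtain ⟨u', h1, h2⟩ := h.2 j
    exact ⟨u', h1, ih h2 (by gcongr)⟩

theorem Reg.down (h : Reg ρ T L (n + 1) A u) : Reg ρ T L n A u := by
  induction n generalizing A u with
  | zero => exact h.1
  | succ n ih =>
    refine ⟨h.1, fun j => ?_⟩
    obtain ⟨u', h1, h2⟩ := h.2 j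
    exact ⟨u', h1, ih h2⟩

theorem Reg.le {m : ℕ} (h : Reg ρ T L n A u) (hm : m ≤ n) : Reg ρ T L m A u := by
  induction hm using Nat.decreasingInduction with
  | self => exact h
  | of_succ k _ ih => exact ih.down

theorem Reg0.congr (h : Reg0 ρ T L A u) (e : ∀ t ∈ Ioo 0 T, u t = v t) : Reg0 ρ T L A v :=
  ⟨h.1.congr fun t ht => (e t ht).symm, fun t ht => by rw [← e t ht]; exact h.2 t ht⟩

theorem Reg.congr (h : Reg ρ T L n A u) (e : ∀ t ∈ Ioo 0 T, u t = v t) : Reg ρ T L n A v := by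
  cases n with
  | zero => exact Reg0.congr h e
  | succ n =>
    refine ⟨h.1.congr e, fun j => ?_⟩
    obtain ⟨u', h1, h2⟩ := h.2 j
    exact ⟨u', h1.congr e fun _ _ => rfl, h2⟩

theorem Reg0.add (h : Reg0 ρ T L A u) (h' : Reg0 ρ T L B v) : Reg0 ρ T L (A + B) (u + v) :=
  ⟨h.1.add h'.1, fun t ht => ⟨(norm_add_le _ _).trans (by
    rw [add_mul]; exact add_le_add (h.2 t ht).1 (h'.2 t ht).1),
    (Supp _).add_mem (h.2 t ht).2 (h'.2 t ht).2⟩⟩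

theorem Reg.add (h : Reg ρ T L n A u) (h' : Reg ρ T L n B v) : Reg ρ T L n (A + B) (u + v) := by
  induction n generalizing A B u v with
  | zero => exact Reg0.add h h'
  | succ n ih =>
    refine ⟨h.1.add h'.1, fun j => ?_⟩
    obtain ⟨u', h1, h2⟩ := h.2 j
    obtain ⟨v', h3, h4⟩ := h'.2 j
    refine ⟨u' + v', h1.add h3, ?_⟩
    rw [mul_add]
    exact ih h2 h4

theorem Reg0.smul (c : ℝ) (h : Reg0 ρ T L A u) : Reg0 ρ T L (|c| * A) (c • u) :=
  ⟨h.1.const_smul c, fun t ht => ⟨by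
    rw [Pi.smul_apply, norm_smul, Real.norm_eq_abs, mul_assoc]
    exact mul_le_mul_of_nonneg_left (h.2 t ht).1 (abs_nonneg c),
    (Supp _).smul_mem _ (h.2 t ht).2⟩⟩

theorem Reg.smul (c : ℝ) (h : Reg ρ T L n A u) : Reg ρ T L n (|c| * A) (c • u) := by
  induction n generalizing A u with
  | zero => exact Reg0.smul c h
  | succ n ih =>
    refine ⟨h.1.smul c, fun j => ?_⟩
    obtain ⟨u', h1, h2⟩ := h.2 j
    refine ⟨c • u', h1.smul c, ?_⟩
    rw [mul_left_comm]
    exact ih h2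

/-! ### Derivatives along shifts in space-time -/

/-- The `i`-th unit vector of `ℝ³`. -/
abbrev e3 (i : Fin 3) : E3 := EuclideanSpace.single i 1

/-- The curve obtained from `u(t)` by moving along a space-time direction. -/
def crv : Dir → ℝ → (ℝ → H) → ℝ → H
  | none, t, u => fun h => u (t + h)
  | some i, t, u => fun h => shift (h • e3 i) (u t)

theorem crv_zero (j : Dir) (t : ℝ) (u : ℝ → H) : crv j t u 0 = u t := by
  cases j with
  | none => simp [crv]
  | some i => simp [crv, shift_zero]

theorem IsD.hasDerivAt_crv (hu : ∀ i : Fin 3, ∃ w, IsD T (some i) u w) (h : IsD T j u u') {t : ℝ}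
    (ht : t ∈ Ioo 0 T) : HasDerivAt (crv j t u) (u' t) 0 := by
  cases j with
  | none => exact HasDerivAt.comp_const_add t 0 (by simpa using h t ht)
  | some i =>
    choose w hw using hu
    have h1 := WD.hasDerivAt (fun k => hw k t ht) i
    rwa [(hw i t ht).unique (h t ht)] at h1

theorem IsD.hasDerivAt_crv' (hu : Reg ρ T L (n + 1) A u) (h : IsD T j u u') {t : ℝ}
    (ht : t ∈ Ioo 0 T) : HasDerivAt (crv j t u) (u' t) 0 :=
  h.hasDerivAt_crv (fun i => let ⟨w, hw, _⟩ := hu.deriv (some i); ⟨w, hw⟩) ht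

theorem isD_of_crv (h : ∀ t ∈ Ioo 0 T, HasDerivAt (crv j t u) (u' t) 0) : IsD T j u u' := by
  cases j with
  | none =>
    intro t ht
    have h1 : HasDerivAt (fun s => crv none t u (s - t)) (u' t) t :=
      HasDerivAt.comp_sub_const t t (by rw [sub_self]; exact h t ht)
    simpa [crv] using h1
  | some i => exact fun t ht => WD.of_hasDerivAt (h t ht)

theorem eventually_add_mem {t : ℝ} (ht : t ∈ Ioo 0 T) : ∀ᶠ h in 𝓝 (0 : ℝ), t + h ∈ Ioo 0 T := by
  have : ContinuousAt (fun h : ℝ => t + h) 0 := by fun_prop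
  exact this.eventually_mem (isOpen_Ioo.mem_nhds (by simpa using ht))

theorem continuousAt_crv (hu : ContinuousOn u (Ioo 0 T)) (j : Dir) {t : ℝ} (ht : t ∈ Ioo 0 T) :
    ContinuousAt (crv j t u) 0 := by
  cases j with
  | none =>
    have h1 : ContinuousAt u (t + 0) := by
      rw [add_zero]; exact hu.continuousAt (isOpen_Ioo.mem_nhds ht)
    exact h1.comp (f := fun h : ℝ => t + h) (by fun_prop)
  | some i =>
    have := continuous_shift_line (e3 i) 0 (u t)
    simp only [zero_add] at this
    exact this.continuousAt

theorem WD.eventually_crv {i : Fin 3} (h : ∀ t ∈ Ioo 0 T, WD i (u t) (v t)) (j : Dir) {t : ℝ}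
    (ht : t ∈ Ioo 0 T) : ∀ᶠ r in 𝓝 (0 : ℝ), WD i (crv j t u r) (crv j t v r) := by
  cases j with
  | none =>
    filter_upwards [eventually_add_mem ht] with r hr
    exact h _ hr
  | some k => exact Eventually.of_forall fun r => (h t ht).shift _

theorem WD.sub {i : Fin 3} {g g' k k' : H} (h : WD i g g') (h' : WD i k k') :
    WD i (g - k) (g' - k') := by
  have := h.add (h'.smul (-1))
  simpa [sub_eq_add_neg] using this

/-- The derivative of a differentiable curve in `H¹` is in `H¹`. -/
theorem WD.of_deriv {i : Fin 3} {a b : ℝ → H} {a' b' : H}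
    (h : ∀ᶠ r in 𝓝 (0 : ℝ), WD i (a r) (b r)) (ha : HasDerivAt a a' 0) (hb : HasDerivAt b b' 0) :
    WD i a' b' := by
  rw [hasDerivAt_iff_tendsto_slope] at ha hb
  refine (isClosed_WD i).mem_of_tendsto (ha.prodMk_nhds hb) ?_
  filter_upwards [h.filter_mono nhdsWithin_le_nhds] with r hr
  rw [slope_def_module, slope_def_module]
  exact (hr.sub h.self_of_nhds).smul _

/-- The constant of the Sobolev embedding. -/
def sobC : ℝ := exists_sobolev_bound.choose

theorem one_le_sobC : 1 ≤ sobC := exists_sobolev_bound.choose_spec.1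

theorem bdd_of_h2 {g : H} {g₁ : Fin 3 → H} {g₂ : Fin 3 → Fin 3 → H} (h₁ : ∀ i, WD i g (g₁ i))
    (h₂ : ∀ i j, WD j (g₁ i) (g₂ i j)) {N : ℝ} (hN : ‖g‖ ≤ N) (hN₁ : ∀ i, ‖g₁ i‖ ≤ N)
    (hN₂ : ∀ i j, ‖g₂ i j‖ ≤ N) : Bdd (sobC * N) g :=
  exists_sobolev_bound.choose_spec.2 g g₁ g₂ h₁ h₂ N hN hN₁ hN₂

theorem Bdd.mono {C C' : ℝ} {a : E3 → ℝ} (h : Bdd C a) (hC : C ≤ C') : Bdd C' a := by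
  filter_upwards [h] with x hx using hx.trans hC

theorem Reg.bdd (hL : 1 ≤ L) (hT : 0 < T) (h : Reg ρ T L n A u) (hn : 2 ≤ n) {t : ℝ}
    (ht : t ∈ Ioo 0 T) : Bdd (sobC * L ^ 2 * A * Real.exp (L * t)) (u t) := by
  have hA := h.nonneg hT
  have h := h.le hn
  choose w hw1 hw2 using fun i : Fin 3 => h.deriv (some i)
  choose z hz1 hz2 using fun i k : Fin 3 => (hw2 i).deriv (some k)
  have hLL : L ≤ L ^ 2 := by nlinarith
  have := bdd_of_h2 (g := u t) (g₁ := fun i => w i t) (g₂ := fun i k => z i k t)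
    (fun i => hw1 i t ht) (fun i k => hz1 i k t ht) (N := L ^ 2 * A * Real.exp (L * t))
    ((h.norm_le ht).trans (by
      gcongr
      nlinarith)) (fun i => ((hw2 i).norm_le ht).trans (by gcongr))
    (fun i k => ((hz2 i k).norm_le ht).trans (by
      rw [← mul_assoc, ← sq]))
  exact this.mono (le_of_eq (by ring))

theorem eventually_norm_lt_of_tendsto {f : ℝ → H} (h : ContinuousAt f 0) {ε : ℝ} (hε : 0 < ε) :
    ∀ᶠ r in 𝓝 (0 : ℝ), ‖f r - f 0‖ < ε := by
  have h1 := Metric.tendsto_nhds.1 h.tendsto ε hε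
  simpa only [dist_eq_norm] using h1

/-- A curve in `H²` moves continuously in `L^∞`. -/
theorem Reg.bdd_crv_sub (h : Reg ρ T L n A u) (hn : 2 ≤ n) (j : Dir) {t : ℝ}
    (ht : t ∈ Ioo 0 T) {ε : ℝ} (hε : 0 < ε) :
    ∀ᶠ r in 𝓝 (0 : ℝ), Bdd ε (crv j t u r - crv j t u 0 : H) := by
  have h := h.le hn
  choose w hw1 hw2 using fun i : Fin 3 => h.deriv (some i)
  choose z hz1 hz2 using fun i k : Fin 3 => (hw2 i).deriv (some k)
  have hs : 0 < sobC := one_pos.trans_le one_le_sobC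
  have hN : 0 < ε / sobC := by positivity
  have c0 := eventually_norm_lt_of_tendsto (continuousAt_crv h.cont j ht) hN
  have c1 := eventually_all.2 fun i =>
    eventually_norm_lt_of_tendsto (continuousAt_crv (hw2 i).cont j ht) hN
  have c2 := eventually_all.2 fun i => eventually_all.2 fun k =>
    eventually_norm_lt_of_tendsto (continuousAt_crv (hz2 i k).cont j ht) hN
  have d1 := eventually_all.2 fun i => WD.eventually_crv (hw1 i) j ht
  have d2 := eventually_all.2 fun i => eventually_all.2 fun k => WD.eventually_crv (hz1 i k) j ht
  have d1' := d1.self_of_nhds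
  have d2' := d2.self_of_nhds
  filter_upwards [c0, c1, c2, d1, d2] with r h0 h1 h2 k1 k2
  have := bdd_of_h2 (fun i => (k1 i).sub (d1' i)) (fun i k => (k2 i k).sub (d2' i k))
    h0.le (fun i => (h1 i).le) (fun i k => (h2 i k).le)
  rwa [mul_div_cancel₀ _ hs.ne'] at this

theorem eventually_deriv_le {f : ℝ → H} {f' : H} (h : HasDerivAt f f' 0) {ε : ℝ} (hε : 0 < ε) :
    ∀ᶠ r in 𝓝 (0 : ℝ), ‖f r - f 0 - r • f'‖ ≤ ε * |r| := by
  have h1 := hasDerivAt_iff_isLittleO_nhds_zero.1 h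
  rw [Asymptotics.isLittleO_iff] at h1
  simpa using h1 hε

/-- A differentiable curve in `H²` is differentiable in `L^∞`. -/
theorem Reg.bdd_crv_deriv (h : Reg ρ T L n A u) (hn : 3 ≤ n) (hj : IsD T j u u') {t : ℝ}
    (ht : t ∈ Ioo 0 T) {ε : ℝ} (hε : 0 < ε) :
    ∀ᶠ r in 𝓝 (0 : ℝ), Bdd (ε * |r|) (crv j t u r - crv j t u 0 - r • u' t : H) := by
  have h := h.le hn
  choose w hw1 hw2 using fun i : Fin 3 => h.deriv (some i)
  choose z hz1 hz2 using fun i k : Fin 3 => (hw2 i).deriv (some k)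
  choose w' hw1' hw2' using fun i : Fin 3 => (hw2 i).deriv j
  choose z' hz1' hz2' using fun i k : Fin 3 => (hz2 i k).deriv j
  have hs : 0 < sobC := one_pos.trans_le one_le_sobC
  have hN : 0 < ε / sobC := by positivity
  have D0 := hj.hasDerivAt_crv' h ht
  have D1 := fun i => (hw1' i).hasDerivAt_crv' (hw2 i) ht
  have D2 := fun i k => (hz1' i k).hasDerivAt_crv' (hz2 i k) ht
  have c0 := eventually_deriv_le D0 hN
  have c1 := eventually_all.2 fun i => eventually_deriv_le (D1 i) hN
  have c2 := eventually_all.2 fun i => eventually_all.2 fun k => eventually_deriv_le (D2 i k) hN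
  have d1 := eventually_all.2 fun i => WD.eventually_crv (hw1 i) j ht
  have d2 := eventually_all.2 fun i => eventually_all.2 fun k => WD.eventually_crv (hz1 i k) j ht
  have d1' := d1.self_of_nhds
  have d2' := d2.self_of_nhds
  have e1 : ∀ i, WD i (u' t) (w' i t) := fun i =>
    WD.of_deriv (WD.eventually_crv (hw1 i) j ht) D0 (D1 i)
  have e2 : ∀ i k, WD k (w' i t) (z' i k t) := fun i k =>
    WD.of_deriv (WD.eventually_crv (hz1 i k) j ht) (D1 i) (D2 i k)
  filter_upwards [c0, c1, c2, d1, d2] with r h0 h1 h2 k1 k2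
  have := bdd_of_h2 (fun i => ((k1 i).sub (d1' i)).sub ((e1 i).smul r))
    (fun i k => ((k2 i k).sub (d2' i k)).sub ((e2 i k).smul r)) h0 h1 h2
  rwa [← mul_assoc, mul_div_cancel₀ _ hs.ne'] at this

/-! ### Products of curves -/

theorem crv_prod (j : Dir) {t : ℝ} {C : ℝ} (h : Bdd C (u t) ∨ Bdd C (v t)) :
    crv j t (fun t => prod (u t) (v t)) = fun r => prod (crv j t u r) (crv j t v r) := by
  cases j with
  | none => rfl
  | some i =>
    funext r
    rcases h with h | h
    · exact shift_prod _ h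
    · change shift _ (prod (u t) (v t)) = _
      rw [prod_comm, shift_prod _ h, prod_comm]
      rfl

theorem IsD.mul_of_three (hL : 1 ≤ L) (hT : 0 < T) {a b : ℕ} (hu : Reg ρ T L a A u)
    (hv : Reg ρ T L b B v) (ha : 1 ≤ a) (hb : 3 ≤ b) (h : IsD T j u u') (h' : IsD T j v v') :
    IsD T j (fun t => prod (u t) (v t)) (fun t => prod (u' t) (v t) + prod (u t) (v' t)) := by
  refine isD_of_crv fun t ht => ?_
  have hbv := hv.bdd hL hT (by omega) ht
  rw [crv_prod j (Or.inr hbv)]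
  obtain ⟨v'', hv1, hv2⟩ := (hv.le hb).deriv j
  have hbv' := hv2.bdd hL hT le_rfl ht
  rw [hv1.unique h' ht] at hbv'
  set C := max (sobC * L ^ 2 * B * Real.exp (L * t)) (sobC * L ^ 2 * (L * B) * Real.exp (L * t))
  have hC : 0 ≤ C := by
    refine le_max_of_le_left ?_
    have := hv.nonneg hT
    have := one_le_sobC
    positivity
  have key := hasDerivAt_ml (a := fun r => crv j t v r) (a' := v' t) (u := crv j t u) hC
    (fun _ => Lp_aesm _) (Lp_aesm _) (by rw [crv_zero]; exact hbv.mono (le_max_left _ _))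
    (hbv'.mono (le_max_right _ _)) ?_ (h.hasDerivAt_crv' (n := 0) (hu.le ha) ht)
  · rw [crv_zero, crv_zero] at key
    have e : (fun r => prod (crv j t u r) (crv j t v r)) =
        fun r => ml (crv j t v r) (crv j t u r) := funext fun r => prod_comm _ _
    rw [e]
    refine key.congr_deriv ?_
    rw [prod_comm (u' t), prod_comm (u t), add_comm]
  · intro ε hε
    filter_upwards [hv.bdd_crv_deriv hb h' ht hε] with r hr
    filter_upwards [hr, Lp.coeFn_sub (crv j t v r - crv j t v 0) (r • v' t),
      Lp.coeFn_sub (crv j t v r) (crv j t v 0), Lp.coeFn_smul r (v' t)] with x h1 h2 h3 h4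
    rw [h2, Pi.sub_apply, h3, Pi.sub_apply, h4, Pi.smul_apply, smul_eq_mul] at h1
    exact h1

/-- The Leibniz rule in all space-time directions. Four derivatives in total suffice: by the
Sobolev embedding, either one factor has three of them and is differentiable in `L^∞`, or both have
two and are continuous in `L^∞`. -/
theorem IsD.mul (hL : 1 ≤ L) (hT : 0 < T) {a b : ℕ} (hu : Reg ρ T L a A u)
    (hv : Reg ρ T L b B v) (ha : 1 ≤ a) (hb : 1 ≤ b) (hab : 4 ≤ a + b) (h : IsD T j u u')
    (h' : IsD T j v v') :
    IsD T j (fun t => prod (u t) (v t)) (fun t => prod (u' t) (v t) + prod (u t) (v' t)) := by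
  by_cases hb3 : 3 ≤ b
  · exact h.mul_of_three hL hT hu hv ha hb3 h'
  by_cases ha3 : 3 ≤ a
  · refine (h'.mul_of_three hL hT hv hu hb ha3 h).congr (fun t _ => prod_comm _ _) fun t _ => ?_
    rw [prod_comm (v' t), prod_comm (v t), add_comm]
  have ha2 : 2 ≤ a := by omega
  have hb2 : 2 ≤ b := by omega
  refine isD_of_crv fun t ht => ?_
  have hbu := hu.bdd hL hT ha2 ht
  have hbv := hv.bdd hL hT hb2 ht
  rw [crv_prod j (Or.inr hbv)]
  set C := max (sobC * L ^ 2 * A * Real.exp (L * t)) (sobC * L ^ 2 * B * Real.exp (L * t))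
  have hC : 0 ≤ C := by
    refine le_max_of_le_left ?_
    have := hu.nonneg hT
    have := one_le_sobC
    positivity
  have key := hasDerivAt_prod (a := crv j t u) (b := crv j t v) hC
    (by rw [crv_zero]; exact hbu.mono (le_max_left _ _))
    (by rw [crv_zero]; exact hbv.mono (le_max_right _ _))
    (fun ε hε => hv.bdd_crv_sub hb2 j ht hε) (h.hasDerivAt_crv' (n := 0) (hu.le ha) ht)
    (h'.hasDerivAt_crv' (n := 0) (hv.le hb) ht)
  rwa [crv_zero, crv_zero] at key

/-- The constant in the estimate of a product by its factors. -/
def prodC (T L : ℝ) (c : ℕ) : ℝ := 2 ^ c * (sobC * L ^ 2 * Real.exp (L * T))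

theorem prodC_nonneg (c : ℕ) : 0 ≤ prodC T L c := by
  have := one_le_sobC
  unfold prodC
  positivity

theorem Reg0.mul (hL : 1 ≤ L) (hT : 0 < T) {a b : ℕ} (hu : Reg ρ T L a A u)
    (hv : Reg ρ T L b B v) (hb : 2 ≤ b) :
    Reg0 ρ T L (prodC T L 0 * A * B) (fun t => prod (u t) (v t)) := by
  have hA := hu.nonneg hT
  have hB := hv.nonneg hT
  refine ⟨?_, fun t ht => ⟨?_, ml_mem_Supp (hv.supp ht)⟩⟩
  · intro t ht
    refine ContinuousAt.continuousWithinAt ?_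
    have hbv := hv.bdd hL hT hb ht
    set C := sobC * L ^ 2 * B * Real.exp (L * t)
    have hC : 0 ≤ C := by
      have := one_le_sobC
      positivity
    have hcu := hu.cont.continuousAt (isOpen_Ioo.mem_nhds ht)
    rw [Metric.continuousAt_iff']
    intro ε hε
    set η := min 1 (ε / (‖u t‖ + 1 + C + 1)) with hη
    have hη0 : 0 < η := by positivity
    have h1 : ∀ᶠ s in 𝓝 t, Bdd η (v s - v t : H) := by
      have h := hv.bdd_crv_sub hb none ht hη0
      have h2 : Tendsto (fun s : ℝ => s - t) (𝓝 t) (𝓝 0) := by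
        have : ContinuousAt (fun s : ℝ => s - t) t := by fun_prop
        simpa using this.tendsto
      filter_upwards [h2.eventually h] with s hs
      simpa [crv] using hs
    filter_upwards [h1, Metric.continuousAt_iff'.1 hcu η hη0] with s hs1 hs2
    rw [dist_eq_norm] at hs2 ⊢
    have e : prod (u s) (v s) - prod (u t) (v t) =
        prod (v s - v t) (u s) + prod (v t) (u s - u t) := by
      have hvs : Bdd (η + C) (v s) := by
        have := hs1.add hbv
        rwa [sub_add_cancel] at this
      rw [sub_eq_add_neg (v s), sub_eq_add_neg (u s), ← neg_one_smul ℝ (v t),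
        ← neg_one_smul ℝ (u t), add_prod hvs (hbv.smul _), smul_prod _ hbv, prod_add hbv,
        prod_smul _ hbv, prod_comm (v s), prod_comm (v t), prod_comm (v t)]
      module
    rw [e]
    have hus : ‖u s‖ ≤ ‖u t‖ + 1 := by
      have : ‖u s‖ ≤ ‖u s - u t‖ + ‖u t‖ := by simpa using norm_add_le (u s - u t) (u t)
      linarith [min_le_left 1 (ε / (‖u t‖ + 1 + C + 1))]
    calc _ ≤ η * (‖u t‖ + 1) + C * η := by
          refine (norm_add_le _ _).trans (add_le_add ?_ ?_)
          · exact (norm_prod_le hs1).trans (by gcongr)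
          · exact (norm_prod_le hbv).trans (by gcongr)
      _ < η * (‖u t‖ + 1 + C + 1) := by nlinarith
      _ ≤ ε / (‖u t‖ + 1 + C + 1) * (‖u t‖ + 1 + C + 1) := by
          gcongr
          exact min_le_right _ _
      _ = ε := div_mul_cancel₀ _ (by positivity)
  · refine (norm_prod_le' (hv.bdd hL hT hb ht)).trans ?_
    have h1 := hu.norm_le ht
    have h2 : Real.exp (L * t) ≤ Real.exp (L * T) := by
      apply Real.exp_le_exp.2
      nlinarith [ht.2]
    have h3 := one_le_sobC
    calc sobC * L ^ 2 * B * Real.exp (L * t) * ‖u t‖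
        ≤ sobC * L ^ 2 * B * Real.exp (L * T) * (A * Real.exp (L * t)) := by gcongr
      _ = prodC T L 0 * A * B * Real.exp (L * t) := by
        rw [prodC, pow_zero]
        ring

/-- The product of a curve with `a` derivatives and one with `b` derivatives has `c` derivatives, if
`c ≤ a, b` and `c + 3 ≤ a + b`: whenever at most `c` derivatives are distributed over the two
factors, one of the factors still has two derivatives left and is bounded by the Sobolev
embedding. -/
theorem Reg.mul (hL : 1 ≤ L) (hT : 0 < T) {a b c : ℕ} (hu : Reg ρ T L a A u)
    (hv : Reg ρ T L b B v) (hca : c ≤ a) (hcb : c ≤ b) (hab : c + 3 ≤ a + b) :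
    Reg ρ T L c (prodC T L c * A * B) (fun t => prod (u t) (v t)) := by
  have base : ∀ {a b : ℕ} {A B : ℝ} {u v : ℝ → H}, Reg ρ T L a A u → Reg ρ T L b B v →
      3 ≤ a + b → Reg0 ρ T L (prodC T L 0 * A * B) (fun t => prod (u t) (v t)) := by
    intro a b A B u v hu hv hab
    -- the factor with at least two derivatives is the bounded one
    by_cases hb : 2 ≤ b
    · exact Reg0.mul hL hT hu hv hb
    · have := Reg0.mul hL hT hv hu (by omega)
      rw [mul_right_comm] at this
      exact this.congr fun t _ => prod_comm _ _
  induction c generalizing a b A B u v with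
  | zero => exact base hu hv (by omega)
  | succ c ih =>
    have hA := hu.nonneg hT
    have hB := hv.nonneg hT
    refine ⟨(base hu hv (by omega)).mono ?_, fun j => ?_⟩
    · have h3 := one_le_sobC
      gcongr
      rw [prodC, prodC]
      gcongr
      · norm_num
      · omega
    · obtain ⟨a, rfl⟩ : ∃ a', a = a' + 1 := ⟨a - 1, by omega⟩
      obtain ⟨b, rfl⟩ : ∃ b', b = b' + 1 := ⟨b - 1, by omega⟩
      obtain ⟨u', hu1, hu2⟩ := hu.deriv j
      obtain ⟨v', hv1, hv2⟩ := hv.deriv j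
      refine ⟨_, hu1.mul hL hT hu hv (by omega) (by omega) (by omega) hv1, ?_⟩
      have h1 := ih hu2 hv (by omega) (by omega) (by omega)
      have h2 := ih hu hv2 (by omega) (by omega) (by omega)
      have h3 := h1.add h2
      have e : prodC T L c * (L * A) * B + prodC T L c * A * (L * B) =
          L * (prodC T L (c + 1) * A * B) := by
        rw [prodC, prodC, pow_succ]
        ring
      rw [e] at h3
      exact h3

/-! ### Multiplication by smooth coefficients -/

/-- The unit vector of a space-time direction. -/
def dirVec : Dir → ℝ × E3
  | none => (1, 0)
  | some i => (0, e3 i)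

theorem norm_dirVec (j : Dir) : ‖dirVec j‖ = 1 := by
  cases j <;> simp [dirVec, Prod.norm_def]

/-- The partial derivative of a coefficient in a space-time direction. -/
def dV (j : Dir) (V : ℝ × E3 → ℝ) : ℝ × E3 → ℝ := fun p => fderiv ℝ V p (dirVec j)

theorem IsCoeff.le {s s' : ℕ} {M : ℝ} {V : ℝ × E3 → ℝ} (h : IsCoeff s T ρ M V) (hs : s' ≤ s) :
    IsCoeff s' T ρ M V := ⟨h.1, fun j hj => h.2 j (hj.trans hs)⟩

theorem IsCoeff.mono {s : ℕ} {M M' : ℝ} {V : ℝ × E3 → ℝ} (h : IsCoeff s T ρ M V) (hM : M ≤ M') :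
    IsCoeff s T ρ M' V := ⟨h.1, fun j hj p hp => (h.2 j hj p hp).trans hM⟩

theorem IsCoeff.dV {M : ℝ} {V : ℝ × E3 → ℝ} (h : IsCoeff (n + 1) T ρ M V) (j : Dir) :
    IsCoeff n T ρ M (dV j V) := by
  have h1 : ContDiff ℝ ∞ (fderiv ℝ V) := h.1.fderiv_right (by simp)
  refine ⟨h1.clm_apply contDiff_const, fun k hk p hp => ?_⟩
  have e : CubicWave.dV j V = (ContinuousLinearMap.apply ℝ ℝ (dirVec j)) ∘ fderiv ℝ V := rfl
  rw [e]
  refine (ContinuousLinearMap.norm_iteratedFDeriv_comp_left _ (h1.contDiffAt (x := p))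
    (by exact_mod_cast le_top)).trans ?_
  have h2 : ‖ContinuousLinearMap.apply ℝ ℝ (dirVec j)‖ ≤ 1 := by
    refine ContinuousLinearMap.opNorm_le_bound _ zero_le_one fun f => ?_
    rw [ContinuousLinearMap.apply_apply, one_mul]
    refine (f.le_opNorm _).trans ?_
    rw [norm_dirVec, mul_one]
  rw [norm_iteratedFDeriv_fderiv]
  exact (mul_le_of_le_one_left (norm_nonneg _) h2).trans (h.2 (k + 1) (by omega) p hp)

theorem IsCoeff.abs_le {M : ℝ} {V : ℝ × E3 → ℝ} (h : IsCoeff n T ρ M V) {t : ℝ} (ht : t ∈ Ioo 0 T)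
    {x : E3} (hx : ‖x‖ ≤ ρ + T) : |V (t, x)| ≤ M := by
  have := h.2 0 (Nat.zero_le _) (t, x) ⟨⟨ht.1.le, ht.2.le⟩, by simpa using hx⟩
  simpa using this

/-- A `C¹` function is uniformly differentiable on compact sets. -/
theorem eventually_sub_sub_le {V : ℝ × E3 → ℝ} (hV : ContDiff ℝ ∞ V) {K : Set (ℝ × E3)}
    (hK : IsCompact K) (j : Dir) {ε : ℝ} (hε : 0 < ε) :
    ∀ᶠ h in 𝓝 (0 : ℝ), ∀ p ∈ K, |V (p + h • dirVec j) - V p - h * dV j V p| ≤ ε * |h| := by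
  have hc : Continuous (dV j V) :=
    ((hV.continuous_fderiv (by simp)).clm_apply continuous_const)
  have h1 : ∀ᶠ h in 𝓝 (0 : ℝ), ∀ p ∈ K, |dV j V (p + h • dirVec j) - dV j V p| < ε := by
    refine hK.eventually_forall_of_forall_eventually fun p _ => ?_
    have hcont : Continuous fun q : ℝ × (ℝ × E3) =>
        |dV j V (q.2 + q.1 • dirVec j) - dV j V q.2| := by fun_prop
    refine hcont.continuousAt.eventually_lt continuousAt_const ?_
    simpa using hε
  obtain ⟨δ, hδ, hball⟩ := Metric.eventually_nhds_iff_ball.1 h1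
  filter_upwards [Metric.ball_mem_nhds (0 : ℝ) hδ] with h hh p hp
  have hd : ∀ s ∈ Metric.ball (0 : ℝ) δ,
      HasDerivWithinAt (fun s : ℝ => V (p + s • dirVec j) - s * dV j V p)
        (dV j V (p + s • dirVec j) - dV j V p) (Metric.ball (0 : ℝ) δ) s := by
    intro s _
    have h2 : HasDerivAt (fun s : ℝ => p + s • dirVec j) (dirVec j) s := by
      simpa using ((hasDerivAt_id s).smul_const (dirVec j)).const_add p
    have h3 := ((hV.differentiable (by simp)).differentiableAt (x := p + s • dirVec
      j)).hasFDerivAt.comp_hasDerivAt s h2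
    have h4 := (hasDerivAt_id s).mul_const (dV j V p)
    simp only [one_mul] at h4
    exact (h3.fun_sub h4).hasDerivWithinAt
  have h5 := (convex_ball (0 : ℝ) δ).norm_image_sub_le_of_norm_hasDerivWithin_le hd
    (C := ε) (fun s hs => (hball s hs p hp).le) (Metric.mem_ball_self hδ) hh
  simpa [sub_right_comm] using h5

theorem crv_ml (V : ℝ × E3 → ℝ) (hV : Continuous V) (j : Dir) (t r : ℝ) {R : ℝ}
    (hu : u t ∈ Supp R) : crv j t (fun t => ml (fun x => V (t, x)) (u t)) r =
      ml (fun x => V ((t, x) + r • dirVec j)) (crv j t u r) := by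
  cases j with
  | none => simp [crv, dirVec]
  | some i =>
    symm
    refine ofFun_eq ?_
    obtain ⟨C, hC⟩ := (isCompact_closedBall (0 : E3) R).exists_bound_of_continuousOn
      (f := fun x => V (t, x)) (by fun_prop)
    have h1 : ∀ᵐ x ∂μ₀, |V (t, x) * u t x| ≤ C * |u t x| := by
      filter_upwards [mem_Supp.1 hu] with x hx
      by_cases hxR : R < ‖x‖
      · simp [hx hxR]
      · rw [abs_mul]
        gcongr
        exact hC x (by simpa using hxR)
    have hm : AEStronglyMeasurable (fun x => V (t, x)) μ₀ :=
      (by fun_prop : Continuous fun x => V (t, x)).aestronglyMeasurable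
    have h2 := ofFun_coe (memLp_ml hm h1)
    have h3 := ae_shift (r • e3 i) h2
    have h4 := shift_coe (r • e3 i) (ml (fun x => V (t, x)) (u t))
    filter_upwards [h3, h4, shift_coe (r • e3 i) (u t)] with x k1 k2 k3
    simp only [crv]
    rw [k2, k3]
    simp only [ml]
    rw [k1]
    simp [dirVec]

theorem IsD.coeff {V : ℝ × E3 → ℝ} (hV : ContDiff ℝ ∞ V) (hu : Reg ρ T L (n + 1) A u)
    (h : IsD T j u u') :
    IsD T j (fun t => ml (fun x => V (t, x)) (u t))
      (fun t => ml (fun x => dV j V (t, x)) (u t) + ml (fun x => V (t, x)) (u' t)) := by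
  refine isD_of_crv fun t ht => ?_
  have hVc := hV.continuous
  have hdVc : Continuous (dV j V) :=
    ((hV.continuous_fderiv (by simp)).clm_apply continuous_const)
  -- near `t` everything is supported in a fixed ball, to which the coefficient is restricted
  set R := ρ + T + 1 with hR
  set K : Set E3 := Metric.closedBall 0 R with hK
  have hKm : MeasurableSet K := Metric.isClosed_closedBall.measurableSet
  have hKc : IsCompact K := isCompact_closedBall _ _
  have hrep : ∀ (a : E3 → ℝ) (g : H), g ∈ Supp R → ml (K.indicator a) g = ml a g := by
    intro a g hg
    refine ofFun_congr ?_
    filter_upwards [mem_Supp.1 hg] with x hx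
    by_cases hxK : x ∈ K
    · simp [hxK]
    · have : R < ‖x‖ := by simpa [hK] using hxK
      simp [hx this]
  obtain ⟨C, hC⟩ := hKc.exists_bound_of_continuousOn (f := fun x => V (t, x)) (by fun_prop)
  obtain ⟨C', hC'⟩ := hKc.exists_bound_of_continuousOn (f := fun x => dV j V (t, x)) (by fun_prop)
  have hutR : u t ∈ Supp R := Supp.mono (by rw [hR]; linarith [ht.2]) (hu.supp ht)
  have hu'tR : u' t ∈ Supp R := by
    have hd := h.hasDerivAt_crv' hu ht
    rw [hasDerivAt_iff_tendsto_slope] at hd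
    refine (isClosed_Supp R).mem_of_tendsto hd ?_
    have h1 : ∀ᶠ r in 𝓝 (0 : ℝ), crv j t u r ∈ Supp R := by
      cases j with
      | none =>
        filter_upwards [eventually_add_mem ht] with r hr
        exact Supp.mono (by rw [hR]; linarith [hr.2]) (hu.supp hr)
      | some i =>
        filter_upwards [Metric.ball_mem_nhds (0 : ℝ) one_pos] with r hr
        refine Supp.mono ?_ (Supp.shift (hu.supp ht) _)
        rw [norm_smul]
        simp only [Metric.mem_ball, dist_zero_right] at hr
        simp only [hR, PiLp.norm_single, norm_one, mul_one]
        linarith [ht.2]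
    filter_upwards [h1.filter_mono nhdsWithin_le_nhds] with r hr
    rw [slope_def_module]
    exact (Supp R).smul_mem _ ((Supp R).sub_mem hr h1.self_of_nhds)
  have hind : ∀ {c : ℝ} {a : E3 → ℝ}, (∀ x ∈ K, ‖a x‖ ≤ c) → Bdd (max c 0) (K.indicator a) := by
    intro c a ha
    refine Eventually.of_forall fun x => ?_
    by_cases hx : x ∈ K
    · rw [indicator_of_mem hx]; exact le_max_of_le_left (ha x hx)
    · rw [indicator_of_notMem hx]; simp
  have key := hasDerivAt_ml (a := fun r => K.indicator fun x => V ((t, x) + r • dirVec j))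
    (a' := K.indicator fun x => dV j V (t, x)) (u := crv j t u)
    (C := max (max C 0) (max C' 0)) (le_max_of_le_left (le_max_right _ _))
    (fun r => ((by fun_prop : Continuous fun x => V ((t, x) + r •
      dirVec j)).aestronglyMeasurable).indicator hKm)
    (((by fun_prop : Continuous fun x => dV j V (t, x)).aestronglyMeasurable).indicator hKm)
    ((hind (by simpa using hC)).mono (le_max_left _ _)) ((hind hC').mono (le_max_right _ _))
    (fun ε hε => ?_) (h.hasDerivAt_crv' hu ht)
  · rw [crv_zero] at key
    simp only [zero_smul, add_zero] at key
    rw [hrep _ _ hutR, hrep _ _ hu'tR] at key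
    refine key.congr_of_eventuallyEq ?_
    filter_upwards [eventually_add_mem ht, Metric.ball_mem_nhds (0 : ℝ) one_pos] with r hr hr1
    rw [crv_ml V hVc j t r hutR]
    symm
    refine hrep _ _ ?_
    cases j with
    | none => exact Supp.mono (by rw [hR]; linarith [hr.2]) (hu.supp hr)
    | some i =>
      refine Supp.mono ?_ (Supp.shift (hu.supp ht) _)
      rw [norm_smul]
      simp only [Metric.mem_ball, dist_zero_right] at hr1
      simp only [hR, PiLp.norm_single, norm_one, mul_one]
      linarith [ht.2]
  · filter_upwards [eventually_sub_sub_le hV (isCompact_singleton (x := t) |>.prod hKc) j hε]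
      with r hr
    refine Eventually.of_forall fun x => ?_
    by_cases hx : x ∈ K
    · simpa [hx] using hr (t, x) ⟨rfl, hx⟩
    · simp only [indicator_of_notMem hx]
      simp only [sub_self, mul_zero, abs_zero]
      positivity

theorem continuousOn_coeff {V : ℝ × E3 → ℝ} (hV : Continuous V) (hu : Reg0 ρ T L A u) :
    ContinuousOn (fun t => ml (fun x => V (t, x)) (u t)) (Ioo 0 T) := by
  intro t ht
  refine ContinuousAt.continuousWithinAt ?_
  set R := ρ + T with hR
  set K : Set E3 := Metric.closedBall 0 R with hK
  have hKm : MeasurableSet K := Metric.isClosed_closedBall.measurableSet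
  have hKc : IsCompact K := isCompact_closedBall _ _
  have hout : ∀ s ∈ Ioo 0 T, ∀ᵐ x ∂μ₀, x ∉ K → u s x = 0 := by
    intro s hs
    filter_upwards [mem_Supp.1 (hu.2 s hs).2] with x hx hxK
    refine hx (lt_of_lt_of_le ?_ (not_le.1 fun h => hxK (mem_closedBall_zero_iff.2 h)).le)
    rw [hR]
    linarith [hs.2]
  obtain ⟨C, hC⟩ := hKc.exists_bound_of_continuousOn (f := fun x => V (t, x)) (by fun_prop)
  have hm : ∀ s, AEStronglyMeasurable (fun x => V (s, x)) μ₀ := fun s =>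
    (by fun_prop : Continuous fun x => V (s, x)).aestronglyMeasurable
  have hcu := hu.1.continuousAt (isOpen_Ioo.mem_nhds ht)
  rw [Metric.continuousAt_iff']
  intro ε hε
  set η := min 1 (ε / (‖u t‖ + 1 + |C| + 1)) with hη
  have hη0 : 0 < η := by positivity
  have h1 : ∀ᶠ s in 𝓝 t, ∀ x ∈ K, |V (s, x) - V (t, x)| < η := by
    refine hKc.eventually_forall_of_forall_eventually fun x _ => ?_
    have hcont : Continuous fun q : ℝ × E3 => |V q - V (t, q.2)| := by fun_prop
    refine hcont.continuousAt.eventually_lt continuousAt_const ?_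
    simpa using hη0
  filter_upwards [h1, Metric.continuousAt_iff'.1 hcu η hη0, isOpen_Ioo.mem_nhds ht]
    with s hs1 hs2 hs
  rw [dist_eq_norm] at hs2 ⊢
  have hmd : AEStronglyMeasurable (fun x => V (s, x) - V (t, x)) μ₀ := (hm s).sub (hm t)
  have b1 : ∀ᵐ x ∂μ₀, |(V (s, x) - V (t, x)) * u s x| ≤ η * |u s x| := by
    filter_upwards [hout s hs] with x hx
    by_cases hxK : x ∈ K
    · rw [abs_mul]; gcongr; exact (hs1 x hxK).le
    · simp [hx hxK]
  have b2 : ∀ s ∈ Ioo 0 T, ∀ᵐ x ∂μ₀, |V (t, x) * u s x| ≤ |C| * |u s x| := by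
    intro s hs
    filter_upwards [hout s hs] with x hx
    by_cases hxK : x ∈ K
    · rw [abs_mul]
      exact mul_le_mul_of_nonneg_right ((hC x hxK).trans (le_abs_self C)) (abs_nonneg _)
    · simp [hx hxK]
  have b3 : ∀ᵐ x ∂μ₀, |V (t, x) * (u s - u t : H) x| ≤ |C| * |(u s - u t : H) x| := by
    filter_upwards [hout s hs, hout t ht, Lp.coeFn_sub (u s) (u t)] with x h1 h2 h3
    by_cases hxK : x ∈ K
    · rw [abs_mul]
      exact mul_le_mul_of_nonneg_right ((hC x hxK).trans (le_abs_self C)) (abs_nonneg _)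
    · rw [h3, Pi.sub_apply, h1 hxK, h2 hxK]; simp
  have b4 : ∀ᵐ x ∂μ₀, |V (s, x) * u s x| ≤ (η + |C|) * |u s x| := by
    filter_upwards [b1, b2 s hs] with x h1 h2
    have : V (s, x) * u s x = (V (s, x) - V (t, x)) * u s x + V (t, x) * u s x := by ring
    rw [this]
    refine (abs_add_le _ _).trans ?_
    linarith
  have e : ml (fun x => V (s, x)) (u s) - ml (fun x => V (t, x)) (u t) =
      ml (fun x => V (s, x) - V (t, x)) (u s) + ml (fun x => V (t, x)) (u s - u t) := by
    refine Lp.ext ?_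
    filter_upwards [Lp.coeFn_sub (ml (fun x => V (s, x)) (u s)) (ml (fun x => V (t, x)) (u t)),
      Lp.coeFn_add (ml (fun x => V (s, x) - V (t, x)) (u s)) (ml (fun x => V (t, x)) (u s - u t)),
      ofFun_coe (memLp_ml (hm s) b4), ofFun_coe (memLp_ml (hm t) (b2 t ht)),
      ofFun_coe (memLp_ml hmd b1), ofFun_coe (memLp_ml (hm t) b3),
      Lp.coeFn_sub (u s) (u t)] with x h1 h2 h3 h4 h5 h6 h7
    rw [h1, h2, Pi.sub_apply, Pi.add_apply]
    simp only [ml]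
    rw [h3, h4, h5, h6, h7]
    simp only [Pi.sub_apply]
    ring
  rw [e]
  have hus : ‖u s‖ ≤ ‖u t‖ + 1 := by
    have : ‖u s‖ ≤ ‖u s - u t‖ + ‖u t‖ := by simpa using norm_add_le (u s - u t) (u t)
    linarith [min_le_left 1 (ε / (‖u t‖ + 1 + |C| + 1))]
  calc _ ≤ η * (‖u t‖ + 1) + |C| * η := by
        refine (norm_add_le _ _).trans (add_le_add ?_ ?_)
        · exact (norm_ml_le' hmd b1).trans (by gcongr)
        · exact (norm_ml_le' (hm t) b3).trans (by gcongr)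
    _ < η * (‖u t‖ + 1 + |C| + 1) := by nlinarith
    _ ≤ ε / (‖u t‖ + 1 + |C| + 1) * (‖u t‖ + 1 + |C| + 1) := by
        gcongr
        exact min_le_right _ _
    _ = ε := div_mul_cancel₀ _ (by positivity)

/-- An admissible coefficient is a multiplier with norm independent of the weight `L`: every
derivative that falls on the coefficient costs `M` in place of a factor `L ≥ 1`, and the `2 ^ n`
counts the terms of the Leibniz rule. Only the values of the coefficient in the light cone
matter. -/
theorem Reg.coeff (hL : 1 ≤ L) (hT : 0 < T) {M : ℝ} (hM : 0 ≤ M) {V : ℝ × E3 → ℝ}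
    (hu : Reg ρ T L n A u) (hV : IsCoeff n T ρ M V) :
    Reg ρ T L n (2 ^ n * M * A) (fun t => ml (fun x => V (t, x)) (u t)) := by
  have base : ∀ {n : ℕ} {A : ℝ} {u : ℝ → H} {V : ℝ × E3 → ℝ}, Reg ρ T L n A u →
      IsCoeff n T ρ M V → Reg0 ρ T L (M * A) fun t => ml (fun x => V (t, x)) (u t) := by
    intro n A u V hu hV
    have hVc := hV.1.continuous
    refine ⟨continuousOn_coeff hVc hu.reg0, fun t ht => ⟨?_, ml_mem_Supp (hu.supp ht)⟩⟩
    refine (norm_ml_le' (C := M) (by fun_prop : Continuous fun x =>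
      V (t, x)).aestronglyMeasurable ?_).trans ?_
    · filter_upwards [mem_Supp.1 (hu.supp ht)] with x hx
      by_cases hxR : ρ + t < ‖x‖
      · simp [hx hxR]
      · rw [abs_mul]
        gcongr
        exact hV.abs_le ht (by linarith [ht.2, not_lt.1 hxR])
    · rw [mul_assoc]
      gcongr
      exact hu.norm_le ht
  induction n generalizing A u V with
  | zero =>
    rw [pow_zero, one_mul]
    exact base hu hV
  | succ n ih =>
    have hA := hu.nonneg hT
    refine ⟨(base hu hV).mono ?_, fun j => ?_⟩
    · rw [mul_assoc]
      exact le_mul_of_one_le_left (by positivity) (one_le_pow₀ (by norm_num))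
    · obtain ⟨u', h1, h2⟩ := hu.deriv j
      refine ⟨_, h1.coeff hV.1 hu, ?_⟩
      have h3 := (ih hu.down (hV.dV j)).add (ih h2 (hV.le (Nat.le_succ n)))
      refine Reg.mono (by linarith) h3 ?_
      have h4 : 2 ^ n * M * A ≤ 2 ^ n * M * (L * A) := by
        gcongr
        exact le_mul_of_one_le_left hA hL
      rw [pow_succ]
      linarith

/-! ### Retarded potentials -/

section

variable {ρ T L : ℝ} {F F' u : ℝ → H} {A : ℝ} {n p : ℕ} {c : ℝ × E3 → ℝ}

/-- The uniform probability measure on `(0,1) × S²`. -/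
def pot : Measure (ℝ × E3) := ((volume : Measure ℝ).restrict (Ioo 0 1)).prod sph

instance : IsProbabilityMeasure ((volume : Measure ℝ).restrict (Ioo 0 1)) :=
  ⟨by simp⟩

instance : IsProbabilityMeasure pot := by unfold pot; infer_instance

/-- The integral `t^p ∫ c(r,y) F(t(1-r), x + t r y) dr dσ(y)` over `(0,1) × S²`. For `p = 2` and
`c = r` it is Kirchhoff's retarded potential; the other exponents and densities arise from it by
differentiation in `t`. In these coordinates the domain of integration does not depend on `t`. -/
def kop (p : ℕ) (c : ℝ × E3 → ℝ) (F : ℝ → H) (t : ℝ) : H :=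
  t ^ p • ∫ q, c q • shift ((t * q.1) • q.2) (F (t * (1 - q.1))) ∂pot

/-- Continuous densities on `(0,1) × S²` that are bounded by `r`. -/
def Dens (c : ℝ × E3 → ℝ) : Prop :=
  Continuous c ∧ ∀ q : ℝ × E3, q.1 ∈ Ioo (0 : ℝ) 1 → ‖q.2‖ = 1 → |c q| ≤ q.1

theorem Dens.mul {c d : ℝ × E3 → ℝ} (hc : Dens c) (hd : Continuous d)
    (h : ∀ q : ℝ × E3, q.1 ∈ Ioo (0 : ℝ) 1 → ‖q.2‖ = 1 → |d q| ≤ 1) : Dens fun q => c q * d q :=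
  ⟨hc.1.mul hd, fun q h1 h2 => by
    rw [abs_mul]
    exact (mul_le_of_le_one_right (abs_nonneg _) (h q h1 h2)).trans (hc.2 q h1 h2)⟩

theorem Dens.time (hc : Dens c) : Dens fun q => c q * (1 - q.1) :=
  hc.mul (by fun_prop) fun q h1 _ => by
    rw [abs_le]; constructor <;> linarith [h1.1, h1.2]

theorem Dens.space (hc : Dens c) (i : Fin 3) : Dens fun q => c q * (q.1 * q.2 i) :=
  hc.mul (by fun_prop) fun q h1 h2 => by
    rw [abs_mul, abs_of_pos h1.1]
    have := coord_abs_le h2.le i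
    nlinarith [h1.1, h1.2, abs_nonneg (q.2 i)]

theorem dens_fst : Dens fun q => q.1 :=
  ⟨continuous_fst, fun q h1 _ => by rw [abs_of_pos h1.1]⟩

theorem ae_pot : ∀ᵐ q ∂pot, q.1 ∈ Ioo (0 : ℝ) 1 ∧ ‖q.2‖ = 1 := by
  have h1 : ∀ᵐ q ∂pot, q.1 ∈ Ioo (0 : ℝ) 1 :=
    Measure.quasiMeasurePreserving_fst.ae (ae_restrict_mem measurableSet_Ioo)
  have h2 : ∀ᵐ q ∂pot, ‖q.2‖ = 1 := Measure.quasiMeasurePreserving_snd.ae ae_sph_norm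
  filter_upwards [h1, h2] with q h1 h2 using ⟨h1, h2⟩

theorem retard_mem {t : ℝ} (ht : t ∈ Ioo 0 T) {r : ℝ} (hr : r ∈ Ioo (0 : ℝ) 1) :
    t * (1 - r) ∈ Ioo 0 T := by
  have h1 : 0 < 1 - r := by linarith [hr.2]
  refine ⟨mul_pos ht.1 h1, ?_⟩
  nlinarith [ht.1, ht.2, hr.1]

theorem pot_eq : pot = ((volume : Measure ℝ).prod sph).restrict (Ioo (0 : ℝ) 1 ×ˢ univ) := by
  rw [← Measure.prod_restrict, Measure.restrict_univ]
  rfl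

theorem aesm_kop (hF : ContinuousOn F (Ioo 0 T)) (hc : Continuous c) {t : ℝ} (ht : t ∈ Ioo 0 T) :
    AEStronglyMeasurable (fun q : ℝ × E3 => c q • shift ((t * q.1) • q.2) (F (t * (1 - q.1))))
      pot := by
  rw [pot_eq]
  refine ContinuousOn.aestronglyMeasurable ?_ (measurableSet_Ioo.prod MeasurableSet.univ)
  refine hc.continuousOn.smul ?_
  have h1 : ContinuousOn (fun q : ℝ × E3 => F (t * (1 - q.1))) (Ioo (0 : ℝ) 1 ×ˢ univ) :=
    hF.comp (by fun_prop) fun q hq => retard_mem ht hq.1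
  exact continuous_shift.comp_continuousOn
    ((by fun_prop : Continuous fun q : ℝ × E3 => (t * q.1) • q.2).continuousOn.prodMk h1)

theorem norm_kop_integrand_le (hc : Dens c) {q : ℝ × E3} (hq : q.1 ∈ Ioo (0 : ℝ) 1 ∧ ‖q.2‖ = 1)
    (v : E3) (g : H) : ‖c q • shift v g‖ ≤ q.1 * ‖g‖ := by
  rw [norm_smul, norm_shift, Real.norm_eq_abs]
  gcongr
  exact hc.2 q hq.1 hq.2

theorem Reg0.norm_le_exp (hL : 0 ≤ L) (hA : 0 ≤ A) (hF : Reg0 ρ T L A F) {t : ℝ}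
    (ht : t ∈ Ioo 0 T) : ‖F t‖ ≤ A * Real.exp (L * T) := by
  refine (hF.2 t ht).1.trans ?_
  gcongr
  exact ht.2.le

theorem kop_bound (hL : 0 ≤ L) (hA : 0 ≤ A) (hF : Reg0 ρ T L A F) (hc : Dens c) {t : ℝ}
    (ht : t ∈ Ioo 0 T) : ∀ᵐ q ∂pot, ‖c q • shift ((t * q.1) • q.2) (F (t * (1 - q.1)))‖ ≤
      A * Real.exp (L * T) := by
  filter_upwards [ae_pot] with q hq
  refine (norm_kop_integrand_le hc hq _ _).trans ?_
  refine (mul_le_of_le_one_left (norm_nonneg _) hq.1.2.le).trans ?_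
  exact hF.norm_le_exp hL hA (retard_mem ht hq.1)

theorem integrable_kop (hL : 0 ≤ L) (hA : 0 ≤ A) (hF : Reg0 ρ T L A F) (hc : Dens c) {t : ℝ}
    (ht : t ∈ Ioo 0 T) :
    Integrable (fun q : ℝ × E3 => c q • shift ((t * q.1) • q.2) (F (t * (1 - q.1)))) pot :=
  Integrable.of_bound (aesm_kop hF.1 hc.1 ht) _ (kop_bound hL hA hF hc ht)

/-- The smallness gained from the weight `e^{Lt}` by the retardation, when the potential carries the
factor `t ^ p`, `p ≤ 2`. -/
def retC (T L : ℝ) : ℕ → ℝ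
  | 0 => 1
  | 1 => 1 / L
  | _ => T / L

/-- The retardation turns `e^{Lt}` into `e^{Lt(1-r)}`, and `t r e^{-Ltr} ≤ 1 / L`. -/
theorem pow_mul_exp_le (hL : 0 < L) (hp : p ≤ 2) {t r : ℝ} (ht : t ∈ Ioo 0 T)
    (hr : r ∈ Ioo (0 : ℝ) 1) : t ^ p * (r * Real.exp (L * (t * (1 - r)))) ≤
      retC T L p * Real.exp (L * t) := by
  have hx : 0 ≤ L * (t * r) := by have := ht.1; have := hr.1; positivity
  have h1 : t * r * Real.exp (L * (t * (1 - r))) ≤ 1 / L * Real.exp (L * t) := by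
    have e : Real.exp (L * t) = Real.exp (L * (t * r)) * Real.exp (L * (t * (1 - r))) := by
      rw [← Real.exp_add]; ring_nf
    rw [e, ← mul_assoc (1 / L)]
    refine mul_le_mul_of_nonneg_right ?_ (Real.exp_pos _).le
    rw [div_mul_eq_mul_div, one_mul, le_div_iff₀ hL]
    have := Real.add_one_le_exp (L * (t * r))
    linarith
  have h0 : r * Real.exp (L * (t * (1 - r))) ≤ Real.exp (L * t) := by
    refine (mul_le_of_le_one_left (Real.exp_pos _).le hr.2.le).trans ?_
    apply Real.exp_le_exp.2
    nlinarith
  interval_cases p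
  · simpa [retC] using h0
  · simp only [retC, pow_one]
    linarith
  · simp only [retC]
    calc t ^ 2 * (r * Real.exp (L * (t * (1 - r)))) =
        t * (t * r * Real.exp (L * (t * (1 - r)))) := by ring
      _ ≤ T * (1 / L * Real.exp (L * t)) := by
        exact mul_le_mul ht.2.le h1 (by have := hr.1; have := ht.1; positivity)
          (ht.1.le.trans ht.2.le)
      _ = T / L * Real.exp (L * t) := by ring

theorem continuousAt_kop (hL : 0 ≤ L) (hA : 0 ≤ A) (hF : Reg0 ρ T L A F) (hc : Dens c) (p : ℕ)
    {t : ℝ} (ht : t ∈ Ioo 0 T) : ContinuousAt (kop p c F) t := by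
  have hI := isOpen_Ioo.mem_nhds ht
  suffices h : ContinuousAt
      (fun t => ∫ q, c q • shift ((t * q.1) • q.2) (F (t * (1 - q.1))) ∂pot) t from
    ((continuous_pow p).continuousAt (x := t)).smul h
  refine continuousAt_of_dominated (bound := fun _ => A * Real.exp (L * T)) ?_ ?_
    (integrable_const _) ?_
  · filter_upwards [hI] with s hs using aesm_kop hF.1 hc.1 hs
  · filter_upwards [hI] with s hs using kop_bound hL hA hF hc hs
  · filter_upwards [ae_pot] with q hq
    have h1 : ContinuousAt (fun t => F (t * (1 - q.1))) t :=
      ContinuousAt.comp (g := F) (f := fun t => t * (1 - q.1))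
        (hF.1.continuousAt (isOpen_Ioo.mem_nhds (retard_mem ht hq.1))) (by fun_prop)
    have h2 : ContinuousAt (fun t : ℝ => (t * q.1) • q.2) t := by fun_prop
    have h3 : ContinuousAt (fun t => shift ((t * q.1) • q.2) (F (t * (1 - q.1)))) t :=
      ContinuousAt.comp (g := fun p : E3 × H => shift p.1 p.2)
        (f := fun t => ((t * q.1) • q.2, F (t * (1 - q.1)))) continuous_shift.continuousAt
        (h2.prodMk h1)
    exact h3.const_smul (c q)

theorem Reg0.kop (hL : 0 < L) (hA : 0 ≤ A) (hF : Reg0 ρ T L A F) (hc : Dens c) (hp : p ≤ 2) :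
    Reg0 ρ T L (retC T L p * A) (kop p c F) := by
  refine ⟨fun t ht => (continuousAt_kop hL.le hA hF hc p ht).continuousWithinAt,
    fun t ht => ⟨?_, ?_⟩⟩
  · have h1 : ∀ᵐ q ∂pot, ‖t ^ p • (c q • shift ((t * q.1) • q.2) (F (t * (1 - q.1))))‖ ≤
        retC T L p * A * Real.exp (L * t) := by
      filter_upwards [ae_pot] with q hq
      rw [norm_smul, Real.norm_of_nonneg (pow_nonneg ht.1.le p)]
      calc _ ≤ t ^ p * (q.1 * (A * Real.exp (L * (t * (1 - q.1))))) := by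
            have := ht.1
            have := hq.1.1
            refine mul_le_mul_of_nonneg_left ((norm_kop_integrand_le hc hq _ _).trans ?_)
              (by positivity)
            gcongr
            exact (hF.2 _ (retard_mem ht hq.1)).1
        _ = A * (t ^ p * (q.1 * Real.exp (L * (t * (1 - q.1))))) := by ring
        _ ≤ A * (retC T L p * Real.exp (L * t)) := by
            exact mul_le_mul_of_nonneg_left (pow_mul_exp_le hL hp ht hq.1) hA
        _ = _ := by ring
    have h2 := norm_integral_le_of_norm_le_const h1
    rw [integral_smul] at h2
    simpa [CubicWave.kop] using h2
  · refine (Supp _).smul_mem _ ?_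
    refine (Supp (ρ + t)).convex.integral_mem (isClosed_Supp _) ?_
      (integrable_kop hL.le hA hF hc ht)
    filter_upwards [ae_pot] with q hq
    refine (Supp _).smul_mem _ (Supp.mono ?_
      (Supp.shift (hF.2 _ (retard_mem ht hq.1)).2 _))
    rw [norm_smul, hq.2, mul_one, Real.norm_of_nonneg (mul_nonneg ht.1.le hq.1.1.le)]
    linarith

theorem hasDerivAt_shift_of_zero {y : ℝ → H} {y' : H} {t : ℝ} (hy : HasDerivAt y y' t)
    (h0 : y t = 0) (v : E3) :
    HasDerivAt (fun s => shift (s • v) (y s)) (shift (t • v) y') t := by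
  rw [hasDerivAt_iff_tendsto_slope] at hy ⊢
  have h1 : Tendsto (fun s : ℝ => s • v) (𝓝[≠] t) (𝓝 (t • v)) :=
    (by fun_prop : Continuous fun s : ℝ => s • v).continuousAt.tendsto.mono_left
      nhdsWithin_le_nhds
  have h2 := (continuous_shift.tendsto (t • v, y')).comp (h1.prodMk_nhds hy)
  refine h2.congr fun s => ?_
  simp only [Function.comp_apply, slope_def_module, h0, map_zero, sub_zero, map_smul]

theorem hasDerivAt_shift_curve {a t : ℝ} {F' : H} {Fi : Fin 3 → H} (v : E3)
    (hF : HasDerivAt F F' (t * a)) (hi : ∀ i, WD i (F (t * a)) (Fi i)) :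
    HasDerivAt (fun t => shift (t • v) (F (t * a)))
      (a • shift (t • v) F' + ∑ i, v i • shift (t • v) (Fi i)) t := by
  have h1 : HasDerivAt (fun s => F (s * a) - F (t * a)) (a • F') t := by
    have h := HasDerivAt.scomp (g₁ := F) t hF ((hasDerivAt_id t).mul_const a)
    simpa [Function.comp_def] using h.sub_const (F (t * a))
  have h2 := hasDerivAt_shift_of_zero h1 (sub_self _) v
  have h3 := hasDerivAt_shift_line hi v 0 t
  simp only [zero_add] at h3
  have h4 := h2.fun_add h3
  rw [map_smul] at h4
  refine h4.congr_of_eventuallyEq (Eventually.of_forall fun s => ?_)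
  simp only [map_sub, sub_add_cancel]

theorem hasDerivAt_kop_zero (hL : 0 ≤ L) (hA : 0 ≤ A) {Fi : Fin 3 → ℝ → H}
    (hF : Reg0 ρ T L A F) (hF' : Reg0 ρ T L A F') (hFi : ∀ i, Reg0 ρ T L A (Fi i))
    (h : IsD T none F F') (hi : ∀ i, IsD T (some i) F (Fi i)) (hc : Dens c) {t : ℝ}
    (ht : t ∈ Ioo 0 T) : HasDerivAt (kop 0 c F)
      (kop 0 (fun q => c q * (1 - q.1)) F' t +
        ∑ i, kop 0 (fun q => c q * (q.1 * q.2 i)) (Fi i) t) t := by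
  have hI := isOpen_Ioo.mem_nhds ht
  have i1 := fun t (ht : t ∈ Ioo 0 T) => integrable_kop hL hA hF' hc.time ht
  have i2 := fun t (ht : t ∈ Ioo 0 T) i => integrable_kop hL hA (hFi i) (hc.space i) ht
  have key := hasDerivAt_integral_of_dominated_loc_of_deriv_le (μ := pot)
    (F := fun t q => c q • shift ((t * q.1) • q.2) (F (t * (1 - q.1))))
    (F' := fun t q => (c q * (1 - q.1)) • shift ((t * q.1) • q.2) (F' (t * (1 - q.1))) +
      ∑ i, (c q * (q.1 * q.2 i)) • shift ((t * q.1) • q.2) (Fi i (t * (1 - q.1)))) (x₀ := t)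
    (s := Ioo 0 T) (bound := fun _ => A * Real.exp (L * T) + ∑ _i : Fin 3, A * Real.exp (L * T))
    hI ?_ (integrable_kop hL hA hF hc ht)
    ((i1 t ht).add (integrable_finsetSum _ fun i _ => i2 t ht i)).aestronglyMeasurable
    ?_ (integrable_const _) ?_
  · have h2 := key.2
    rw [integral_add (i1 t ht) (integrable_finsetSum _ fun i _ => i2 t ht i),
      integral_finsetSum _ fun i _ => i2 t ht i] at h2
    have e : kop 0 c F = fun t => ∫ q, c q • shift ((t * q.1) • q.2) (F (t * (1 - q.1))) ∂pot :=
      funext fun t => by simp [kop]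
    rw [e]
    simp only [kop, pow_zero, one_smul]
    exact h2
  · filter_upwards [hI] with s hs using aesm_kop hF.1 hc.1 hs
  · filter_upwards [ae_pot] with q hq s hs
    refine (norm_add_le _ _).trans (add_le_add ?_ (norm_sum_le_of_le _ fun i _ => ?_))
    · refine (norm_kop_integrand_le hc.time hq _ _).trans ?_
      refine (mul_le_of_le_one_left (norm_nonneg _) hq.1.2.le).trans ?_
      exact hF'.norm_le_exp hL hA (retard_mem hs hq.1)
    · refine (norm_kop_integrand_le (hc.space i) hq _ _).trans ?_
      refine (mul_le_of_le_one_left (norm_nonneg _) hq.1.2.le).trans ?_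
      exact (hFi i).norm_le_exp hL hA (retard_mem hs hq.1)
  · filter_upwards [ae_pot] with q hq s hs
    have hm := retard_mem hs hq.1
    have h3 := (hasDerivAt_shift_curve (q.1 • q.2) (h _ hm) (fun i => hi i _ hm)).const_smul (c q)
    simp only [smul_smul, smul_add, Finset.smul_sum] at h3
    exact h3

theorem isD_kop_space (hL : 0 ≤ L) (hA : 0 ≤ A) {i : Fin 3} {Fi : ℝ → H} (hF : Reg0 ρ T L A F)
    (hFi : Reg0 ρ T L A Fi) (h : IsD T (some i) F Fi) (hc : Dens c) (p : ℕ) :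
    IsD T (some i) (kop p c F) (kop p c Fi) := by
  intro t ht
  refine WD.smul _ fun φ hφ => ?_
  have e : ∀ {G : ℝ → H}, Reg0 ρ T L A G → ∀ k : H,
      inner ℝ (∫ q, c q • shift ((t * q.1) • q.2) (G (t * (1 - q.1))) ∂pot) k =
        ∫ q, inner ℝ (c q • shift ((t * q.1) • q.2) (G (t * (1 - q.1)))) k ∂pot := by
    intro G hG k
    have h1 := (innerSL ℝ k).integral_comp_comm (integrable_kop hL hA hG hc ht)
    simp only [innerSL_apply_apply] at h1
    rw [real_inner_comm, ← h1]
    simp only [real_inner_comm k]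
  rw [e hF, e hFi, ← integral_neg]
  refine integral_congr_ae ?_
  filter_upwards [ae_pot] with q hq
  exact ((h _ (retard_mem ht hq.1)).shift _).smul _ φ hφ

theorem kop_eq_smul (p : ℕ) (c : ℝ × E3 → ℝ) (F : ℝ → H) (t : ℝ) :
    kop p c F t = t ^ p • kop 0 c F t := by simp [kop]

/-- The operator bounds for retarded potentials on curves with `n` derivatives. A time derivative
falls on the four arguments of the integrand or on the factor `t ^ p`; the latter loses a power of
`t`, but it does not use up the factor `L` that is allowed for a derivative. -/
def kopC (T L : ℝ) : ℕ → ℕ → ℝ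
  | 0, p => retC T L p
  | n + 1, p => 4 * kopC T L n p + p * kopC T L n (p - 1) / L

theorem retC_nonneg (hT : 0 ≤ T) (hL : 0 ≤ L) (p : ℕ) : 0 ≤ retC T L p := by
  unfold retC
  split <;> positivity

theorem kopC_nonneg (hT : 0 ≤ T) (hL : 0 ≤ L) (n p : ℕ) : 0 ≤ kopC T L n p := by
  induction n generalizing p with
  | zero => exact retC_nonneg hT hL p
  | succ n ih =>
    have h1 := ih p
    have h2 := ih (p - 1)
    rw [kopC]
    positivity

theorem retC_le_kopC (hT : 0 ≤ T) (hL : 0 ≤ L) (n p : ℕ) : retC T L p ≤ kopC T L n p := by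
  induction n with
  | zero => exact le_rfl
  | succ n ih =>
    have h1 := kopC_nonneg hT hL n p
    have h2 := kopC_nonneg hT hL n (p - 1)
    have h3 : 0 ≤ p * kopC T L n (p - 1) / L := by positivity
    rw [kopC]
    linarith

/-- The time derivative of a retarded potential is a sum of retarded potentials of the
derivatives. -/
theorem isD_kop_none (hL : 1 ≤ L) (hT : 0 < T) (p : ℕ) (hc : Dens c) {Fi : Fin 3 → ℝ → H}
    (hF : Reg ρ T L n A F) (h1 : IsD T none F F') (h2 : Reg0 ρ T L (L * A) F')
    (h3 : ∀ i, IsD T (some i) F (Fi i)) (h4 : ∀ i, Reg0 ρ T L (L * A) (Fi i)) :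
    IsD T none (kop p c F) ((p : ℝ) • kop (p - 1) c F + (kop p (fun q => c q * (1 - q.1)) F' +
      (kop p (fun q => c q * (q.1 * q.2 0)) (Fi 0) + (kop p (fun q => c q * (q.1 * q.2 1)) (Fi 1) +
      kop p (fun q => c q * (q.1 * q.2 2)) (Fi 2))))) := by
  intro t ht
  have hA := hF.nonneg hT
  have hL0 : 0 ≤ L := by linarith
  have hF0 : Reg0 ρ T L (L * A) F := hF.reg0.mono (le_mul_of_one_le_left hA hL)
  have h5 := hasDerivAt_kop_zero hL0 (by positivity) hF0 h2 h4 h1 h3 hc ht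
  have h6 := (hasDerivAt_pow p t).fun_smul h5
  refine (h6.congr_of_eventuallyEq (Eventually.of_forall fun s =>
    kop_eq_smul p c F s)).congr_deriv ?_
  simp only [Pi.add_apply, Pi.smul_apply, kop_eq_smul p, kop_eq_smul (p - 1),
    Fin.sum_univ_three, smul_add, mul_smul]
  abel

theorem Reg.kop (hL : 1 ≤ L) (hT : 0 < T) (hF : Reg ρ T L n A F) (hc : Dens c) (hp : p ≤ 2) :
    Reg ρ T L n (kopC T L n p * A) (kop p c F) := by
  have hL0 : 0 < L := by linarith
  induction n generalizing p c A F with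
  | zero => exact Reg0.kop hL0 (hF.nonneg hT) hF hc hp
  | succ n ih =>
    have hA := hF.nonneg hT
    refine ⟨(Reg0.kop hL0 hA hF.reg0 hc hp).mono ?_, fun j => ?_⟩
    · gcongr
      exact retC_le_kopC hT.le hL0.le _ _
    have hLA : A ≤ L * A := le_mul_of_one_le_left hA hL
    have hLA0 : 0 ≤ L * A := by positivity
    have hF0 : Reg0 ρ T L (L * A) F := hF.reg0.mono hLA
    have hk := kopC_nonneg hT.le hL0.le n p
    have hk' := kopC_nonneg hT.le hL0.le n (p - 1)
    cases j with
    | none =>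
      obtain ⟨F', h1, h2⟩ := hF.deriv none
      choose Fi h3 h4 using fun i : Fin 3 => hF.deriv (some i)
      refine ⟨_, isD_kop_none hL hT p hc hF h1 h2.reg0 h3 fun i => (h4 i).reg0, ?_⟩
      have h7 := ((ih hF.down hc (show p - 1 ≤ 2 by omega)).smul (p : ℝ)).add
        ((ih h2 hc.time hp).add ((ih (h4 0) (hc.space 0) hp).add
          ((ih (h4 1) (hc.space 1) hp).add (ih (h4 2) (hc.space 2) hp))))
      refine Reg.mono hL0.le h7 (le_of_eq ?_)
      rw [Nat.abs_cast, kopC]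
      field_simp
      ring
    | some i =>
      obtain ⟨F', h1, h2⟩ := hF.deriv (some i)
      refine ⟨_, isD_kop_space hL0.le hLA0 hF0 h2.reg0 h1 hc p, ?_⟩
      refine Reg.mono hL0.le (ih h2 hc hp) ?_
      rw [kopC]
      have h3 : 0 ≤ p * kopC T L n (p - 1) / L := by positivity
      nlinarith [mul_nonneg h3 hLA0, mul_nonneg hk hLA0]

/-- The retarded potential is small for large weights. The induction needs the exponents `1` and `2`
together; for the exponent `0` there is no gain, but it enters with a factor `1 / L`. -/
theorem exists_kopC_le (T : ℝ) (n : ℕ) :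
    ∃ C : ℝ, 0 ≤ C ∧ ∀ L : ℝ, 1 ≤ L → kopC T L n 1 ≤ C / L ∧ kopC T L n 2 ≤ C / L := by
  have h0 : ∀ (n : ℕ) (L : ℝ), kopC T L n 0 = 4 ^ n := by
    intro n L
    induction n with
    | zero => rfl
    | succ n ih => simp [kopC, ih, pow_succ, mul_comm]
  induction n with
  | zero =>
    refine ⟨max 1 T, by positivity, fun L hL => ⟨?_, ?_⟩⟩
    · change 1 / L ≤ _
      gcongr
      exact le_max_left _ _
    · change T / L ≤ _
      gcongr
      exact le_max_right _ _
  | succ n ih =>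
    obtain ⟨C, hC, h⟩ := ih
    refine ⟨6 * C + 4 ^ n, by positivity, fun L hL => ?_⟩
    obtain ⟨h1, h2⟩ := h L hL
    have hL0 : 0 < L := by linarith
    have hCL : 0 ≤ C / L := by positivity
    have hCC : C / L / L ≤ C / L := div_le_self hCL hL
    have h4 : (0 : ℝ) ≤ 4 ^ n / L := by positivity
    refine ⟨?_, ?_⟩
    · change 4 * kopC T L n 1 + ((1 : ℕ) : ℝ) * kopC T L n 0 / L ≤ _
      rw [h0, Nat.cast_one, one_mul, add_div, mul_div_assoc]
      linarith
    · change 4 * kopC T L n 2 + ((2 : ℕ) : ℝ) * kopC T L n 1 / L ≤ _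
      rw [add_div, mul_div_assoc, mul_div_assoc]
      have h3 : kopC T L n 1 / L ≤ C / L / L := by gcongr
      push_cast
      linarith

/-- Kirchhoff's retarded potential, the solution operator of the wave equation with vanishing
Cauchy data. -/
def kir (F : ℝ → H) : ℝ → H := kop 2 (fun q => q.1) F

theorem Reg.kir (hL : 1 ≤ L) (hT : 0 < T) (hF : Reg ρ T L n A F) :
    Reg ρ T L n (kopC T L n 2 * A) (kir F) := hF.kop hL hT dens_fst le_rfl

end

/-! ### Spherical means -/

section

/-- The spherical mean `∫ c(y) g(x + σ y) dσ(y)` with density `c`. -/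
def sphm (c : E3 → ℝ) (g : H) (σ : ℝ) : H := ∫ y, c y • shift (σ • y) g ∂sph

theorem integrable_sphm {c : E3 → ℝ} (hc : Continuous c) (g : H) (σ : ℝ) :
    Integrable (fun y => c y • shift (σ • y) g) sph :=
  integrable_sph (hc.smul ((continuous_shift_left g).comp (continuous_const_smul σ)))

theorem norm_sphm_le {c : E3 → ℝ} (hb : ∀ y, ‖y‖ = 1 → |c y| ≤ 1) (g : H) (σ : ℝ) :
    ‖sphm c g σ‖ ≤ ‖g‖ := by
  have h : ∀ᵐ y ∂sph, ‖c y • shift (σ • y) g‖ ≤ ‖g‖ := by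
    filter_upwards [ae_sph_norm] with y hy
    rw [norm_smul, norm_shift, Real.norm_eq_abs]
    exact mul_le_of_le_one_left (norm_nonneg _) (hb y hy)
  simpa [sphm] using norm_integral_le_of_norm_le_const h

theorem hasDerivAt_sphm {c : E3 → ℝ} (hc : Continuous c) (hb : ∀ y, ‖y‖ = 1 → |c y| ≤ 1)
    {g : H} {g₁ : Fin 3 → H} (h₁ : ∀ i, WD i g (g₁ i)) (σ : ℝ) :
    HasDerivAt (sphm c g) (∑ i, sphm (fun y => c y * y i) (g₁ i) σ) σ := by
  have hi : ∀ (i : Fin 3) σ, Integrable (fun y => (c y * y i) • shift (σ • y) (g₁ i)) sph :=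
    fun i σ => integrable_sphm (by fun_prop) _ σ
  have key := hasDerivAt_integral_of_dominated_loc_of_deriv_le (μ := sph)
    (F := fun σ y => c y • shift (σ • y) g)
    (F' := fun σ y => ∑ i, (c y * y i) • shift (σ • y) (g₁ i)) (x₀ := σ)
    (s := univ) (bound := fun _ => ∑ i, ‖g₁ i‖)
    univ_mem (Eventually.of_forall fun σ => (integrable_sphm hc g σ).aestronglyMeasurable)
    (integrable_sphm hc g σ)
    (integrable_finsetSum _ fun i _ => hi i σ).aestronglyMeasurable
    ?_ (integrable_const _) ?_
  · have h2 := key.2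
    rw [integral_finsetSum _ fun i _ => hi i σ] at h2
    exact h2
  · filter_upwards [ae_sph_norm] with y hy σ _
    refine norm_sum_le_of_le _ fun i _ => ?_
    rw [norm_smul, norm_shift, norm_mul, Real.norm_eq_abs, Real.norm_eq_abs]
    exact mul_le_of_le_one_left (norm_nonneg _)
      (mul_le_one₀ (hb y hy) (abs_nonneg _) (coord_abs_le hy.le i))
  · refine Eventually.of_forall fun y σ _ => ?_
    have h3 := (hasDerivAt_shift_line h₁ y 0 σ).const_smul (c y)
    simp only [zero_add, Finset.smul_sum, smul_smul] at h3
    exact h3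

theorem abs_coord_le_one (i : Fin 3) (y : E3) (hy : ‖y‖ = 1) : |y i| ≤ 1 := coord_abs_le hy.le i

/-- The Laplacian of a spherical mean in terms of radial derivatives, by
`integral_sph_laplacian`. -/
theorem sphm_laplacian {g₁ : Fin 3 → H} {g₂ : Fin 3 → Fin 3 → H}
    (h₂ : ∀ i j, WD j (g₁ i) (g₂ i j)) (σ : ℝ) :
    σ • ∑ i, sphm (fun _ => 1) (g₂ i i) σ =
      σ • ∑ i, ∑ j, sphm (fun y => y i * y j) (g₂ i j) σ +
        (2 : ℝ) • ∑ i, sphm (fun y => y i) (g₁ i) σ := by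
  have key := integral_sph_laplacian (F := H) (f₁ := fun i y => shift (σ • y) (g₁ i))
    (f₂ := fun i j y => σ • shift (σ • y) (g₂ i j)) (fun i y => ?_) (fun i j =>
      ((continuous_shift_left (g₂ i j)).comp (continuous_const_smul σ)).const_smul σ)
  · have i1 : ∀ i j, Integrable (fun y => σ • shift (σ • y) (g₂ i j)) sph := fun i j =>
      (by simpa using integrable_sphm (c := fun _ => 1) continuous_const (g₂ i j) σ :
        Integrable (fun y => shift (σ • y) (g₂ i j)) sph).smul σ
    have i2 : ∀ i j, Integrable (fun y : E3 => (y i * y j) • σ • shift (σ • y) (g₂ i j)) sph :=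
      fun i j => by
        have := (integrable_sphm (c := fun y => y i * y j) (by fun_prop) (g₂ i j) σ).smul σ
        refine this.congr (Eventually.of_forall fun y => ?_)
        simp only [Pi.smul_apply]
        rw [smul_comm]
    have i3 : ∀ i, Integrable (fun y : E3 => y i • shift (σ • y) (g₁ i)) sph := fun i =>
      integrable_sphm (by fun_prop) _ σ
    rw [integral_sub, integral_sub, integral_smul, integral_finsetSum, integral_finsetSum,
      integral_finsetSum] at key
    · have e2 : ∀ i, ∫ y : E3, ∑ j, (y i * y j) • σ • shift (σ • y) (g₂ i j) ∂sph =
          σ • ∑ j, sphm (fun y => y i * y j) (g₂ i j) σ := by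
        intro i
        rw [integral_finsetSum _ fun j _ => i2 i j, Finset.smul_sum]
        refine Finset.sum_congr rfl fun j _ => ?_
        rw [sphm, ← integral_smul]
        refine integral_congr_ae (Eventually.of_forall fun y => ?_)
        exact smul_comm _ _ _
      have e1 : ∀ i, ∫ y : E3, σ • shift (σ • y) (g₂ i i) ∂sph =
          σ • sphm (fun _ => 1) (g₂ i i) σ := by
        intro i
        rw [integral_smul]
        simp [sphm]
      simp only [e1, e2, ← Finset.smul_sum] at key
      rw [sub_sub, sub_eq_zero] at key
      exact key
    · exact fun i _ => i3 i
    · exact fun i _ => integrable_finsetSum _ fun j _ => i2 i j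
    · exact fun i _ => i1 i i
    · exact integrable_finsetSum _ fun i _ => i1 i i
    · exact integrable_finsetSum _ fun i _ => integrable_finsetSum _ fun j _ => i2 i j
    · exact (integrable_finsetSum _ fun i _ => i1 i i).sub
        (integrable_finsetSum _ fun i _ => integrable_finsetSum _ fun j _ => i2 i j)
    · exact (integrable_finsetSum _ fun i _ => i3 i).smul (2 : ℝ)
  · have h := (hasFDerivAt_shift (h₂ i) (σ • y)).comp y
      ((hasFDerivAt_id y).const_smul σ)
    refine h.congr_fderiv ?_
    ext1 v
    simp only [ContinuousLinearMap.coe_comp, Function.comp_apply, sum_apply,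
      ContinuousLinearMap.smulRight_apply, EuclideanSpace.coe_proj, smul_apply,
      ContinuousLinearMap.coe_id', id, PiLp.smul_apply, smul_eq_mul]
    refine Finset.sum_congr rfl fun j _ => ?_
    rw [smul_smul, mul_comm]

/-- `σ` times the spherical mean of radius `σ`; as a function of `σ` and `x` it solves the wave
equation with Cauchy data `0` and `g`. -/
def wmean (g : H) (σ : ℝ) : H := σ • sphm (fun _ => 1) g σ

/-- The derivative of `wmean g`, in terms of the first derivatives `g₁` of `g`. -/
def wmean' (g : H) (g₁ : Fin 3 → H) (σ : ℝ) : H :=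
  sphm (fun _ => 1) g σ + σ • ∑ i, sphm (fun y => y i) (g₁ i) σ

theorem wmean_zero (g : H) : wmean g 0 = 0 := by simp [wmean]

theorem wmean'_zero (g : H) (g₁ : Fin 3 → H) : wmean' g g₁ 0 = g := by
  simp [wmean', sphm, shift_zero]

theorem norm_wmean_le (g : H) (σ : ℝ) : ‖wmean g σ‖ ≤ |σ| * ‖g‖ := by
  rw [wmean, norm_smul, Real.norm_eq_abs]
  exact mul_le_mul_of_nonneg_left (norm_sphm_le (by simp) g σ) (abs_nonneg _)

theorem hasDerivAt_wmean {g : H} {g₁ : Fin 3 → H} (h₁ : ∀ i, WD i g (g₁ i)) (σ : ℝ) :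
    HasDerivAt (wmean g) (wmean' g g₁ σ) σ := by
  have h := (hasDerivAt_id σ).fun_smul
    (hasDerivAt_sphm (c := fun _ => 1) continuous_const (by simp) h₁ σ)
  refine h.congr_deriv ?_
  simp [wmean', add_comm]

/-- The spherical means solve the wave equation: Darboux's equation. -/
theorem hasDerivAt_wmean' {g : H} {g₁ : Fin 3 → H} {g₂ : Fin 3 → Fin 3 → H}
    (h₁ : ∀ i, WD i g (g₁ i)) (h₂ : ∀ i j, WD j (g₁ i) (g₂ i j)) (σ : ℝ) :
    HasDerivAt (wmean' g g₁) (∑ i, wmean (g₂ i i) σ) σ := by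
  have h := (hasDerivAt_sphm (c := fun _ => 1) continuous_const (by simp) h₁ σ).fun_add
    ((hasDerivAt_id σ).fun_smul (HasDerivAt.fun_sum (u := Finset.univ) fun i _ =>
      hasDerivAt_sphm (c := fun y : E3 => y i) (by fun_prop) (abs_coord_le_one i) (h₂ i) σ))
  refine h.congr_deriv ?_
  have e := sphm_laplacian h₂ σ
  simp only [wmean, ← Finset.smul_sum, id, one_smul, one_mul] at e ⊢
  rw [e, two_smul]
  abel

end

/-! ### Kirchhoff's formula solves the wave equation -/

section

variable {ρ T L : ℝ} {F F' u : ℝ → H} {A : ℝ} {n p : ℕ} {c : ℝ × E3 → ℝ}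

theorem intervalIntegrable_conv {f : ℝ → H} {β : ℝ → H} {K : ℝ} (hf : ContinuousOn f (Ioo 0 T))
    (hK : ∀ t ∈ Ioo 0 T, ‖f t‖ ≤ K) (hβ : Continuous β) (s : ℝ) {t t' : ℝ} (ht : t ∈ Ico 0 T)
    (ht' : t' ∈ Ico 0 T) :
    IntervalIntegrable (fun τ => inner ℝ (f τ) (β (s - τ))) volume t t' := by
  have h0 : IntegrableOn (fun τ => inner ℝ (f τ) (β (s - τ))) (Ioo 0 T) := by
    have hb : Continuous fun τ => β (s - τ) := hβ.comp (by fun_prop)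
    obtain ⟨B, hB⟩ := (isCompact_Icc (a := (0 : ℝ)) (b := T)).exists_bound_of_continuousOn
      hb.continuousOn
    refine IntegrableOn.of_bound (C := K * B) (by simp)
      ((hf.inner hb.continuousOn).aestronglyMeasurable measurableSet_Ioo) ?_
    filter_upwards [ae_restrict_mem measurableSet_Ioo] with τ hτ
    refine (norm_inner_le_norm _ _).trans ?_
    exact mul_le_mul (hK τ hτ) (hB τ ⟨hτ.1.le, hτ.2.le⟩) (norm_nonneg _)
      ((norm_nonneg _).trans (hK τ hτ))
  refine intervalIntegrable_iff.2 (h0.mono_set fun τ hτ => ?_)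
  exact ⟨(le_min ht.1 ht'.1).trans_lt hτ.1, hτ.2.trans_lt (max_lt ht.2 ht'.2)⟩

/-- Differentiation of a convolution in time. -/
theorem hasDerivAt_conv {f : ℝ → H} {β β' : ℝ → H} {K : ℝ} (hf : ContinuousOn f (Ioo 0 T))
    (hK : ∀ t ∈ Ioo 0 T, ‖f t‖ ≤ K) (hβ : ∀ σ, HasDerivAt β (β' σ) σ) (hβ' : Continuous β')
    {t : ℝ} (ht : t ∈ Ioo 0 T) :
    HasDerivAt (fun t => ∫ τ in (0 : ℝ)..t, inner ℝ (f τ) (β (t - τ)))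
      (inner ℝ (f t) (β 0) + ∫ τ in (0 : ℝ)..t, inner ℝ (f τ) (β' (t - τ))) t := by
  have hT : 0 < T := ht.1.trans ht.2
  have hβc : Continuous β := continuous_iff_continuousAt.2 fun σ => (hβ σ).continuousAt
  have hK0 : 0 ≤ K := (norm_nonneg _).trans (hK t ht)
  obtain ⟨B, hB⟩ := (isCompact_Icc (a := -T) (b := T)).exists_bound_of_continuousOn
    hβ'.continuousOn
  have hB0 : 0 ≤ B := (norm_nonneg _).trans (hB 0 ⟨by linarith, hT.le⟩)
  have hLip : ∀ σ ∈ Icc (-T) T, ‖β σ - β 0‖ ≤ B * |σ| := by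
    intro σ hσ
    have h := (convex_Icc (-T) T).norm_image_sub_le_of_norm_hasDerivWithin_le
      (fun σ _ => (hβ σ).hasDerivWithinAt) hB (x := 0) (y := σ) ⟨by linarith, hT.le⟩ hσ
    simpa using h
  have m0 : (0 : ℝ) ∈ Ico 0 T := ⟨le_rfl, hT⟩
  have mt : t ∈ Ico 0 T := ⟨ht.1.le, ht.2⟩
  have hA : HasDerivAt (fun s => ∫ τ in (0 : ℝ)..t, inner ℝ (f τ) (β (s - τ)))
      (∫ τ in (0 : ℝ)..t, inner ℝ (f τ) (β' (t - τ))) t := by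
    refine (intervalIntegral.hasDerivAt_integral_of_dominated_loc_of_deriv_le
      (F' := fun s τ => inner ℝ (f τ) (β' (s - τ))) (bound := fun _ => K * B)
      (isOpen_Ioo.mem_nhds ht)
      (Eventually.of_forall fun s =>
        (intervalIntegrable_conv hf hK hβc s m0 mt).def'.aestronglyMeasurable)
      (intervalIntegrable_conv hf hK hβc t m0 mt)
      (intervalIntegrable_conv hf hK hβ' t m0 mt).def'.aestronglyMeasurable
      (Eventually.of_forall fun τ hτ s hs => ?_) intervalIntegrable_const
      (Eventually.of_forall fun τ hτ s hs => ?_)).2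
    · rw [uIoc_of_le ht.1.le] at hτ
      refine (norm_inner_le_norm _ _).trans ?_
      refine mul_le_mul (hK τ ⟨hτ.1, hτ.2.trans_lt ht.2⟩) (hB _ ?_) (norm_nonneg _) hK0
      constructor <;> linarith [hs.1, hs.2, hτ.1, hτ.2, ht.2]
    · have h := (hβ (s - τ)).scomp s ((hasDerivAt_id s).sub_const τ)
      rw [one_smul] at h
      exact ((innerSL ℝ (f τ)).hasFDerivAt.comp_hasDerivAt s h)
  have hB' : HasDerivAt (fun s => ∫ τ in t..s, inner ℝ (f τ) (β (s - τ) - β 0)) 0 t := by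
    rw [hasDerivAt_iff_isLittleO]
    refine Asymptotics.IsBigO.trans_isLittleO (g := fun s : ℝ => (s - t) * (s - t)) ?_ ?_
    · refine Asymptotics.IsBigO.of_bound (K * B) ?_
      filter_upwards [isOpen_Ioo.mem_nhds ht] with s hs
      rw [intervalIntegral.integral_same, smul_zero, sub_zero, sub_zero, norm_mul, ← mul_assoc]
      change _ ≤ K * B * |s - t| * |s - t|
      refine intervalIntegral.norm_integral_le_of_norm_le_const fun τ hτ => ?_
      have hτ' : τ ∈ Ioo 0 T :=
        ⟨(lt_min ht.1 hs.1).trans hτ.1, hτ.2.trans_lt (max_lt ht.2 hs.2)⟩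
      refine (norm_inner_le_norm _ _).trans ?_
      rw [mul_assoc]
      refine mul_le_mul (hK τ hτ') ((hLip _ ?_).trans ?_) (norm_nonneg _) hK0
      · constructor <;> linarith [hs.1, hs.2, hτ'.1, hτ'.2]
      · refine mul_le_mul_of_nonneg_left ?_ hB0
        have := abs_sub_right_of_mem_uIcc (uIoc_subset_uIcc hτ)
        exact this
    · have h : Tendsto (fun s : ℝ => s - t) (𝓝 t) (𝓝 0) := by
        have : ContinuousAt (fun s : ℝ => s - t) t := by fun_prop
        simpa using this.tendsto
      simpa using ((Asymptotics.isLittleO_one_iff ℝ).2 h).mul_isBigO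
        (Asymptotics.isBigO_refl (fun s : ℝ => s - t) (𝓝 t))
  have hC : HasDerivAt (fun s => ∫ τ in t..s, inner ℝ (f τ) (β 0)) (inner ℝ (f t) (β 0)) t := by
    have hc : ContinuousOn (fun τ => inner ℝ (f τ) (β 0)) (Ioo 0 T) :=
      hf.inner continuousOn_const
    exact intervalIntegral.integral_hasDerivAt_right (by simp)
      (hc.stronglyMeasurableAtFilter isOpen_Ioo t ht) (hc.continuousAt (isOpen_Ioo.mem_nhds ht))
  refine (((hA.fun_add hB').fun_add hC).congr_of_eventuallyEq ?_).congr_deriv (by ring)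
  filter_upwards [isOpen_Ioo.mem_nhds ht] with s hs
  have ms : s ∈ Ico 0 T := ⟨hs.1.le, hs.2⟩
  have i1 := intervalIntegrable_conv hf hK hβc s m0 mt
  have i2 := intervalIntegrable_conv hf hK hβc s mt ms
  have i3 := intervalIntegrable_conv hf hK (continuous_const (y := β 0)) s mt ms
  rw [← intervalIntegral.integral_add_adjacent_intervals i1 i2, add_assoc]
  congr 1
  simp only [inner_sub_right]
  rw [intervalIntegral.integral_sub i2 i3, sub_add_cancel]

theorem sphm_neg (g : H) (σ : ℝ) : sphm (fun _ => 1) g (-σ) = sphm (fun _ => 1) g σ := by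
  have h := (map_sph (LinearIsometryEquiv.neg ℝ)).integral_comp
    (LinearIsometryEquiv.neg ℝ).toHomeomorph.measurableEmbedding
    (fun y => (1 : ℝ) • shift (σ • y) g)
  rw [sphm, sphm, ← h]
  simp

/-- Kirchhoff's formula as a Duhamel integral. -/
theorem inner_kir (hL : 0 ≤ L) (hA : 0 ≤ A) (hF : Reg0 ρ T L A F) (g : H) {t : ℝ}
    (ht : t ∈ Ioo 0 T) :
    inner ℝ (kir F t) g = ∫ τ in (0 : ℝ)..t, inner ℝ (F τ) (wmean g (t - τ)) := by
  have hi := integrable_kop hL hA hF dens_fst ht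
  have e1 : inner ℝ (kir F t) g =
      t ^ 2 * ∫ q, inner ℝ (q.1 • shift ((t * q.1) • q.2) (F (t * (1 - q.1)))) g ∂pot := by
    have h1 := (innerSL ℝ g).integral_comp_comm hi
    simp only [innerSL_apply_apply] at h1
    rw [kir, kop, inner_smul_left, real_inner_comm, ← h1]
    simp only [real_inner_comm g, conj_trivial]
  have hi' : Integrable (fun q : ℝ × E3 =>
      inner ℝ (q.1 • shift ((t * q.1) • q.2) (F (t * (1 - q.1)))) g)
      (((volume : Measure ℝ).restrict (Ioo 0 1)).prod sph) := by
    refine ((innerSL ℝ g).integrable_comp hi).congr (Eventually.of_forall fun q => ?_)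
    simp only [innerSL_apply_apply]
    rw [real_inner_comm]
  have e2 : ∀ r : ℝ, ∫ y, inner ℝ (r • shift ((t * r) • y) (F (t * (1 - r)))) g ∂sph =
      r * inner ℝ (F (t * (1 - r))) (sphm (fun _ => 1) g (t * r)) := by
    intro r
    have h2 := (innerSL ℝ (F (t * (1 - r)))).integral_comp_comm
      (integrable_sphm (c := fun _ => 1) continuous_const g (-(t * r)))
    rw [← sphm_neg]
    rw [sphm]
    simp only [innerSL_apply_apply, one_smul] at h2 ⊢
    rw [← h2, ← integral_const_mul]
    refine integral_congr_ae (Eventually.of_forall fun y => ?_)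
    simp only [inner_smul_left, conj_trivial, inner_shift, neg_smul]
  rw [e1, pot, integral_prod _ hi']
  simp only [e2]
  have e3 := intervalIntegral.integral_comp_sub_mul (a := 0) (b := 1)
    (fun τ => inner ℝ (F τ) (wmean g (t - τ))) ht.1.ne' t
  simp only [mul_one, mul_zero, sub_self, sub_zero] at e3
  rw [eq_comm, inv_smul_eq_iff₀ ht.1.ne'] at e3
  rw [e3, intervalIntegral.integral_of_le zero_le_one, ← integral_Ioc_eq_integral_Ioo, smul_eq_mul,
    pow_two, mul_assoc, ← integral_const_mul t]
  congr 1
  refine integral_congr_ae (Eventually.of_forall fun r => ?_)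
  simp only [wmean, inner_smul_right]
  rw [show t - (t - t * r) = t * r by ring, show t - t * r = t * (1 - r) by ring]
  ring

/-- Kirchhoff's retarded potential solves the wave equation: tested against a test function, it is a
Duhamel integral of solutions of the wave equation, which is differentiated twice in time. -/
theorem kir_wave (hL : 0 ≤ L) (hA : 0 ≤ A) (hF : Reg0 ρ T L A F) {k k' : ℝ → H} {k₁ k₂ : Fin 3 → H}
    (h1 : IsD T none (kir F) k) (h2 : IsD T none k k') {t : ℝ} (ht : t ∈ Ioo 0 T)
    (h3 : ∀ i, WD i (kir F t) (k₁ i)) (h4 : ∀ i, WD i (k₁ i) (k₂ i)) :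
    k' t = F t + ∑ i, k₂ i := by
  refine ext_inner_test fun φ hφ => ?_
  have w1 : ∀ i, WD i (ofFun φ) (ofFun (pderiv i φ)) := fun i => hφ.WD i
  have w2 : ∀ i j, WD j (ofFun (pderiv i φ)) (ofFun (pderiv j (pderiv i φ))) :=
    fun i j => (hφ.pderiv i).WD j
  have hK : ∀ t ∈ Ioo 0 T, ‖F t‖ ≤ A * Real.exp (L * T) := fun t ht => hF.norm_le_exp hL hA ht
  have c2 : Continuous fun σ => ∑ i, wmean (ofFun (pderiv i (pderiv i φ))) σ :=
    continuous_finsetSum _ fun i _ => continuous_iff_continuousAt.2 fun σ =>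
      (hasDerivAt_wmean (fun j => ((hφ.pderiv i).pderiv i).WD j) σ).continuousAt
  have c1 : Continuous (wmean' (ofFun φ) fun i => ofFun (pderiv i φ)) :=
    continuous_iff_continuousAt.2 fun σ => (hasDerivAt_wmean' w1 w2 σ).continuousAt
  -- the boundary term vanishes for the first derivative, and is `F` for the second
  have d1 : ∀ s ∈ Ioo 0 T, inner ℝ (k s) (ofFun φ) = ∫ τ in (0 : ℝ)..s,
      inner ℝ (F τ) (wmean' (ofFun φ) (fun i => ofFun (pderiv i φ)) (s - τ)) := by
    intro s hs
    have e := hasDerivAt_conv hF.1 hK (hasDerivAt_wmean w1) c1 hs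
    rw [wmean_zero, inner_zero_right, zero_add] at e
    have e' := HasDerivAt.inner ℝ (h1 s hs) (hasDerivAt_const s (ofFun φ))
    rw [inner_zero_right, zero_add] at e'
    refine e'.unique (e.congr_of_eventuallyEq ?_)
    filter_upwards [isOpen_Ioo.mem_nhds hs] with r hr using inner_kir hL hA hF _ hr
  have e := hasDerivAt_conv hF.1 hK (hasDerivAt_wmean' w1 w2) c2 ht
  have e' := HasDerivAt.inner ℝ (h2 t ht) (hasDerivAt_const t (ofFun φ))
  rw [inner_zero_right, zero_add] at e'
  have e2 := e'.unique (e.congr_of_eventuallyEq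
    (by filter_upwards [isOpen_Ioo.mem_nhds ht] with r hr using d1 r hr))
  rw [e2, wmean'_zero, inner_add_left]
  congr 1
  simp only [inner_sum, sum_inner]
  rw [intervalIntegral.integral_finsetSum]
  · refine Finset.sum_congr rfl fun i _ => ?_
    rw [← inner_kir hL hA hF _ ht]
    rw [h3 i _ (hφ.pderiv i), h4 i _ hφ, neg_neg]
  · intro i _
    refine intervalIntegrable_conv hF.1 hK ?_ t ⟨le_rfl, ht.1.trans ht.2⟩ ⟨ht.1.le, ht.2⟩
    exact continuous_iff_continuousAt.2 fun σ =>
      (hasDerivAt_wmean (fun j => ((hφ.pderiv i).pderiv i).WD j) σ).continuousAt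

theorem norm_kop_le (hL : 0 ≤ L) (hA : 0 ≤ A) (hF : Reg0 ρ T L A F) (hc : Dens c) {t : ℝ}
    (ht : t ∈ Ioo 0 T) : ‖kop p c F t‖ ≤ t ^ p * (A * Real.exp (L * T)) := by
  rw [kop, norm_smul, Real.norm_of_nonneg (pow_nonneg ht.1.le p)]
  refine mul_le_mul_of_nonneg_left ?_ (pow_nonneg ht.1.le p)
  simpa using norm_integral_le_of_norm_le_const (kop_bound hL hA hF hc ht)

/-- A retarded potential vanishes to second order at `t = 0`, and its time derivative to first
order. -/
theorem kir_deriv_le (hL : 1 ≤ L) (hT : 0 < T) (hF : Reg ρ T L 1 A F) {k : ℝ → H}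
    (h : IsD T none (kir F) k) : ∃ B, ∀ t ∈ Ioo 0 T, ‖kir F t‖ ≤ B * t ^ 2 ∧ ‖k t‖ ≤ B * t := by
  have hL0 : 0 ≤ L := by linarith
  have hA := hF.nonneg hT
  have hLA : A ≤ L * A := le_mul_of_one_le_left hA hL
  have hLA0 : 0 ≤ L * A := by positivity
  have hF0 : Reg0 ρ T L (L * A) F := hF.reg0.mono hLA
  obtain ⟨F', h1, h2⟩ := hF.deriv none
  choose Fi h3 h4 using fun i : Fin 3 => hF.deriv (some i)
  set E := L * A * Real.exp (L * T) with hE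
  have hE0 : 0 ≤ E := by positivity
  have hsq : ∀ t ∈ Ioo 0 T, t ^ 2 * E ≤ T * E * t := fun t ht => by
    have := mul_le_mul_of_nonneg_right ht.2.le (mul_nonneg ht.1.le hE0)
    linarith
  refine ⟨2 * E + 4 * (T * E), fun t ht => ?_⟩
  have hTE : 0 ≤ T * E * t := mul_nonneg (mul_nonneg hT.le hE0) ht.1.le
  have hEt : 0 ≤ E * t := mul_nonneg hE0 ht.1.le
  refine ⟨?_, ?_⟩
  · refine (norm_kop_le (p := 2) hL0 hLA0 hF0 dens_fst ht).trans ?_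
    rw [mul_comm]
    refine mul_le_mul_of_nonneg_right ?_ (sq_nonneg t)
    have := mul_nonneg hT.le hE0
    linarith
  · rw [h.unique (isD_kop_none hL hT 2 dens_fst hF h1 h2 h3 h4) ht]
    have n1 := norm_kop_le (p := 1) hL0 hLA0 hF0 dens_fst ht
    have n2 := (norm_kop_le (p := 2) hL0 hLA0 h2 dens_fst.time ht).trans (hsq t ht)
    have n3 := fun i =>
      (norm_kop_le (p := 2) hL0 hLA0 (h4 i) (dens_fst.space i) ht).trans (hsq t ht)
    simp only [Pi.add_apply, Pi.smul_apply]
    refine (norm_add_le _ _).trans ?_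
    rw [norm_smul]
    have m1 := norm_add₄_le (a := kop 2 (fun q => q.1 * (1 - q.1)) F' t)
      (b := kop 2 (fun q => q.1 * (q.1 * q.2 0)) (Fi 0) t)
      (c := kop 2 (fun q => q.1 * (q.1 * q.2 1)) (Fi 1) t)
      (d := kop 2 (fun q => q.1 * (q.1 * q.2 2)) (Fi 2) t)
    have := n3 0
    have := n3 1
    have := n3 2
    simp only [pow_one, ← add_assoc] at *
    norm_num at *
    linarith

/-- The curve `u` on `(0,T)`, continued by zero. -/
def zext (T : ℝ) (u : ℝ → H) : ℝ → H := (Ioo 0 T).indicator u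

theorem zext_eq {t : ℝ} (ht : t ∈ Ioo 0 T) : zext T u t = u t := indicator_of_mem ht u

theorem zext_nonpos {t : ℝ} (ht : t ≤ 0) : zext T u t = 0 :=
  indicator_of_notMem (fun h => h.1.not_ge ht) u

theorem zext_eventuallyEq {t : ℝ} (ht : t ∈ Ioo 0 T) : zext T u =ᶠ[𝓝 t] u := by
  filter_upwards [isOpen_Ioo.mem_nhds ht] with s hs using zext_eq hs

/-- A curve that vanishes with its derivative at `t = 0` has a `C¹` continuation by zero. -/
theorem contDiffOn_zext {k : ℝ → H} (h : IsD T none u k) (hk : ContinuousOn k (Ioo 0 T))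
    {B : ℝ} (hB : ∀ t ∈ Ioo 0 T, ‖u t‖ ≤ B * t ^ 2 ∧ ‖k t‖ ≤ B * t) :
    ContDiffOn ℝ 1 (zext T u) (Iio T) := by
  have hd : ∀ t ∈ Iio T, HasDerivAt (zext T u) (zext T k t) t := by
    intro t ht
    rcases lt_trichotomy t 0 with h0 | h0 | h0
    · rw [zext_nonpos h0.le]
      refine (hasDerivAt_const t (0 : H)).congr_of_eventuallyEq ?_
      filter_upwards [isOpen_Iio.mem_nhds h0] with s hs using zext_nonpos hs.le
    · subst h0
      rw [zext_nonpos le_rfl, hasDerivAt_iff_isLittleO]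
      refine Asymptotics.IsBigO.trans_isLittleO (g := fun s : ℝ => s * s) ?_ ?_
      · refine Asymptotics.IsBigO.of_bound |B| ?_
        filter_upwards [isOpen_Iio.mem_nhds ht] with s hs
        rw [zext_nonpos le_rfl, smul_zero, sub_zero, sub_zero]
        rcases le_or_gt s 0 with h1 | h1
        · rw [zext_nonpos h1, norm_zero]
          positivity
        · rw [zext_eq ⟨h1, hs⟩]
          refine (hB s ⟨h1, hs⟩).1.trans ?_
          rw [Real.norm_of_nonneg (mul_self_nonneg s), ← pow_two]
          exact mul_le_mul_of_nonneg_right (le_abs_self B) (sq_nonneg s)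
      · have h1 : Tendsto (fun s : ℝ => s) (𝓝 0) (𝓝 0) := tendsto_id
        simpa using ((Asymptotics.isLittleO_one_iff ℝ).2 h1).mul_isBigO
          (Asymptotics.isBigO_refl (fun s : ℝ => s) (𝓝 0))
    · have hm : t ∈ Ioo 0 T := ⟨h0, ht⟩
      rw [zext_eq hm]
      exact (h t hm).congr_of_eventuallyEq (zext_eventuallyEq hm)
  have hc : ContinuousOn (zext T k) (Iio T) := by
    intro t ht
    refine ContinuousAt.continuousWithinAt ?_
    rcases lt_trichotomy t 0 with h0 | h0 | h0
    · refine (continuousAt_const (y := (0 : H))).congr ?_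
      filter_upwards [isOpen_Iio.mem_nhds h0] with s hs using (zext_nonpos hs.le).symm
    · subst h0
      rw [ContinuousAt, zext_nonpos le_rfl]
      refine squeeze_zero_norm' (a := fun s => |B| * |s|) ?_ ?_
      · filter_upwards [isOpen_Iio.mem_nhds ht] with s hs
        rcases le_or_gt s 0 with h1 | h1
        · rw [zext_nonpos h1, norm_zero]
          positivity
        · rw [zext_eq ⟨h1, hs⟩]
          refine (hB s ⟨h1, hs⟩).2.trans ?_
          rw [← abs_mul]
          exact le_abs_self _
      · have : Continuous fun s : ℝ => |B| * |s| := by fun_prop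
        simpa using this.tendsto 0
    · have hm : t ∈ Ioo 0 T := ⟨h0, ht⟩
      exact (hk.continuousAt (isOpen_Ioo.mem_nhds hm)).congr (zext_eventuallyEq hm).symm
  rw [show (1 : WithTop ℕ∞) = 0 + 1 from (zero_add 1).symm, contDiffOn_succ_iff_deriv_of_isOpen
    isOpen_Iio]
  refine ⟨fun t ht => (hd t ht).differentiableAt.differentiableWithinAt, by simp, ?_⟩
  exact contDiffOn_zero.2 (hc.congr fun t ht => (hd t ht).deriv)

end

/-! ### Weak derivatives of higher order -/

section

theorem pderiv_comm (i j : Fin 3) {φ : E3 → ℝ} (h : Test φ) :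
    pderiv i (pderiv j φ) = pderiv j (pderiv i φ) := by
  have key : ∀ a b : Fin 3, ∀ x, pderiv a (pderiv b φ) x =
      fderiv ℝ (fderiv ℝ φ) x (EuclideanSpace.single a 1) (EuclideanSpace.single b 1) := by
    intro a b x
    have hd : DifferentiableAt ℝ (fderiv ℝ φ) x :=
      (h.1.fderiv_right (m := ∞) (by simp)).differentiable (by simp) x
    change fderiv ℝ (fun x => fderiv ℝ φ x (EuclideanSpace.single b 1)) x _ = _
    rw [fderiv_clm_apply hd (differentiableAt_const _)]
    simp
  funext x
  rw [key, key]
  have hs : IsSymmSndFDerivAt ℝ φ x := h.1.contDiffAt.isSymmSndFDerivAt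
    (by rw [minSmoothness_of_isRCLikeNormedField]; exact WithTop.coe_le_coe.2 le_top)
  exact hs _ _

theorem iterate_pderiv_comm (i j : Fin 3) (n : ℕ) {φ : E3 → ℝ} (h : Test φ) :
    (pderiv j)^[n] (pderiv i φ) = pderiv i ((pderiv j)^[n] φ) := by
  induction n with
  | zero => rfl
  | succ n ih =>
    rw [Function.iterate_succ_apply', Function.iterate_succ_apply', ih,
      pderiv_comm j i (iterate_pderiv_smooth j n h)]

theorem pderivs_add_single (α : Fin 3 → ℕ) (i : Fin 3) {φ : E3 → ℝ} (h : Test φ) :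
    pderivs (α + Pi.single i 1) φ = pderivs α (pderiv i φ) := by
  have h2 := iterate_pderiv_smooth 2 (α 2) h
  have h1 := iterate_pderiv_smooth 1 (α 1) h2
  unfold pderivs
  fin_cases i
  · simp [iterate_pderiv_comm 0 2 _ h, iterate_pderiv_comm 0 1 _ h2]
  · simp [iterate_pderiv_comm 1 2 _ h]
  · simp

theorem sum_add_single (α : Fin 3 → ℕ) (i : Fin 3) :
    ∑ j, (α + Pi.single i 1 : Fin 3 → ℕ) j = (∑ j, α j) + 1 := by
  simp [Finset.sum_add_distrib]

theorem hasWeakDeriv_univ_iff {α : Fin 3 → ℕ} {g g' : H} : HasWeakDeriv univ α g g' ↔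
    ∀ φ, Test φ → inner ℝ g (ofFun (pderivs α φ)) = (-1) ^ (∑ i, α i) * inner ℝ g' (ofFun φ) := by
  constructor
  · intro h φ hφ
    rw [Test.inner (pderivs_smooth α hφ), Test.inner hφ]
    exact h φ (isTest_univ.2 hφ)
  · intro h φ hφ
    have hφ' := isTest_univ.1 hφ
    have := h φ hφ'
    rwa [Test.inner (pderivs_smooth α hφ'), Test.inner hφ'] at this

theorem hasWeakDeriv_zero_idx {g : H} : HasWeakDeriv univ 0 g g :=
  hasWeakDeriv_univ_iff.2 fun φ _ => by simp [pderivs]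

theorem HasWeakDeriv.unique {α : Fin 3 → ℕ} {g g₁ g₂ : H} (h₁ : HasWeakDeriv univ α g g₁)
    (h₂ : HasWeakDeriv univ α g g₂) : g₁ = g₂ := by
  refine ext_inner_test fun φ hφ => ?_
  have := (hasWeakDeriv_univ_iff.1 h₁ φ hφ).symm.trans (hasWeakDeriv_univ_iff.1 h₂ φ hφ)
  exact mul_left_cancel₀ (pow_ne_zero _ (by norm_num)) this

theorem HasWeakDeriv.wd {α : Fin 3 → ℕ} {i : Fin 3} {g g₁ g₂ : H} (h₁ : HasWeakDeriv univ α g g₁)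
    (h₂ : HasWeakDeriv univ (α + Pi.single i 1) g g₂) : WD i g₁ g₂ := by
  intro φ hφ
  have e1 := hasWeakDeriv_univ_iff.1 h₁ _ (hφ.pderiv i)
  have e2 := hasWeakDeriv_univ_iff.1 h₂ _ hφ
  rw [pderivs_add_single α i hφ, e1, sum_add_single, pow_succ, mul_assoc] at e2
  have := mul_left_cancel₀ (pow_ne_zero _ (by norm_num)) e2
  linarith

theorem HasWeakDeriv.of_wd {α : Fin 3 → ℕ} {i : Fin 3} {g g₁ g₂ : H}
    (h₁ : HasWeakDeriv univ α g g₁) (h₂ : WD i g₁ g₂) :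
    HasWeakDeriv univ (α + Pi.single i 1) g g₂ := by
  refine hasWeakDeriv_univ_iff.2 fun φ hφ => ?_
  rw [pderivs_add_single α i hφ, hasWeakDeriv_univ_iff.1 h₁ _ (hφ.pderiv i), h₂ φ hφ,
    sum_add_single, pow_succ]
  ring

theorem hasWeakDeriv_two {i : Fin 3} {g g₁ g₂ : H} (h₁ : WD i g g₁) (h₂ : WD i g₁ g₂) :
    HasWeakDeriv univ (Pi.single i 2) g g₂ := by
  have := (hasWeakDeriv_zero_idx.of_wd h₁).of_wd h₂
  rwa [zero_add, ← Pi.single_add] at this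

end

/-! ### Elements of Sobolev spaces and of `⋂ C^k H^{s-k}` -/

section

variable {Ω : Set E3} {m s k : ℕ} {T : ℝ}

theorem mem_multiIdx {α : Fin 3 → ℕ} : α ∈ multiIdx m ↔ ∑ i, α i ≤ m := by
  simp only [multiIdx, Finset.mem_filter, Fintype.mem_piFinset, Finset.mem_range,
    and_iff_right_iff_imp]
  intro h i
  have := Finset.single_le_sum (f := α) (fun _ _ => Nat.zero_le _) (Finset.mem_univ i)
  omega

/-- The component `∂^α g` of an element of `H^m(Ω)`. -/
def Sob.comp (α : multiIdx m) : Sob Ω m →L[ℝ] L2 Ω :=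
  (PiLp.proj 2 (fun _ : multiIdx m => L2 Ω) α).comp (Sob Ω m).subtypeL

theorem Sob.comp_apply (α : multiIdx m) (G : Sob Ω m) : Sob.comp α G = G.1 α := rfl

theorem Sob.norm_comp_le (α : multiIdx m) (G : Sob Ω m) : ‖Sob.comp α G‖ ≤ ‖G‖ :=
  PiLp.norm_apply_le G.1 α

theorem Sob.weakDeriv (G : Sob Ω m) (α : multiIdx m) :
    HasWeakDeriv Ω α.1 (Sob.toL2 G) (Sob.comp α G) := G.2 α

/-- The inclusion `H^m(Ω) ⊆ L²(Ω)`. -/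
def Sob.incl : Sob Ω m →L[ℝ] L2 Ω := Sob.comp ⟨0, zero_mem_multiIdx m⟩

theorem Sob.incl_apply (G : Sob Ω m) : Sob.incl G = Sob.toL2 G := rfl

theorem Sob.toL2_injective : Function.Injective (Sob.toL2 : Sob univ m → L2 univ) := by
  intro G G' h
  refine Subtype.ext (PiLp.ext fun α => ?_)
  have h1 := Sob.weakDeriv G α
  rw [h] at h1
  exact h1.unique (Sob.weakDeriv G' α)

theorem sobENorm_toL2 (G : Sob univ m) : sobENorm univ m (Sob.toL2 G) = ‖G‖ₑ := by
  refine le_antisymm (iInf₂_le (f := fun (G' : Sob univ m) (_ : Sob.toL2 G' = Sob.toL2 G) => ‖G'‖ₑ)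
    G rfl) (le_iInf₂ fun G' h => ?_)
  rw [Sob.toL2_injective h]

theorem sobENorm_toL2_le (G : Sob Ω m) : sobENorm Ω m (Sob.toL2 G) ≤ ‖G‖ₑ :=
  iInf₂_le (f := fun (G' : Sob Ω m) (_ : Sob.toL2 G' = Sob.toL2 G) => ‖G'‖ₑ) G rfl

theorem iteratedDeriv_clm {E F : Type*} [NormedAddCommGroup E] [NormedSpace ℝ E]
    [NormedAddCommGroup F] [NormedSpace ℝ F] (L : E →L[ℝ] F) {U : ℝ → E} {I : Set ℝ}
    (hI : IsOpen I) (hU : ContDiffOn ℝ k U I) {t : ℝ} (ht : t ∈ I) :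
    iteratedDeriv k (fun t => L (U t)) t = L (iteratedDeriv k U t) := by
  have h : ContDiffAt ℝ k U t := hU.contDiffAt (hI.mem_nhds ht)
  rw [iteratedDeriv_eq_iteratedFDeriv, iteratedDeriv_eq_iteratedFDeriv]
  have := L.iteratedFDeriv_comp_left h le_rfl
  exact congrArg (fun M => M fun _ => (1 : ℝ)) this

theorem iteratedDeriv_congr {E : Type*} [NormedAddCommGroup E] [NormedSpace ℝ E] {u v : ℝ → E}
    (h : ∀ t ∈ Ioo 0 T, u t = v t) {t : ℝ} (ht : t ∈ Ioo 0 T) :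
    iteratedDeriv k u t = iteratedDeriv k v t := by
  refine Filter.EventuallyEq.iteratedDeriv_eq k ?_
  filter_upwards [isOpen_Ioo.mem_nhds ht] with r hr using h r hr

theorem hasDerivAt_iteratedDeriv {E : Type*} [NormedAddCommGroup E] [NormedSpace ℝ E] {u : ℝ → E}
    {n : ℕ} (hu : ContDiffOn ℝ n u (Ioo 0 T)) (hk : k < n) {t : ℝ} (ht : t ∈ Ioo 0 T) :
    HasDerivAt (iteratedDeriv k u) (iteratedDeriv (k + 1) u t) t := by
  rw [iteratedDeriv_succ]
  refine DifferentiableAt.hasDerivAt ?_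
  have h := (hu.differentiableOn_iteratedDerivWithin (by exact_mod_cast hk)
    isOpen_Ioo.uniqueDiffOn).differentiableAt (isOpen_Ioo.mem_nhds ht)
  refine h.congr_of_eventuallyEq ?_
  filter_upwards [isOpen_Ioo.mem_nhds ht] with r hr
  exact (iteratedDerivWithin_of_isOpen isOpen_Ioo hr).symm

theorem continuousOn_iteratedDeriv {E : Type*} [NormedAddCommGroup E] [NormedSpace ℝ E] {u : ℝ → E}
    (hu : ContDiffOn ℝ k u (Ioo 0 T)) : ContinuousOn (iteratedDeriv k u) (Ioo 0 T) := by
  refine (hu.continuousOn_iteratedDerivWithin le_rfl isOpen_Ioo.uniqueDiffOn).congr fun t ht => ?_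
  exact (iteratedDerivWithin_of_isOpen isOpen_Ioo ht).symm

theorem MemHs.iteratedDeriv_eq {u : ℝ → L2 Ω} {U : ℝ → Sob Ω m} (hU : ContDiffOn ℝ k U (Ioo 0 T))
    (h : ∀ t ∈ Ioo 0 T, Sob.toL2 (U t) = u t) {t : ℝ} (ht : t ∈ Ioo 0 T) :
    iteratedDeriv k u t = Sob.toL2 (iteratedDeriv k U t) := by
  rw [← Sob.incl_apply, ← iteratedDeriv_clm Sob.incl isOpen_Ioo hU ht]
  exact iteratedDeriv_congr (fun t ht => (h t ht).symm) ht

/-- A function in `⋂ C^k H^{s-k}` has mixed derivatives of order up to `s`, bounded by its norm. -/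
theorem exists_derivs {u : ℝ → H} (h : hsENorm s T univ u < ⊤) :
    ∃ G : ℕ → (Fin 3 → ℕ) → ℝ → H, (∀ t ∈ Ioo 0 T, G 0 0 t = u t) ∧
      ∀ k α, k + ∑ i, α i ≤ s → ContinuousOn (G k α) (Ioo 0 T) ∧
        (∀ t ∈ Ioo 0 T, ‖G k α t‖ ≤ (hsENorm s T univ u).toReal) ∧
        (k + ∑ i, α i + 1 ≤ s → IsD T none (G k α) (G (k + 1) α) ∧
          ∀ i, IsD T (some i) (G k α) (G k (α + Pi.single i 1))) := by
  have hm : MemHs s T univ u := by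
    by_contra hn
    rw [hsENorm, if_neg hn] at h
    exact lt_irrefl _ h
  have hU : ∀ k, ∃ U : ℝ → Sob univ (s - k), k ≤ s → ContDiffOn ℝ k U (Ioo 0 T) ∧
      ∀ t ∈ Ioo 0 T, Sob.toL2 (U t) = u t := fun k => by
    by_cases hk : k ≤ s
    · obtain ⟨U, hU⟩ := hm k hk
      exact ⟨U, fun _ => hU⟩
    · exact ⟨0, fun h => absurd h hk⟩
  choose U hU using hU
  classical
  let G : ℕ → (Fin 3 → ℕ) → ℝ → H := fun k α t =>
    if hα : α ∈ multiIdx (s - k) then Sob.comp ⟨α, hα⟩ (iteratedDeriv k (U k) t) else 0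
  have mem : ∀ {k α}, k + ∑ i, α i ≤ s → α ∈ multiIdx (s - k) := fun h =>
    mem_multiIdx.2 (by omega)
  have hG : ∀ {k α} (h : k + ∑ i, α i ≤ s), G k α =
      fun t => Sob.comp ⟨α, mem h⟩ (iteratedDeriv k (U k) t) := fun h => by
    funext t
    simp only [G, dif_pos (mem h)]
  have hGw : ∀ {k α}, k + ∑ i, α i ≤ s → ∀ t ∈ Ioo 0 T,
      HasWeakDeriv univ α (iteratedDeriv k u t) (G k α t) := by
    intro k α h t ht
    have hk : k ≤ s := by omega
    rw [hG h, MemHs.iteratedDeriv_eq (hU k hk).1 (hU k hk).2 ht]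
    exact Sob.weakDeriv (iteratedDeriv k (U k) t) ⟨α, mem h⟩
  refine ⟨G, fun t ht => ?_, fun k α hkα => ⟨?_, fun t ht => ?_, fun hlt => ⟨?_, fun i => ?_⟩⟩⟩
  · exact (hGw (by simp) t ht).unique (by simpa using hasWeakDeriv_zero_idx)
  · rw [hG hkα]
    exact (Sob.comp _).continuous.comp_continuousOn
      (continuousOn_iteratedDeriv (hU k (by omega)).1)
  · have hk : k ≤ s := by omega
    rw [hG hkα]
    refine (Sob.norm_comp_le _ _).trans ?_
    have e : ‖iteratedDeriv k (U k) t‖ₑ ≤ hsENorm s T univ u := by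
      rw [← sobENorm_toL2, ← MemHs.iteratedDeriv_eq (hU k hk).1 (hU k hk).2 ht, hsENorm, if_pos hm]
      refine (le_iSup₂ (f := fun t (_ : t ∈ Ioo 0 T) =>
        sobENorm univ (s - k) (iteratedDeriv k u t)) t ht).trans ?_
      exact Finset.single_le_sum (f := fun k => ⨆ t ∈ Ioo 0 T,
        sobENorm univ (s - k) (iteratedDeriv k u t)) (fun _ _ => zero_le)
        (Finset.mem_range.2 (by omega))
    have := ENNReal.toReal_mono h.ne e
    rwa [toReal_enorm] at this
  · have h1 : k + 1 + ∑ i, α i ≤ s := by omega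
    have hk1 : k + 1 ≤ s := by omega
    have e : ∀ t ∈ Ioo 0 T, G k α t =
        Sob.comp ⟨α, mem h1⟩ (iteratedDeriv k (U (k + 1)) t) := fun t ht => by
      refine (hGw hkα t ht).unique ?_
      rw [MemHs.iteratedDeriv_eq ((hU (k + 1) hk1).1.of_le (by norm_cast; omega))
        (hU (k + 1) hk1).2 ht]
      exact Sob.weakDeriv (iteratedDeriv k (U (k + 1)) t) ⟨α, mem h1⟩
    intro t ht
    rw [hG h1]
    have hd := (Sob.comp ⟨α, mem h1⟩).hasFDerivAt.comp_hasDerivAt t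
      (hasDerivAt_iteratedDeriv (hU (k + 1) hk1).1 (Nat.lt_succ_self k) ht)
    refine hd.congr_of_eventuallyEq ?_
    filter_upwards [isOpen_Ioo.mem_nhds ht] with r hr using e r hr
  · intro t ht
    exact (hGw hkα t ht).wd (hGw (by rw [sum_add_single]; omega) t ht)

theorem IsD.supp {u u' : ℝ → H} {j : Dir} {R : ℝ} (h : IsD T j u u')
    (hu : ∀ t ∈ Ioo 0 T, u t ∈ Supp R) : ∀ t ∈ Ioo 0 T, u' t ∈ Supp R := by
  intro t ht
  cases j with
  | none =>
    have h1 := hasDerivAt_iff_tendsto_slope.1 (h t ht)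
    refine (isClosed_Supp R).mem_of_tendsto h1 ?_
    filter_upwards [nhdsWithin_le_nhds (isOpen_Ioo.mem_nhds ht)] with r hr
    rw [slope_def_module]
    exact (Supp R).smul_mem _ ((Supp R).sub_mem (hu r hr) (hu t ht))
  | some i => exact Supp.wd (hu t ht) (h t ht)

/-- Sources are regular curves. -/
theorem IsSource.reg {ρ L : ℝ} {f : ℝ → H} (h : IsSource s T ρ f) (hL : 1 ≤ L) :
    Reg ρ T L s (hsENorm s T univ f).toReal f := by
  obtain ⟨G, h0, hG⟩ := exists_derivs h.1
  set A := (hsENorm s T univ f).toReal with hA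
  have hA0 : 0 ≤ A := ENNReal.toReal_nonneg
  have hsupp : ∀ n k α, k + ∑ i, α i = n → n ≤ s → ∀ t ∈ Ioo 0 T, G k α t ∈ Supp ρ := by
    intro n
    induction n with
    | zero =>
      intro k α hk _ t ht
      have hk0 : k = 0 := by omega
      have hα0 : α = 0 := by
        funext i
        have := Finset.single_le_sum (f := α) (fun _ _ => Nat.zero_le _) (Finset.mem_univ i)
        simp only [Pi.zero_apply]
        omega
      rw [hk0, hα0, h0 t ht, mem_Supp, μ₀_eq]
      filter_upwards [h.2 t ht] with x hx hx'
      exact hx (by simpa using hx'.le)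
    | succ n ih =>
      intro k α hk hn t ht
      rcases k with _ | k
      · obtain ⟨i, hi⟩ : ∃ i, α i ≠ 0 := by
          by_contra! hc
          simp [hc] at hk
        have e : α = (α - Pi.single i 1) + Pi.single i 1 := by
          rw [tsub_add_cancel_of_le]
          intro j
          by_cases hj : j = i
          · subst hj
            simpa using Nat.one_le_iff_ne_zero.2 hi
          · simp [hj]
        have hsum := sum_add_single (α - Pi.single i 1) i
        rw [← e] at hsum
        rw [e]
        exact ((hG 0 (α - Pi.single i 1) (by omega)).2.2 (by omega)).2 i |>.supp
          (ih 0 _ (by omega) (by omega)) t ht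
      · exact ((hG k α (by omega)).2.2 (by omega)).1.supp (ih k α (by omega) (by omega)) t ht
  have h0r : ∀ k α, k + ∑ i, α i ≤ s → ∀ B, A ≤ B → Reg0 ρ T L B (G k α) := by
    intro k α hk B hB
    refine ⟨(hG k α hk).1, fun t ht => ⟨?_,
      Supp.mono (by linarith [ht.1]) (hsupp _ k α rfl hk t ht)⟩⟩
    refine ((hG k α hk).2.1 t ht).trans (hB.trans ?_)
    exact le_mul_of_one_le_right (hA0.trans hB)
      (Real.one_le_exp (mul_nonneg (by linarith) ht.1.le))
  have key : ∀ n k α, k + ∑ i, α i + n ≤ s → ∀ B, A ≤ B → Reg ρ T L n B (G k α) := by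
    intro n
    induction n with
    | zero => exact fun k α hk B hB => h0r k α hk B hB
    | succ n ih =>
      intro k α hk B hB
      have hLB : A ≤ L * B := hB.trans (le_mul_of_one_le_left (hA0.trans hB) hL)
      refine ⟨h0r k α (by omega) B hB, fun j => ?_⟩
      cases j with
      | none => exact ⟨_, ((hG k α (by omega)).2.2 (by omega)).1, ih (k + 1) α (by omega) _ hLB⟩
      | some i => exact ⟨_, ((hG k α (by omega)).2.2 (by omega)).2 i,
          ih k _ (by rw [sum_add_single]; omega) _ hLB⟩
  exact (key s 0 0 (by simp) A le_rfl).congr h0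

end

/-! ### Finite speed of propagation and uniqueness -/

section

theorem ae_μ₀_iff {p : E3 → Prop} : (∀ᵐ x ∂μ₀, p x) ↔ ∀ᵐ x ∂(volume : Measure E3), p x := by
  rw [μ₀_eq]

/-- The part of `g` in the closed ball of radius `R`. -/
def cut (R : ℝ) (g : H) : H := ml ({x : E3 | ‖x‖ ≤ R}.indicator fun _ => 1) g

theorem cut_coe (R : ℝ) (g : H) : cut R g =ᵐ[μ₀] {x : E3 | ‖x‖ ≤ R}.indicator g := by
  have hm : MeasurableSet {x : E3 | ‖x‖ ≤ R} := measurableSet_le measurable_norm measurable_const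
  have h := ml_coe (a := {x : E3 | ‖x‖ ≤ R}.indicator fun _ => 1) (C := 1)
    ((measurable_const.indicator hm).aestronglyMeasurable)
    (Eventually.of_forall fun x => by by_cases hx : ‖x‖ ≤ R <;> simp [hx]) g
  refine h.trans (Eventually.of_forall fun x => ?_)
  by_cases hx : ‖x‖ ≤ R <;> simp [hx]

theorem cut_mem_Supp (R : ℝ) (g : H) : cut R g ∈ Supp R := by
  rw [mem_Supp]
  filter_upwards [cut_coe R g] with x hx h
  rw [hx, indicator_of_notMem (by simpa using h)]

theorem inner_cut {R : ℝ} (g : H) {k : H} (hk : k ∈ Supp R) :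
    inner ℝ (cut R g) k = inner ℝ g k := by
  rw [inner_eq, inner_eq]
  refine integral_congr_ae ?_
  filter_upwards [cut_coe R g, mem_Supp.1 hk] with x h1 h2
  rw [h1]
  by_cases hx : ‖x‖ ≤ R
  · rw [indicator_of_mem (by simpa using hx)]
  · rw [h2 (not_le.1 hx), mul_zero, mul_zero]

theorem norm_cut_le (R : ℝ) (g : H) : ‖cut R g‖ ≤ ‖g‖ := by
  refine Lp.norm_le_norm_of_ae_le ?_
  filter_upwards [cut_coe R g] with x hx
  rw [hx]
  exact norm_indicator_le_norm_self _ _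

theorem norm_cut_le_mul {R C : ℝ} {g k : H} (h : ∀ᵐ x ∂μ₀, ‖x‖ ≤ R → |k x| ≤ C * |g x|) :
    ‖cut R k‖ ≤ C * ‖cut R g‖ := by
  refine Lp.norm_le_mul_norm_of_ae_le_mul ?_
  filter_upwards [cut_coe R g, cut_coe R k, h] with x h1 h2 h3
  rw [h1, h2]
  by_cases hx : ‖x‖ ≤ R
  · rw [indicator_of_mem (by simpa using hx), indicator_of_mem (by simpa using hx)]
    exact h3 hx
  · rw [indicator_of_notMem (by simpa using hx), indicator_of_notMem (by simpa using hx)]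
    simp

/-- The test functions with support in the open ball of radius `R`, as a subspace of `L²(ℝ³)`. -/
def testIn (R : ℝ) : Submodule ℝ H where
  carrier := {k | ∃ φ, IsTest (ball3 R) φ ∧ k = ofFun φ}
  add_mem' := by
    rintro _ _ ⟨φ, h, rfl⟩ ⟨ψ, h', rfl⟩
    refine ⟨φ + ψ, ⟨h.1.add h'.1, h.2.1.add h'.2.1,
      (tsupport_add φ ψ).trans (union_subset h.2.2 h'.2.2)⟩, ?_⟩
    refine (ofFun_eq ?_).symm
    filter_upwards [Lp.coeFn_add (ofFun φ) (ofFun ψ), Test.coe ⟨h.1, h.2.1⟩,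
      Test.coe ⟨h'.1, h'.2.1⟩] with x h1 h2 h3
    rw [h1, Pi.add_apply, Pi.add_apply, h2, h3]
  zero_mem' := by
    refine ⟨0, ⟨contDiff_const, HasCompactSupport.zero, by simp⟩, ?_⟩
    refine (ofFun_eq ?_).symm
    filter_upwards [Lp.coeFn_zero ℝ 2 μ₀] with x h1
    rw [h1]
  smul_mem' := by
    rintro c _ ⟨φ, h, rfl⟩
    refine ⟨fun x => c * φ x, ⟨contDiff_const.mul h.1, h.2.1.mul_left, ?_⟩, ?_⟩
    · exact (tsupport_mul_subset_right (f := fun _ => c) (g := φ)).trans h.2.2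
    refine (ofFun_eq ?_).symm
    filter_upwards [Lp.coeFn_smul c (ofFun φ), Test.coe ⟨h.1, h.2.1⟩] with x h1 h2
    rw [h1, Pi.smul_apply, h2, smul_eq_mul]

theorem testIn_le_Supp (R : ℝ) : testIn R ≤ Supp R := by
  rintro _ ⟨φ, h, rfl⟩
  rw [mem_Supp]
  filter_upwards [Test.coe ⟨h.1, h.2.1⟩] with x h1 h2
  rw [h1]
  refine image_eq_zero_of_notMem_tsupport fun hx => ?_
  have := h.2.2 hx
  simp only [ball3, Metric.mem_ball, dist_zero_right] at this
  linarith

theorem cut_mem_closure_testIn (R : ℝ) (g : H) : cut R g ∈ (testIn R).topologicalClosure := by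
  set K := (testIn R).topologicalClosure with hK
  have hKc : IsClosed (K : Set H) := (testIn R).isClosed_topologicalClosure
  have : CompleteSpace K := hKc.completeSpace_coe
  obtain ⟨a, ha, b, hb, hab⟩ := K.exists_add_mem_mem_orthogonal (cut R g)
  have haS : a ∈ Supp R :=
    (testIn R).topologicalClosure_minimal (testIn_le_Supp R) (isClosed_Supp R) ha
  have hbS : b ∈ Supp R := by
    have : b = cut R g - a := by rw [hab]; abel
    rw [this]
    exact (Supp R).sub_mem (cut_mem_Supp R g) haS
  have hb0 : b = 0 := by
    have h1 := Metric.isOpen_ball.ae_eq_zero_of_integral_contDiff_smul_eq_zero (μ := μ₀)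
      (U := ball3 R) (f := b)
      (((Lp.memLp b).locallyIntegrable (by norm_num)).locallyIntegrableOn _) ?_
    · refine Lp.ext ?_
      have h2 : ∀ᵐ x ∂μ₀, x ∉ Metric.sphere (0 : E3) R := by
        rw [μ₀_eq]
        exact measure_eq_zero_iff_ae_notMem.1 (Measure.addHaar_sphere _ _ _)
      filter_upwards [h1, h2, mem_Supp.1 hbS, Lp.coeFn_zero ℝ 2 μ₀] with x h1 h2 h3 h4
      rw [h4, Pi.zero_apply]
      rcases lt_trichotomy ‖x‖ R with h | h | h
      · exact h1 (by simpa using h)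
      · exact absurd (by simpa using h) h2
      · exact h3 h
    · intro φ h1 h2 h3
      have h4 : ofFun φ ∈ K := (testIn R).le_topologicalClosure ⟨φ, ⟨h1, h2, h3⟩, rfl⟩
      have h5 := (K.mem_orthogonal b).1 hb _ h4
      rw [real_inner_comm, Test.inner ⟨h1, h2⟩] at h5
      simpa [mul_comm] using h5
  rw [hab, hb0, add_zero]
  exact ha

theorem norm_cut_le_of_test {R B : ℝ} {g : H}
    (h : ∀ φ, Test φ → ofFun φ ∈ Supp R → inner ℝ g (ofFun φ) ≤ B * ‖ofFun φ‖) :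
    ‖cut R g‖ ≤ B ∨ cut R g = 0 := by
  have hcl : IsClosed {k : H | inner ℝ g k ≤ B * ‖k‖} :=
    isClosed_le (by fun_prop) (by fun_prop)
  have h1 : inner ℝ g (cut R g) ≤ B * ‖cut R g‖ := by
    refine closure_minimal (s := (testIn R : Set H)) (t := {k : H | inner ℝ g k ≤ B * ‖k‖})
      ?_ hcl (cut_mem_closure_testIn R g)
    rintro k hk
    obtain ⟨φ, hφ, rfl⟩ := id hk
    exact h φ ⟨hφ.1, hφ.2.1⟩ (testIn_le_Supp R hk)
  rw [← inner_cut g (cut_mem_Supp R g), real_inner_self_eq_norm_sq, pow_two] at h1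
  by_cases h0 : cut R g = 0
  · exact Or.inr h0
  · exact Or.inl (le_of_mul_le_mul_right h1 (norm_pos_iff.2 h0))

theorem wmean_mem_Supp {R : ℝ} {g : H} (hg : g ∈ Supp R) (σ : ℝ) :
    wmean g σ ∈ Supp (R + |σ|) := by
  refine (Supp _).smul_mem _ ?_
  refine (Supp _).convex.integral_mem (isClosed_Supp _) ?_
    (integrable_sphm (c := fun _ => 1) continuous_const g σ)
  filter_upwards [ae_sph_norm] with y hy
  refine (Supp _).smul_mem _ ?_
  have := Supp.shift hg (σ • y)
  rwa [norm_smul, hy, mul_one, Real.norm_eq_abs] at this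

theorem pderivs_two (i : Fin 3) {φ : E3 → ℝ} (h : Test φ) :
    pderivs (Pi.single i 2) φ = pderiv i (pderiv i φ) := by
  have e : (Pi.single i 2 : Fin 3 → ℕ) = 0 + Pi.single i 1 + Pi.single i 1 := by
    rw [zero_add, ← Pi.single_add]
  rw [e, pderivs_add_single _ _ h, pderivs_add_single _ _ (h.pderiv i)]
  rfl

theorem inner_wmean (g k : H) (σ : ℝ) :
    inner ℝ g (wmean k σ) = σ * ∫ y, inner ℝ g (shift (σ • y) k) ∂sph := by
  have h2 := (innerSL ℝ g).integral_comp_comm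
    (integrable_sphm (c := fun _ => 1) continuous_const k σ)
  simp only [innerSL_apply_apply, one_smul] at h2
  rw [wmean, inner_smul_right, h2]
  simp only [sphm, one_smul]

theorem inner_wmean_of_weak {i : Fin 3} {g k : H} (h : HasWeakDeriv univ (Pi.single i 2) g k)
    {φ : E3 → ℝ} (hφ : Test φ) (σ : ℝ) :
    inner ℝ g (wmean (ofFun (pderiv i (pderiv i φ))) σ) = inner ℝ k (wmean (ofFun φ) σ) := by
  rw [inner_wmean, inner_wmean]
  congr 2
  funext y
  have e := hasWeakDeriv_univ_iff.1 h _ (hφ.shift (σ • y))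
  rw [pderivs_two i (hφ.shift _), pderiv_shift, pderiv_shift] at e
  rw [shift_ofFun ((hφ.pderiv i).pderiv i), shift_ofFun hφ, e]
  simp

end

section

variable {T : ℝ} {w : ℝ → H}

/-- A domain of dependence estimate for `|□w| ≤ C |w|` with vanishing Cauchy data, which improves an
exponential bound on a backward light cone by the factor `C T / c`: the wave operator is tested
against the backward solutions `wmean φ (t - τ)`, whose supports fill such a cone. -/
theorem norm_cut_le_exp (hw : ContDiffOn ℝ 1 w (Iio T)) (h0 : ∀ t ≤ 0, w t = 0)
    {w₂ : ℝ → H} {l : ℝ → Fin 3 → H} (hT : 0 < T)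
    (hw₂ : ∀ t ∈ Ioo 0 T, HasDerivAt (_root_.deriv w) (w₂ t) t)
    (hl : ∀ t ∈ Ioo 0 T, ∀ i, HasWeakDeriv univ (Pi.single i 2) (w t) (l t i)) {R C : ℝ}
    (hC : 0 ≤ C)
    (hq : ∀ t ∈ Ioo 0 T, ∀ᵐ x ∂μ₀, ‖x‖ ≤ R → |(w₂ t - ∑ i, l t i : H) x| ≤ C * |w t x|)
    {A c : ℝ} (hA : 0 ≤ A) (hc : 0 < c)
    (hN : ∀ t ∈ Ioo 0 T, ‖cut (R - t) (w t)‖ ≤ A * Real.exp (c * t)) :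
    ∀ t ∈ Ioo 0 T, ‖cut (R - t) (w t)‖ ≤ C * T * A / c * Real.exp (c * t) := by
  intro t ht
  have hd : ∀ τ ∈ Iio T, HasDerivAt w (_root_.deriv w τ) τ := fun τ hτ =>
    ((hw.differentiableOn one_ne_zero).differentiableAt (isOpen_Iio.mem_nhds hτ)).hasDerivAt
  have hdc : ContinuousOn (_root_.deriv w) (Iio T) :=
    hw.continuousOn_deriv_of_isOpen isOpen_Iio le_rfl
  -- the second Cauchy datum, read off from `t ≤ 0`
  have hd0 : _root_.deriv w 0 = 0 := by
    have h1 := (hd 0 hT).hasDerivWithinAt (s := Iic 0)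
    have h2 : HasDerivWithinAt w 0 (Iic 0) 0 :=
      (hasDerivWithinAt_const (0 : ℝ) (Iic 0) (0 : H)).congr (fun x hx => h0 x hx) (h0 0 le_rfl)
    exact (uniqueDiffWithinAt_Iic 0).eq_deriv _ h1 h2
  have hB0 : 0 ≤ C * T * A / c * Real.exp (c * t) := by positivity
  refine (norm_cut_le_of_test fun φ hφ hs => ?_).elim id fun h => by rw [h, norm_zero]; exact hB0
  have w1 : ∀ i, WD i (ofFun φ) (ofFun (pderiv i φ)) := fun i => hφ.WD i
  have w2 : ∀ i j, WD j (ofFun (pderiv i φ)) (ofFun (pderiv j (pderiv i φ))) :=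
    fun i j => (hφ.pderiv i).WD j
  set b := wmean (ofFun φ) with hb
  set b' := wmean' (ofFun φ) (fun i => ofFun (pderiv i φ)) with hb'
  have hbd : ∀ σ, HasDerivAt b (b' σ) σ := hasDerivAt_wmean w1
  have hbd' : ∀ σ, HasDerivAt b' _ σ := hasDerivAt_wmean' w1 w2
  have hbt : ∀ τ, HasDerivAt (fun τ => b (t - τ)) (-b' (t - τ)) τ := fun τ => by
    have h := (hbd (t - τ)).scomp τ ((hasDerivAt_id τ).const_sub t)
    rw [neg_smul, one_smul] at h
    exact h
  have hbt' : ∀ τ, HasDerivAt (fun τ => b' (t - τ))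
      (-∑ i, wmean (ofFun (pderiv i (pderiv i φ))) (t - τ)) τ := fun τ => by
    have h := (hbd' (t - τ)).scomp τ ((hasDerivAt_id τ).const_sub t)
    rw [neg_smul, one_smul] at h
    exact h
  -- `p` equals `⟨w t, φ⟩` at `τ = t`, vanishes at `τ = 0`, and its derivative only sees `□w`
  set p : ℝ → ℝ := fun τ => inner ℝ (_root_.deriv w τ) (b (t - τ)) + inner ℝ (w τ) (b' (t - τ))
    with hp
  have hsub : Icc 0 t ⊆ Iio T := fun τ hτ => hτ.2.trans_lt ht.2
  have hpc : ContinuousOn p (Icc 0 t) := by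
    refine ContinuousOn.add ((hdc.mono hsub).inner fun τ _ => ?_)
      ((hw.continuousOn.mono hsub).inner fun τ _ => ?_)
    · exact (hbt τ).continuousAt.continuousWithinAt
    · exact (hbt' τ).continuousAt.continuousWithinAt
  have hpd : ∀ τ ∈ Ioo 0 t, HasDerivAt p (inner ℝ (w₂ τ - ∑ i, l τ i) (b (t - τ))) τ := by
    intro τ hτ
    have hm : τ ∈ Ioo 0 T := ⟨hτ.1, hτ.2.trans ht.2⟩
    have h1 := ((hw₂ τ hm).inner ℝ (hbt τ)).fun_add ((hd τ hm.2).inner ℝ (hbt' τ))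
    refine h1.congr_deriv ?_
    simp only [inner_neg_right, inner_sum, inner_sub_left, sum_inner]
    simp only [inner_wmean_of_weak (hl τ hm _) hφ]
    ring
  have hpb : ∀ τ ∈ Ioo 0 t, |inner ℝ (w₂ τ - ∑ i, l τ i) (b (t - τ))| ≤
      C * T * A * ‖ofFun φ‖ * Real.exp (c * τ) := by
    intro τ hτ
    have hm : τ ∈ Ioo 0 T := ⟨hτ.1, hτ.2.trans ht.2⟩
    have hbs : b (t - τ) ∈ Supp (R - τ) := by
      have := wmean_mem_Supp hs (t - τ)
      rw [abs_of_nonneg (by linarith [hτ.2])] at this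
      exact Supp.mono (by linarith) this
    rw [← inner_cut _ hbs]
    refine (abs_real_inner_le_norm _ _).trans ?_
    have h1 : ‖cut (R - τ) (w₂ τ - ∑ i, l τ i)‖ ≤ C * ‖cut (R - τ) (w τ)‖ := by
      refine norm_cut_le_mul ?_
      filter_upwards [hq τ hm] with x hx hx' using hx (by linarith [hτ.1])
    have h2 : ‖b (t - τ)‖ ≤ T * ‖ofFun φ‖ := by
      refine (norm_wmean_le _ _).trans (mul_le_mul_of_nonneg_right ?_ (norm_nonneg _))
      rw [abs_of_nonneg (by linarith [hτ.2])]
      linarith [hτ.1, ht.2]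
    calc _ ≤ (C * (A * Real.exp (c * τ))) * (T * ‖ofFun φ‖) :=
          mul_le_mul (h1.trans (mul_le_mul_of_nonneg_left (hN τ hm) hC)) h2 (norm_nonneg _)
            (by positivity)
      _ = _ := by ring
  set D := C * T * A * ‖ofFun φ‖ with hD
  have hD0 : 0 ≤ D := by positivity
  have hmono : MonotoneOn (fun τ => D / c * Real.exp (c * τ) - p τ) (Icc 0 t) := by
    have he : ∀ τ : ℝ, HasDerivAt (fun τ => D / c * Real.exp (c * τ)) (D * Real.exp (c * τ)) τ := by
      intro τ
      refine (((hasDerivAt_id τ).const_mul c).exp.const_mul (D / c)).congr_deriv ?_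
      simp only [id]
      field_simp
    have hdd : ∀ τ ∈ Ioo 0 t, HasDerivAt (fun τ => D / c * Real.exp (c * τ) - p τ) _ τ :=
      fun τ hτ => (he τ).fun_sub (hpd τ hτ)
    refine monotoneOn_of_deriv_nonneg (convex_Icc 0 t) ((by fun_prop :
      Continuous fun τ => D / c * Real.exp (c * τ)).continuousOn.sub hpc) ?_ ?_
    · rw [interior_Icc]
      exact fun τ hτ => (hdd τ hτ).differentiableAt.differentiableWithinAt
    · rw [interior_Icc]
      intro τ hτ
      rw [(hdd τ hτ).deriv]
      linarith [le_abs_self (inner ℝ (w₂ τ - ∑ i, l τ i) (b (t - τ))), hpb τ hτ]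
  have h1 := hmono (left_mem_Icc.2 ht.1.le) (right_mem_Icc.2 ht.1.le) ht.1.le
  have hp0 : p 0 = 0 := by simp [hp, hd0, h0 0 le_rfl]
  have hpt : p t = inner ℝ (w t) (ofFun φ) := by
    simp only [hp, sub_self, hb, hb', wmean_zero, wmean'_zero, inner_zero_right, zero_add]
  simp only [hp0, hpt, mul_zero, Real.exp_zero, mul_one, sub_zero] at h1
  have h2 : 0 ≤ D / c := by positivity
  calc inner ℝ (w t) (ofFun φ) ≤ D / c * Real.exp (c * t) := by linarith
    _ = _ := by rw [hD]; ring

/-- Uniqueness for differential inequalities `|□w| ≤ C |w|` with vanishing Cauchy data, where `C`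
may depend on the radius of a ball in space. -/
theorem eq_zero_of_wave_le (hT : 0 < T) (hw : ContDiffOn ℝ 1 w (Iio T)) (h0 : ∀ t ≤ 0, w t = 0)
    {w₂ : ℝ → H} {l : ℝ → Fin 3 → H}
    (hw₂ : ∀ t ∈ Ioo 0 T, HasDerivAt (_root_.deriv w) (w₂ t) t)
    (hl : ∀ t ∈ Ioo 0 T, ∀ i, HasWeakDeriv univ (Pi.single i 2) (w t) (l t i))
    (hq : ∀ R : ℝ, ∃ C, 0 ≤ C ∧ ∀ t ∈ Ioo 0 T, ∀ᵐ x ∂μ₀, ‖x‖ ≤ R →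
      |(w₂ t - ∑ i, l t i : H) x| ≤ C * |w t x|)
    {A : ℝ} (hA : ∀ t ∈ Ioo 0 T, ‖w t‖ ≤ A) : ∀ t ∈ Ioo 0 T, w t = 0 := by
  intro t ht
  have hA0 : 0 ≤ A := (norm_nonneg _).trans (hA t ht)
  have key : ∀ R : ℝ, cut (R - t) (w t) = 0 := by
    intro R
    obtain ⟨C, hC, hq⟩ := hq R
    -- with this exponent every application of `norm_cut_le_exp` gains a factor `1 / 2`
    set c := 2 * (C * T) + 1 with hc
    have hc0 : 0 < c := by positivity
    have it : ∀ n : ℕ, ∀ t ∈ Ioo 0 T,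
        ‖cut (R - t) (w t)‖ ≤ A * (1 / 2) ^ n * Real.exp (c * t) := by
      intro n
      induction n with
      | zero =>
        intro t ht
        refine (norm_cut_le _ _).trans ((hA t ht).trans ?_)
        rw [pow_zero, mul_one]
        exact le_mul_of_one_le_right hA0 (Real.one_le_exp (mul_nonneg hc0.le ht.1.le))
      | succ n ih =>
        intro t ht
        refine (norm_cut_le_exp hw h0 hT hw₂ hl hC hq (by positivity) hc0 ih t ht).trans ?_
        refine mul_le_mul_of_nonneg_right ?_ (Real.exp_pos _).le
        rw [div_le_iff₀ hc0, pow_succ]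
        have : 0 ≤ A * (1 / 2) ^ n := by positivity
        rw [hc]
        linarith
    have hlim : Tendsto (fun n : ℕ => A * (1 / 2 : ℝ) ^ n * Real.exp (c * t)) atTop (𝓝 0) := by
      simpa using ((tendsto_pow_atTop_nhds_zero_of_lt_one (r := (1 / 2 : ℝ)) (by norm_num)
        (by norm_num)).const_mul A).mul_const (Real.exp (c * t))
    exact norm_le_zero_iff.1 (ge_of_tendsto' hlim fun n => it n t ht)
  refine Lp.ext ?_
  have h1 : ∀ᵐ x ∂μ₀, ∀ n : ℕ, (cut (n : ℝ) (w t)) x = {x : E3 | ‖x‖ ≤ n}.indicator (w t) x :=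
    ae_all_iff.2 fun n => cut_coe _ _
  filter_upwards [h1] with x h1
  obtain ⟨n, hn⟩ := exists_nat_ge ‖x‖
  have h3 := h1 n
  have h4 := key (n + t)
  rw [add_sub_cancel_right] at h4
  rw [h4, indicator_of_mem (by simpa using hn)] at h3
  rw [← h3]

/-- Bounds on the range and the second time derivative of a curve in `⋂ C^k H^{s-k}`, `s ≥ 2`. -/
theorem exists_bdd_of_hsENorm {s : ℕ} (hs : 2 ≤ s) {u : ℝ → H} (h : hsENorm s T univ u < ⊤) :
    ∃ B, 0 ≤ B ∧ (∀ t ∈ Ioo 0 T, ‖u t‖ ≤ B ∧ Bdd B (u t)) ∧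
      ∀ t ∈ Ioo 0 T, HasDerivAt (_root_.deriv u) (_root_.deriv (_root_.deriv u) t) t := by
  obtain ⟨G, h0, hG⟩ := exists_derivs h
  set A := (hsENorm s T univ u).toReal
  have hA : 0 ≤ A := ENNReal.toReal_nonneg
  have sum1 : ∀ i : Fin 3, ∑ j, (0 + Pi.single i 1 : Fin 3 → ℕ) j = 1 := fun i => by
    rw [sum_add_single]; simp
  have sum2 : ∀ i k : Fin 3, ∑ j, (0 + Pi.single i 1 + Pi.single k 1 : Fin 3 → ℕ) j = 2 :=
    fun i k => by rw [sum_add_single, sum1]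
  have z : ∑ j, (0 : Fin 3 → ℕ) j = 0 := by simp
  refine ⟨sobC * A, mul_nonneg (zero_le_one.trans one_le_sobC) hA, fun t ht => ?_, fun t ht => ?_⟩
  · have n0 := (hG 0 0 (by omega)).2.1 t ht
    have hb : Bdd (sobC * A) (G 0 0 t) :=
      bdd_of_h2 (fun i => ((hG 0 0 (by omega)).2.2 (by omega)).2 i t ht)
        (fun i j => ((hG 0 (0 + Pi.single i 1) (by rw [sum1]; omega)).2.2
          (by rw [sum1]; omega)).2 j t ht) n0
        (fun i => (hG 0 _ (by rw [sum1]; omega)).2.1 t ht)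
        (fun i j => (hG 0 _ (by rw [sum2]; omega)).2.1 t ht)
    rw [h0 t ht] at n0 hb
    exact ⟨n0.trans (le_mul_of_one_le_left hA one_le_sobC), hb⟩
  · have d1 : IsD T none u (G 1 0) :=
      ((hG 0 0 (by omega)).2.2 (by omega)).1.congr h0 fun _ _ => rfl
    have d2 : IsD T none (G 1 0) (G 2 0) := ((hG 1 0 (by omega)).2.2 (by omega)).1
    have e : _root_.deriv u =ᶠ[𝓝 t] G 1 0 := by
      filter_upwards [isOpen_Ioo.mem_nhds ht] with r hr using (d1 r hr).deriv
    exact ((d2 t ht).congr_of_eventuallyEq e).differentiableAt.hasDerivAt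

/-- Solutions of the cubic equation are unique. Since both solutions are bounded, their difference
satisfies `|□w| ≤ C |w|` on every ball; the coefficients may be unbounded on `ℝ³`. -/
theorem IsCubicSol.unique {s : ℕ} (hs : 2 ≤ s) (hT : 0 < T) {V h : ℝ × E3 → ℝ} (hV : Continuous V)
    (hh : Continuous h) {f u v : ℝ → H} (hu : IsCubicSol s T V h f u)
    (hv : IsCubicSol s T V h f v) : ∀ t ∈ Ioo 0 T, u t = v t := by
  obtain ⟨hu1, hu2, hu3, hu4⟩ := hu
  obtain ⟨hv1, hv2, hv3, hv4⟩ := hv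
  obtain ⟨B, hB, b1, b2⟩ := exists_bdd_of_hsENorm hs hu1
  obtain ⟨B', hB', b1', b2'⟩ := exists_bdd_of_hsENorm hs hv1
  choose! l hl hle using hu4
  choose! l' hl' hle' using hv4
  have hd : ∀ {u : ℝ → H}, ContDiffOn ℝ 1 u (Iio T) → ∀ τ ∈ Iio T,
      HasDerivAt u (_root_.deriv u τ) τ := fun hu τ hτ =>
    ((hu.differentiableOn one_ne_zero).differentiableAt (isOpen_Iio.mem_nhds hτ)).hasDerivAt
  have key := eq_zero_of_wave_le hT (w := u - v) (hu3.sub hv3)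
    (fun t ht => by rw [Pi.sub_apply, hu2 t ht, hv2 t ht, sub_zero])
    (w₂ := fun t => _root_.deriv (_root_.deriv u) t - _root_.deriv (_root_.deriv v) t)
    (l := fun t i => l t i - l' t i) (fun t ht => ?_) (fun t ht i => ?_) (fun R => ?_)
    (A := B + B') (fun t ht => ?_)
  · exact fun t ht => sub_eq_zero.1 (key t ht)
  · refine ((b2 t ht).sub (b2' t ht)).congr_of_eventuallyEq ?_
    filter_upwards [isOpen_Ioo.mem_nhds ht] with r hr
    exact ((hd hu3 r hr.2).sub (hd hv3 r hr.2)).deriv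
  · have := hasWeakDeriv_add (hl t ht i) (hasWeakDeriv_smul (-1) (hl' t ht i))
    simp only [neg_smul, one_smul, ← sub_eq_add_neg] at this
    exact this
  · have hK : IsCompact (Icc (0 : ℝ) T ×ˢ Metric.closedBall (0 : E3) R) :=
      isCompact_Icc.prod (isCompact_closedBall _ _)
    obtain ⟨C₁, hC₁⟩ := hK.exists_bound_of_continuousOn hV.continuousOn
    obtain ⟨C₂, hC₂⟩ := hK.exists_bound_of_continuousOn hh.continuousOn
    refine ⟨|C₁| + |C₂| * (B ^ 2 + B * B' + B' ^ 2), by positivity, fun t ht => ?_⟩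
    have es : (∑ i, l t i : H) =ᵐ[μ₀] fun x => ∑ i, l t i x := Lp.coeFn_finsetSum _ _
    have es' : (∑ i, l' t i : H) =ᵐ[μ₀] fun x => ∑ i, l' t i x := Lp.coeFn_finsetSum _ _
    rw [Finset.sum_sub_distrib]
    have q1 := ae_μ₀_iff.2 (hle t ht)
    have q2 := ae_μ₀_iff.2 (hle' t ht)
    have c1 := Lp.coeFn_sub (_root_.deriv (_root_.deriv u) t - _root_.deriv (_root_.deriv v) t)
      (∑ i, l t i - ∑ i, l' t i)
    have c2 := Lp.coeFn_sub (_root_.deriv (_root_.deriv u) t) (_root_.deriv (_root_.deriv v) t)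
    have c3 := Lp.coeFn_sub (∑ i, l t i) (∑ i, l' t i)
    have c4 := Lp.coeFn_sub (u t) (v t)
    filter_upwards [es, es', q1, q2, c1, c2, c3, c4, (b1 t ht).2, (b1' t ht).2]
      with x es es' q1 q2 c1 c2 c3 c4 hb hb' hx
    rw [Pi.sub_apply, c1, Pi.sub_apply, c2, Pi.sub_apply, c3, Pi.sub_apply, es, es', c4,
      Pi.sub_apply]
    have hm : ((t, x) : ℝ × E3) ∈ Icc (0 : ℝ) T ×ˢ Metric.closedBall (0 : E3) R :=
      ⟨⟨ht.1.le, ht.2.le⟩, by simpa using hx⟩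
    have k1 := (hC₁ _ hm).trans (le_abs_self C₁)
    have k2 := (hC₂ _ hm).trans (le_abs_self C₂)
    rw [Real.norm_eq_abs] at k1 k2
    have e : _root_.deriv (_root_.deriv u) t x - _root_.deriv (_root_.deriv v) t x -
        (∑ i, l t i x - ∑ i, l' t i x) = -(V (t, x) + h (t, x) *
          (u t x ^ 2 + u t x * v t x + v t x ^ 2)) * (u t x - v t x) := by
      linear_combination q1 - q2
    rw [e, abs_mul, abs_neg]
    refine mul_le_mul_of_nonneg_right ((abs_add_le _ _).trans (add_le_add k1 ?_)) (abs_nonneg _)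
    rw [abs_mul]
    refine mul_le_mul k2 ?_ (abs_nonneg _) (abs_nonneg _)
    refine (abs_add_le _ _).trans (add_le_add ((abs_add_le _ _).trans (add_le_add ?_ ?_)) ?_)
    · rw [abs_pow]
      exact pow_le_pow_left₀ (abs_nonneg _) hb 2
    · rw [abs_mul]
      exact mul_le_mul hb hb' (abs_nonneg _) hB
    · rw [abs_pow]
      exact pow_le_pow_left₀ (abs_nonneg _) hb' 2
  · exact (norm_sub_le _ _).trans (add_le_add (b1 t ht).1 (b1' t ht).1)

end

/-! ### Cubic equations in Banach spaces -/

section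

-- the normed structure on trilinear maps is found at this depth only
set_option maxSynthPendingDepth 4

variable {E F : Type*} [NormedAddCommGroup E] [NormedSpace ℝ E] [NormedAddCommGroup F]
  [NormedSpace ℝ F] {K : E →L[ℝ] E →L[ℝ] E →L[ℝ] E} {β : ℝ}

theorem cube_sub (K : E →L[ℝ] E →L[ℝ] E →L[ℝ] E) (x y : E) :
    K x x x - K y y y = K (x - y) x x + K y (x - y) x + K y y (x - y) := by
  simp only [map_sub, sub_apply]
  abel

theorem norm_cube_sub_le (hβ : 0 ≤ β) (hK : ∀ x y z, ‖K x y z‖ ≤ β * ‖x‖ * ‖y‖ * ‖z‖) {x y : E}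
    {r : ℝ} (hx : ‖x‖ ≤ r) (hy : ‖y‖ ≤ r) :
    ‖K x x x - K y y y‖ ≤ 3 * β * r ^ 2 * ‖x - y‖ := by
  have hr : 0 ≤ r := (norm_nonneg _).trans hx
  have key : ∀ a b c : E, ∀ p q s : ℝ, ‖a‖ ≤ p → ‖b‖ ≤ q → ‖c‖ ≤ s →
      ‖K a b c‖ ≤ β * p * q * s := by
    intro a b c p q s ha hb hc
    have := (norm_nonneg _).trans ha
    have := (norm_nonneg _).trans hb
    refine (hK a b c).trans ?_
    gcongr
  rw [cube_sub]
  refine (norm_add₃_le).trans ?_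
  have h1 := key (x - y) x x _ _ _ le_rfl hx hx
  have h2 := key y (x - y) x _ _ _ hy le_rfl hx
  have h3 := key y y (x - y) _ _ _ hy hy le_rfl
  linarith

/-- Small solutions of `u + K(u,u,u) = a`, with the expansion to third order. -/
theorem exists_cubic_solution [CompleteSpace E] (hβ : 0 ≤ β)
    (hK : ∀ x y z, ‖K x y z‖ ≤ β * ‖x‖ * ‖y‖ * ‖z‖) {a : E} (ha : 24 * β * ‖a‖ ^ 2 ≤ 1) :
    ∃ u, u + K u u u = a ∧ ‖u - a + K a a a‖ ≤ 96 * β ^ 2 * ‖a‖ ^ 5 := by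
  -- `u ↦ a - K u u u` is a contraction of the ball of radius `2 ‖a‖`
  set r := 2 * ‖a‖ with hr
  have hr0 : 0 ≤ r := by positivity
  have hcube : ∀ u : E, ‖u‖ ≤ r → ‖K u u u‖ ≤ 8 * β * ‖a‖ ^ 3 := by
    intro u hu
    have h := norm_cube_sub_le hβ hK (x := u) (y := 0) (r := r) hu (by simpa using hr0)
    refine (hK u u u).trans ?_
    calc β * ‖u‖ * ‖u‖ * ‖u‖ ≤ β * r * r * r := by gcongr
      _ = _ := by rw [hr]; ring
  set g : E → E := fun u => a - K u u u with hg
  have hmaps : MapsTo g (Metric.closedBall 0 r) (Metric.closedBall 0 r) := by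
    intro u hu
    rw [mem_closedBall_zero_iff] at hu ⊢
    refine (norm_sub_le _ _).trans ?_
    have h1 := hcube u hu
    have h2 : 8 * β * ‖a‖ ^ 3 ≤ ‖a‖ := by nlinarith [norm_nonneg a]
    linarith
  have hcontr : ContractingWith (1 / 2) (hmaps.restrict g _ _) := by
    refine ⟨by norm_num, LipschitzWith.of_dist_le_mul fun x y => ?_⟩
    rw [Subtype.dist_eq, Subtype.dist_eq, dist_eq_norm, dist_eq_norm]
    simp only [MapsTo.val_restrict_apply, hg, sub_sub_sub_cancel_left]
    rw [norm_sub_rev]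
    refine (norm_cube_sub_le hβ hK (mem_closedBall_zero_iff.1 x.2)
      (mem_closedBall_zero_iff.1 y.2)).trans ?_
    refine mul_le_mul_of_nonneg_right ?_ (norm_nonneg _)
    rw [hr]
    norm_num
    linarith
  obtain ⟨u, hu, hfix, -⟩ := hcontr.exists_fixedPoint' (x := 0)
    Metric.isClosed_closedBall.isComplete hmaps (by simpa using hr0) (edist_ne_top _ _)
  have hu' : ‖u‖ ≤ r := mem_closedBall_zero_iff.1 hu
  have hfix' : a - K u u u = u := hfix
  have e2 : a - u = K u u u := sub_eq_of_eq_add ((sub_eq_iff_eq_add.1 hfix').trans (add_comm _ _))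
  refine ⟨u, by rw [← e2]; abel, ?_⟩
  have e : u - a + K a a a = K a a a - K u u u := by rw [← e2]; abel
  rw [e]
  refine (norm_cube_sub_le hβ hK (r := r) (by rw [hr]; linarith [norm_nonneg a]) hu').trans ?_
  rw [e2]
  calc _ ≤ 3 * β * r ^ 2 * (8 * β * ‖a‖ ^ 3) := by gcongr; exact hcube u hu'
    _ = _ := by rw [hr]; ring

theorem hasDerivAt_tri {f g k : ℝ → E} {f' g' k' : E} {t : ℝ} (hf : HasDerivAt f f' t)
    (hg : HasDerivAt g g' t) (hk : HasDerivAt k k' t) :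
    HasDerivAt (fun ε => K (f ε) (g ε) (k ε))
      (K f' (g t) (k t) + K (f t) g' (k t) + K (f t) (g t) k') t := by
  have h1 : HasDerivAt (fun ε => K (f ε)) (K f') t := K.hasFDerivAt.comp_hasDerivAt t hf
  have h2 := (h1.clm_apply hg).clm_apply hk
  simpa only [add_apply] using h2

/-- The cubic equation `u + K(u,u,u) = a` is solved near zero by a smooth function of `a`. -/
theorem exists_smooth_cubic_solution [CompleteSpace E] (K : E →L[ℝ] E →L[ℝ] E →L[ℝ] E) :
    ∃ Ψ : E → E, ContDiffAt ℝ 3 Ψ 0 ∧ Ψ 0 = 0 ∧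
      ∀ᶠ x in 𝓝 0, Ψ x + K (Ψ x) (Ψ x) (Ψ x) = x := by
  set Φ : E → E := fun u => u + K u u u with hΦ
  have hs : ContDiff ℝ 3 Φ := by
    refine contDiff_id.add ?_
    exact ((K.contDiff.comp contDiff_id).clm_apply contDiff_id).clm_apply contDiff_id
  have hd : HasFDerivAt Φ ((ContinuousLinearEquiv.refl ℝ E : E ≃L[ℝ] E) : E →L[ℝ] E) 0 := by
    have h1 : HasFDerivAt (fun u : E => K u u u) (0 : E →L[ℝ] E) 0 := by
      have h2 := (K.hasFDerivAt (x := 0)).clm_apply (hasFDerivAt_id (0 : E))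
      have h3 := h2.clm_apply (hasFDerivAt_id (0 : E))
      refine h3.congr_fderiv ?_
      ext v
      simp
    refine ((hasFDerivAt_id (0 : E)).add h1).congr_fderiv ?_
    ext v
    simp
  have h0 : Φ 0 = 0 := by simp [hΦ]
  have hst := hs.contDiffAt.hasStrictFDerivAt' hd (by norm_num : (3 : WithTop ℕ∞) ≠ 0)
  refine ⟨hs.contDiffAt.localInverse hd (by norm_num), ?_, ?_, ?_⟩
  · have := hs.contDiffAt.to_localInverse hd (by norm_num)
    rwa [h0] at this
  · have := hs.contDiffAt.localInverse_apply_image hd (by norm_num)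
    rwa [h0] at this
  · have := hst.eventually_right_inverse
    rw [h0] at this
    exact this

theorem hasDerivAt_line {f : E → F} {x a : E} (h : DifferentiableAt ℝ f x) :
    HasDerivAt (fun ε : ℝ => f (x + ε • a)) (fderiv ℝ f x a) 0 := by
  have h1 : HasDerivAt (fun ε : ℝ => x + ε • a) a 0 := by
    simpa using ((hasDerivAt_id (0 : ℝ)).smul_const a).const_add x
  have h2 : HasFDerivAt f (fderiv ℝ f x) (x + (0 : ℝ) • a) := by simpa using h.hasFDerivAt
  exact h2.comp_hasDerivAt 0 h1

theorem eventually_line {p : E → Prop} {x : E} (h : ∀ᶠ y in 𝓝 x, p y) (a : E) :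
    ∀ᶠ ε : ℝ in 𝓝 0, p (x + ε • a) := by
  have hc : ContinuousAt (fun ε : ℝ => x + ε • a) 0 := by fun_prop
  have : Tendsto (fun ε : ℝ => x + ε • a) (𝓝 0) (𝓝 x) := by simpa using hc.tendsto
  exact this.eventually h

theorem eventually_contDiffAt_dir {n : ℕ} {f : E → F} {x : E} (h : ContDiffAt ℝ (n + 1 : ℕ) f x)
    (a : E) : ContDiffAt ℝ n (fun y => fderiv ℝ f y a) x :=
  (h.fderiv_right (m := n) (by norm_cast)).clm_apply contDiffAt_const

/-- The mixed third derivative at zero of the solution of a symmetric cubic equation. The equation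
is differentiated three times; at zero, `Ψ` vanishes and `Ψ' = id`, and only the six terms remain in
which every factor is differentiated once. -/
theorem third_derivative {Ψ : E → E} (hΨ : ContDiffAt ℝ 3 Ψ 0) (h0 : Ψ 0 = 0)
    (he : ∀ᶠ x in 𝓝 0, Ψ x + K (Ψ x) (Ψ x) (Ψ x) = x)
    (hs₁ : ∀ x y z, K x y z = K y x z) (hs₂ : ∀ x y z, K x y z = K x z y) (a₁ a₂ a₃ : E) :
    fderiv ℝ (fun x => fderiv ℝ (fun x => fderiv ℝ Ψ x a₃) x a₂) 0 a₁ =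
      -((6 : ℝ) • K a₁ a₂ a₃) := by
  have hΨ' : ∀ᶠ x in 𝓝 0, ContDiffAt ℝ ((2 + 1 : ℕ) : WithTop ℕ∞) Ψ x := hΨ.eventually (by norm_num)
  have hd : ∀ᶠ x in 𝓝 0, DifferentiableAt ℝ Ψ x :=
    hΨ'.mono fun x hx => hx.differentiableAt (by norm_num)
  have he' : ∀ᶠ x in 𝓝 0, Ψ x = x - K (Ψ x) (Ψ x) (Ψ x) :=
    he.mono fun x hx => eq_sub_of_add_eq hx
  set D : E → E → E := fun a x => fderiv ℝ Ψ x a with hD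
  have hD1 : ∀ᶠ x in 𝓝 0, ∀ a, D a x = a - (K (D a x) (Ψ x) (Ψ x) + K (Ψ x) (D a x) (Ψ x) +
      K (Ψ x) (Ψ x) (D a x)) := by
    filter_upwards [he'.eventually_nhds, hd] with x h1 h2 a
    have h3 := hasDerivAt_line (a := a) h2
    have h4 : HasDerivAt (fun ε : ℝ => x + ε • a) a 0 := by
      simpa using ((hasDerivAt_id (0 : ℝ)).smul_const a).const_add x
    have h5 := h4.fun_sub (hasDerivAt_tri (K := K) h3 h3 h3)
    simp only [zero_smul, add_zero] at h5
    exact h3.unique (h5.congr_of_eventuallyEq (eventually_line h1 a))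
  have hD0 : ∀ a, D a 0 = a := fun a => by
    have := hD1.self_of_nhds a
    simpa [h0] using this
  have hDs : ∀ᶠ x in 𝓝 0, ∀ a, ContDiffAt ℝ ((1 + 1 : ℕ) : WithTop ℕ∞) (D a) x :=
    hΨ'.mono fun x hx a => eventually_contDiffAt_dir hx a
  have hDd : ∀ᶠ x in 𝓝 0, ∀ a, DifferentiableAt ℝ (D a) x :=
    hDs.mono fun x hx a => (hx a).differentiableAt (by norm_num)
  set D₂ : E → E := fun x => fderiv ℝ (D a₃) x a₂ with hD₂
  have hD2 : ∀ᶠ x in 𝓝 0, D₂ x =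
      -((K (D₂ x) (Ψ x) (Ψ x) + K (D a₃ x) (D a₂ x) (Ψ x) + K (D a₃ x) (Ψ x) (D a₂ x)) +
        (K (D a₂ x) (D a₃ x) (Ψ x) + K (Ψ x) (D₂ x) (Ψ x) + K (Ψ x) (D a₃ x) (D a₂ x)) +
        (K (D a₂ x) (Ψ x) (D a₃ x) + K (Ψ x) (D a₂ x) (D a₃ x) + K (Ψ x) (Ψ x) (D₂ x))) := by
    filter_upwards [hD1.eventually_nhds, hd, hDd] with x h1 h2 h3
    have g := hasDerivAt_line (a := a₂) h2
    have g3 := hasDerivAt_line (a := a₂) (h3 a₃)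
    have h5 := (((hasDerivAt_tri (K := K) g3 g g).fun_add (hasDerivAt_tri (K := K) g g3 g)).fun_add
      (hasDerivAt_tri (K := K) g g g3)).const_sub a₃
    simp only [zero_smul, add_zero] at h5
    exact g3.unique (h5.congr_of_eventuallyEq
      ((eventually_line h1 a₂).mono fun ε hε => hε a₃))
  have hD2d : DifferentiableAt ℝ D₂ 0 :=
    (eventually_contDiffAt_dir (hDs.self_of_nhds a₃) a₂).differentiableAt (by norm_num)
  have g := hasDerivAt_line (a := a₁) hd.self_of_nhds
  have g2 := hasDerivAt_line (a := a₁) (hDd.self_of_nhds a₂)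
  have g3 := hasDerivAt_line (a := a₁) (hDd.self_of_nhds a₃)
  have g23 := hasDerivAt_line (a := a₁) hD2d
  have h5 := ((((hasDerivAt_tri (K := K) g23 g g).fun_add (hasDerivAt_tri (K := K) g3 g2 g)).fun_add
    (hasDerivAt_tri (K := K) g3 g g2)).fun_add
    (((hasDerivAt_tri (K := K) g2 g3 g).fun_add (hasDerivAt_tri (K := K) g g23 g)).fun_add
    (hasDerivAt_tri (K := K) g g3 g2))).fun_add
    (((hasDerivAt_tri (K := K) g2 g g3).fun_add (hasDerivAt_tri (K := K) g g2 g3)).fun_add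
    (hasDerivAt_tri (K := K) g g g23)) |>.fun_neg
  have h6 := g23.unique (h5.congr_of_eventuallyEq (eventually_line hD2 a₁))
  have hDa : fderiv ℝ Ψ 0 a₁ = a₁ := hD0 a₁
  simp only [zero_smul, add_zero, h0, map_zero, zero_apply, zero_add, hD0, hDa] at h6
  change fderiv ℝ D₂ 0 a₁ = _
  have p1 : K a₃ a₂ a₁ = K a₁ a₂ a₃ := (hs₁ _ _ _).trans ((hs₂ _ _ _).trans (hs₁ _ _ _))
  have p2 : K a₃ a₁ a₂ = K a₁ a₂ a₃ := (hs₁ _ _ _).trans (hs₂ _ _ _)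
  have p3 : K a₂ a₃ a₁ = K a₁ a₂ a₃ := (hs₂ _ _ _).trans (hs₁ _ _ _)
  rw [h6, p1, p2, p3, hs₂ a₁ a₃ a₂, hs₁ a₂ a₁ a₃]
  module

/-- Successive partial derivatives at zero of a function of three parameters that agrees, near zero,
with a smooth function of a linear combination. -/
theorem nested_deriv_eq {Ψ : E → E} (hΨ : ContDiffAt ℝ 3 Ψ 0) (e : E →L[ℝ] F) (a₁ a₂ a₃ : E)
    {U : ℝ → ℝ → ℝ → F} (hU : ∀ᶠ p in 𝓝 (0 : ℝ × ℝ × ℝ),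
      U p.1 p.2.1 p.2.2 = e (Ψ (p.1 • a₁ + p.2.1 • a₂ + p.2.2 • a₃))) :
    deriv (fun ε₁ => deriv (fun ε₂ => deriv (fun ε₃ => U ε₁ ε₂ ε₃) 0) 0) 0 =
      e (fderiv ℝ (fun x => fderiv ℝ (fun x => fderiv ℝ Ψ x a₃) x a₂) 0 a₁) := by
  have hΨ' : ∀ᶠ x in 𝓝 0, ContDiffAt ℝ ((2 + 1 : ℕ) : WithTop ℕ∞) Ψ x := hΨ.eventually (by norm_num)
  have hd : ∀ᶠ x in 𝓝 0, DifferentiableAt ℝ Ψ x :=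
    hΨ'.mono fun x hx => hx.differentiableAt (by norm_num)
  set D : E → E := fun x => fderiv ℝ Ψ x a₃ with hD
  have hDs : ∀ᶠ x in 𝓝 0, ContDiffAt ℝ ((1 + 1 : ℕ) : WithTop ℕ∞) D x :=
    hΨ'.mono fun x hx => eventually_contDiffAt_dir hx a₃
  have hDd : ∀ᶠ x in 𝓝 0, DifferentiableAt ℝ D x :=
    hDs.mono fun x hx => hx.differentiableAt (by norm_num)
  set D₂ : E → E := fun x => fderiv ℝ D x a₂ with hD₂
  have hD2d : DifferentiableAt ℝ D₂ 0 :=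
    (eventually_contDiffAt_dir hDs.self_of_nhds a₂).differentiableAt (by norm_num)
  have dl : ∀ {f : E → E} {x a : E}, DifferentiableAt ℝ f x →
      HasDerivAt (fun ε : ℝ => e (f (x + ε • a))) (e (fderiv ℝ f x a)) 0 := fun h =>
    e.hasFDerivAt.comp_hasDerivAt 0 (hasDerivAt_line h)
  have c1 : ∀ᶠ ε₁ : ℝ in 𝓝 0, ∀ᶠ q in 𝓝 (0 : ℝ × ℝ),
      U ε₁ q.1 q.2 = e (Ψ (ε₁ • a₁ + q.1 • a₂ + q.2 • a₃)) := hU.curry_nhds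
  have c2 : ∀ᶠ ε₁ : ℝ in 𝓝 0, ∀ᶠ ε₂ : ℝ in 𝓝 0,
      DifferentiableAt ℝ Ψ (ε₁ • a₁ + ε₂ • a₂) := by
    have hc : ContinuousAt (fun q : ℝ × ℝ => q.1 • a₁ + q.2 • a₂) 0 := by fun_prop
    have ht : Tendsto (fun q : ℝ × ℝ => q.1 • a₁ + q.2 • a₂) (𝓝 0) (𝓝 0) := by
      simpa using hc.tendsto
    exact Eventually.curry_nhds (x := (0 : ℝ)) (y := (0 : ℝ)) (ht.eventually hd)
  have c3 : ∀ᶠ ε₁ : ℝ in 𝓝 0, DifferentiableAt ℝ D (ε₁ • a₁) := by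
    simpa using eventually_line hDd a₁
  have s1 : ∀ᶠ ε₁ : ℝ in 𝓝 0, deriv (fun ε₂ => deriv (fun ε₃ => U ε₁ ε₂ ε₃) 0) 0 =
      e (D₂ (ε₁ • a₁)) := by
    filter_upwards [c1, c2, c3] with ε₁ h1 h2 h3
    have s2 : ∀ᶠ ε₂ : ℝ in 𝓝 0, deriv (fun ε₃ => U ε₁ ε₂ ε₃) 0 =
        e (D (ε₁ • a₁ + ε₂ • a₂)) := by
      have h1' : ∀ᶠ ε₂ : ℝ in 𝓝 0, ∀ᶠ ε₃ : ℝ in 𝓝 0,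
        U ε₁ ε₂ ε₃ = e (Ψ (ε₁ • a₁ + ε₂ • a₂ + ε₃ • a₃)) :=
        Eventually.curry_nhds (x := (0 : ℝ)) (y := (0 : ℝ)) h1
      filter_upwards [h1', h2] with ε₂ h4 h5
      exact ((dl h5).congr_of_eventuallyEq h4).deriv
    exact ((dl h3).congr_of_eventuallyEq s2).deriv
  have h := dl (a := a₁) hD2d
  simp only [zero_add] at h
  exact (h.congr_of_eventuallyEq s1).deriv

end

/-! ### The Banach space of regular curves -/

section

open scoped BoundedContinuousFunction

/-- Words of length at most `s` in the four directions, which index iterated derivatives; the head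
of a word is the derivative that is taken last. -/
abbrev Word (s : ℕ) : Type := {w : List Dir // w.length ≤ s}

instance (s : ℕ) : Finite (Word s) := List.finite_length_le Dir s

instance (s : ℕ) : Fintype (Word s) := Fintype.ofFinite _

/-- Families of bounded continuous curves in `L²(ℝ³)` over `(0,T)`. -/
abbrev Fam (T : ℝ) (s : ℕ) : Type := Word s → (Ioo (0 : ℝ) T →ᵇ H)

variable {ρ T L A : ℝ} {s n : ℕ} {u v : ℝ → H} {j : Dir}

open Classical in
/-- The `w`-th curve of a family, with the weights `e^{-Lt} L^{-|w|}` removed. -/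
def cur (L : ℝ) (x : Fam T s) (w : Word s) (t : ℝ) : H :=
  if h : t ∈ Ioo 0 T then (L ^ w.1.length * Real.exp (L * t)) • x w ⟨t, h⟩ else 0

theorem cur_eq (x : Fam T s) (w : Word s) {t : ℝ} (h : t ∈ Ioo 0 T) :
    cur L x w t = (L ^ w.1.length * Real.exp (L * t)) • x w ⟨t, h⟩ := dif_pos h

theorem cur_add (x y : Fam T s) (w : Word s) : cur L (x + y) w = cur L x w + cur L y w := by
  funext t
  by_cases h : t ∈ Ioo 0 T
  · simp [cur_eq _ _ h]
  · simp [cur, h]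

theorem cur_smul (c : ℝ) (x : Fam T s) (w : Word s) : cur L (c • x) w = c • cur L x w := by
  funext t
  by_cases h : t ∈ Ioo 0 T
  · simp [cur_eq _ _ h, smul_comm c]
  · simp [cur, h]

theorem cur_zero (w : Word s) : cur L (0 : Fam T s) w = 0 := by
  simpa using cur_smul (L := L) 0 (0 : Fam T s) w

/-- Appending a derivative to a word. -/
def Word.cons (j : Dir) (w : Word s) (h : w.1.length < s) : Word s := ⟨j :: w.1, h⟩

/-- The Banach space of curves all of whose derivatives of order at most `s` in time and space are
continuous in `L²(ℝ³)` and that are supported in `|x| ≤ ρ + t`; a curve is represented by the family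
of its weighted derivatives. -/
def RegSp (ρ T L : ℝ) (s : ℕ) : Submodule ℝ (Fam T s) where
  carrier := {x | (∀ w, ∀ t ∈ Ioo 0 T, cur L x w t ∈ Supp (ρ + t)) ∧
    ∀ w j, ∀ h : w.1.length < s, IsD T j (cur L x w) (cur L x (Word.cons j w h))}
  add_mem' := by
    intro x y hx hy
    refine ⟨fun w t ht => ?_, fun w j h => ?_⟩
    · rw [cur_add]
      exact (Supp _).add_mem (hx.1 w t ht) (hy.1 w t ht)
    · rw [cur_add, cur_add]
      exact (hx.2 w j h).add (hy.2 w j h)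
  zero_mem' := by
    refine ⟨fun w t ht => ?_, fun w j h => ?_⟩
    · rw [cur_zero]
      exact (Supp _).zero_mem
    · rw [cur_zero, cur_zero]
      cases j with
      | none => exact fun t _ => hasDerivAt_const t 0
      | some i => exact fun t _ => WD.zero i
  smul_mem' := by
    intro c x hx
    refine ⟨fun w t ht => ?_, fun w j h => ?_⟩
    · rw [cur_smul]
      exact (Supp _).smul_mem c (hx.1 w t ht)
    · rw [cur_smul, cur_smul]
      exact (hx.2 w j h).smul c

theorem norm_cur_le (hL : 0 ≤ L) (x : Fam T s) (w : Word s) {t : ℝ} (ht : t ∈ Ioo 0 T) :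
    ‖cur L x w t‖ ≤ L ^ w.1.length * ‖x‖ * Real.exp (L * t) := by
  rw [cur_eq _ _ ht, norm_smul, Real.norm_of_nonneg (by positivity), mul_right_comm]
  gcongr
  exact ((x w).norm_coe_le_norm _).trans (norm_le_pi_norm x w)

theorem tendstoUniformlyOn_cur (hL : 0 ≤ L) {x : ℕ → Fam T s} {y : Fam T s}
    (h : Tendsto x atTop (𝓝 y)) (w : Word s) :
    TendstoUniformlyOn (fun n => cur L (x n) w) (cur L y w) atTop (Ioo 0 T) := by
  rw [Metric.tendstoUniformlyOn_iff]
  intro ε hε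
  set D := L ^ w.1.length * Real.exp (L * T) + 1 with hD
  have hD0 : 0 < D := by positivity
  filter_upwards [(tendsto_iff_norm_sub_tendsto_zero.1 h).eventually_lt_const
    (show 0 < ε / D by positivity)] with n hn t ht
  rw [dist_comm, dist_eq_norm]
  have e : cur L (x n) w t - cur L y w t = cur L (x n - y) w t := by
    rw [sub_eq_add_neg (x n), ← neg_one_smul ℝ y, cur_add, cur_smul]
    simp [sub_eq_add_neg]
  rw [e]
  refine (norm_cur_le hL _ w ht).trans_lt ?_
  calc _ = (L ^ w.1.length * Real.exp (L * t)) * ‖x n - y‖ := by ring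
    _ ≤ D * ‖x n - y‖ := by
      have : Real.exp (L * t) ≤ Real.exp (L * T) := by
        have := ht.2.le
        gcongr
      have : L ^ w.1.length * Real.exp (L * t) ≤ D := by
        rw [hD]
        have := mul_le_mul_of_nonneg_left this (pow_nonneg hL w.1.length)
        linarith
      exact mul_le_mul_of_nonneg_right this (norm_nonneg _)
    _ < D * (ε / D) := mul_lt_mul_of_pos_left hn hD0
    _ = ε := mul_div_cancel₀ _ hD0.ne'

/-- Differentiation in time and in space and the support condition pass to uniform limits, so the
regular curves form a Banach space. -/
theorem isClosed_RegSp (hL : 0 ≤ L) : IsClosed (RegSp ρ T L s : Set (Fam T s)) := by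
  refine IsSeqClosed.isClosed fun x y hx hxy => ?_
  have hu := tendstoUniformlyOn_cur hL hxy
  refine ⟨fun w t ht => ?_, fun w j h => ?_⟩
  · exact (isClosed_Supp _).mem_of_tendsto ((hu w).tendsto_at ht)
      (Eventually.of_forall fun n => (hx n).1 w t ht)
  · cases j with
    | none =>
      intro t ht
      exact hasDerivAt_of_tendstoUniformlyOn isOpen_Ioo (hu _)
        (Eventually.of_forall fun n t ht => (hx n).2 w none h t ht)
        (fun t ht => (hu w).tendsto_at ht) ht
    | some i =>
      intro t ht
      exact (isClosed_WD i).mem_of_tendsto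
        (((hu w).tendsto_at ht).prodMk_nhds ((hu (Word.cons (some i) w h)).tendsto_at ht))
        (Eventually.of_forall fun n => (hx n).2 w (some i) h t ht)

/-- The Banach space of regular curves. It is a type of its own, rather than the coercion of
`RegSp`, so that its norm is not unfolded in unification. -/
def RegCurve (ρ T L : ℝ) (s : ℕ) : Type := RegSp ρ T L s

instance : NormedAddCommGroup (RegCurve ρ T L s) :=
  inferInstanceAs (NormedAddCommGroup (RegSp ρ T L s))

instance : NormedSpace ℝ (RegCurve ρ T L s) :=
  inferInstanceAs (NormedSpace ℝ (RegSp ρ T L s))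

theorem completeSpace_regCurve (hL : 0 ≤ L) : CompleteSpace (RegCurve ρ T L s) :=
  (isClosed_RegSp hL).completeSpace_coe

/-- The curve represented by an element of `RegCurve`. -/
def cv (x : RegCurve ρ T L s) : ℝ → H := cur L x.1 ⟨[], Nat.zero_le s⟩

theorem cv_add (x y : RegCurve ρ T L s) : cv (x + y) = cv x + cv y := cur_add _ _ _

theorem cv_smul (c : ℝ) (x : RegCurve ρ T L s) : cv (c • x) = c • cv x := cur_smul _ _ _

theorem reg_cur (hL : 0 ≤ L) (x : RegCurve ρ T L s) (w : Word s) (h : w.1.length + n ≤ s) :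
    Reg ρ T L n (L ^ w.1.length * ‖x‖) (cur L x.1 w) := by
  have base : ∀ w : Word s, Reg0 ρ T L (L ^ w.1.length * ‖x‖) (cur L x.1 w) := by
    intro w
    refine ⟨?_, fun t ht => ⟨norm_cur_le hL x.1 w ht, x.2.1 w t ht⟩⟩
    rw [continuousOn_iff_continuous_domRestrict]
    have e : (Ioo 0 T).domRestrict (cur L x.1 w) =
        fun t : Ioo 0 T => (L ^ w.1.length * Real.exp (L * t.1)) • x.1 w t := by
      funext t
      rw [domRestrict_apply, cur_eq _ _ t.2]
    rw [e]
    have := (x.1 w).continuous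
    fun_prop
  induction n generalizing w with
  | zero => exact base w
  | succ n ih =>
    refine ⟨base w, fun j => ⟨_, x.2.2 w j (by omega), ?_⟩⟩
    have := ih (Word.cons j w (by omega)) (by simp only [Word.cons, List.length_cons]; omega)
    refine this.mono hL (le_of_eq ?_)
    simp only [Word.cons, List.length_cons, pow_succ]
    ring

theorem reg_cv (hL : 0 ≤ L) (x : RegCurve ρ T L s) : Reg ρ T L s ‖x‖ (cv x) := by
  unfold cv
  have h := reg_cur (n := s) hL x ⟨[], Nat.zero_le s⟩ (Nat.zero_add s).le
  rw [List.length_nil, pow_zero, one_mul] at h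
  exact h

/-- A regular curve determines its derivatives, hence the whole family that represents it. -/
theorem cv_injective (hL : 0 < L) {x y : RegCurve ρ T L s} (h : ∀ t ∈ Ioo 0 T, cv x t = cv y t) :
    x = y := by
  have key : ∀ (w : List Dir) (hw : w.length ≤ s), ∀ t ∈ Ioo 0 T,
      cur L x.1 ⟨w, hw⟩ t = cur L y.1 ⟨w, hw⟩ t := by
    intro w
    induction w with
    | nil => exact fun _ => h
    | cons j w ih =>
      intro hw t ht
      have hw' : w.length < s := hw
      have h1 : IsD T j (cur L x.1 ⟨w, hw'.le⟩) (cur L x.1 ⟨j :: w, hw⟩) := x.2.2 ⟨w, hw'.le⟩ j hw'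
      have h2 : IsD T j (cur L y.1 ⟨w, hw'.le⟩) (cur L y.1 ⟨j :: w, hw⟩) := y.2.2 ⟨w, hw'.le⟩ j hw'
      exact (h1.congr (ih hw'.le) fun _ _ => rfl).unique h2 ht
  refine Subtype.ext (funext fun w => BoundedContinuousFunction.ext fun t => ?_)
  have := key w.1 w.2 t.1 t.2
  rw [cur_eq _ _ t.2, cur_eq _ _ t.2] at this
  exact smul_right_injective H (by positivity : L ^ w.1.length * Real.exp (L * t.1) ≠ 0) this

open Classical in
/-- A choice of the derivative of a curve in the direction `j`. -/
def dirD (T : ℝ) (j : Dir) (u : ℝ → H) : ℝ → H := if h : ∃ u', IsD T j u u' then h.choose else 0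

theorem Reg.dirD (h : Reg ρ T L (n + 1) A u) (j : Dir) :
    IsD T j u (dirD T j u) ∧ Reg ρ T L n (L * A) (dirD T j u) := by
  obtain ⟨u', h1, h2⟩ := h.deriv j
  have hex : ∃ u', IsD T j u u' := ⟨u', h1⟩
  have e : IsD T j u (CubicWave.dirD T j u) := by
    rw [CubicWave.dirD, dif_pos hex]
    exact hex.choose_spec
  exact ⟨e, h2.congr fun t ht => h1.unique e ht⟩

theorem exists_cv_eq (hL : 0 < L) (hT : 0 < T) (h : Reg ρ T L s A u) :
    ∃ x : RegCurve ρ T L s, (∀ t ∈ Ioo 0 T, cv x t = u t) ∧ ‖x‖ ≤ A := by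
  have hA : 0 ≤ A := h.nonneg hT
  set D : List Dir → ℝ → H := fun w => w.foldr (dirD T) u with hD
  have hreg : ∀ w : List Dir, w.length ≤ s →
      Reg ρ T L (s - w.length) (L ^ w.length * A) (D w) := by
    intro w
    induction w with
    | nil => intro _; simpa [hD] using h
    | cons j w ih =>
      intro hw
      have hw' : w.length < s := hw
      have h1 := ih hw'.le
      obtain ⟨m, hm⟩ : ∃ m, s - w.length = m + 1 := ⟨s - w.length - 1, by omega⟩
      rw [hm] at h1
      have h2 := (h1.dirD j).2
      have e : s - (j :: w).length = m := by simp only [List.length_cons]; omega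
      rw [e, List.length_cons, pow_succ]
      refine h2.mono hL.le (le_of_eq ?_)
      ring
  have hder : ∀ (w : List Dir) (j : Dir), w.length < s → IsD T j (D w) (D (j :: w)) := by
    intro w j hw
    have h1 := hreg w hw.le
    obtain ⟨m, hm⟩ : ∃ m, s - w.length = m + 1 := ⟨s - w.length - 1, by omega⟩
    rw [hm] at h1
    exact (h1.dirD j).1
  let x : Fam T s := fun w => BoundedContinuousFunction.ofNormedAddCommGroup
    (fun t : Ioo 0 T => (L ^ w.1.length * Real.exp (L * t.1))⁻¹ • D w.1 t.1)
    (by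
      have h1 := continuousOn_iff_continuous_domRestrict.1 (hreg w.1 w.2).cont
      have h2 : Continuous fun t : Ioo 0 T => (L ^ w.1.length * Real.exp (L * t.1))⁻¹ :=
        Continuous.inv₀ (by fun_prop) fun t => by positivity
      exact h2.smul h1) A
    (fun t => by
      rw [norm_smul, norm_inv, Real.norm_of_nonneg (by positivity), inv_mul_le_iff₀ (by positivity)]
      refine ((hreg w.1 w.2).norm_le t.2).trans (le_of_eq ?_)
      ring)
  have hx : ∀ w, ∀ t ∈ Ioo 0 T, cur L x w t = D w.1 t := by
    intro w t ht
    rw [cur_eq _ _ ht]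
    simp only [x, BoundedContinuousFunction.coe_ofNormedAddCommGroup]
    rw [smul_inv_smul₀ (by positivity)]
  refine ⟨⟨x, fun w t ht => ?_, fun w j hj => ?_⟩, fun t ht => hx _ t ht, ?_⟩
  · rw [hx w t ht]
    exact (hreg w.1 w.2).supp ht
  · exact (hder w.1 j hj).congr (fun t ht => (hx w t ht).symm)
      fun t ht => (hx (Word.cons j w hj) t ht).symm
  · change ‖x‖ ≤ A
    refine (pi_norm_le_iff_of_nonneg hA).2 fun w => ?_
    exact BoundedContinuousFunction.norm_ofNormedAddCommGroup_le _ hA _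

/-- A map of curves that respects regularity acts as a bounded operator. -/
theorem exists_clm (hL : 0 < L) (hT : 0 < T) {C : ℝ} (Φ : (ℝ → H) → ℝ → H)
    (hreg : ∀ A u, Reg ρ T L s A u → Reg ρ T L s (C * A) (Φ u))
    (hadd : ∀ A B u v, Reg ρ T L s A u → Reg ρ T L s B v → ∀ t ∈ Ioo 0 T,
      Φ (u + v) t = Φ u t + Φ v t)
    (hsmul : ∀ (c : ℝ) A u, Reg ρ T L s A u → ∀ t ∈ Ioo 0 T, Φ (c • u) t = c • Φ u t) :
    ∃ K : RegCurve ρ T L s →L[ℝ] RegCurve ρ T L s, (∀ x, ‖K x‖ ≤ C * ‖x‖) ∧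
      ∀ x, ∀ t ∈ Ioo 0 T, cv (K x) t = Φ (cv x) t := by
  choose K hK hKn using fun x : RegCurve ρ T L s => exists_cv_eq hL hT (hreg _ _ (reg_cv hL.le x))
  refine ⟨LinearMap.mkContinuous ⟨⟨K, fun x y => ?_⟩, fun c x => ?_⟩ C hKn, hKn, hK⟩
  · refine cv_injective hL fun t ht => ?_
    rw [hK _ t ht, cv_add, cv_add, Pi.add_apply, hK _ t ht, hK _ t ht]
    exact hadd _ _ _ _ (reg_cv hL.le x) (reg_cv hL.le y) t ht
  · refine cv_injective hL fun t ht => ?_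
    simp only [RingHom.id_apply]
    rw [hK _ t ht, cv_smul, cv_smul, Pi.smul_apply, hK _ t ht]
    exact hsmul c _ _ (reg_cv hL.le x) t ht

/-- Evaluation at a time `t`. -/
theorem exists_eval (hL : 0 ≤ L) {t : ℝ} (ht : t ∈ Ioo 0 T) :
    ∃ e : RegCurve ρ T L s →L[ℝ] H, ∀ x, e x = cv x t :=
  ⟨LinearMap.mkContinuous ⟨⟨fun x => cv x t, fun x y => by rw [cv_add, Pi.add_apply]⟩,
    fun c x => congrFun (cv_smul c x) t⟩ (Real.exp (L * t)) fun x => by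
      rw [mul_comm]
      exact (reg_cv hL x).norm_le ht, fun _ => rfl⟩

/-! ### The operators of the cubic wave equation -/

theorem exists_mul_clm (hs : 3 ≤ s) (hL : 1 ≤ L) (hT : 0 < T) :
    ∃ P : RegCurve ρ T L s →L[ℝ] RegCurve ρ T L s →L[ℝ] RegCurve ρ T L s,
      (∀ x y, ‖P x y‖ ≤ prodC T L s * ‖x‖ * ‖y‖) ∧
      ∀ x y, ∀ t ∈ Ioo 0 T, cv (P x y) t = prod (cv x t) (cv y t) := by
  have hL0 : 0 < L := by linarith
  choose P hP hPn using fun x y : RegCurve ρ T L s => exists_cv_eq hL0 hT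
    (Reg.mul hL hT (reg_cv hL0.le x) (reg_cv hL0.le y) le_rfl le_rfl (by omega : s + 3 ≤ s + s))
  have hb : ∀ (x : RegCurve ρ T L s), ∀ t ∈ Ioo 0 T, ∃ C, Bdd C (cv x t) := fun x t ht =>
    ⟨_, (reg_cv hL0.le x).bdd hL hT (by omega) ht⟩
  refine ⟨LinearMap.mkContinuous₂ (LinearMap.mk₂ ℝ P ?_ ?_ ?_ ?_) (prodC T L s) hPn, hPn, hP⟩
  · refine fun x y z => cv_injective hL0 fun t ht => ?_
    obtain ⟨C, hC⟩ := hb x t ht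
    obtain ⟨C', hC'⟩ := hb y t ht
    rw [hP _ _ t ht, cv_add, cv_add, Pi.add_apply, Pi.add_apply, hP _ _ t ht, hP _ _ t ht]
    exact add_prod hC hC'
  · refine fun c x y => cv_injective hL0 fun t ht => ?_
    obtain ⟨C, hC⟩ := hb x t ht
    rw [hP _ _ t ht, cv_smul, cv_smul, Pi.smul_apply, Pi.smul_apply, hP _ _ t ht]
    exact smul_prod c hC
  · refine fun x y z => cv_injective hL0 fun t ht => ?_
    obtain ⟨C, hC⟩ := hb x t ht
    rw [hP _ _ t ht, cv_add, cv_add, Pi.add_apply, Pi.add_apply, hP _ _ t ht, hP _ _ t ht]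
    exact prod_add hC
  · refine fun c x y => cv_injective hL0 fun t ht => ?_
    obtain ⟨C, hC⟩ := hb x t ht
    rw [hP _ _ t ht, cv_smul, cv_smul, Pi.smul_apply, Pi.smul_apply, hP _ _ t ht]
    exact prod_smul c hC

theorem coeff_coe {V : ℝ × E3 → ℝ} (hV : Continuous V) (t : ℝ) {R : ℝ} {g : H} (hg : g ∈ Supp R) :
    ml (fun x => V (t, x)) g =ᵐ[μ₀] fun x => V (t, x) * g x := by
  have hc : Continuous fun x : E3 => V (t, x) := by fun_prop
  obtain ⟨C, hC⟩ := (isCompact_closedBall (0 : E3) R).exists_bound_of_continuousOn hc.continuousOn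
  refine ofFun_coe (memLp_ml (C := C) hc.aestronglyMeasurable ?_)
  filter_upwards [mem_Supp.1 hg] with x hx
  by_cases hxR : R < ‖x‖
  · simp [hx hxR]
  · rw [abs_mul]
    exact mul_le_mul_of_nonneg_right (hC x (by simpa using hxR)) (abs_nonneg _)

theorem exists_coeff_clm (hL : 1 ≤ L) (hT : 0 < T) {M : ℝ} (hM : 0 ≤ M) {V : ℝ × E3 → ℝ}
    (hV : IsCoeff s T ρ M V) :
    ∃ K : RegCurve ρ T L s →L[ℝ] RegCurve ρ T L s, (∀ x, ‖K x‖ ≤ 2 ^ s * M * ‖x‖) ∧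
      ∀ x, ∀ t ∈ Ioo 0 T, cv (K x) t = ml (fun y => V (t, y)) (cv x t) := by
  have hVc := hV.1.continuous
  refine exists_clm (by linarith) hT (fun u t => ml (fun y => V (t, y)) (u t))
    (fun A u hu => hu.coeff hL hT hM hV) (fun A B u v hu hv t ht => ?_) (fun c A u hu t ht => ?_)
  · refine Lp.ext ?_
    filter_upwards [coeff_coe hVc t ((hu.add hv).supp ht), coeff_coe hVc t (hu.supp ht),
      coeff_coe hVc t (hv.supp ht), Lp.coeFn_add (u t) (v t),
      Lp.coeFn_add (ml (fun y => V (t, y)) (u t)) (ml (fun y => V (t, y)) (v t))]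
      with x h1 h2 h3 h4 h5
    rw [h1, h5, Pi.add_apply, Pi.add_apply, h4, Pi.add_apply, h2, h3, mul_add]
  · refine Lp.ext ?_
    filter_upwards [coeff_coe hVc t ((hu.smul c).supp ht), coeff_coe hVc t (hu.supp ht),
      Lp.coeFn_smul c (u t), Lp.coeFn_smul c (ml (fun y => V (t, y)) (u t))] with x h1 h2 h3 h4
    rw [h1, h4, Pi.smul_apply, Pi.smul_apply, h3, Pi.smul_apply, h2, smul_eq_mul, smul_eq_mul]
    ring

theorem exists_kir_clm (hL : 1 ≤ L) (hT : 0 < T) :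
    ∃ K : RegCurve ρ T L s →L[ℝ] RegCurve ρ T L s, (∀ x, ‖K x‖ ≤ kopC T L s 2 * ‖x‖) ∧
      ∀ x, ∀ t ∈ Ioo 0 T, cv (K x) t = kir (cv x) t := by
  have hL0 : 0 ≤ L := by linarith
  refine exists_clm (by linarith) hT kir (fun A u hu => hu.kir hL hT)
    (fun A B u v hu hv t ht => ?_) (fun c A u hu t ht => ?_)
  · have i1 := integrable_kop hL0 (hu.nonneg hT) hu.reg0 dens_fst ht
    have i2 := integrable_kop hL0 (hv.nonneg hT) hv.reg0 dens_fst ht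
    simp only [kir, kop, Pi.add_apply, map_add, smul_add]
    rw [integral_add i1 i2, smul_add]
  · simp only [kir, kop, Pi.smul_apply, map_smul]
    rw [smul_comm c, ← integral_smul c]
    congr 1
    refine integral_congr_ae (Eventually.of_forall fun q => ?_)
    exact smul_comm _ _ _

end

/-! ### Restriction to a subset -/

section

variable {Ω : Set E3} {m s k n : ℕ} {ρ T L A : ℝ} {u : ℝ → H}

theorem res_coe (g : H) : res Ω g =ᵐ[(volume : Measure E3).restrict Ω] g := MemLp.coeFn_toLp _

theorem ae_restrict_of_ae_μ₀ {p : E3 → Prop} (h : ∀ᵐ x ∂μ₀, p x) :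
    ∀ᵐ x ∂(volume : Measure E3).restrict Ω, p x :=
  ae_restrict_of_ae (ae_μ₀_iff.1 h)

/-- The restriction operator `L²(ℝ³) → L²(Ω)`. -/
def resL (Ω : Set E3) : H →L[ℝ] L2 Ω :=
  LinearMap.mkContinuous ⟨⟨res Ω, fun g k => by
    refine Lp.ext ?_
    filter_upwards [res_coe (Ω := Ω) (g + k), res_coe (Ω := Ω) g, res_coe (Ω := Ω) k,
      Lp.coeFn_add (res Ω g) (res Ω k), ae_restrict_of_ae_μ₀ (Ω := Ω) (Lp.coeFn_add g k)]
      with x h1 h2 h3 h4 h5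
    rw [h1, h4, Pi.add_apply, h2, h3, h5, Pi.add_apply]⟩, fun c g => by
    refine Lp.ext ?_
    filter_upwards [res_coe (Ω := Ω) (c • g), res_coe (Ω := Ω) g, Lp.coeFn_smul c (res Ω g),
      ae_restrict_of_ae_μ₀ (Ω := Ω) (Lp.coeFn_smul c g)] with x h1 h2 h3 h4
    simp only [RingHom.id_apply]
    rw [h1, h3, Pi.smul_apply, h2, h4, Pi.smul_apply]⟩ 1 fun g => by
    change ‖res Ω g‖ ≤ 1 * ‖g‖
    rw [one_mul, res, Lp.norm_toLp, Lp.norm_def]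
    exact ENNReal.toReal_mono (Lp.eLpNorm_ne_top g)
      (eLpNorm_mono_measure _ (Measure.restrict_mono_set volume (subset_univ Ω)))

theorem resL_apply (g : H) : resL Ω g = res Ω g := rfl

theorem norm_res_le (g : H) : ‖res Ω g‖ ≤ ‖g‖ := by
  rw [res, Lp.norm_toLp, Lp.norm_def]
  exact ENNReal.toReal_mono (Lp.eLpNorm_ne_top g)
    (eLpNorm_mono_measure _ (Measure.restrict_mono_set volume (subset_univ Ω)))

theorem res_univ (g : H) : res univ g = g := Lp.ext (res_coe g)

theorem tsupport_pderiv_subset (i : Fin 3) (φ : E3 → ℝ) : tsupport (pderiv i φ) ⊆ tsupport φ :=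
  tsupport_fderiv_apply_subset ℝ (EuclideanSpace.single i 1)

theorem tsupport_pderivs_subset (α : Fin 3 → ℕ) (φ : E3 → ℝ) :
    tsupport (pderivs α φ) ⊆ tsupport φ := by
  have it : ∀ (i : Fin 3) (n : ℕ) (φ : E3 → ℝ), tsupport ((pderiv i)^[n] φ) ⊆ tsupport φ := by
    intro i n
    induction n with
    | zero => exact fun φ => subset_rfl
    | succ n ih => exact fun φ => (ih _).trans (tsupport_pderiv_subset i φ)
  exact (it 0 _ _).trans ((it 1 _ _).trans (it 2 _ _))

theorem HasWeakDeriv.res {α : Fin 3 → ℕ} {g g' : H} (h : HasWeakDeriv univ α g g') :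
    HasWeakDeriv Ω α (res Ω g) (res Ω g') := by
  have key : ∀ (g : H) (φ : E3 → ℝ), tsupport φ ⊆ Ω →
      ∫ x in Ω, CubicWave.res Ω g x * φ x = ∫ x in univ, g x * φ x := by
    intro g φ hφ
    have e : ∫ x in univ, g x * φ x = ∫ x in Ω, g x * φ x := by
      rw [setIntegral_univ]
      refine (setIntegral_eq_integral_of_forall_compl_eq_zero fun x hx => ?_).symm
      rw [image_eq_zero_of_notMem_tsupport fun hx' => hx (hφ hx'), mul_zero]
    rw [e]
    · refine integral_congr_ae ?_
      filter_upwards [res_coe (Ω := Ω) g] with x hx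
      rw [hx]
  intro φ hφ
  rw [key _ _ ((tsupport_pderivs_subset α φ).trans hφ.2.2), key _ _ hφ.2.2]
  exact h φ ⟨hφ.1, hφ.2.1, subset_univ _⟩

theorem Sob.norm_le_sum (G : Sob Ω m) : ‖G‖ ≤ ∑ α, ‖Sob.comp α G‖ := by
  change ‖G.1‖ ≤ _
  rw [PiLp.norm_eq_of_L2]
  refine Real.sqrt_le_iff.2 ⟨Finset.sum_nonneg fun _ _ => norm_nonneg _, ?_⟩
  exact Finset.sum_sq_le_sq_sum_of_nonneg fun _ _ => norm_nonneg _

/-- The restriction operator `H^m(ℝ³) → H^m(Ω)`. -/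
def resS (Ω : Set E3) (m : ℕ) : Sob univ m →L[ℝ] Sob Ω m :=
  LinearMap.mkContinuous
    ⟨⟨fun G => ⟨WithLp.toLp 2 fun α => resL Ω (G.1 α), fun α => (Sob.weakDeriv G α).res⟩,
      fun G G' => Subtype.ext (PiLp.ext fun α => map_add (resL Ω) _ _)⟩,
      fun c G => Subtype.ext (PiLp.ext fun α => map_smul (resL Ω) c _)⟩ 1 fun G => by
    change ‖(WithLp.toLp 2 fun α => resL Ω (G.1 α) : PiLp 2 fun _ : multiIdx m => L2 Ω)‖ ≤ 1 * ‖G.1‖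
    rw [one_mul, PiLp.norm_eq_of_L2, PiLp.norm_eq_of_L2]
    refine Real.sqrt_le_sqrt (Finset.sum_le_sum fun α _ => ?_)
    exact pow_le_pow_left₀ (norm_nonneg _) (norm_res_le _) 2

theorem toL2_resS (G : Sob univ m) : Sob.toL2 (resS Ω m G) = res Ω (Sob.toL2 G) := rfl

theorem norm_resS_le (G : Sob univ m) : ‖resS Ω m G‖ ≤ ‖G‖ := by
  have := (resS Ω m).le_of_opNorm_le (LinearMap.mkContinuous_norm_le _ zero_le_one _) G
  rwa [one_mul] at this

/-! ### Regular curves belong to `⋂ C^k H^{s-k}` -/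

theorem hasDerivAt_sob {U : ℝ → Sob Ω m} {W : Sob Ω m} {t : ℝ}
    (h : ∀ α, HasDerivAt (fun r => Sob.comp α (U r)) (Sob.comp α W) t) : HasDerivAt U W t := by
  rw [hasDerivAt_iff_isLittleO]
  refine Asymptotics.IsBigO.trans_isLittleO
    (g := fun r => ∑ α, ‖Sob.comp α (U r) - Sob.comp α (U t) - (r - t) • Sob.comp α W‖) ?_ ?_
  · refine Asymptotics.IsBigO.of_bound 1 (Eventually.of_forall fun r => ?_)
    rw [one_mul, Real.norm_of_nonneg (Finset.sum_nonneg fun _ _ => norm_nonneg _)]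
    refine (Sob.norm_le_sum _).trans (le_of_eq ?_)
    simp only [map_sub, map_smul]
  · exact Asymptotics.IsLittleO.fun_sum fun α _ => (hasDerivAt_iff_isLittleO.1 (h α)).norm_left

theorem continuousAt_sob {U : ℝ → Sob Ω m} {t : ℝ}
    (h : ∀ α, ContinuousAt (fun r => Sob.comp α (U r)) t) : ContinuousAt U t := by
  rw [ContinuousAt, tendsto_iff_norm_sub_tendsto_zero]
  refine squeeze_zero (g := fun r => ∑ α, ‖Sob.comp α (U r) - Sob.comp α (U t)‖)
    (fun _ => norm_nonneg _) (fun r => ?_) ?_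
  · refine (Sob.norm_le_sum _).trans (le_of_eq ?_)
    simp only [map_sub]
  · simpa using tendsto_finsetSum (Finset.univ : Finset (multiIdx m)) fun α _ =>
      tendsto_iff_norm_sub_tendsto_zero.1 (h α)

theorem Reg.exists_weak (k : ℕ) : ∀ α : Fin 3 → ℕ, ∑ i, α i = k → ∀ n, Reg ρ T L (k + n) A u →
    ∃ v, (∀ t ∈ Ioo 0 T, HasWeakDeriv univ α (u t) (v t)) ∧ Reg ρ T L n (L ^ k * A) v := by
  induction k with
  | zero =>
    intro α hα n hu
    have hα0 : α = 0 := by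
      funext i
      have := Finset.single_le_sum (f := α) (fun _ _ => Nat.zero_le _) (Finset.mem_univ i)
      simp only [Pi.zero_apply]
      omega
    subst hα0
    refine ⟨u, fun t _ => hasWeakDeriv_zero_idx, ?_⟩
    rw [zero_add] at hu
    rwa [pow_zero, one_mul]
  | succ k ih =>
    intro α hα n hu
    obtain ⟨i, hi⟩ : ∃ i, α i ≠ 0 := by
      by_contra! hc
      simp [hc] at hα
    obtain ⟨β, rfl⟩ : ∃ β, α = β + Pi.single i 1 := by
      refine ⟨α - Pi.single i 1, (tsub_add_cancel_of_le fun j => ?_).symm⟩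
      by_cases hj : j = i
      · subst hj
        simpa using Nat.one_le_iff_ne_zero.2 hi
      · simp [hj]
    rw [sum_add_single] at hα
    rw [show k + 1 + n = k + (n + 1) by ring] at hu
    obtain ⟨v, h1, h2⟩ := ih β (by omega) (n + 1) hu
    obtain ⟨w, h3, h4⟩ := h2.deriv (some i)
    refine ⟨w, fun t ht => (h1 t ht).of_wd (h3 t ht), ?_⟩
    rwa [← mul_assoc, ← pow_succ'] at h4

/-- The constant that bounds the `H^m` norm by the weighted norm. -/
def sobConst (T L : ℝ) (m : ℕ) : ℝ := Fintype.card (multiIdx m) * (L ^ m * Real.exp (L * T))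

/-- A regular curve with `m + n` derivatives is a curve of class `C^n` in `H^m(ℝ³)`. -/
theorem Reg.exists_sob (hL : 1 ≤ L) (hT : 0 < T) (n : ℕ) (h : Reg ρ T L (m + n) A u) :
    ∃ U : ℝ → Sob univ m, (∀ t ∈ Ioo 0 T, Sob.toL2 (U t) = u t) ∧ ContDiffOn ℝ n U (Ioo 0 T) ∧
      ∀ t ∈ Ioo 0 T, ‖U t‖ ≤ sobConst T L m * A := by
  have hA := h.nonneg hT
  have ex : ∀ (n : ℕ) (A : ℝ) (u : ℝ → H), Reg ρ T L (m + n) A u → 0 ≤ A →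
      ∃ (U : ℝ → Sob univ m) (v : multiIdx m → ℝ → H),
        (∀ t ∈ Ioo 0 T, Sob.toL2 (U t) = u t) ∧ (∀ α, ∀ t ∈ Ioo 0 T, Sob.comp α (U t) = v α t) ∧
        (∀ α, ∀ t ∈ Ioo 0 T, HasWeakDeriv univ α.1 (u t) (v α t)) ∧
        ∀ α, Reg ρ T L n (L ^ m * A) (v α) := by
    intro n A u h hA
    have hv : ∀ α : multiIdx m, ∃ v, (∀ t ∈ Ioo 0 T, HasWeakDeriv univ α.1 (u t) (v t)) ∧
        Reg ρ T L n (L ^ m * A) v := by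
      intro α
      have hα := mem_multiIdx.1 α.2
      obtain ⟨v, h1, h2⟩ := Reg.exists_weak (∑ i, α.1 i) α.1 rfl n (h.le (by omega))
      refine ⟨v, h1, h2.mono (by linarith) ?_⟩
      exact mul_le_mul_of_nonneg_right (pow_le_pow_right₀ hL hα) hA
    choose v hv1 hv2 using hv
    have h0 : ∀ t ∈ Ioo 0 T, v ⟨0, zero_mem_multiIdx m⟩ t = u t := fun t ht =>
      (hv1 _ t ht).unique hasWeakDeriv_zero_idx
    classical
    let U : ℝ → Sob univ m := fun t => if ht : t ∈ Ioo 0 T then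
      ⟨WithLp.toLp 2 fun α => v α t, fun α => by
        change HasWeakDeriv univ α.1 (v _ t) (v α t)
        rw [h0 t ht]
        exact hv1 α t ht⟩ else 0
    have hU : ∀ α, ∀ t ∈ Ioo 0 T, Sob.comp α (U t) = v α t := by
      intro α t ht
      simp only [U, dif_pos ht]
      rfl
    exact ⟨U, v, fun t ht => (hU _ t ht).trans (h0 t ht), hU, hv1, hv2⟩
  have hsm : ∀ (n : ℕ) (A : ℝ) (u : ℝ → H), Reg ρ T L (m + n) A u → 0 ≤ A → ∀ U : ℝ → Sob univ m,
      (∀ t ∈ Ioo 0 T, Sob.toL2 (U t) = u t) → ContDiffOn ℝ n U (Ioo 0 T) := by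
    intro n
    induction n with
    | zero =>
      intro A u h hA U hU
      obtain ⟨U', v, h1, h2, -, h4⟩ := ex 0 A u h hA
      have e : ∀ t ∈ Ioo 0 T, U t = U' t := fun t ht =>
        Sob.toL2_injective ((hU t ht).trans (h1 t ht).symm)
      rw [Nat.cast_zero]
      refine contDiffOn_zero.2 fun t ht => ContinuousAt.continuousWithinAt ?_
      refine continuousAt_sob fun α => ?_
      refine ((h4 α).cont.continuousAt (isOpen_Ioo.mem_nhds ht)).congr ?_
      filter_upwards [isOpen_Ioo.mem_nhds ht] with r hr
      rw [e r hr, h2 α r hr]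
    | succ n ih =>
      intro A u h hA U hU
      obtain ⟨U', v, h1, h2, h3, h4⟩ := ex (n + 1) A u h hA
      have e : ∀ t ∈ Ioo 0 T, U t = U' t := fun t ht =>
        Sob.toL2_injective ((hU t ht).trans (h1 t ht).symm)
      obtain ⟨u', d1, d2⟩ := Reg.deriv (n := m + n) h none
      have hLA : 0 ≤ L * A := by positivity
      obtain ⟨W, v', w1, w2, w3, w4⟩ := ex n (L * A) u' d2 hLA
      have hd : ∀ t ∈ Ioo 0 T, HasDerivAt U (W t) t := by
        intro t ht
        refine hasDerivAt_sob fun α => ?_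
        obtain ⟨z, z1, -⟩ := (h4 α).deriv none
        have ez : z t = v' α t := by
          refine HasWeakDeriv.unique (hasWeakDeriv_univ_iff.2 fun φ hφ => ?_) (w3 α t ht)
          have i1 := (d1 t ht).inner ℝ (hasDerivAt_const t (ofFun (pderivs α.1 φ)))
          have i2 := ((z1 t ht).inner ℝ (hasDerivAt_const t (ofFun φ))).const_mul
            ((-1) ^ (∑ i, α.1 i) : ℝ)
          simp only [inner_zero_right, zero_add] at i1 i2
          refine i1.unique (i2.congr_of_eventuallyEq ?_)
          filter_upwards [isOpen_Ioo.mem_nhds ht] with r hr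
          exact hasWeakDeriv_univ_iff.1 (h3 α r hr) φ hφ
        rw [w2 α t ht, ← ez]
        refine (z1 t ht).congr_of_eventuallyEq ?_
        filter_upwards [isOpen_Ioo.mem_nhds ht] with r hr
        rw [e r hr, h2 α r hr]
      rw [Nat.cast_succ, contDiffOn_succ_iff_deriv_of_isOpen isOpen_Ioo]
      refine ⟨fun t ht => (hd t ht).differentiableAt.differentiableWithinAt, by simp, ?_⟩
      exact (ih (L * A) u' d2 hLA W w1).congr fun t ht => (hd t ht).deriv
  obtain ⟨U, v, h1, h2, -, h4⟩ := ex n A u h hA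
  refine ⟨U, h1, hsm n A u h hA U h1, fun t ht => ?_⟩
  refine (Sob.norm_le_sum _).trans ?_
  have hb : ∀ α, ‖Sob.comp α (U t)‖ ≤ L ^ m * A * Real.exp (L * T) := by
    intro α
    rw [h2 α t ht]
    refine ((h4 α).norm_le ht).trans ?_
    have := ht.2.le
    gcongr
  refine (Finset.sum_le_sum fun α _ => hb α).trans (le_of_eq ?_)
  rw [Finset.sum_const, Finset.card_univ, nsmul_eq_mul, sobConst]
  ring

theorem Reg.memHs (hL : 1 ≤ L) (hT : 0 < T) (h : Reg ρ T L s A u) :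
    MemHs s T Ω fun t => res Ω (u t) := by
  intro k hk
  have h' : Reg ρ T L (s - k + k) A u := by rwa [Nat.sub_add_cancel hk]
  obtain ⟨U, h1, h2, -⟩ := h'.exists_sob hL hT k
  refine ⟨fun t => resS Ω _ (U t), (resS Ω (s - k)).contDiff.comp_contDiffOn h2, fun t ht => ?_⟩
  rw [toL2_resS, h1 t ht]

theorem Reg.iteratedDeriv (k : ℕ) : ∀ {A : ℝ} {u : ℝ → H}, Reg ρ T L (n + k) A u →
    Reg ρ T L n (L ^ k * A) (iteratedDeriv k u) := by
  induction k with
  | zero =>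
    intro A u h
    rw [pow_zero, one_mul, iteratedDeriv_zero]
    exact h
  | succ k ih =>
    intro A u h
    obtain ⟨u', h1, h2⟩ := Reg.deriv (n := n + k) h none
    have h3 := ih h2
    rw [pow_succ, mul_assoc]
    refine h3.congr fun t ht => ?_
    rw [iteratedDeriv_succ']
    exact iteratedDeriv_congr (fun r hr => (h1 r hr).deriv.symm) ht

/-- The constant that bounds the `ℋ^s` norm by the weighted norm. -/
def hsConst (T L : ℝ) (s : ℕ) : ℝ :=
  ∑ k ∈ Finset.range (s + 1), sobConst T L (s - k) * L ^ k

theorem sobConst_nonneg (hL : 0 ≤ L) (m : ℕ) : 0 ≤ sobConst T L m := by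
  unfold sobConst
  positivity

theorem hsConst_nonneg (hL : 0 ≤ L) (s : ℕ) : 0 ≤ hsConst T L s :=
  Finset.sum_nonneg fun k _ => mul_nonneg (sobConst_nonneg hL _) (pow_nonneg hL k)

/-- The weighted norm of a regular curve controls the `ℋ^s` norm of its restrictions. -/
theorem Reg.hsENorm_res_le (hL : 1 ≤ L) (hT : 0 < T) (h : Reg ρ T L s A u) :
    hsENorm s T Ω (fun t => res Ω (u t)) ≤ ENNReal.ofReal (hsConst T L s * A) := by
  have hL0 : 0 ≤ L := by linarith
  have hA := h.nonneg hT
  rw [hsENorm, if_pos (h.memHs hL hT), hsConst, Finset.sum_mul, ENNReal.ofReal_sum_of_nonneg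
    fun k _ => mul_nonneg (mul_nonneg (sobConst_nonneg hL0 _) (pow_nonneg hL0 k)) hA]
  refine Finset.sum_le_sum fun k hk => iSup₂_le fun t ht => ?_
  have hk' : k ≤ s := Nat.lt_succ_iff.1 (Finset.mem_range.1 hk)
  have h' : Reg ρ T L (s - k + k) A u := by rwa [Nat.sub_add_cancel hk']
  obtain ⟨U, h1, h2, -⟩ := h'.exists_sob hL hT k
  have hu : ContDiffOn ℝ k u (Ioo 0 T) :=
    (Sob.incl.contDiff.comp_contDiffOn h2).congr fun t ht => (h1 t ht).symm
  obtain ⟨W, w1, -, w3⟩ := Reg.exists_sob (m := s - k) (n := 0) hL hT (Reg.iteratedDeriv k h')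
  have e : _root_.iteratedDeriv k (fun t => res Ω (u t)) t = Sob.toL2 (resS Ω (s - k) (W t)) := by
    rw [toL2_resS, w1 t ht]
    exact iteratedDeriv_clm (resL Ω) isOpen_Ioo hu ht
  rw [e]
  refine (sobENorm_toL2_le _).trans ?_
  rw [← ofReal_norm]
  refine ENNReal.ofReal_le_ofReal ((norm_resS_le _).trans ((w3 t ht).trans (le_of_eq ?_)))
  ring

theorem Reg.hsENorm_lt_top (hL : 1 ≤ L) (hT : 0 < T) (h : Reg ρ T L s A u) :
    hsENorm s T univ u < ⊤ := by
  have := h.hsENorm_res_le (Ω := univ) hL hT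
  simp only [res_univ] at this
  exact this.trans_lt ENNReal.ofReal_lt_top

/-! ### The norm of `⋂ C^k H^{s-k}` -/

theorem MemHs.congr {u v : ℝ → L2 Ω} (h : MemHs s T Ω u) (e : ∀ t ∈ Ioo 0 T, u t = v t) :
    MemHs s T Ω v := fun k hk => by
  obtain ⟨U, h1, h2⟩ := h k hk
  exact ⟨U, h1, fun t ht => (h2 t ht).trans (e t ht)⟩

theorem hsENorm_congr {u v : ℝ → L2 Ω} (e : ∀ t ∈ Ioo 0 T, u t = v t) :
    hsENorm s T Ω u = hsENorm s T Ω v := by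
  have hiff : MemHs s T Ω u ↔ MemHs s T Ω v :=
    ⟨fun h => h.congr e, fun h => h.congr fun t ht => (e t ht).symm⟩
  rw [hsENorm, hsENorm]
  by_cases h : MemHs s T Ω u
  · rw [if_pos h, if_pos (hiff.1 h)]
    refine Finset.sum_congr rfl fun k _ => iSup_congr fun t => iSup_congr fun ht => ?_
    rw [iteratedDeriv_congr e ht]
  · rw [if_neg h, if_neg (mt hiff.2 h)]

theorem sobENorm_add_le (g k : L2 Ω) :
    sobENorm Ω m (g + k) ≤ sobENorm Ω m g + sobENorm Ω m k := by
  unfold sobENorm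
  simp only [ENNReal.iInf_add, ENNReal.add_iInf]
  refine le_iInf fun G => le_iInf fun hG => le_iInf fun K => le_iInf fun hK => ?_
  refine (iInf₂_le (G + K) ?_).trans ((enorm_add_le G K).trans (add_comm _ _).le)
  rw [← hG, ← hK]
  exact (map_add Sob.incl G K).trans (add_comm _ _)

theorem sobENorm_smul_le {c : ℝ} (hc : c ≠ 0) (g : L2 Ω) :
    sobENorm Ω m (c • g) ≤ ‖c‖ₑ * sobENorm Ω m g := by
  unfold sobENorm
  simp only [ENNReal.mul_iInf_of_ne (enorm_ne_zero.2 hc) enorm_ne_top]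
  refine le_iInf fun G => le_iInf fun hG => ?_
  refine (iInf₂_le (c • G) ?_).trans (enorm_smul c G).le
  rw [← hG]
  exact map_smul Sob.incl c G

theorem MemHs.contDiffOn {u : ℝ → L2 Ω} (h : MemHs s T Ω u) (hk : k ≤ s) :
    ContDiffOn ℝ k u (Ioo 0 T) := by
  obtain ⟨U, h1, h2⟩ := h k hk
  exact (Sob.incl.contDiff.comp_contDiffOn h1).congr fun t ht => (h2 t ht).symm

theorem hsENorm_add_le (u v : ℝ → L2 Ω) :
    hsENorm s T Ω (u + v) ≤ hsENorm s T Ω u + hsENorm s T Ω v := by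
  by_cases hu : MemHs s T Ω u
  swap
  · rw [hsENorm.eq_1 s T Ω u, if_neg hu, top_add]
    exact le_top
  by_cases hv : MemHs s T Ω v
  swap
  · rw [hsENorm.eq_1 s T Ω v, if_neg hv, add_top]
    exact le_top
  have huv : MemHs s T Ω (u + v) := fun k hk => by
    obtain ⟨U, h1, h2⟩ := hu k hk
    obtain ⟨W, h3, h4⟩ := hv k hk
    refine ⟨U + W, h1.add h3, fun t ht => ?_⟩
    rw [Pi.add_apply, Pi.add_apply, ← h2 t ht, ← h4 t ht]
    exact map_add Sob.incl _ _
  rw [hsENorm, hsENorm, hsENorm, if_pos hu, if_pos hv, if_pos huv, ← Finset.sum_add_distrib]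
  refine Finset.sum_le_sum fun k hk => iSup₂_le fun t ht => ?_
  have hk' : k ≤ s := Nat.lt_succ_iff.1 (Finset.mem_range.1 hk)
  have hn := isOpen_Ioo.mem_nhds ht
  rw [iteratedDeriv_add ((hu.contDiffOn hk').contDiffAt hn) ((hv.contDiffOn hk').contDiffAt hn)]
  refine (sobENorm_add_le _ _).trans (add_le_add ?_ ?_)
  · exact le_iSup₂ (f := fun t (_ : t ∈ Ioo 0 T) => sobENorm Ω (s - k) (iteratedDeriv k u t)) t ht
  · exact le_iSup₂ (f := fun t (_ : t ∈ Ioo 0 T) => sobENorm Ω (s - k) (iteratedDeriv k v t)) t ht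

theorem hsENorm_smul_le {c : ℝ} (hc : c ≠ 0) (u : ℝ → L2 Ω) :
    hsENorm s T Ω (c • u) ≤ ‖c‖ₑ * hsENorm s T Ω u := by
  by_cases hu : MemHs s T Ω u
  swap
  · rw [hsENorm.eq_1 s T Ω u, if_neg hu, ENNReal.mul_top (enorm_ne_zero.2 hc)]
    exact le_top
  have hcu : MemHs s T Ω (c • u) := fun k hk => by
    obtain ⟨U, h1, h2⟩ := hu k hk
    refine ⟨c • U, h1.const_smul c, fun t ht => ?_⟩
    rw [Pi.smul_apply, Pi.smul_apply, ← h2 t ht]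
    exact map_smul Sob.incl _ _
  rw [hsENorm, hsENorm, if_pos hu, if_pos hcu, Finset.mul_sum]
  refine Finset.sum_le_sum fun k hk => iSup₂_le fun t ht => ?_
  have hk' : k ≤ s := Nat.lt_succ_iff.1 (Finset.mem_range.1 hk)
  have hn := isOpen_Ioo.mem_nhds ht
  rw [iteratedDeriv_const_smul ((hu.contDiffOn hk').contDiffAt hn)]
  refine (sobENorm_smul_le hc _).trans (mul_le_mul_right ?_ _)
  exact le_iSup₂ (f := fun t (_ : t ∈ Ioo 0 T) => sobENorm Ω (s - k) (iteratedDeriv k u t)) t ht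

end

/-! ### The linear wave equation with a potential, and its cubic interaction -/

variable {ρ T L M : ℝ} {s : ℕ} {V h : ℝ × E3 → ℝ}

theorem IsWaveSol.congr {F F' : ℝ → E3 → ℝ} {u : ℝ → H} (hu : IsWaveSol s T V F u)
    (e : ∀ t ∈ Ioo 0 T, ∀ᵐ x ∂(volume : Measure E3), F t x = F' t x) :
    IsWaveSol s T V F' u := by
  refine ⟨hu.1, hu.2.1, hu.2.2.1, fun t ht => ?_⟩
  obtain ⟨l, l1, l2⟩ := hu.2.2.2 t ht
  refine ⟨l, l1, ?_⟩
  filter_upwards [l2, e t ht] with x hx hx'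
  rw [hx, hx']

/-- A regular curve of the form `kir y`, extended by zero to negative times, is a strong solution
of the wave equation: the potential is moved to the right hand side. -/
theorem isWaveSol_zext (hs : 2 ≤ s) (hL : 1 ≤ L) (hT : 0 < T) {x y : RegCurve ρ T L s}
    (hx : ∀ t ∈ Ioo 0 T, cv x t = kir (cv y) t) {F : ℝ → E3 → ℝ}
    (hF : ∀ t ∈ Ioo 0 T, ∀ᵐ p ∂(volume : Measure E3), cv y t p + V (t, p) * cv x t p = F t p) :
    IsWaveSol s T V F (zext T (cv x)) := by
  have hL0 : 0 ≤ L := zero_le_one.trans hL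
  have rx := reg_cv hL0 x
  have ry := reg_cv hL0 y
  obtain ⟨n, rfl⟩ : ∃ n, s = n + 2 := ⟨s - 2, (Nat.sub_add_cancel hs).symm⟩
  obtain ⟨k, k1, k2⟩ := rx.deriv none
  obtain ⟨k', k3, -⟩ := k2.deriv none
  choose a a1 a2 using fun i => rx.deriv (some i)
  choose b b1 b2 using fun i => (a2 i).deriv (some i)
  have hk : IsD T none (kir (cv y)) k := k1.congr hx fun _ _ => rfl
  obtain ⟨B, hB⟩ := kir_deriv_le hL hT (ry.le (m := 1) (by lia)) hk
  refine ⟨?_, fun t ht => zext_nonpos ht, contDiffOn_zext k1 k2.cont (B := B) ?_, ?_⟩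
  · rw [hsENorm_congr fun t ht => zext_eq ht]
    exact rx.hsENorm_lt_top hL hT
  · intro t ht
    rw [hx t ht]
    exact hB t ht
  · intro t ht
    refine ⟨fun i => b i t, fun i => ?_, ?_⟩
    · rw [zext_eq ht]
      exact hasWeakDeriv_two (a1 i t ht) (b1 i t ht)
    · have hd : deriv (deriv (zext T (cv x))) t = k' t := by
        have e : deriv (zext T (cv x)) =ᶠ[𝓝 t] k := by
          filter_upwards [isOpen_Ioo.mem_nhds ht] with r hr
          rw [(zext_eventuallyEq hr).deriv_eq]
          exact (k1 r hr).deriv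
        rw [e.deriv_eq]
        exact (k3 t ht).deriv
      have hw : k' t = cv y t + ∑ i, b i t :=
        kir_wave hL0 (norm_nonneg y) ry.reg0 hk k3 ht
          (fun i => by rw [← hx t ht]; exact a1 i t ht) fun i => b1 i t ht
      rw [hd, zext_eq ht, hw, Fin.sum_univ_three]
      rw [← ae_μ₀_iff]
      filter_upwards [Lp.coeFn_add (cv y t) (b 0 t + b 1 t + b 2 t),
        Lp.coeFn_add (b 0 t + b 1 t) (b 2 t), Lp.coeFn_add (b 0 t) (b 1 t),
        ae_μ₀_iff.2 (hF t ht)] with p e1 e2 e3 e4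
      rw [e1, Pi.add_apply, e2, Pi.add_apply, e3, Pi.add_apply, Fin.sum_univ_three, ← e4]
      ring

/-- A bounded perturbation of the identity of norm at most `1/2` is invertible, and the inverse has
norm at most `2`. -/
theorem exists_inverse_one_add {X : Type*} [NormedAddCommGroup X] [NormedSpace ℝ X]
    [CompleteSpace X] (B : X →L[ℝ] X) (hB : ∀ x, ‖B x‖ ≤ 1 / 2 * ‖x‖) :
    ∃ N : X →L[ℝ] X, (∀ x, N x + B (N x) = x) ∧ ∀ x, ‖N x‖ ≤ 2 * ‖x‖ := by
  have hn : ‖-B‖ < 1 := by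
    rw [norm_neg]
    exact (B.opNorm_le_bound (by norm_num) hB).trans_lt (by norm_num)
  set U := Units.oneSub (-B) hn
  have hU : ∀ x, U.inv x + B (U.inv x) = x := by
    intro x
    have e : (U.val * U.inv) x = x := by rw [U.val_inv]; rfl
    have e' : U.val = 1 + B := by rw [Units.val_oneSub, sub_neg_eq_add]
    rw [e'] at e
    exact e
  refine ⟨U.inv, hU, fun x => ?_⟩
  have h1 : ‖U.inv x‖ ≤ ‖x‖ + 1 / 2 * ‖U.inv x‖ := by
    calc ‖U.inv x‖ = ‖x - B (U.inv x)‖ := by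
          congr 1
          exact eq_sub_of_add_eq (hU x)
      _ ≤ ‖x‖ + ‖B (U.inv x)‖ := norm_sub_le _ _
      _ ≤ _ := by gcongr; exact hB _
  linarith

set_option maxSynthPendingDepth 4 in
theorem exists_trilinear {X : Type*} [NormedAddCommGroup X] [NormedSpace ℝ X]
    (P : X →L[ℝ] X →L[ℝ] X) (G : X →L[ℝ] X) :
    ∃ tri : X →L[ℝ] X →L[ℝ] X →L[ℝ] X, ∀ x y z, tri x y z = G (P (P x y) z) :=
  ⟨(ContinuousLinearMap.compL ℝ X X (X →L[ℝ] X)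
    ((ContinuousLinearMap.compL ℝ X X X G).comp P)).comp P, fun _ _ _ => rfl⟩

set_option maxSynthPendingDepth 4 in
/-- `lin` and `tri` are the solution operators of the equations `(□ + V) u = f` and
`(□ + V) w = h x y z` on the space of regular curves, bounded by `κ` and `β`. In terms of them the
cubic equation with source `f` reads `u + tri u u u = lin f`. -/
structure IsResponse (κ β : ℝ) (V h : ℝ × E3 → ℝ)
    (lin : RegCurve ρ T L s →L[ℝ] RegCurve ρ T L s)
    (tri : RegCurve ρ T L s →L[ℝ] RegCurve ρ T L s →L[ℝ] RegCurve ρ T L s →L[ℝ] RegCurve ρ T L s) :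
    Prop where
  norm_lin : ∀ x, ‖lin x‖ ≤ κ * ‖x‖
  norm_tri : ∀ x y z, ‖tri x y z‖ ≤ β * ‖x‖ * ‖y‖ * ‖z‖
  symm_left : ∀ x y z, tri x y z = tri y x z
  symm_right : ∀ x y z, tri x y z = tri x z y
  wave_lin : ∀ x, IsWaveSol s T V (fun t p => cv x t p) (zext T (cv (lin x)))
  wave_tri : ∀ x y z, IsWaveSol s T V (fun t p => h (t, p) * zext T (cv x) t p *
    zext T (cv y) t p * zext T (cv z) t p) (zext T (cv (tri x y z)))
  cubic : ∀ x u, u + tri u u u = lin x → IsCubicSol s T V h (cv x) (zext T (cv u))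

set_option maxSynthPendingDepth 4 in
/-- The equations with coefficients `V`, `h` are solvable in the space of regular curves, with
solution operators bounded by `κ` and `β`. -/
def HasResponse (ρ T L : ℝ) (s : ℕ) (κ β : ℝ) (V h : ℝ × E3 → ℝ) : Prop :=
  ∃ lin tri, IsResponse (ρ := ρ) (T := T) (L := L) (s := s) κ β V h lin tri

theorem cv_bdd (hs : 2 ≤ s) (hL : 1 ≤ L) (hT : 0 < T) (x : RegCurve ρ T L s) {t : ℝ}
    (ht : t ∈ Ioo 0 T) : ∃ C, Bdd C (cv x t) :=
  ⟨_, (reg_cv (zero_le_one.trans hL) x).bdd hL hT hs ht⟩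

theorem cv_sub (x y : RegCurve ρ T L s) : cv (x - y) = cv x - cv y := by
  have e : x - y = x + (-1 : ℝ) • y := by rw [neg_one_smul ℝ y, sub_eq_add_neg]
  rw [e, cv_add, cv_smul, neg_one_smul ℝ (cv y), sub_eq_add_neg]

theorem cv_triple (hs : 2 ≤ s) (hL : 1 ≤ L) (hT : 0 < T)
    {P : RegCurve ρ T L s → RegCurve ρ T L s → RegCurve ρ T L s}
    (hP : ∀ x y, ∀ t ∈ Ioo 0 T, cv (P x y) t = prod (cv x t) (cv y t)) (x y z : RegCurve ρ T L s)
    {t : ℝ} (ht : t ∈ Ioo 0 T) :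
    cv (P (P x y) z) t =ᵐ[μ₀] fun p => cv x t p * cv y t p * cv z t p := by
  obtain ⟨C, hC⟩ := cv_bdd hs hL hT y ht
  obtain ⟨D, hD⟩ := cv_bdd hs hL hT z ht
  rw [hP _ _ t ht, hP _ _ t ht]
  filter_upwards [prod_coe' (g := prod (cv x t) (cv y t)) hD,
    prod_coe' (g := cv x t) hC] with p e1 e2
  rw [e1, e2]

/-- The linear equation `(□ + V) u = f` is solved by inverting `u + kir (V u) = kir f`. -/
theorem exists_lin (hs : 2 ≤ s) (hL : 1 ≤ L) (hT : 0 < T) (hM : 0 ≤ M)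
    (hLM : kopC T L s 2 * (2 ^ s * M) ≤ 1 / 2) (hV : IsCoeff s T ρ M V) :
    ∃ lin : RegCurve ρ T L s →L[ℝ] RegCurve ρ T L s, (∀ x, ‖lin x‖ ≤ 2 * kopC T L s 2 * ‖x‖) ∧
      ∀ x, IsWaveSol s T V (fun t p => cv x t p) (zext T (cv (lin x))) := by
  have hL0 : 0 ≤ L := zero_le_one.trans hL
  have hκ : 0 ≤ kopC T L s 2 := kopC_nonneg hT.le hL0 s 2
  have : CompleteSpace (RegCurve ρ T L s) := completeSpace_regCurve hL0
  obtain ⟨K, K1, K2⟩ := exists_kir_clm (ρ := ρ) (s := s) hL hT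
  obtain ⟨W, W1, W2⟩ := exists_coeff_clm hL hT hM hV
  obtain ⟨N, N1, N2⟩ := exists_inverse_one_add (K.comp W) fun x => by
    calc ‖K (W x)‖ ≤ kopC T L s 2 * ‖W x‖ := K1 _
      _ ≤ kopC T L s 2 * (2 ^ s * M * ‖x‖) := mul_le_mul_of_nonneg_left (W1 x) hκ
      _ = kopC T L s 2 * (2 ^ s * M) * ‖x‖ := by ring
      _ ≤ _ := mul_le_mul_of_nonneg_right hLM (norm_nonneg x)
  refine ⟨N.comp K, fun x => ?_, fun x => ?_⟩
  · rw [ContinuousLinearMap.comp_apply]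
    linarith [N2 (K x), K1 x]
  · rw [ContinuousLinearMap.comp_apply]
    -- the solution is itself a retarded potential, to which Kirchhoff's formula applies
    have e : N (K x) = K (x - W (N (K x))) := by
      rw [map_sub]
      exact eq_sub_of_add_eq (N1 (K x))
    refine isWaveSol_zext hs hL hT (y := x - W (N (K x))) (fun t ht => ?_) fun t ht => ?_
    · conv_lhs => rw [e]
      exact K2 _ t ht
    · rw [cv_sub, Pi.sub_apply, W2 _ t ht, ← ae_μ₀_iff]
      filter_upwards [Lp.coeFn_sub (cv x t) (ml (fun y => V (t, y)) (cv (N (K x)) t)),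
        coeff_coe hV.1.continuous t ((reg_cv hL0 (N (K x))).supp ht)] with p e1 e2
      rw [e1, Pi.sub_apply, e2]
      ring

/-- Multiplication of three regular curves and a coefficient, as a trilinear map composed with
bilinear multiplication. -/
theorem exists_cubic_term (hs : 3 ≤ s) (hL : 1 ≤ L) (hT : 0 < T) (hM : 0 ≤ M)
    (hh : IsCoeff s T ρ M h) :
    ∃ (G : RegCurve ρ T L s →L[ℝ] RegCurve ρ T L s)
      (P : RegCurve ρ T L s →L[ℝ] RegCurve ρ T L s →L[ℝ] RegCurve ρ T L s),
      (∀ x y z, ‖G (P (P x y) z)‖ ≤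
        2 ^ s * M * (prodC T L s * prodC T L s) * ‖x‖ * ‖y‖ * ‖z‖) ∧
      (∀ x y z, P (P x y) z = P (P y x) z) ∧ (∀ x y z, P (P x y) z = P (P x z) y) ∧
      ∀ x y z, ∀ t ∈ Ioo 0 T, cv (G (P (P x y) z)) t =ᵐ[μ₀]
        fun p => h (t, p) * cv x t p * cv y t p * cv z t p := by
  have hL0 : 0 ≤ L := zero_le_one.trans hL
  have hL1 : 0 < L := zero_lt_one.trans_le hL
  have hs2 : 2 ≤ s := by lia
  have hC : 0 ≤ prodC T L s := prodC_nonneg s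
  obtain ⟨G, G1, G2⟩ := exists_coeff_clm hL hT hM hh
  obtain ⟨P, P1, P2⟩ := exists_mul_clm (ρ := ρ) hs hL hT
  refine ⟨G, P, fun x y z => ?_, fun x y z => ?_, fun x y z => ?_, fun x y z t ht => ?_⟩
  · calc ‖G (P (P x y) z)‖ ≤ 2 ^ s * M * ‖P (P x y) z‖ := G1 _
      _ ≤ 2 ^ s * M * (prodC T L s * (prodC T L s * ‖x‖ * ‖y‖) * ‖z‖) := by
        refine mul_le_mul_of_nonneg_left ((P1 _ _).trans ?_) (by positivity)
        exact mul_le_mul_of_nonneg_right (mul_le_mul_of_nonneg_left (P1 _ _) hC) (norm_nonneg z)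
      _ = _ := by ring
  · have e : P x y = P y x := cv_injective hL1 fun t ht => by
      rw [P2 _ _ t ht, P2 _ _ t ht, prod_comm (cv x t)]
    rw [e]
  · refine cv_injective hL1 fun t ht => Lp.ext ?_
    filter_upwards [cv_triple hs2 hL hT P2 x y z ht, cv_triple hs2 hL hT P2 x z y ht] with p e1 e2
    rw [e1, e2]
    ring
  · rw [G2 _ t ht]
    filter_upwards [cv_triple hs2 hL hT P2 x y z ht, coeff_coe hh.1.continuous t
      ((reg_cv hL0 (P (P x y) z)).supp ht)] with p e1 e2
    rw [e2, e1]
    ring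

theorem exists_isResponse (hs : 3 ≤ s) (hL : 1 ≤ L) (hT : 0 < T) (hM : 0 ≤ M)
    (hLM : kopC T L s 2 * (2 ^ s * M) ≤ 1 / 2) (hV : IsCoeff s T ρ M V)
    (hh : IsCoeff s T ρ M h) :
    HasResponse ρ T L s (2 * kopC T L s 2)
      (2 * kopC T L s 2 * (2 ^ s * M * (prodC T L s * prodC T L s))) V h := by
  have hκ : 0 ≤ kopC T L s 2 := kopC_nonneg hT.le (zero_le_one.trans hL) s 2
  obtain ⟨lin, n_lin, wave⟩ := exists_lin (by lia) hL hT hM hLM hV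
  obtain ⟨G, P, GP1, GP2, GP3, GP4⟩ := exists_cubic_term hs hL hT hM hh
  obtain ⟨tri, tri_eq⟩ := exists_trilinear P (lin.comp G)
  refine ⟨lin, tri, n_lin, fun x y z => ?_, fun x y z => ?_, fun x y z => ?_, wave,
    fun x y z => ?_, fun x u hu => ?_⟩
  · rw [tri_eq]
    refine (n_lin _).trans ((mul_le_mul_of_nonneg_left (GP1 x y z) (by positivity)).trans_eq ?_)
    ring
  · rw [tri_eq, tri_eq, GP2]
  · rw [tri_eq, tri_eq, GP3]
  · rw [tri_eq]
    refine (wave (G (P (P x y) z))).congr fun t ht => ?_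
    rw [zext_eq ht, zext_eq ht, zext_eq ht]
    exact ae_μ₀_iff.1 (GP4 x y z t ht)
  · rw [tri_eq] at hu
    have e : u = lin (x - G (P (P u u) u)) := by
      rw [map_sub]
      exact eq_sub_of_add_eq hu
    have hw := wave (x - G (P (P u u) u))
    rw [← e] at hw
    refine hw.congr fun t ht => ?_
    rw [cv_sub, Pi.sub_apply, zext_eq ht, ← ae_μ₀_iff]
    filter_upwards [Lp.coeFn_sub (cv x t) (cv (G (P (P u u) u)) t), GP4 u u u t ht]
      with p e1 e2
    rw [e1, Pi.sub_apply, e2]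
    ring

/-- For a large exponential weight `L` all equations with coefficients bounded by `M` are solvable,
with uniform bounds. -/
theorem exists_uniform_response (hs : 3 ≤ s) (hT : 0 < T) (ρ M : ℝ) :
    ∃ L κ β : ℝ, 1 ≤ L ∧ 0 ≤ κ ∧ 0 ≤ β ∧ ∀ V h : ℝ × E3 → ℝ, IsCoeff s T ρ M V →
      IsCoeff s T ρ M h → HasResponse ρ T L s κ β V h := by
  obtain ⟨C, hC, hk⟩ := exists_kopC_le T s
  set D := C * (2 ^ s * max M 0)
  have hD : 0 ≤ D := by positivity
  obtain ⟨L, hL, hLM⟩ : ∃ L, 1 ≤ L ∧ kopC T L s 2 * (2 ^ s * max M 0) ≤ 1 / 2 := by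
    have hL : (1 : ℝ) ≤ 1 + 2 * D := by linarith
    refine ⟨1 + 2 * D, hL, ?_⟩
    calc kopC T (1 + 2 * D) s 2 * (2 ^ s * max M 0)
        ≤ C / (1 + 2 * D) * (2 ^ s * max M 0) :=
          mul_le_mul_of_nonneg_right (hk _ hL).2 (by positivity)
      _ = D / (1 + 2 * D) := by ring
      _ ≤ 1 / 2 := by
        rw [div_le_iff₀ (zero_lt_one.trans_le hL)]
        linarith
  have hκ := kopC_nonneg hT.le (zero_le_one.trans hL) s 2
  have hP : 0 ≤ prodC T L s := prodC_nonneg s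
  exact ⟨L, 2 * kopC T L s 2, 2 * kopC T L s 2 * (2 ^ s * max M 0 * (prodC T L s * prodC T L s)),
    hL, by positivity, by positivity, fun V h hV hh => exists_isResponse hs hL hT
      (le_max_right M 0) hLM (hV.mono (le_max_left M 0)) (hh.mono (le_max_left M 0))⟩

/-! ### The source-to-solution map and its third linearization -/

variable {ρ T L M κ β : ℝ} {s : ℕ} {V h : ℝ × E3 → ℝ} {f : ℝ → H}

theorem IsCubicSol.congr {f f' u : ℝ → H} (hu : IsCubicSol s T V h f u)
    (e : ∀ t ∈ Ioo 0 T, f t = f' t) : IsCubicSol s T V h f' u :=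
  IsWaveSol.congr hu fun t ht => by
    rw [e t ht]
    exact Eventually.of_forall fun _ => rfl

theorem cubicSol_eq (hs : 2 ≤ s) (hT : 0 < T) (hV : Continuous V) (hh : Continuous h) {u : ℝ → H}
    (hu : IsCubicSol s T V h f u) : ∀ t ∈ Ioo 0 T, cubicSol s T V h f t = u t := by
  have hex : ∃ u, IsCubicSol s T V h f u := ⟨u, hu⟩
  rw [cubicSol, dif_pos hex]
  exact hex.choose_spec.unique hs hT hV hh hu

theorem IsSource.exists_cv (hL : 1 ≤ L) (hT : 0 < T) (hf : IsSource s T ρ f) :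
    ∃ x : RegCurve ρ T L s, (∀ t ∈ Ioo 0 T, cv x t = f t) ∧ ‖x‖ ≤ (hsENorm s T univ f).toReal :=
  exists_cv_eq (zero_lt_one.trans_le hL) hT (hf.reg hL)

theorem IsSource.add {f g : ℝ → H} (hf : IsSource s T ρ f) (hg : IsSource s T ρ g) :
    IsSource s T ρ (f + g) := by
  refine ⟨(hsENorm_add_le f g).trans_lt (ENNReal.add_lt_top.2 ⟨hf.1, hg.1⟩), fun t ht => ?_⟩
  rw [← ae_μ₀_iff]
  filter_upwards [ae_μ₀_iff.2 (hf.2 t ht), ae_μ₀_iff.2 (hg.2 t ht), Lp.coeFn_add (f t) (g t)]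
    with x h1 h2 h3 hx
  rw [Pi.add_apply, h3, Pi.add_apply, h1 hx, h2 hx, add_zero]

theorem IsSource.smul {c : ℝ} (hc : c ≠ 0) (hf : IsSource s T ρ f) : IsSource s T ρ (c • f) := by
  refine ⟨(hsENorm_smul_le hc f).trans_lt (ENNReal.mul_lt_top enorm_lt_top hf.1), fun t ht => ?_⟩
  rw [← ae_μ₀_iff]
  filter_upwards [ae_μ₀_iff.2 (hf.2 t ht), Lp.coeFn_smul c (f t)] with x h1 h2 hx
  rw [Pi.smul_apply, h2, Pi.smul_apply, h1 hx, smul_zero]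

variable {lin : RegCurve ρ T L s →L[ℝ] RegCurve ρ T L s}
  {tri : RegCurve ρ T L s →L[ℝ] RegCurve ρ T L s →L[ℝ] RegCurve ρ T L s →L[ℝ] RegCurve ρ T L s}

theorem IsResponse.cubicSol_eq (H : IsResponse κ β V h lin tri) (hs : 2 ≤ s) (hT : 0 < T)
    (hV : Continuous V) (hh : Continuous h) {x u : RegCurve ρ T L s} (hu : u + tri u u u = lin x)
    (hf : ∀ t ∈ Ioo 0 T, cv x t = f t) : ∀ t ∈ Ioo 0 T, cubicSol s T V h f t = cv u t := by
  intro t ht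
  rw [CubicWave.cubicSol_eq hs hT hV hh ((H.cubic x u hu).congr hf) t ht, zext_eq ht]

/-- The cubic equation is solvable for small sources, with the expansion
`u = lin f - tri (lin f) (lin f) (lin f) + O(‖f‖ ^ 5)`. -/
theorem IsResponse.exists_sol (H : IsResponse κ β V h lin tri) (hL : 0 ≤ L) (hβ : 0 ≤ β)
    {x : RegCurve ρ T L s} {r : ℝ} (hr : κ * ‖x‖ ≤ r) (hx : 24 * β * r ^ 2 ≤ 1) :
    ∃ u, u + tri u u u = lin x ∧
      ‖u - lin x + tri (lin x) (lin x) (lin x)‖ ≤ 96 * β ^ 2 * r ^ 5 := by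
  have : CompleteSpace (RegCurve ρ T L s) := completeSpace_regCurve hL
  have hl : ‖lin x‖ ≤ r := (H.norm_lin x).trans hr
  obtain ⟨u, h1, h2⟩ := exists_cubic_solution hβ H.norm_tri (a := lin x) (by
    refine le_trans ?_ hx
    exact mul_le_mul_of_nonneg_left (pow_le_pow_left₀ (norm_nonneg _) hl 2) (by positivity))
  refine ⟨u, h1, h2.trans ?_⟩
  exact mul_le_mul_of_nonneg_left (pow_le_pow_left₀ (norm_nonneg _) hl 5) (by positivity)

/-- The solution depends smoothly on the source near zero, which identifies the third derivative. -/
theorem IsResponse.thirdLin_eq (H : IsResponse κ β V h lin tri) (hs : 2 ≤ s) (hL : 0 ≤ L)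
    (hT : 0 < T) (hV : Continuous V) (hh : Continuous h) {f₁ f₂ f₃ : ℝ → CubicWave.H}
    {x₁ x₂ x₃ : RegCurve ρ T L s} (h₁ : ∀ t ∈ Ioo 0 T, cv x₁ t = f₁ t)
    (h₂ : ∀ t ∈ Ioo 0 T, cv x₂ t = f₂ t) (h₃ : ∀ t ∈ Ioo 0 T, cv x₃ t = f₃ t) :
    ∀ t ∈ Ioo 0 T, thirdLin s T V h f₁ f₂ f₃ t = cv (tri (lin x₁) (lin x₂) (lin x₃)) t := by
  intro t ht
  have : CompleteSpace (RegCurve ρ T L s) := completeSpace_regCurve hL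
  obtain ⟨Ψ, hΨ, h0, he⟩ := exists_smooth_cubic_solution tri
  obtain ⟨e, hev⟩ := exists_eval (ρ := ρ) (s := s) hL ht
  have hcont : Continuous fun p : ℝ × ℝ × ℝ =>
      p.1 • lin x₁ + p.2.1 • lin x₂ + p.2.2 • lin x₃ := by fun_prop
  have hlim : Tendsto (fun p : ℝ × ℝ × ℝ =>
      p.1 • lin x₁ + p.2.1 • lin x₂ + p.2.2 • lin x₃) (𝓝 0) (𝓝 0) := by
    have := hcont.tendsto 0
    simpa using this
  have hU : ∀ᶠ p in 𝓝 (0 : ℝ × ℝ × ℝ),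
      cubicSol s T V h (p.1 • f₁ + p.2.1 • f₂ + p.2.2 • f₃) t =
        e (Ψ (p.1 • lin x₁ + p.2.1 • lin x₂ + p.2.2 • lin x₃)) := by
    filter_upwards [hlim.eventually he] with p hp
    rw [hev]
    refine H.cubicSol_eq hs hT hV hh (x := p.1 • x₁ + p.2.1 • x₂ + p.2.2 • x₃) ?_ ?_ t ht
    · rw [hp]
      simp only [map_add, map_smul]
    · intro r hr
      simp only [cv_add, cv_smul, Pi.add_apply, Pi.smul_apply, h₁ r hr, h₂ r hr, h₃ r hr]
  have key := nested_deriv_eq hΨ e (lin x₁) (lin x₂) (lin x₃)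
    (U := fun ε₁ ε₂ ε₃ => cubicSol s T V h (ε₁ • f₁ + ε₂ • f₂ + ε₃ • f₃) t) hU
  rw [third_derivative hΨ h0 he H.symm_left H.symm_right] at key
  rw [thirdLin, key, map_neg, map_smul, hev, smul_neg, neg_smul, neg_neg, smul_smul]
  norm_num

/-! ### Stability of the third linearization -/

variable {ρ T L M κ β ε δ : ℝ} {s : ℕ} {V h V' h' : ℝ × E3 → ℝ}

/-- The alternating sum over the signs of the last two arguments extracts the symmetric trilinear
part of a cube. -/
theorem tri_polarization {E : Type*} [NormedAddCommGroup E] [NormedSpace ℝ E]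
    {K : E →L[ℝ] E →L[ℝ] E →L[ℝ] E} (hs₁ : ∀ x y z, K x y z = K y x z)
    (hs₂ : ∀ x y z, K x y z = K x z y) (a b d : E) :
    K (a + b + d) (a + b + d) (a + b + d) - K (a + b - d) (a + b - d) (a + b - d)
      - K (a - b + d) (a - b + d) (a - b + d) + K (a - b - d) (a - b - d) (a - b - d)
      = (24 : ℝ) • K a b d := by
  have e1 : K a d b = K a b d := hs₂ _ _ _
  have e2 : K b a d = K a b d := hs₁ _ _ _
  have e3 : K b d a = K a b d := by rw [hs₂, e2]
  have e4 : K d a b = K a b d := by rw [hs₁, e1]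
  have e5 : K d b a = K a b d := by rw [hs₂, e4]
  simp only [map_add, map_sub, add_apply, sub_apply, e1, e2, e3, e4, e5]
  module

/-- The source `ε (f₁ + σ f₂ + τ f₃)`. -/
def polSource {X : Type*} [AddCommGroup X] [Module ℝ X] (ε : ℝ) (f₁ f₂ f₃ : X) (σ τ : ℝ) : X :=
  ε • (f₁ + σ • f₂ + τ • f₃)

/-- The alternating sum over signs of a function of two signs. -/
def altSum {X : Type*} [AddCommGroup X] (S : ℝ → ℝ → X) : X :=
  S 1 1 - S 1 (-1) - S (-1) 1 + S (-1) (-1)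

theorem altSum_polSource {X : Type*} [AddCommGroup X] [Module ℝ X] (ε : ℝ) (f₁ f₂ f₃ : X) :
    altSum (polSource ε f₁ f₂ f₃) = 0 := by
  simp only [altSum, polSource]
  module

theorem norm_altSum_le {X : Type*} [NormedAddCommGroup X] {S : ℝ → ℝ → X} {c : ℝ}
    (hS : ∀ σ τ, |σ| ≤ 1 → |τ| ≤ 1 → ‖S σ τ‖ ≤ c) : ‖altSum S‖ ≤ 4 * c := by
  have h1 := hS 1 1 (by norm_num) (by norm_num)
  have h2 := hS 1 (-1) (by norm_num) (by norm_num)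
  have h3 := hS (-1) 1 (by norm_num) (by norm_num)
  have h4 := hS (-1) (-1) (by norm_num) (by norm_num)
  calc ‖altSum S‖ ≤ ‖S 1 1‖ + ‖S 1 (-1)‖ + ‖S (-1) 1‖ + ‖S (-1) (-1)‖ :=
        (norm_add_le _ _).trans (by
          gcongr
          exact (norm_sub_le _ _).trans (by gcongr; exact norm_sub_le _ _))
    _ ≤ _ := by linarith

theorem norm_polSource_le {X : Type*} [NormedAddCommGroup X] [NormedSpace ℝ X] (hε : 0 ≤ ε)
    {x₁ x₂ x₃ : X} (h₁ : ‖x₁‖ ≤ 1) (h₂ : ‖x₂‖ ≤ 1) (h₃ : ‖x₃‖ ≤ 1) {σ τ : ℝ} (hσ : |σ| ≤ 1)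
    (hτ : |τ| ≤ 1) : ‖polSource ε x₁ x₂ x₃ σ τ‖ ≤ 3 * ε := by
  have e2 : ‖σ • x₂‖ ≤ 1 := by
    rw [norm_smul]
    exact mul_le_one₀ hσ (norm_nonneg _) h₂
  have e3 : ‖τ • x₃‖ ≤ 1 := by
    rw [norm_smul]
    exact mul_le_one₀ hτ (norm_nonneg _) h₃
  have e : ‖x₁ + σ • x₂ + τ • x₃‖ ≤ 3 :=
    norm_add₃_le.trans (by linarith)
  rw [polSource, norm_smul, Real.norm_of_nonneg hε, mul_comm]
  exact mul_le_mul_of_nonneg_right e hε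

theorem IsSource.polSource {f₁ f₂ f₃ : ℝ → H} (h₁ : IsSource s T ρ f₁) (h₂ : IsSource s T ρ f₂)
    (h₃ : IsSource s T ρ f₃) (hε : 0 < ε) {σ τ : ℝ} (hσ : σ ≠ 0) (hτ : τ ≠ 0) :
    IsSource s T ρ (polSource ε f₁ f₂ f₃ σ τ) :=
  ((h₁.add (h₂.smul hσ)).add (h₃.smul hτ)).smul hε.ne'

theorem hsENorm_smul_le_one {f : ℝ → H} {σ : ℝ} (hσ : |σ| = 1) (hf : hsENorm s T univ f = 1) :
    hsENorm s T univ (σ • f) ≤ 1 := by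
  refine (hsENorm_smul_le (fun h => by simp [h] at hσ) f).trans_eq ?_
  rw [hf, mul_one, ← ofReal_norm, Real.norm_eq_abs, hσ, ENNReal.ofReal_one]

theorem hsENorm_polSource_le {f₁ f₂ f₃ : ℝ → H} (h₁ : hsENorm s T univ f₁ = 1)
    (h₂ : hsENorm s T univ f₂ = 1) (h₃ : hsENorm s T univ f₃ = 1) (hε : 0 < ε) {σ τ : ℝ}
    (hσ : |σ| = 1) (hτ : |τ| = 1) :
    hsENorm s T univ (polSource ε f₁ f₂ f₃ σ τ) ≤ ENNReal.ofReal (3 * ε) := by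
  calc hsENorm s T univ (polSource ε f₁ f₂ f₃ σ τ)
      ≤ ‖ε‖ₑ * (1 + 1 + 1) := by
        refine (hsENorm_smul_le hε.ne' _).trans ?_
        gcongr
        refine (hsENorm_add_le _ _).trans (add_le_add ?_ (hsENorm_smul_le_one hτ h₃))
        exact (hsENorm_add_le _ _).trans (add_le_add h₁.le (hsENorm_smul_le_one hσ h₂))
    _ = ENNReal.ofReal (3 * ε) := by
        rw [mul_comm, ENNReal.ofReal_mul (by norm_num), Real.enorm_of_nonneg hε.le]
        norm_num

theorem hsENorm_altSum_le {Ω : Set E3} {S : ℝ → ℝ → ℝ → L2 Ω} {c : ℝ≥0∞}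
    (hS : ∀ σ τ, |σ| = 1 → |τ| = 1 → hsENorm s T Ω (S σ τ) ≤ c) :
    hsENorm s T Ω (altSum S) ≤ 4 * c := by
  have neg : ∀ σ τ, |σ| = 1 → |τ| = 1 → hsENorm s T Ω ((-1 : ℝ) • S σ τ) ≤ c := by
    intro σ τ hσ hτ
    refine (hsENorm_smul_le (by norm_num) _).trans ?_
    rw [enorm_neg, enorm_one, one_mul]
    exact hS σ τ hσ hτ
  have e : altSum S = S 1 1 + (-1 : ℝ) • S 1 (-1) + (-1 : ℝ) • S (-1) 1 + S (-1) (-1) := by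
    rw [altSum]
    module
  have o : |(1 : ℝ)| = 1 := abs_one
  have m : |(-1 : ℝ)| = 1 := by norm_num
  rw [e]
  calc _ ≤ c + c + c + c := (hsENorm_add_le _ _).trans (add_le_add ((hsENorm_add_le _ _).trans
        (add_le_add ((hsENorm_add_le _ _).trans (add_le_add (hS _ _ o o) (neg _ _ o m)))
        (neg _ _ m o))) (hS _ _ m m))
    _ = 4 * c := by ring

variable {lin : RegCurve ρ T L s →L[ℝ] RegCurve ρ T L s}
  {tri : RegCurve ρ T L s →L[ℝ] RegCurve ρ T L s →L[ℝ] RegCurve ρ T L s →L[ℝ] RegCurve ρ T L s}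

/-- The third linearization is a finite difference of order three of the source-to-solution map,
up to an error of size `ε ^ 2`. -/
theorem IsResponse.exists_remainder (H : IsResponse κ β V h lin tri) (hs : 2 ≤ s) (hL : 0 ≤ L)
    (hT : 0 < T) (hκ : 0 ≤ κ) (hβ : 0 ≤ β) (hV : Continuous V) (hh : Continuous h) (hε : 0 < ε)
    (hεβ : 24 * β * (κ * (3 * ε)) ^ 2 ≤ 1) {f₁ f₂ f₃ : ℝ → CubicWave.H}
    {x₁ x₂ x₃ : RegCurve ρ T L s} (h₁ : ∀ t ∈ Ioo 0 T, cv x₁ t = f₁ t)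
    (h₂ : ∀ t ∈ Ioo 0 T, cv x₂ t = f₂ t) (h₃ : ∀ t ∈ Ioo 0 T, cv x₃ t = f₃ t)
    (n₁ : ‖x₁‖ ≤ 1) (n₂ : ‖x₂‖ ≤ 1) (n₃ : ‖x₃‖ ≤ 1) :
    ∃ r : RegCurve ρ T L s, ‖r‖ ≤ 3888 * β ^ 2 * κ ^ 5 * ε ^ 2 ∧ ∀ t ∈ Ioo 0 T,
      thirdLin s T V h f₁ f₂ f₃ t = cv r t - (24 * ε ^ 3)⁻¹ •
        altSum (fun σ τ => cubicSol s T V h (polSource ε f₁ f₂ f₃ σ τ) t) := by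
  set x := polSource ε x₁ x₂ x₃ with hx
  have hex : ∀ σ τ : ℝ, ∃ u, |σ| ≤ 1 → |τ| ≤ 1 → u + tri u u u = lin (x σ τ) ∧
      ‖u - lin (x σ τ) + tri (lin (x σ τ)) (lin (x σ τ)) (lin (x σ τ))‖ ≤
        96 * β ^ 2 * (κ * (3 * ε)) ^ 5 := by
    intro σ τ
    by_cases hσ : |σ| ≤ 1
    · by_cases hτ : |τ| ≤ 1
      · obtain ⟨u, hu⟩ := H.exists_sol hL hβ (mul_le_mul_of_nonneg_left
          (norm_polSource_le hε.le n₁ n₂ n₃ hσ hτ) hκ) hεβ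
        exact ⟨u, fun _ _ => hu⟩
      · exact ⟨0, fun _ h => absurd h hτ⟩
    · exact ⟨0, fun h => absurd h hσ⟩
  choose u hu using hex
  -- `R σ τ` is the remainder of the expansion to third order of the solution
  set R : ℝ → ℝ → RegCurve ρ T L s := fun σ τ => u σ τ - lin (x σ τ) +
    tri (lin (x σ τ)) (lin (x σ τ)) (lin (x σ τ)) with hR
  have hε3 : 0 < 24 * ε ^ 3 := by positivity
  have alt : altSum R = altSum u + (24 * ε ^ 3) • tri (lin x₁) (lin x₂) (lin x₃) := by
    have p := tri_polarization H.symm_left H.symm_right (lin x₁) (lin x₂) (lin x₃)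
    have l : lin (altSum x) = 0 := by rw [hx, altSum_polSource, map_zero]
    have c : altSum (fun σ τ => tri (lin (x σ τ)) (lin (x σ τ)) (lin (x σ τ))) =
        (24 * ε ^ 3) • tri (lin x₁) (lin x₂) (lin x₃) := by
      rw [mul_comm, mul_smul, ← p]
      have q : ∀ σ τ, lin (x σ τ) = ε • (lin x₁ + σ • lin x₂ + τ • lin x₃) := fun σ τ => by
        simp only [hx, polSource, map_add, map_smul]
      have q' : ∀ y, tri (ε • y) (ε • y) (ε • y) = ε ^ 3 • tri y y y := fun y => by
        simp only [map_smul, smul_apply, smul_smul]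
        congr 1
        ring
      simp only [altSum, q, q', one_smul, neg_smul, ← sub_eq_add_neg]
      simp only [smul_sub, smul_add]
    rw [← c]
    simp only [altSum, map_add, map_sub] at l ⊢
    simp only [hR]
    rw [← sub_eq_zero, ← neg_eq_zero, ← l]
    abel
  refine ⟨(24 * ε ^ 3)⁻¹ • altSum R, ?_, fun t ht => ?_⟩
  · rw [norm_smul, norm_inv, Real.norm_of_nonneg hε3.le, inv_mul_le_iff₀ hε3]
    refine (norm_altSum_le fun σ τ hσ hτ => (hu σ τ hσ hτ).2).trans_eq ?_
    ring
  · have sol : ∀ σ τ : ℝ, |σ| ≤ 1 → |τ| ≤ 1 →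
        cubicSol s T V h (polSource ε f₁ f₂ f₃ σ τ) t = cv (u σ τ) t := by
      intro σ τ hσ hτ
      refine H.cubicSol_eq hs hT hV hh (hu σ τ hσ hτ).1 (fun r hr => ?_) t ht
      simp only [hx, polSource, cv_add, cv_smul, Pi.add_apply, Pi.smul_apply, h₁ r hr, h₂ r hr,
        h₃ r hr]
    have e : altSum (fun σ τ => cubicSol s T V h (polSource ε f₁ f₂ f₃ σ τ) t) =
        cv (altSum u) t := by
      have o : |(1 : ℝ)| ≤ 1 := abs_one.le
      have m : |(-1 : ℝ)| ≤ 1 := by norm_num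
      simp only [altSum, cv_sub, cv_add, Pi.add_apply, Pi.sub_apply]
      rw [sol _ _ o o, sol _ _ o m, sol _ _ m o, sol _ _ m m]
    rw [H.thirdLin_eq hs hL hT hV hh h₁ h₂ h₃ t ht, e, alt, cv_smul, cv_add, cv_smul,
      Pi.smul_apply, Pi.add_apply, Pi.smul_apply, smul_add, inv_smul_smul₀ hε3.ne',
      add_sub_cancel_left]

/-- If two source-to-solution maps differ by at most `δ` on sources of norm at most `3 ε`, then the
response operators differ by the error `δ / ε ^ 3` of the finite difference plus its remainder. -/
theorem hsENorm_triOp_sub_le {lin' : RegCurve ρ T L s →L[ℝ] RegCurve ρ T L s}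
    {tri' : RegCurve ρ T L s →L[ℝ] RegCurve ρ T L s →L[ℝ] RegCurve ρ T L s →L[ℝ] RegCurve ρ T L s}
    (H : IsResponse κ β V h lin tri) (H' : IsResponse κ β V' h' lin' tri') (hs : 2 ≤ s)
    (hL : 1 ≤ L) (hT : 0 < T) (hκ : 0 ≤ κ) (hβ : 0 ≤ β) (hV : Continuous V) (hh : Continuous h)
    (hV' : Continuous V') (hh' : Continuous h') (hε : 0 < ε)
    (hεβ : 24 * β * (κ * (3 * ε)) ^ 2 ≤ 1) (hδ : 0 ≤ δ)
    (hP : ∀ f, IsSource s T ρ f → hsENorm s T univ f ≤ ENNReal.ofReal (3 * ε) →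
      hsENorm s T (ball3 ρ) (srcToSol s T ρ V h f - srcToSol s T ρ V' h' f) ≤ ENNReal.ofReal δ)
    {f₁ f₂ f₃ : ℝ → CubicWave.H} (h₁ : IsSource s T ρ f₁) (h₂ : IsSource s T ρ f₂)
    (h₃ : IsSource s T ρ f₃) (n₁ : hsENorm s T univ f₁ = 1) (n₂ : hsENorm s T univ f₂ = 1)
    (n₃ : hsENorm s T univ f₃ = 1) :
    hsENorm s T (ball3 ρ) (triOp s T ρ V h f₁ f₂ f₃ - triOp s T ρ V' h' f₁ f₂ f₃) ≤
      ENNReal.ofReal (hsConst T L s * (7776 * β ^ 2 * κ ^ 5) * ε ^ 2 + δ / (6 * ε ^ 3)) := by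
  have hL0 : 0 ≤ L := zero_le_one.trans hL
  obtain ⟨x₁, c₁, m₁⟩ := h₁.exists_cv hL hT
  obtain ⟨x₂, c₂, m₂⟩ := h₂.exists_cv hL hT
  obtain ⟨x₃, c₃, m₃⟩ := h₃.exists_cv hL hT
  rw [n₁, ENNReal.toReal_one] at m₁
  rw [n₂, ENNReal.toReal_one] at m₂
  rw [n₃, ENNReal.toReal_one] at m₃
  obtain ⟨r, r1, r2⟩ := H.exists_remainder hs hL0 hT hκ hβ hV hh hε hεβ c₁ c₂ c₃ m₁ m₂ m₃
  obtain ⟨r', r1', r2'⟩ := H'.exists_remainder hs hL0 hT hκ hβ hV' hh' hε hεβ c₁ c₂ c₃ m₁ m₂ m₃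
  set D : ℝ → ℝ → ℝ → L2 (ball3 ρ) := fun σ τ =>
    srcToSol s T ρ V h (polSource ε f₁ f₂ f₃ σ τ) - srcToSol s T ρ V' h' (polSource ε f₁ f₂ f₃ σ τ)
  have hε3 : 0 < 24 * ε ^ 3 := by positivity
  have hD : hsENorm s T (ball3 ρ) (altSum D) ≤ 4 * ENNReal.ofReal δ := by
    refine hsENorm_altSum_le fun σ τ hσ hτ => hP _ ?_ (hsENorm_polSource_le n₁ n₂ n₃ hε hσ hτ)
    exact h₁.polSource h₂ h₃ hε (fun e => by simp [e] at hσ) fun e => by simp [e] at hτ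
  have e : ∀ t ∈ Ioo 0 T, (triOp s T ρ V h f₁ f₂ f₃ - triOp s T ρ V' h' f₁ f₂ f₃) t =
      ((fun t => res (ball3 ρ) (cv (r - r') t)) + (-(24 * ε ^ 3)⁻¹) • altSum D) t := by
    intro t ht
    simp only [Pi.sub_apply, Pi.add_apply, Pi.smul_apply, triOp, srcToSol, r2 t ht, r2' t ht,
      ← resL_apply, cv_sub, altSum, D, map_sub, map_add, map_smul]
    module
  rw [hsENorm_congr e]
  refine (hsENorm_add_le _ _).trans ?_
  have hC := hsConst_nonneg (T := T) hL0 s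
  rw [ENNReal.ofReal_add (by positivity) (by positivity)]
  refine add_le_add ?_ ?_
  · refine ((reg_cv hL0 (r - r')).hsENorm_res_le hL hT).trans (ENNReal.ofReal_le_ofReal ?_)
    rw [mul_assoc]
    refine mul_le_mul_of_nonneg_left ((norm_sub_le r r').trans ?_) hC
    linarith
  · refine (hsENorm_smul_le (neg_ne_zero.2 (inv_pos.2 hε3).ne') _).trans ?_
    rw [enorm_neg, Real.enorm_of_nonneg (inv_pos.2 hε3).le]
    refine (mul_le_mul_right hD _).trans_eq ?_
    rw [← ENNReal.ofReal_ofNat 4, ← ENNReal.ofReal_mul (by norm_num),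
      ← ENNReal.ofReal_mul (inv_pos.2 hε3).le]
    congr 1
    field_simp
    ring

/-- The step `ε ~ ϱ ^ (4 / 5) * δ ^ (1 / 5)` balances the error `δ / ε ^ 3` of the finite difference
against its remainder `ε ^ 2`. -/
theorem exists_step {a ϱ : ℝ} (ha : 0 ≤ a) (hϱ : 0 < ϱ) :
    ∃ C, 0 < C ∧ ∀ δ, 0 < δ → δ < ϱ →
      ∃ ε, 0 < ε ∧ 3 * ε ≤ ϱ ∧ a * ε ^ 2 + δ / (6 * ε ^ 3) ≤ C * δ ^ (2 / 5 : ℝ) := by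
  have root : ∀ y : ℝ, 0 < y → (y ^ (1 / 5 : ℝ)) ^ 5 = y := fun y hy => by
    rw [← Real.rpow_natCast, ← Real.rpow_mul hy.le]
    norm_num
  have hθ : 0 < ϱ ^ (1 / 5 : ℝ) := Real.rpow_pos_of_pos hϱ _
  set θ := ϱ ^ (1 / 5 : ℝ) with hθ'
  refine ⟨a / 9 * θ ^ 8 + 9 / 2 * (θ ^ 12)⁻¹, by positivity, fun δ hδ hδϱ => ?_⟩
  have hη : 0 < δ ^ (1 / 5 : ℝ) := Real.rpow_pos_of_pos hδ _
  have h2 : δ ^ (2 / 5 : ℝ) = (δ ^ (1 / 5 : ℝ)) ^ 2 := by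
    rw [← Real.rpow_natCast, ← Real.rpow_mul hδ.le]
    norm_num
  have hle : δ ^ (1 / 5 : ℝ) ≤ θ := Real.rpow_le_rpow hδ.le hδϱ.le (by norm_num)
  have h5 := root δ hδ
  rw [h2]
  set η := δ ^ (1 / 5 : ℝ) with hη'
  refine ⟨θ ^ 4 * η / 3, by positivity, ?_, ?_⟩
  · rw [← root ϱ hϱ, ← hθ']
    calc 3 * (θ ^ 4 * η / 3) = θ ^ 4 * η := by ring
      _ ≤ θ ^ 4 * θ := mul_le_mul_of_nonneg_left hle (by positivity)
      _ = θ ^ 5 := by ring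
  · refine le_of_eq ?_
    rw [← h5]
    field_simp
    ring

end CubicWave

end

theorem mainTheorem4 (s : ℕ) (hs : 4 ≤ s) (T ρ M : ℝ) (hT : 0 < T) (hρ : 0 < ρ) :
    ∃ ϱ₀ : ℝ, 0 < ϱ₀ ∧ ∀ ϱ : ℝ, 0 < ϱ → ϱ ≤ ϱ₀ →
      -- the source-to-solution map and the trilinear response operator are well defined
      (∀ V h : ℝ × CubicWave.E3 → ℝ,
        CubicWave.IsCoeff s T ρ M V → CubicWave.IsCoeff s T ρ M h →
        (∀ f, CubicWave.IsSource s T ρ f →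
          CubicWave.hsENorm s T univ f ≤ ENNReal.ofReal ϱ →
          (∃ u, CubicWave.IsCubicSol s T V h f u) ∧
          ∀ u u', CubicWave.IsCubicSol s T V h f u → CubicWave.IsCubicSol s T V h f u' →
            ∀ t ∈ Ioo 0 T, u t = u' t) ∧
        (∀ f₁ f₂ f₃, CubicWave.IsSource s T ρ f₁ → CubicWave.IsSource s T ρ f₂ →
          CubicWave.IsSource s T ρ f₃ →
          ∃ u₁ u₂ u₃ w,
            CubicWave.IsWaveSol s T V (fun t x => f₁ t x) u₁ ∧
            CubicWave.IsWaveSol s T V (fun t x => f₂ t x) u₂ ∧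
            CubicWave.IsWaveSol s T V (fun t x => f₃ t x) u₃ ∧
            CubicWave.IsWaveSol s T V (fun t x => h (t, x) * u₁ t x * u₂ t x * u₃ t x) w ∧
            ∀ t ∈ Ioo 0 T, CubicWave.thirdLin s T V h f₁ f₂ f₃ t = w t)) ∧
      -- the stability estimate
      ∃ C : ℝ, 0 < C ∧ ∀ V h V' h' : ℝ × CubicWave.E3 → ℝ,
        CubicWave.IsCoeff s T ρ M V → CubicWave.IsCoeff s T ρ M h →
        CubicWave.IsCoeff s T ρ M V' → CubicWave.IsCoeff s T ρ M h' →
        ∀ δ : ℝ, 0 < δ → δ < ϱ →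
          (∀ f, CubicWave.IsSource s T ρ f →
            CubicWave.hsENorm s T univ f ≤ ENNReal.ofReal ϱ →
            CubicWave.hsENorm s T (CubicWave.ball3 ρ)
              (CubicWave.srcToSol s T ρ V h f - CubicWave.srcToSol s T ρ V' h' f)
                ≤ ENNReal.ofReal δ) →
          CubicWave.triNorm s T ρ (fun f₁ f₂ f₃ =>
              CubicWave.triOp s T ρ V h f₁ f₂ f₃ - CubicWave.triOp s T ρ V' h' f₁ f₂ f₃)
            ≤ ENNReal.ofReal (C * δ ^ (2 / 5 : ℝ)) := by
  obtain ⟨L, κ, β, hL, hκ, hβ, hR⟩ :=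
    CubicWave.exists_uniform_response (s := s) (by lia) hT ρ M
  have hs2 : 2 ≤ s := by lia
  have hL0 : 0 ≤ L := zero_le_one.trans hL
  have hD : 0 ≤ 24 * β * κ ^ 2 := by positivity
  have hD1 : 0 < 1 + 24 * β * κ ^ 2 := by linarith
  -- sources of size at most `(1 + 24 β κ²)⁻¹` are small in the sense of `exists_cubic_solution`
  have small : ∀ r : ℝ, 0 ≤ r → r ≤ (1 + 24 * β * κ ^ 2)⁻¹ → 24 * β * (κ * r) ^ 2 ≤ 1 := by
    intro r hr hr'
    have h1 : r ≤ 1 := hr'.trans (inv_le_one_of_one_le₀ (by linarith))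
    have h2 : r * (1 + 24 * β * κ ^ 2) ≤ 1 := by rwa [← le_div_iff₀ hD1, one_div]
    calc 24 * β * (κ * r) ^ 2 = 24 * β * κ ^ 2 * r * r := by ring
      _ ≤ 24 * β * κ ^ 2 * r * 1 := mul_le_mul_of_nonneg_left h1 (by positivity)
      _ ≤ 1 := by linarith
  refine ⟨(1 + 24 * β * κ ^ 2)⁻¹, inv_pos.2 hD1, fun ϱ hϱ hϱ' => ⟨fun V h hV hh => ?_, ?_⟩⟩
  · obtain ⟨lin, tri, H⟩ := hR V h hV hh
    have hVc := hV.1.continuous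
    have hhc := hh.1.continuous
    refine ⟨fun f hf hfn => ⟨?_, fun u u' hu hu' => hu.unique hs2 hT hVc hhc hu'⟩,
      fun f₁ f₂ f₃ h₁ h₂ h₃ => ?_⟩
    · obtain ⟨x, hx, hxn⟩ := hf.exists_cv hL hT
      have hxϱ : ‖x‖ ≤ ϱ := hxn.trans (ENNReal.toReal_le_of_le_ofReal hϱ.le hfn)
      obtain ⟨u, hu, -⟩ := H.exists_sol hL0 hβ (mul_le_mul_of_nonneg_left hxϱ hκ)
        (small ϱ hϱ.le hϱ')
      exact ⟨_, (H.cubic x u hu).congr hx⟩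
    · obtain ⟨x₁, c₁, -⟩ := h₁.exists_cv hL hT
      obtain ⟨x₂, c₂, -⟩ := h₂.exists_cv hL hT
      obtain ⟨x₃, c₃, -⟩ := h₃.exists_cv hL hT
      have lin_sol : ∀ (x) (f : ℝ → CubicWave.H), (∀ t ∈ Ioo 0 T, CubicWave.cv x t = f t) →
          CubicWave.IsWaveSol s T V (fun t p => f t p)
            (CubicWave.zext T (CubicWave.cv (lin x))) := fun x f hx =>
        (H.wave_lin x).congr fun t ht => by
          rw [hx t ht]
          exact Eventually.of_forall fun _ => rfl
      refine ⟨_, _, _, _, lin_sol x₁ f₁ c₁, lin_sol x₂ f₂ c₂, lin_sol x₃ f₃ c₃,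
        H.wave_tri _ _ _, fun t ht => ?_⟩
      rw [CubicWave.zext_eq ht]
      exact H.thirdLin_eq hs2 hL0 hT hVc hhc c₁ c₂ c₃ t ht
  · have ha : 0 ≤ CubicWave.hsConst T L s * (7776 * β ^ 2 * κ ^ 5) :=
      mul_nonneg (CubicWave.hsConst_nonneg hL0 s) (by positivity)
    obtain ⟨C, hC, hstep⟩ := CubicWave.exists_step ha hϱ
    refine ⟨C, hC, fun V h V' h' hV hh hV' hh' δ hδ hδϱ hP => sSup_le ?_⟩
    rintro _ ⟨f₁, f₂, f₃, h₁, h₂, h₃, n₁, n₂, n₃, rfl⟩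
    -- the four sources of the finite difference must have norm at most `ϱ`, whence `3 ε ≤ ϱ`
    obtain ⟨ε, hε, hε3, hle⟩ := hstep δ hδ hδϱ
    obtain ⟨lin, tri, H⟩ := hR V h hV hh
    obtain ⟨lin', tri', H'⟩ := hR V' h' hV' hh'
    refine (CubicWave.hsENorm_triOp_sub_le H H' hs2 hL hT hκ hβ hV.1.continuous hh.1.continuous
      hV'.1.continuous hh'.1.continuous hε (small _ (by positivity) (hε3.trans hϱ')) hδ.le
      (fun f hf hfn => hP f hf (hfn.trans (ENNReal.ofReal_le_ofReal hε3)))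
      h₁ h₂ h₃ n₁ n₂ n₃).trans (ENNReal.ofReal_le_ofReal hle)
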